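/- **Setting.** Let $k$ be a field, $I=\{1,\dots,n\}$, and let $\alpha_1,\dots,\alpha_n$ be the standard basis of $\mathbb Z^n$. Let $\chi:\mathbb Z^n\times\mathbb Z^n\to k^\times$ be a bicharacter such that $q_{ij}=\chi(\alpha_i,\alpha_j)$ satisfies $q_{ij}=q_{ji}$. Let $V^+$ be the braided vector space with basis $E_1,\dots,E_n$ and braiding $E_i\otimes E_j\mapsto q_{ij}E_j\otimes E_i$, so that $T(V^+)$ is a $\mathbb Z^n$-graded braided bialgebra with primitive $E_i$ of degree $\alpha_i$. Let $\mathcal I\subset\bigoplus_{m\ge2}T(V^+)_m$ be a $\mathbb Z^n$-graded biideal, and let $\mathcal I_{\max}$ be the largest such biideal. Let $\tau:I\to I$ be a bijection with $\tau^2=\mathrm{id}$, $q_{\tau(i)\tau(j)}=q_{ij}$ for all $i,j$, and $\tau(\mathcal I)=\mathcal I$, where $\tau(E_i)=E_{\tau(i)}$; put $\tau(\alpha_i)=\alpha_{\tau(i)}$ and $\mathbb Z^n_\theta=\{\lambda\in\mathbb Z^n\mid\tau(\lambda)=-\lambda\}$. Let $\mathbf c=(c_1,\dots,c_n)\in k^n$.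 Let $U(\chi)$ be the algebra with generators $E_i,F_i$ $(i\in I)$, $K_\lambda$ $(\lambda\in\mathbb Z^n)$ and relations $K_0=1$, $K_{\lambda+\mu}=K_\lambda K_\mu$, $K_\lambda E_i=\chi(\lambda,\alpha_i)E_iK_\lambda$, $K_\lambda F_i=\chi(\lambda,\alpha_i)^{-1}F_iK_\lambda$, $E_iF_j-F_jE_i=\delta_{ij}(K_i-K_i^{-1})$ with $K_i=K_{\alpha_i}$, and $p(E_1,\dots,E_n)=0=p(F_1,\dots,F_n)$ for every noncommutative polynomial $p$ with $p(E_1,\dots,E_n)\in\mathcal I$. It is a Hopf algebra with $$\Delta(E_i)=E_i\otimes1+K_i\otimes E_i,\qquad \Delta(F_i)=F_i\otimes K_i^{-1}+1\otimes F_i,\qquad \Delta(K_\lambda)=K_\lambda\otimes K_\lambda .$$ Let $S$ be its antipode. Let $U^+,U^-,H$ be the subalgebras generated by the $E_i$, the $F_i$, the $K_\lambda$, respectively; $U^+$ and $U^-$ are graded with $\deg E_i=\alpha_i$, $\deg F_i=-\alpha_i$. Let $H\ltimes U^-$ be the subalgebra generated by $H$ and $U^-$, and let $H_\theta\ltimes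 U^-$ be the subalgebra generated by $K_iK_{\tau(i)}^{-1}$ and $F_i$ $(i\in I)$; it is spanned by the products $K_\lambda f$ with $\lambda\in\mathbb Z^n_\theta$, $f\in U^-$. The subscript $\max$ denotes the same constructions for $\mathcal I_{\max}$, and $\pi_{\max}$ denotes the canonical projections. Let $\langle\,,\rangle$ be the skew-Hopf pairing of $H\ltimes U^-_{\max}$ (with the coproduct of $U(\chi)_{\max}$) and $U^+_{\max}\rtimes H$, that is, the bilinear form determined by $\langle F_i,E_j\rangle=\delta_{ij}$, $\langle K_\lambda,K_\mu\rangle=\chi(\lambda,\mu)^{-1}$, $\langle F_i,K_\lambda\rangle=0=\langle K_\lambda,E_j\rangle$, $\langle1,x\rangle=\varepsilon(x)$, $\langle y,1\rangle=\varepsilon(y)$, $\langle yy',x\rangle=\langle y,x_{(1)}\rangle\langle y',x_{(2)}\rangle$ and $\langle y,xx'\rangle=\langle y_{(1)},x'\rangle\langle y_{(2)},x\rangle$. For $e\in U^+_{\max}\rtimes H$ and $f\in H\ltimes U^-$ put $$e\triangleright f=\langle\pi_{\max}(f_{(1)}),e\rangle f_{(2)},\qquad f\triangleleft e=\langle\pi_{\max}(f_{(2)}),e\rangle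 f_{(1)} .$$ Let $\overline\sigma:U^-_{\max}\to U^+_{\max}\rtimes H$ be the algebra homomorphism with $\overline\sigma(F_i)=c_{\tau(i)}K_iE_{\tau(i)}$. For $\mu\in\mathbb N^n$ let $(F_{\mu,j})_j$, $(E_{\mu,j})_j$ be bases of $(U^-_{\max})_{-\mu}$ and $(U^+_{\max})_\mu$ that are dual with respect to $\langle\,,\rangle$; in sums over $\mu$, an expression containing one $F_\mu$ and one $E_\mu$ stands for its sum over all pairs $(F_{\mu,j},E_{\mu,j})$. Define a bilinear operation $\star$ on $H_\theta\ltimes U^-$ by $$(K_\lambda f)\star(K_\mu g)=\chi(\alpha,\mu)\,K_{\lambda+\mu}\sum_{\rho\in\mathbb N^n}(-1)^{|\rho|}\big(\overline\sigma(F_\rho)\triangleright f\big)K_\rho\big(g\triangleleft(S^{-1}(E_\rho)K_\rho)\big)$$ for $\lambda,\mu\in\mathbb Z^n_\theta$, $f\in U^-_{-\alpha}$, $g\in U^-$, and a linear map $\Delta_\star:H_\theta\ltimes U^-\to(H_\theta\ltimes U^-)\otimes U(\chi)_{\max}$ by $$\Delta_\star(K_\nu f)=\sum_{\lambda,\mu\in\mathbb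 N^n}K_\nu\big(\overline\sigma(F_\lambda)\triangleright f\triangleleft E_\mu\big)K_\lambda\otimes K_\nu F_\mu K_{\mu-\alpha}E_\lambda$$ for $\nu\in\mathbb Z^n_\theta$, $f\in U^-_{-\alpha}$. Let $B_{\mathbf c}\subset U(\chi)$ be the subalgebra generated by $K_iK_{\tau(i)}^{-1}$ and $B_i=F_i+c_iE_{\tau(i)}K_i^{-1}$ $(i\in I)$, with the coaction $(\mathrm{id}\otimes\pi_{\max})\circ\Delta:B_{\mathbf c}\to B_{\mathbf c}\otimes U(\chi)_{\max}$. Let $U(\chi)^{\mathrm{poly}}\supset B_{\mathbf c}$ be the subalgebra generated by $F_i$, $E_iK_i^{-1}$, $K_i^{-1}$, $K_iK_{\tau(i)}^{-1}$ $(i\in I)$, and let $\psi:U(\chi)^{\mathrm{poly}}\to H_\theta\ltimes U^-$ be the linear projection for the decomposition $$U(\chi)^{\mathrm{poly}}=(H_\theta\ltimes U^-)\oplus U(\chi)^{\mathrm{poly}}\,\mathrm{span}_k\{E_iK_i^{-1},K_i^{-1}\mid i\in I\}.$$ Condition (c): the ideal $\mathcal I$ is generated by $p(E_1,\dots,E_n)$,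 $p\in\mathcal S$, for a set $\mathcal S$ of homogeneous noncommutative polynomials such that $\pi_{0,0}\big(P_{-\lambda}(p(B_1,\dots,B_n))\big)=0$ for every $p\in\mathcal S$, where $\lambda\in\mathbb N^n$ is the degree of $p$. Here $P_\lambda$ is the projection onto $U^+K_\lambda G^-$ in $U(\chi)=\bigoplus_{\lambda\in\mathbb Z^n}U^+K_\lambda G^-$, with $G^-$ the subalgebra generated by the $F_iK_i$, and $\pi_{0,0}$ is the projection onto $U^+_0HU^-_0$ in $U(\chi)=\bigoplus_{\alpha,\beta\in\mathbb N^n}U^+_\alpha HU^-_{-\beta}$. **Statement.** Dual bases as above exist. The formulas for $\star$ and $\Delta_\star$ have only finitely many nonzero summands, they determine a unique bilinear operation $\star$ and a unique linear map $\Delta_\star$, and these do not depend on the choice of the dual bases. The linear projection $\psi$ exists and is unique. Moreover: 1. For every $\mathbf c\in k^n$, the operation $\star$ is associative with unit $1$, and $\Delta_\star$ makes $(H_\theta\ltimes U^-,\star)$ a right $U(\chi)_{\max}$-comodule algebra. Likewise $B_{\mathbf c}$ is a right $U(\chi)_{\max}$-comodule algebra with the coaction $(\mathrm{id}\otimes\pi_{\max})\circ\Delta$.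 2. If condition (c) holds, then the restriction $\psi:B_{\mathbf c}\to(H_\theta\ltimes U^-,\star)$ is an isomorphism of right $U(\chi)_{\max}$-comodule algebras, where the target has the coaction $\Delta_\star$. -/

import Mathlib

open scoped TensorProduct

namespace StarProduct

noncomputable section

/-! ## Bicharacters, words and weights -/

/-- The weight lattice `ℤⁿ`. -/
abbrev Weight (n : ℕ) : Type := Fin n → ℤ

/-- The standard basis vector `α_i` of `ℤⁿ`. -/
def α {n : ℕ} (i : Fin n) : Weight n := Pi.single i 1

/-- An element of `ℕⁿ`, seen in `ℤⁿ`. -/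
def natWeight {n : ℕ} (μ : Fin n → ℕ) : Weight n := fun i => (μ i : ℤ)

/-- A bicharacter `χ : ℤⁿ × ℤⁿ → kˣ` for which the matrix `q_ij = χ(α_i, α_j)` is symmetric. -/
structure SymmetricBicharacter (k : Type*) [Field k] (n : ℕ) where
  toHom : Weight n →+ Weight n →+ Additive kˣ
  symm : ∀ i j, toHom (α i) (α j) = toHom (α j) (α i)

variable {k : Type*} [Field k] {n : ℕ}

namespace SymmetricBicharacter

variable (χ : SymmetricBicharacter k n)

/-- The value `χ(a, b)` as an element of the field. -/
def val (a b : Weight n) : k := (((χ.toHom a b).toMul : kˣ) : k)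

instance : CoeFun (SymmetricBicharacter k n) (fun _ => Weight n → Weight n → k) where
  coe := val

theorem ne_zero (a b : Weight n) : χ a b ≠ 0 := Units.ne_zero _
theorem zero_left (a : Weight n) : χ 0 a = 1 := by simp [val]
theorem zero_right (a : Weight n) : χ a 0 = 1 := by simp [val]
theorem add_left (a b c : Weight n) : χ (a + b) c = χ a c * χ b c := by simp [val]
theorem add_right (a b c : Weight n) : χ a (b + c) = χ a b * χ a c := by simp [val]
theorem symm_simple (i j : Fin n) : χ (α i) (α j) = χ (α j) (α i) := by simp only [val, χ.symm i j]
theorem symm_all (a b : Weight n) : χ a b = χ b a := by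
  have h : χ.toHom = χ.toHom.flip := by
    ext i j
    exact congrArg (fun z => ((z.toMul : kˣ) : k)) (χ.symm i j)
  have := DFunLike.congr_fun (DFunLike.congr_fun h a) b
  simp only [val, this]
  rfl
theorem neg_neg (a b : Weight n) : χ (-a) (-b) = χ a b := by simp [val]
theorem neg_comm (a b : Weight n) : χ (-a) b = χ a (-b) := by simp [val]
theorem neg_mul (a b : Weight n) : χ (-a) b * χ a b = 1 := by simp [val]
theorem neg_mul' (a b : Weight n) : χ a (-b) * χ a b = 1 := by simp [val]

end SymmetricBicharacter

/-- The product of the family `x` along a word `l`, that is `x_{l_1} ⋯ x_{l_m}`. -/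
def word {A : Type*} [Monoid A] (x : Fin n → A) (l : List (Fin n)) : A := (l.map x).prod

/-- The weight `α_{l_1} + ⋯ + α_{l_m}` of a word. -/
def wordWeight (l : List (Fin n)) : Weight n := (l.map α).sum

/-- The span of all products of weight `μ` in the family `x`. -/
def weightSpan (k : Type*) [Field k] {A : Type*} [Ring A] [Algebra k A] (x : Fin n → A) (μ : Weight n) :
    Submodule k A :=
  Submodule.span k {a | ∃ l : List (Fin n), wordWeight l = μ ∧ word x l = a}

/-- The tensor algebra of a vector space with a basis indexed by `1, …, n`, that is the algebra of
noncommutative polynomials in `n` variables. -/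
abbrev Tens (k : Type*) [Field k] (n : ℕ) : Type _ := FreeAlgebra k (Fin n)

/-- The variables of the tensor algebra. -/
abbrev var (k : Type*) [Field k] {n : ℕ} (i : Fin n) : Tens k n := FreeAlgebra.ι k i

/-- Evaluation `p(x_1, …, x_n)` of noncommutative polynomials. -/
abbrev polyEval {A : Type*} [Ring A] [Algebra k A] (x : Fin n → A) : Tens k n →ₐ[k] A :=
  FreeAlgebra.lift k x

/-! ## The braided coproduct on the tensor algebra and pre-Nichols ideals -/

/-- The action of the group-like element `K_i` on the tensor algebra, `K_i · x_j = q_ij x_j`. -/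
def groupAct (χ : SymmetricBicharacter k n) (i : Fin n) : Tens k n →ₐ[k] Tens k n :=
  FreeAlgebra.lift k fun j => χ (α i) (α j) • var k j

/-- Left multiplication by `x_i ⊗ 1 + 1 ⊗ x_i` in the braided tensor square of the tensor
algebra: `a ⊗ b ↦ x_i a ⊗ b + (K_i · a) ⊗ x_i b`. -/
def braidedLeftMul (χ : SymmetricBicharacter k n) (i : Fin n) :
    Module.End k (Tens k n ⊗[k] Tens k n) :=
  TensorProduct.map (LinearMap.mulLeft k (var k i)) LinearMap.id +
    TensorProduct.map (groupAct χ i).toLinearMap (LinearMap.mulLeft k (var k i))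

/-- The coproduct of the braided Hopf algebra `T(V⁺(χ))`: the homomorphism into the braided tensor
square with `x_i ↦ x_i ⊗ 1 + 1 ⊗ x_i`. The same formula is the coproduct of `T(V⁻(χ))`, as the two
braidings agree on the basis vectors. -/
def braidedComul (χ : SymmetricBicharacter k n) : Tens k n →ₗ[k] Tens k n ⊗[k] Tens k n :=
  LinearMap.applyₗ (1 ⊗ₜ[k] 1) ∘ₗ (FreeAlgebra.lift k (braidedLeftMul χ)).toLinearMap

/-- A `ℤⁿ`-graded biideal of `T(V⁺(χ))` contained in `⨁_{m ≥ 2} T(V⁺(χ))_m`. The corresponding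
quotient is a pre-Nichols algebra. -/
structure PreNicholsIdeal (χ : SymmetricBicharacter k n) where
  ideal : Submodule k (Tens k n)
  mul_left : ∀ a, ∀ p ∈ ideal, a * p ∈ ideal
  mul_right : ∀ a, ∀ p ∈ ideal, p * a ∈ ideal
  graded : ideal ≤ ⨆ μ : Weight n, ideal ⊓ weightSpan k (var k) μ
  two_le : ideal ≤ Submodule.span k {p | ∃ l : List (Fin n), 2 ≤ l.length ∧ word (var k) l = p}
  comul_mem : ∀ p ∈ ideal, braidedComul χ p ∈
    LinearMap.range (TensorProduct.map ideal.subtype (LinearMap.id (R := k) (M := Tens k n))) ⊔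
    LinearMap.range (TensorProduct.map (LinearMap.id (R := k) (M := Tens k n)) ideal.subtype)

/-- The maximal pre-Nichols ideal, which defines the Nichols algebra: the sum of all of them. -/
def maxIdeal (χ : SymmetricBicharacter k n) : PreNicholsIdeal χ where
  ideal := ⨆ J : PreNicholsIdeal χ, J.ideal
  mul_left a p hp := by
    have : (⨆ J : PreNicholsIdeal χ, J.ideal) ≤
        (⨆ J : PreNicholsIdeal χ, J.ideal).comap (LinearMap.mulLeft k a) :=
      iSup_le fun J p hp => (le_iSup (fun J : PreNicholsIdeal χ => J.ideal) J) (J.mul_left a p hp)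
    exact this hp
  mul_right a p hp := by
    have : (⨆ J : PreNicholsIdeal χ, J.ideal) ≤
        (⨆ J : PreNicholsIdeal χ, J.ideal).comap (LinearMap.mulRight k a) :=
      iSup_le fun J p hp => (le_iSup (fun J : PreNicholsIdeal χ => J.ideal) J) (J.mul_right a p hp)
    exact this hp
  graded := iSup_le fun J => J.graded.trans <| iSup_mono fun μ =>
    inf_le_inf_right _ (le_iSup (fun J : PreNicholsIdeal χ => J.ideal) J)
  two_le := iSup_le fun J => J.two_le
  comul_mem p hp := by
    set M := ⨆ J : PreNicholsIdeal χ, J.ideal with hM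
    have : M ≤ (LinearMap.range (TensorProduct.map M.subtype
          (LinearMap.id (R := k) (M := Tens k n))) ⊔
        LinearMap.range (TensorProduct.map (LinearMap.id (R := k) (M := Tens k n))
          M.subtype)).comap (braidedComul χ) := by
      refine iSup_le fun J p hp => ?_
      have hJ : J.ideal ≤ M := le_iSup (fun J : PreNicholsIdeal χ => J.ideal) J
      refine SetLike.le_def.1 (sup_le_sup ?_ ?_) (J.comul_mem p hp)
      · rintro _ ⟨t, rfl⟩
        refine ⟨TensorProduct.map (Submodule.inclusion hJ) LinearMap.id t, ?_⟩
        rw [← LinearMap.comp_apply, ← TensorProduct.map_comp]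
        rfl
      · rintro _ ⟨t, rfl⟩
        refine ⟨TensorProduct.map LinearMap.id (Submodule.inclusion hJ) t, ?_⟩
        rw [← LinearMap.comp_apply, ← TensorProduct.map_comp]
        rfl
    exact this hp

theorem le_maxIdeal {χ : SymmetricBicharacter k n} (J : PreNicholsIdeal χ) :
    J.ideal ≤ (maxIdeal χ).ideal :=
  le_iSup (fun J : PreNicholsIdeal χ => J.ideal) J

/-! ### Auxiliary facts on evaluations -/

section Aux

variable {A : Type*} [Ring A] [Algebra k A]

theorem polyEval_word (x : Fin n → A) (l : List (Fin n)) :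
    polyEval x (word (var k) l) = word x l := by
  induction l with
  | nil => simp [word]
  | cons i l ih => simp_all [word]

/-- If `v_i u_j = q_ij u_j v_i` then evaluation at `u + v` is computed by the braided coproduct. -/
theorem polyEval_add (χ : SymmetricBicharacter k n) (u v : Fin n → A)
    (h : ∀ i j, v i * u j = χ (α i) (α j) • (u j * v i)) (p : Tens k n) :
    polyEval (fun i => u i + v i) p =
      LinearMap.mul' k A (TensorProduct.map (polyEval u).toLinearMap (polyEval v).toLinearMap
        (braidedComul χ p)) := by
  have key : ∀ i (a : Tens k n), v i * polyEval u a = polyEval u (groupAct χ i a) * v i := by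
    intro i a
    induction a using FreeAlgebra.induction with
    | grade0 r => simp [Algebra.commutes]
    | grade1 j => simp [groupAct, h]
    | mul a b ha hb =>
      rw [map_mul, ← mul_assoc, ha, mul_assoc, hb, map_mul, map_mul, mul_assoc]
    | add a b ha hb => simp [mul_add, add_mul, ha, hb]
  suffices H : ∀ (p : Tens k n) (t : Tens k n ⊗[k] Tens k n),
      LinearMap.mul' k A (TensorProduct.map (polyEval u).toLinearMap (polyEval v).toLinearMap
        (FreeAlgebra.lift k (braidedLeftMul χ) p t)) = polyEval (fun i => u i + v i) p *
      LinearMap.mul' k A (TensorProduct.map (polyEval u).toLinearMap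
        (polyEval v).toLinearMap t) by
    have := H p (1 ⊗ₜ 1)
    simp only [TensorProduct.map_tmul, AlgHom.toLinearMap_apply, map_one, LinearMap.mul'_apply,
      mul_one] at this
    exact this.symm
  intro p
  induction p using FreeAlgebra.induction with
  | grade0 r =>
    intro t
    rw [AlgHom.commutes, AlgHom.commutes, Module.algebraMap_end_apply, map_smul, map_smul,
      Algebra.smul_def]
  | grade1 i =>
    intro t
    induction t using TensorProduct.induction_on with
    | zero => simp
    | tmul a b =>
      simp [braidedLeftMul, add_mul, ← mul_assoc, key]
    | add s t hs ht => simp_all [mul_add]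
  | mul a b ha hb => intro t; simp [ha, hb, mul_assoc]
  | add a b ha hb => intro t; simp [ha, hb, add_mul]

/-- Evaluation at a family twisted by commuting group-like factors. -/
theorem polyEval_twist (g : Weight n → A) (g0 : g 0 = 1) (gadd : ∀ a b, g (a + b) = g a * g b)
    (y : Fin n → A) (h : ∀ a i, g a * y i = y i * g a) {μ : Weight n} {p : Tens k n}
    (hp : p ∈ weightSpan k (var k) μ) :
    polyEval (fun i => g (α i) * y i) p = g μ * polyEval y p := by
  induction hp using Submodule.span_induction with
  | mem p hp =>
    obtain ⟨l, rfl, rfl⟩ := hp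
    rw [polyEval_word, polyEval_word]
    induction l with
    | nil => simp [word, wordWeight, g0]
    | cons i l ih =>
      have e1 : ∀ z : Fin n → A, word z (i :: l) = z i * word z l := fun z => by simp [word]
      have e2 : wordWeight (i :: l) = α i + wordWeight l := by simp [wordWeight]
      rw [e1, e1, e2, ih, gadd, mul_assoc, mul_assoc, ← mul_assoc (y i), ← h, mul_assoc]
  | zero => simp
  | add a b _ _ ha hb => simp [ha, hb, mul_add]
  | smul r a _ ha => simp [ha]

theorem PreNicholsIdeal.le_of_homogeneous {χ : SymmetricBicharacter k n} (J : PreNicholsIdeal χ)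
    (S : Submodule k (Tens k n))
    (h : ∀ μ, ∀ p ∈ J.ideal, p ∈ weightSpan k (var k) μ → p ∈ S) : J.ideal ≤ S :=
  J.graded.trans (iSup_le fun μ p hp => h μ p hp.1 hp.2)

theorem PreNicholsIdeal.polyEval_twist_eq_zero {χ : SymmetricBicharacter k n}
    (J : PreNicholsIdeal χ) (g : Weight n → A) (g0 : g 0 = 1)
    (gadd : ∀ a b, g (a + b) = g a * g b) (y : Fin n → A) (h : ∀ a i, g a * y i = y i * g a)
    (hy : ∀ p ∈ J.ideal, polyEval y p = 0) (p : Tens k n) (hp : p ∈ J.ideal) :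
    polyEval (fun i => g (α i) * y i) p = 0 := by
  refine J.le_of_homogeneous
    (LinearMap.ker (polyEval (fun i => g (α i) * y i)).toLinearMap) ?_ hp
  intro μ p hp hμ
  simp only [LinearMap.mem_ker, AlgHom.toLinearMap_apply]
  rw [polyEval_twist g g0 gadd y h hμ, hy p hp, mul_zero]

theorem PreNicholsIdeal.polyEval_eq_zero_of_mul {χ : SymmetricBicharacter k n}
    (J : PreNicholsIdeal χ) (x : Fin n → A) (hx : ∀ i j, x i * x j = 0) (p : Tens k n)
    (hp : p ∈ J.ideal) : polyEval x p = 0 := by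
  have : J.ideal ≤ LinearMap.ker (polyEval x).toLinearMap := by
    refine J.two_le.trans (Submodule.span_le.2 ?_)
    rintro _ ⟨l, hl, rfl⟩
    simp only [SetLike.mem_coe, LinearMap.mem_ker, AlgHom.toLinearMap_apply, polyEval_word]
    match l, hl with
    | i :: j :: l, _ => simp [word, ← mul_assoc, hx]
  exact this hp

theorem PreNicholsIdeal.polyEval_add_eq_zero {χ : SymmetricBicharacter k n}
    (J : PreNicholsIdeal χ) (u v : Fin n → A)
    (h : ∀ i j, v i * u j = χ (α i) (α j) • (u j * v i))
    (hu : ∀ p ∈ J.ideal, polyEval u p = 0) (hv : ∀ p ∈ J.ideal, polyEval v p = 0)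
    (p : Tens k n) (hp : p ∈ J.ideal) : polyEval (fun i => u i + v i) p = 0 := by
  rw [polyEval_add χ u v h]
  have : LinearMap.range (TensorProduct.map J.ideal.subtype
        (LinearMap.id (R := k) (M := Tens k n))) ⊔
      LinearMap.range (TensorProduct.map (LinearMap.id (R := k) (M := Tens k n))
        J.ideal.subtype) ≤
      LinearMap.ker (LinearMap.mul' k A ∘ₗ
        TensorProduct.map (polyEval u).toLinearMap (polyEval v).toLinearMap) := by
    refine sup_le ?_ ?_
    · rintro _ ⟨t, rfl⟩
      induction t using TensorProduct.induction_on with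
      | zero => simp
      | tmul a b => simp [hu _ a.2]
      | add s t hs ht => rw [map_add]; exact add_mem hs ht
    · rintro _ ⟨t, rfl⟩
      induction t using TensorProduct.induction_on with
      | zero => simp
      | tmul a b => simp [hv _ b.2]
      | add s t hs ht => rw [map_add]; exact add_mem hs ht
  exact this (J.comul_mem p hp)

end Aux

/-! ## Bosonizations -/

/-- Generators of a bosonization: `X_i` for `i = 1, …, n` and `K_λ` for `λ ∈ ℤⁿ`. -/
inductive BosGen (n : ℕ) : Type
  | X (i : Fin n)
  | K (a : Weight n)

/-- Defining relations of `(T(V^±(χ))/J) ⋊ H`, where the sign `s` is `1` or `-1`. -/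
inductive BosRel (χ : SymmetricBicharacter k n) (s : ℤˣ) (J : PreNicholsIdeal χ) :
    FreeAlgebra k (BosGen n) → FreeAlgebra k (BosGen n) → Prop
  | K_zero : BosRel χ s J (FreeAlgebra.ι k (.K 0)) 1
  | K_add (a b : Weight n) : BosRel χ s J (FreeAlgebra.ι k (.K (a + b)))
      (FreeAlgebra.ι k (.K a) * FreeAlgebra.ι k (.K b))
  | K_X (a : Weight n) (i : Fin n) :
      BosRel χ s J (FreeAlgebra.ι k (.K a) * FreeAlgebra.ι k (.X i))
        (χ a (s • α i) • (FreeAlgebra.ι k (.X i) * FreeAlgebra.ι k (.K a)))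
  | ideal (p : Tens k n) (hp : p ∈ J.ideal) :
      BosRel χ s J (polyEval (fun i => FreeAlgebra.ι k (.X i)) p) 0

/-- The bosonization `U⁺ ⋊ H` (for `s = 1`, with `X_i = E_i`) respectively `U⁻ ⋊ H` (for `s = -1`,
with `X_i = F_i`), where `U⁺` is the quotient of the tensor algebra by `J`, and `H` is the group
algebra of `ℤⁿ` with basis `K_λ`. -/
def Bos (χ : SymmetricBicharacter k n) (s : ℤˣ) (J : PreNicholsIdeal χ) : Type _ :=
  RingQuot (BosRel χ s J)

namespace Bos

variable (χ : SymmetricBicharacter k n) (s : ℤˣ) (J : PreNicholsIdeal χ)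

instance : Ring (Bos χ s J) := inferInstanceAs (Ring (RingQuot (BosRel χ s J)))
instance : Algebra k (Bos χ s J) := inferInstanceAs (Algebra k (RingQuot (BosRel χ s J)))

/-- The quotient map from the free algebra on the generators. -/
def mk : FreeAlgebra k (BosGen n) →ₐ[k] Bos χ s J := RingQuot.mkAlgHom k (BosRel χ s J)

/-- The generators `E_i` respectively `F_i`. -/
def X (i : Fin n) : Bos χ s J := mk χ s J (FreeAlgebra.ι k (.X i))

/-- The group-like elements `K_λ`. -/
def K (a : Weight n) : Bos χ s J := mk χ s J (FreeAlgebra.ι k (.K a))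

theorem mk_rel {x y : FreeAlgebra k (BosGen n)} (h : BosRel χ s J x y) :
    mk χ s J x = mk χ s J y := RingQuot.mkAlgHom_rel k h

theorem K_zero : K χ s J 0 = 1 := by
  have := mk_rel χ s J .K_zero
  rwa [map_one] at this

theorem K_add (a b : Weight n) : K χ s J (a + b) = K χ s J a * K χ s J b := by
  have := mk_rel χ s J (.K_add a b)
  rwa [map_mul] at this

theorem K_X (a : Weight n) (i : Fin n) :
    K χ s J a * X χ s J i = χ a (s • α i) • (X χ s J i * K χ s J a) := by
  have := mk_rel χ s J (.K_X a i)
  rwa [map_mul, map_smul, map_mul] at this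

theorem polyEval_X (p : Tens k n) (hp : p ∈ J.ideal) : polyEval (X χ s J) p = 0 := by
  have := mk_rel χ s J (.ideal p hp)
  rw [map_zero] at this
  rw [← this, ← AlgHom.comp_apply]
  congr 1
  ext i
  simp [X]

variable {A : Type*} [Ring A] [Algebra k A]

/-- Families in an algebra that satisfy the defining relations of the bosonization. -/
structure IsLift (x : Fin n → A) (g : Weight n → A) : Prop where
  g_zero : g 0 = 1
  g_add : ∀ a b, g (a + b) = g a * g b
  g_x : ∀ a i, g a * x i = χ a (s • α i) • (x i * g a)
  ideal : ∀ p ∈ J.ideal, polyEval x p = 0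

variable {χ s J} in
/-- The universal property of the bosonization. -/
def lift {x : Fin n → A} {g : Weight n → A} (h : IsLift χ s J x g) : Bos χ s J →ₐ[k] A :=
  RingQuot.liftAlgHom k ⟨FreeAlgebra.lift k fun
    | .X i => x i
    | .K a => g a, by
    rintro _ _ (_ | ⟨a, b⟩ | ⟨a, i⟩ | ⟨p, hp⟩)
    · simp [h.g_zero]
    · simp [h.g_add]
    · simp [h.g_x]
    · rw [map_zero, ← h.ideal p hp, ← AlgHom.comp_apply]
      congr 1
      ext i
      simp⟩

section

variable {χ s J} {x : Fin n → A} {g : Weight n → A} (h : IsLift χ s J x g)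

@[simp] theorem lift_X (i : Fin n) : lift h (X χ s J i) = x i := by
  unfold lift X mk
  erw [RingQuot.liftAlgHom_mkAlgHom_apply]
  simp

@[simp] theorem lift_K (a : Weight n) : lift h (K χ s J a) = g a := by
  unfold lift K mk
  erw [RingQuot.liftAlgHom_mkAlgHom_apply]
  simp

end

variable {χ s J} in
theorem hom_ext {f f' : Bos χ s J →ₐ[k] A} (hX : ∀ i, f (X χ s J i) = f' (X χ s J i))
    (hK : ∀ a, f (K χ s J a) = f' (K χ s J a)) : f = f' := by
  apply RingQuot.ringQuot_ext'
  apply FreeAlgebra.hom_ext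
  funext y
  cases y with
  | X i => exact hX i
  | K a => exact hK a

/-- A subspace that contains `1` and is stable under left multiplication by the generators is
everything. -/
theorem eq_top_of_left (S : Submodule k (Bos χ s J)) (h1 : 1 ∈ S)
    (hX : ∀ i, ∀ x ∈ S, X χ s J i * x ∈ S) (hK : ∀ a, ∀ x ∈ S, K χ s J a * x ∈ S) : S = ⊤ := by
  have H : ∀ y : FreeAlgebra k (BosGen n), ∀ x ∈ S, mk χ s J y * x ∈ S := by
    intro y
    induction y using FreeAlgebra.induction with
    | grade0 r => intro x hx; rw [AlgHom.commutes, ← Algebra.smul_def]; exact S.smul_mem r hx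
    | grade1 y => cases y with
      | X i => exact hX i
      | K a => exact hK a
    | mul a b ha hb => intro x hx; rw [map_mul, mul_assoc]; exact ha _ (hb _ hx)
    | add a b ha hb => intro x hx; rw [map_add, add_mul]; exact add_mem (ha _ hx) (hb _ hx)
  rw [eq_top_iff]
  rintro x -
  obtain ⟨y, rfl⟩ := RingQuot.mkAlgHom_surjective k (BosRel χ s J) x
  have := H y 1 h1
  rwa [mul_one] at this

theorem sign_smul (i j : Fin n) : χ (s • α i) (s • α j) = χ (α i) (α j) := by
  rcases Int.units_eq_one_or s with rfl | rfl
  · simp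
  · have : ∀ i : Fin n, (-1 : ℤˣ) • α i = -α i := fun i => by
      rw [Units.smul_def]; simp
    rw [this, this, χ.neg_neg]

theorem comul_isLift : IsLift χ s J
    (fun i => X χ s J i ⊗ₜ[k] (1 : Bos χ s J) + K χ s J (s • α i) ⊗ₜ[k] X χ s J i)
    (fun a => K χ s J a ⊗ₜ[k] K χ s J a) :=
  ⟨by simp [K_zero, Algebra.TensorProduct.one_def],
    by simp [K_add],
    (by
      intro a i
      have hc : K χ s J a * K χ s J (s • α i) = K χ s J (s • α i) * K χ s J a := by
        rw [← K_add, ← K_add, add_comm]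
      simp [mul_add, add_mul, K_X, hc, TensorProduct.smul_tmul', TensorProduct.tmul_smul]),
    (by
      refine J.polyEval_add_eq_zero (fun i => X χ s J i ⊗ₜ 1)
        (fun i => K χ s J (s • α i) ⊗ₜ X χ s J i) ?_ ?_ ?_
      · intro i j
        simp [K_X, sign_smul, TensorProduct.smul_tmul']
      · intro p hp
        have : polyEval (fun i => X χ s J i ⊗ₜ[k] (1 : Bos χ s J)) =
            Algebra.TensorProduct.includeLeft.comp (polyEval (k := k) (X χ s J)) := by
          ext i; simp
        rw [this, AlgHom.comp_apply, polyEval_X χ s J p hp, map_zero]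
      · intro p hp
        have e : (fun i => K χ s J (s • α i) ⊗ₜ[k] X χ s J i) =
            fun i => (K χ s J (s • α i) ⊗ₜ[k] (1 : Bos χ s J)) * (1 ⊗ₜ[k] X χ s J i) := by
          ext i; simp
        rw [e]
        refine J.polyEval_twist_eq_zero
          (fun a => K χ s J (s • a) ⊗ₜ[k] (1 : Bos χ s J)) ?_ ?_
          (fun i => 1 ⊗ₜ[k] X χ s J i) ?_ ?_ p hp
        · simp [K_zero, Algebra.TensorProduct.one_def]
        · intro a b; simp [K_add]
        · intro a i; simp
        · intro p hp
          have : polyEval (fun i => (1 : Bos χ s J) ⊗ₜ[k] X χ s J i) =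
              Algebra.TensorProduct.includeRight.comp (polyEval (k := k) (X χ s J)) := by
            ext i; simp
          rw [this, AlgHom.comp_apply, polyEval_X χ s J p hp, map_zero])⟩

/-- The coproduct of the bosonization, `X_i ↦ X_i ⊗ 1 + K_{±α_i} ⊗ X_i` and
`K_λ ↦ K_λ ⊗ K_λ`. -/
def comulHom : Bos χ s J →ₐ[k] Bos χ s J ⊗[k] Bos χ s J := lift (comul_isLift χ s J)

theorem counit_isLift : IsLift χ s J (fun _ => (0 : k)) (fun _ => 1) :=
  ⟨rfl, by simp, by simp, J.polyEval_eq_zero_of_mul _ (by simp)⟩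

/-- The counit of the bosonization, `X_i ↦ 0` and `K_λ ↦ 1`. -/
def counitHom : Bos χ s J →ₐ[k] k := lift (counit_isLift χ s J)

@[simp] theorem comulHom_X (i : Fin n) : comulHom χ s J (X χ s J i) =
    X χ s J i ⊗ₜ 1 + K χ s J (s • α i) ⊗ₜ X χ s J i := lift_X _ i
@[simp] theorem comulHom_K (a : Weight n) : comulHom χ s J (K χ s J a) =
    K χ s J a ⊗ₜ K χ s J a := lift_K _ a
@[simp] theorem counitHom_X (i : Fin n) : counitHom χ s J (X χ s J i) = 0 := by simp [counitHom]
@[simp] theorem counitHom_K (a : Weight n) : counitHom χ s J (K χ s J a) = 1 := by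
  simp [counitHom]

instance : Bialgebra k (Bos χ s J) :=
  Bialgebra.ofAlgHom (comulHom χ s J) (counitHom χ s J)
    (by
      apply hom_ext
      · intro i
        simp [TensorProduct.add_tmul, TensorProduct.tmul_add, Algebra.TensorProduct.one_def,
          add_assoc]
      · intro a; simp)
    (by apply hom_ext <;> intro i <;> simp)
    (by apply hom_ext <;> intro i <;> simp)

@[simp] theorem comul_X (i : Fin n) : Coalgebra.comul (R := k) (X χ s J i) =
    X χ s J i ⊗ₜ 1 + K χ s J (s • α i) ⊗ₜ X χ s J i := comulHom_X χ s J i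
@[simp] theorem comul_K (a : Weight n) : Coalgebra.comul (R := k) (K χ s J a) =
    K χ s J a ⊗ₜ K χ s J a := comulHom_K χ s J a
@[simp] theorem counit_X (i : Fin n) : Coalgebra.counit (R := k) (X χ s J i) = 0 :=
  counitHom_X χ s J i
@[simp] theorem counit_K (a : Weight n) : Coalgebra.counit (R := k) (K χ s J a) = 1 :=
  counitHom_K χ s J a

variable {J} in
/-- The canonical projection for an inclusion of pre-Nichols ideals. -/
def proj {J' : PreNicholsIdeal χ} (h : J.ideal ≤ J'.ideal) : Bos χ s J →ₐ[k] Bos χ s J' :=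
  lift (x := X χ s J') (g := K χ s J') ⟨K_zero _ _ _, K_add _ _ _, K_X _ _ _,
    fun p hp => polyEval_X χ s J' p (h hp)⟩

end Bos

/-! ## The Drinfeld double -/

/-- Generators of the Drinfeld double. -/
inductive UGen (n : ℕ) : Type
  | E (i : Fin n)
  | F (i : Fin n)
  | K (a : Weight n)

/-- Defining relations of the Drinfeld double `U(χ)` of the pre-Nichols algebra given by `J`. -/
inductive URel (χ : SymmetricBicharacter k n) (J : PreNicholsIdeal χ) :
    FreeAlgebra k (UGen n) → FreeAlgebra k (UGen n) → Prop
  | K_zero : URel χ J (FreeAlgebra.ι k (.K 0)) 1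
  | K_add (a b : Weight n) : URel χ J (FreeAlgebra.ι k (.K (a + b)))
      (FreeAlgebra.ι k (.K a) * FreeAlgebra.ι k (.K b))
  | K_E (a : Weight n) (i : Fin n) :
      URel χ J (FreeAlgebra.ι k (.K a) * FreeAlgebra.ι k (.E i))
        (χ a (α i) • (FreeAlgebra.ι k (.E i) * FreeAlgebra.ι k (.K a)))
  | K_F (a : Weight n) (i : Fin n) :
      URel χ J (FreeAlgebra.ι k (.K a) * FreeAlgebra.ι k (.F i))
        ((χ a (α i))⁻¹ • (FreeAlgebra.ι k (.F i) * FreeAlgebra.ι k (.K a)))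
  | E_F (i j : Fin n) :
      URel χ J (FreeAlgebra.ι k (.E i) * FreeAlgebra.ι k (.F j) -
          FreeAlgebra.ι k (.F j) * FreeAlgebra.ι k (.E i))
        (if i = j then FreeAlgebra.ι k (.K (α i)) - FreeAlgebra.ι k (.K (-α i)) else 0)
  | ideal_E (p : Tens k n) (hp : p ∈ J.ideal) :
      URel χ J (polyEval (fun i => FreeAlgebra.ι k (.E i)) p) 0
  | ideal_F (p : Tens k n) (hp : p ∈ J.ideal) :
      URel χ J (polyEval (fun i => FreeAlgebra.ι k (.F i)) p) 0

/-- The Drinfeld double `U(χ)` of the pre-Nichols algebra given by `J`. -/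
def U (χ : SymmetricBicharacter k n) (J : PreNicholsIdeal χ) : Type _ := RingQuot (URel χ J)

namespace U

variable (χ : SymmetricBicharacter k n) (J : PreNicholsIdeal χ)

instance : Ring (U χ J) := inferInstanceAs (Ring (RingQuot (URel χ J)))
instance : Algebra k (U χ J) := inferInstanceAs (Algebra k (RingQuot (URel χ J)))

/-- The quotient map from the free algebra on the generators. -/
def mk : FreeAlgebra k (UGen n) →ₐ[k] U χ J := RingQuot.mkAlgHom k (URel χ J)

/-- The generators `E_i`. -/
def E (i : Fin n) : U χ J := mk χ J (FreeAlgebra.ι k (.E i))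

/-- The generators `F_i`. -/
def F (i : Fin n) : U χ J := mk χ J (FreeAlgebra.ι k (.F i))

/-- The group-like elements `K_λ`. -/
def K (a : Weight n) : U χ J := mk χ J (FreeAlgebra.ι k (.K a))

theorem mk_rel {x y : FreeAlgebra k (UGen n)} (h : URel χ J x y) :
    mk χ J x = mk χ J y := RingQuot.mkAlgHom_rel k h

theorem K_zero : K χ J 0 = 1 := by
  have := mk_rel χ J .K_zero
  rwa [map_one] at this

theorem K_add (a b : Weight n) : K χ J (a + b) = K χ J a * K χ J b := by
  have := mk_rel χ J (.K_add a b)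
  rwa [map_mul] at this

theorem K_E (a : Weight n) (i : Fin n) :
    K χ J a * E χ J i = χ a (α i) • (E χ J i * K χ J a) := by
  have := mk_rel χ J (.K_E a i)
  rwa [map_mul, map_smul, map_mul] at this

theorem K_F (a : Weight n) (i : Fin n) :
    K χ J a * F χ J i = (χ a (α i))⁻¹ • (F χ J i * K χ J a) := by
  have := mk_rel χ J (.K_F a i)
  rwa [map_mul, map_smul, map_mul] at this

theorem E_F (i j : Fin n) : E χ J i * F χ J j - F χ J j * E χ J i =
    if i = j then K χ J (α i) - K χ J (-α i) else 0 := by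
  have := mk_rel χ J (.E_F i j)
  rw [map_sub, map_mul, map_mul, apply_ite (mk χ J), map_sub, map_zero] at this
  exact this

theorem polyEval_E (p : Tens k n) (hp : p ∈ J.ideal) : polyEval (E χ J) p = 0 := by
  have := mk_rel χ J (.ideal_E p hp)
  rw [map_zero] at this
  rw [← this, ← AlgHom.comp_apply]
  congr 1
  ext i
  simp [E]

theorem polyEval_F (p : Tens k n) (hp : p ∈ J.ideal) : polyEval (F χ J) p = 0 := by
  have := mk_rel χ J (.ideal_F p hp)
  rw [map_zero] at this
  rw [← this, ← AlgHom.comp_apply]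
  congr 1
  ext i
  simp [F]

variable {A : Type*} [Ring A] [Algebra k A]

/-- Families in an algebra that satisfy the defining relations of `U(χ)`. -/
structure IsLift (e f : Fin n → A) (g : Weight n → A) : Prop where
  g_zero : g 0 = 1
  g_add : ∀ a b, g (a + b) = g a * g b
  g_e : ∀ a i, g a * e i = χ a (α i) • (e i * g a)
  g_f : ∀ a i, g a * f i = (χ a (α i))⁻¹ • (f i * g a)
  e_f : ∀ i j, e i * f j - f j * e i = if i = j then g (α i) - g (-α i) else 0
  ideal_e : ∀ p ∈ J.ideal, polyEval e p = 0
  ideal_f : ∀ p ∈ J.ideal, polyEval f p = 0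

variable {χ J} in
/-- The universal property of `U(χ)`. -/
def lift {e f : Fin n → A} {g : Weight n → A} (h : IsLift χ J e f g) : U χ J →ₐ[k] A :=
  RingQuot.liftAlgHom k ⟨FreeAlgebra.lift k fun
    | .E i => e i
    | .F i => f i
    | .K a => g a, by
    rintro _ _ (_ | ⟨a, b⟩ | ⟨a, i⟩ | ⟨a, i⟩ | ⟨i, j⟩ | ⟨p, hp⟩ | ⟨p, hp⟩)
    · simp [h.g_zero]
    · simp [h.g_add]
    · simp [h.g_e]
    · simp [h.g_f]
    · have := h.e_f i j
      split_ifs at this ⊢ with hij <;> simp [this]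
    · rw [map_zero, ← h.ideal_e p hp, ← AlgHom.comp_apply]
      congr 1
      ext i
      simp
    · rw [map_zero, ← h.ideal_f p hp, ← AlgHom.comp_apply]
      congr 1
      ext i
      simp⟩

section

variable {χ J} {e f : Fin n → A} {g : Weight n → A} (h : IsLift χ J e f g)

@[simp] theorem lift_E (i : Fin n) : lift h (E χ J i) = e i := by
  unfold lift E mk
  erw [RingQuot.liftAlgHom_mkAlgHom_apply]
  simp

@[simp] theorem lift_F (i : Fin n) : lift h (F χ J i) = f i := by
  unfold lift F mk
  erw [RingQuot.liftAlgHom_mkAlgHom_apply]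
  simp

@[simp] theorem lift_K (a : Weight n) : lift h (K χ J a) = g a := by
  unfold lift K mk
  erw [RingQuot.liftAlgHom_mkAlgHom_apply]
  simp

end

variable {χ J} in
theorem hom_ext {φ φ' : U χ J →ₐ[k] A} (hE : ∀ i, φ (E χ J i) = φ' (E χ J i))
    (hF : ∀ i, φ (F χ J i) = φ' (F χ J i)) (hK : ∀ a, φ (K χ J a) = φ' (K χ J a)) : φ = φ' := by
  apply RingQuot.ringQuot_ext'
  apply FreeAlgebra.hom_ext
  funext y
  cases y with
  | E i => exact hE i
  | F i => exact hF i
  | K a => exact hK a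

theorem E_K (a : Weight n) (i : Fin n) :
    E χ J i * K χ J a = (χ a (α i))⁻¹ • (K χ J a * E χ J i) := by
  rw [K_E, smul_smul, inv_mul_cancel₀, one_smul]
  exact Units.ne_zero _

theorem val_neg_right (a b : Weight n) : χ a (-b) = (χ a b)⁻¹ :=
  eq_inv_of_mul_eq_one_left (χ.neg_mul' a b)

theorem val_neg_left (a b : Weight n) : χ (-a) b = (χ a b)⁻¹ :=
  eq_inv_of_mul_eq_one_left (χ.neg_mul a b)

theorem comul_isLift : IsLift χ J
    (fun i => E χ J i ⊗ₜ[k] (1 : U χ J) + K χ J (α i) ⊗ₜ[k] E χ J i)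
    (fun i => (1 : U χ J) ⊗ₜ[k] F χ J i + F χ J i ⊗ₜ[k] K χ J (-α i))
    (fun a => K χ J a ⊗ₜ[k] K χ J a) where
  g_zero := by simp [K_zero, Algebra.TensorProduct.one_def]
  g_add := by simp [K_add]
  g_e a i := by
    have hc : K χ J a * K χ J (α i) = K χ J (α i) * K χ J a := by
      rw [← K_add, ← K_add, add_comm]
    simp [mul_add, add_mul, K_E, hc, TensorProduct.smul_tmul', TensorProduct.tmul_smul]
  g_f a i := by
    have hc : K χ J a * K χ J (-α i) = K χ J (-α i) * K χ J a := by
      rw [← K_add, ← K_add, add_comm]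
    simp [mul_add, add_mul, K_F, hc, TensorProduct.smul_tmul', TensorProduct.tmul_smul]
  e_f i j := by
    have h1 : E χ J i * F χ J j = F χ J j * E χ J i +
        if i = j then K χ J (α i) - K χ J (-α i) else 0 := by rw [← E_F]; abel
    have h2 : (K χ J (α i) * F χ J j) ⊗ₜ[k] (E χ J i * K χ J (-α j)) =
        (F χ J j * K χ J (α i)) ⊗ₜ[k] (K χ J (-α j) * E χ J i) := by
      rw [K_F, E_K, val_neg_left, inv_inv, ← TensorProduct.smul_tmul', TensorProduct.tmul_smul,
        smul_smul, χ.symm_simple i j, inv_mul_cancel₀ (χ.ne_zero _ _), one_smul]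
    simp only [mul_add, add_mul, Algebra.TensorProduct.tmul_mul_tmul, one_mul, mul_one, h1, h2]
    split_ifs with hij
    · subst hij
      simp only [TensorProduct.add_tmul, TensorProduct.tmul_add, TensorProduct.sub_tmul,
        TensorProduct.tmul_sub]
      abel
    · simp only [add_zero]
      abel
  ideal_e := by
    refine J.polyEval_add_eq_zero (fun i => E χ J i ⊗ₜ 1)
      (fun i => K χ J (α i) ⊗ₜ E χ J i) ?_ ?_ ?_
    · intro i j
      simp [K_E, TensorProduct.smul_tmul']
    · intro p hp
      have : polyEval (fun i => E χ J i ⊗ₜ[k] (1 : U χ J)) =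
          Algebra.TensorProduct.includeLeft.comp (polyEval (k := k) (E χ J)) := by
        ext i; simp
      rw [this, AlgHom.comp_apply, polyEval_E χ J p hp, map_zero]
    · intro p hp
      have e : (fun i => K χ J (α i) ⊗ₜ[k] E χ J i) =
          fun i => (K χ J (α i) ⊗ₜ[k] (1 : U χ J)) * (1 ⊗ₜ[k] E χ J i) := by
        ext i; simp
      rw [e]
      refine J.polyEval_twist_eq_zero
        (fun a => K χ J a ⊗ₜ[k] (1 : U χ J)) ?_ ?_ (fun i => 1 ⊗ₜ[k] E χ J i) ?_ ?_ p hp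
      · simp [K_zero, Algebra.TensorProduct.one_def]
      · intro a b; simp [K_add]
      · intro a i; simp
      · intro p hp
        have : polyEval (fun i => (1 : U χ J) ⊗ₜ[k] E χ J i) =
            Algebra.TensorProduct.includeRight.comp (polyEval (k := k) (E χ J)) := by
          ext i; simp
        rw [this, AlgHom.comp_apply, polyEval_E χ J p hp, map_zero]
  ideal_f := by
    refine J.polyEval_add_eq_zero (fun i => 1 ⊗ₜ F χ J i)
      (fun i => F χ J i ⊗ₜ K χ J (-α i)) ?_ ?_ ?_
    · intro i j
      simp [K_F, val_neg_left]
    · intro p hp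
      have : polyEval (fun i => (1 : U χ J) ⊗ₜ[k] F χ J i) =
          Algebra.TensorProduct.includeRight.comp (polyEval (k := k) (F χ J)) := by
        ext i; simp
      rw [this, AlgHom.comp_apply, polyEval_F χ J p hp, map_zero]
    · intro p hp
      have e : (fun i => F χ J i ⊗ₜ[k] K χ J (-α i)) =
          fun i => ((1 : U χ J) ⊗ₜ[k] K χ J (-α i)) * (F χ J i ⊗ₜ[k] 1) := by
        ext i; simp
      rw [e]
      refine J.polyEval_twist_eq_zero
        (fun a => (1 : U χ J) ⊗ₜ[k] K χ J (-a)) ?_ ?_ (fun i => F χ J i ⊗ₜ[k] 1) ?_ ?_ p hp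
      · simp [K_zero, Algebra.TensorProduct.one_def]
      · intro a b; simp [neg_add_rev a b, add_comm (-b), K_add]
      · intro a i; simp
      · intro p hp
        have : polyEval (fun i => F χ J i ⊗ₜ[k] (1 : U χ J)) =
            Algebra.TensorProduct.includeLeft.comp (polyEval (k := k) (F χ J)) := by
          ext i; simp
        rw [this, AlgHom.comp_apply, polyEval_F χ J p hp, map_zero]

/-- The coproduct of `U(χ)`: `E_i ↦ E_i ⊗ 1 + K_i ⊗ E_i`, `F_i ↦ 1 ⊗ F_i + F_i ⊗ K_i⁻¹` and
`K_λ ↦ K_λ ⊗ K_λ`. -/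
def comulHom : U χ J →ₐ[k] U χ J ⊗[k] U χ J := lift (comul_isLift χ J)

theorem counit_isLift : IsLift χ J (fun _ => (0 : k)) (fun _ => 0) (fun _ => 1) :=
  ⟨rfl, by simp, by simp, by simp, by simp, J.polyEval_eq_zero_of_mul _ (by simp),
    J.polyEval_eq_zero_of_mul _ (by simp)⟩

/-- The counit of `U(χ)`: `E_i ↦ 0`, `F_i ↦ 0` and `K_λ ↦ 1`. -/
def counitHom : U χ J →ₐ[k] k := lift (counit_isLift χ J)

@[simp] theorem comulHom_E (i : Fin n) : comulHom χ J (E χ J i) =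
    E χ J i ⊗ₜ 1 + K χ J (α i) ⊗ₜ E χ J i := lift_E _ i
@[simp] theorem comulHom_F (i : Fin n) : comulHom χ J (F χ J i) =
    1 ⊗ₜ F χ J i + F χ J i ⊗ₜ K χ J (-α i) := lift_F _ i
@[simp] theorem comulHom_K (a : Weight n) : comulHom χ J (K χ J a) = K χ J a ⊗ₜ K χ J a :=
  lift_K _ a
@[simp] theorem counitHom_E (i : Fin n) : counitHom χ J (E χ J i) = 0 := lift_E _ i
@[simp] theorem counitHom_F (i : Fin n) : counitHom χ J (F χ J i) = 0 := lift_F _ i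
@[simp] theorem counitHom_K (a : Weight n) : counitHom χ J (K χ J a) = 1 := lift_K _ a

instance : Bialgebra k (U χ J) :=
  Bialgebra.ofAlgHom (comulHom χ J) (counitHom χ J)
    (by
      apply hom_ext
      · intro i
        simp [TensorProduct.add_tmul, TensorProduct.tmul_add, Algebra.TensorProduct.one_def,
          add_assoc]
      · intro i
        simp [TensorProduct.add_tmul, TensorProduct.tmul_add, Algebra.TensorProduct.one_def,
          add_assoc]
      · intro a; simp)
    (by apply hom_ext <;> intro i <;> simp)
    (by apply hom_ext <;> intro i <;> simp)

@[simp] theorem comul_E (i : Fin n) : Coalgebra.comul (R := k) (E χ J i) =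
    E χ J i ⊗ₜ 1 + K χ J (α i) ⊗ₜ E χ J i := comulHom_E χ J i
@[simp] theorem comul_F (i : Fin n) : Coalgebra.comul (R := k) (F χ J i) =
    1 ⊗ₜ F χ J i + F χ J i ⊗ₜ K χ J (-α i) := comulHom_F χ J i
@[simp] theorem comul_K (a : Weight n) : Coalgebra.comul (R := k) (K χ J a) =
    K χ J a ⊗ₜ K χ J a := comulHom_K χ J a

variable {J} in
/-- The canonical projection for an inclusion of pre-Nichols ideals. -/
def proj {J' : PreNicholsIdeal χ} (h : J.ideal ≤ J'.ideal) : U χ J →ₐ[k] U χ J' :=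
  lift (e := E χ J') (f := F χ J') (g := K χ J')
    ⟨K_zero _ _, K_add _ _, K_E _ _, K_F _ _, E_F _ _,
    fun p hp => polyEval_E χ J' p (h hp), fun p hp => polyEval_F χ J' p (h hp)⟩

/-- The canonical homomorphism `U⁻ ⋊ H → U(χ)`. -/
def ofBos : Bos χ (-1) J →ₐ[k] U χ J :=
  Bos.lift (x := F χ J) (g := K χ J) ⟨K_zero _ _, K_add _ _, by
    intro a i
    rw [K_F, show (-1 : ℤˣ) • α i = -α i by rw [Units.smul_def]; simp, val_neg_right],
    polyEval_F χ J⟩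

@[simp] theorem ofBos_X (i : Fin n) : ofBos χ J (Bos.X χ (-1) J i) = F χ J i := Bos.lift_X _ i
@[simp] theorem ofBos_K (a : Weight n) : ofBos χ J (Bos.K χ (-1) J a) = K χ J a :=
  Bos.lift_K _ a

end U

/-! ## The skew-Hopf pairing -/

namespace Pairing

variable (χ : SymmetricBicharacter k n) (J J' : PreNicholsIdeal χ)

/-- The convolution algebra of linear functionals on `U⁺ ⋊ H`. -/
abbrev Dual : Type _ := WithConv (Bos χ 1 J' →ₗ[k] k)

variable {χ J'}

/-- Left translation of functionals, `(translate a φ)(x) = φ(a x)`. -/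
def translate (a : Bos χ 1 J') (φ : Dual χ J') : Dual χ J' :=
  WithConv.toConv (φ.ofConv ∘ₗ LinearMap.mulLeft k a)

theorem translate_apply (a x : Bos χ 1 J') (φ : Dual χ J') : translate a φ x = φ (a * x) := rfl

theorem dual_add_apply (φ ψ : Dual χ J') (x : Bos χ 1 J') : (φ + ψ) x = φ x + ψ x := rfl
theorem dual_smul_apply (r : k) (φ : Dual χ J') (x : Bos χ 1 J') : (r • φ) x = r * φ x := rfl

theorem dual_ext {φ ψ : Dual χ J'} (h : ∀ x, φ x = ψ x) : φ = ψ := by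
  ext x
  exact h x

theorem mul_apply_K (φ ψ : Dual χ J') (a : Weight n) (x : Bos χ 1 J') :
    (φ * ψ) (Bos.K χ 1 J' a * x) =
      (translate (Bos.K χ 1 J' a) φ * translate (Bos.K χ 1 J' a) ψ) x := by
  rw [LinearMap.convMul_apply, LinearMap.convMul_apply, Bialgebra.comul_mul, Bos.comul_K]
  induction (Coalgebra.comul (R := k) x) using TensorProduct.induction_on with
  | zero => simp
  | tmul u v => simp [translate]
  | add s t hs ht => rw [mul_add, map_add, map_add, map_add, map_add, hs, ht]

theorem mul_apply_X (φ ψ : Dual χ J') (j : Fin n) (x : Bos χ 1 J') :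
    (φ * ψ) (Bos.X χ 1 J' j * x) =
      (translate (Bos.X χ 1 J' j) φ * ψ) x +
        (translate (Bos.K χ 1 J' (α j)) φ * translate (Bos.X χ 1 J' j) ψ) x := by
  rw [LinearMap.convMul_apply, LinearMap.convMul_apply, LinearMap.convMul_apply,
    Bialgebra.comul_mul, Bos.comul_X]
  induction (Coalgebra.comul (R := k) x) using TensorProduct.induction_on with
  | zero => simp
  | tmul u v => simp [translate, add_mul]
  | add s t hs ht =>
    rw [mul_add, map_add, map_add, map_add, map_add, map_add, map_add, hs, ht]
    ring

theorem mul_apply_one (φ ψ : Dual χ J') : (φ * ψ) 1 = φ 1 * ψ 1 := by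
  simp [LinearMap.convMul_apply, Algebra.TensorProduct.one_def]

variable (χ J')

theorem charHom_isLift (a : Weight n) :
    Bos.IsLift χ 1 J' (fun _ => (0 : k)) (fun b => χ (-a) b) :=
  ⟨χ.zero_right _, χ.add_right _, by simp, J'.polyEval_eq_zero_of_mul _ (by simp)⟩

/-- The functional `⟨K_a, ·⟩`: the character with `K_b ↦ χ(a, b)⁻¹` and `E_j ↦ 0`. -/
def charHom (a : Weight n) : Bos χ 1 J' →ₐ[k] k := Bos.lift (charHom_isLift χ J' a)

theorem matHom_isLift (i : Fin n) : Bos.IsLift χ 1 J'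
    (fun j => (!![0, if i = j then 1 else 0; 0, 0] : Matrix (Fin 2) (Fin 2) k))
    (fun b => !![χ (α i) b, 0; 0, 1]) where
  g_zero := by rw [χ.zero_right, Matrix.one_fin_two]
  g_add a b := by simp [χ.add_right]
  g_x a j := by
    rcases eq_or_ne i j with rfl | h
    · simp [χ.symm_all]
    · simp [h]
  ideal := J'.polyEval_eq_zero_of_mul _ (by
    intro i' j
    ext a b
    split_ifs <;> fin_cases a <;> fin_cases b <;> simp)

/-- The representation of `U⁺ ⋊ H` on `k²` whose matrix coefficients are `⟨K_i⁻¹, ·⟩`,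
`⟨F_i, ·⟩`, `0` and `⟨1, ·⟩`. -/
def matHom (i : Fin n) : Bos χ 1 J' →ₐ[k] Matrix (Fin 2) (Fin 2) k :=
  Bos.lift (matHom_isLift χ J' i)

/-- The functional `⟨K_a, ·⟩`. -/
def kappa (a : Weight n) : Dual χ J' := WithConv.toConv (charHom χ J' a).toLinearMap

/-- The functional `⟨F_i, ·⟩`. It satisfies `⟨F_i, E_j⟩ = δ_ij`, `⟨F_i, K_a⟩ = 0` and
`⟨F_i, x y⟩ = ⟨K_i⁻¹, x⟩ ⟨F_i, y⟩ + ⟨F_i, x⟩ ⟨1, y⟩`. -/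
def xi (i : Fin n) : Dual χ J' := WithConv.toConv
  (Matrix.entryLinearMap k k (0 : Fin 2) (1 : Fin 2) ∘ₗ (matHom χ J' i).toLinearMap)

variable {χ J'}

theorem kappa_apply (a : Weight n) (x : Bos χ 1 J') : kappa χ J' a x = charHom χ J' a x := rfl

theorem xi_apply (i : Fin n) (x : Bos χ 1 J') : xi χ J' i x = matHom χ J' i x 0 1 := rfl

theorem matHom_one_one (i : Fin n) (x : Bos χ 1 J') :
    matHom χ J' i x 1 0 = 0 ∧ matHom χ J' i x 1 1 = Coalgebra.counit (R := k) x := by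
  have : ∀ x ∈ (⊤ : Submodule k (Bos χ 1 J')),
      matHom χ J' i x 1 0 = 0 ∧ matHom χ J' i x 1 1 = Coalgebra.counit (R := k) x := by
    rw [← Bos.eq_top_of_left χ 1 J'
      { carrier := {x | matHom χ J' i x 1 0 = 0 ∧
          matHom χ J' i x 1 1 = Coalgebra.counit (R := k) x}
        add_mem' := fun {a b} ha hb => by simp_all
        zero_mem' := by simp
        smul_mem' := fun r x hx => by simp_all } ?_ ?_ ?_]
    · intro x hx
      exact hx
    · simp
    · rintro j x ⟨h1, h2⟩
      simp [matHom, Matrix.mul_apply]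
    · rintro a x ⟨h1, h2⟩
      constructor
      · simpa [matHom, Matrix.mul_apply] using h1
      · simpa [matHom, Matrix.mul_apply] using h2
  exact this x trivial

theorem translate_K_kappa (a b : Weight n) :
    translate (Bos.K χ 1 J' b) (kappa χ J' a) = χ (-a) b • kappa χ J' a := by
  apply dual_ext
  intro x
  rw [translate_apply, dual_smul_apply, kappa_apply, kappa_apply]
  simp [charHom]

theorem translate_X_kappa (a : Weight n) (j : Fin n) :
    translate (Bos.X χ 1 J' j) (kappa χ J' a) = 0 := by
  apply dual_ext
  intro x
  rw [translate_apply, kappa_apply]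
  simp [charHom]

theorem translate_K_xi (i : Fin n) (b : Weight n) :
    translate (Bos.K χ 1 J' b) (xi χ J' i) = χ (α i) b • xi χ J' i := by
  apply dual_ext
  intro x
  rw [translate_apply, dual_smul_apply, xi_apply, xi_apply]
  simp [matHom, Matrix.mul_apply]

theorem translate_X_xi (i j : Fin n) :
    translate (Bos.X χ 1 J' j) (xi χ J' i) = if i = j then 1 else 0 := by
  apply dual_ext
  intro x
  rw [translate_apply, xi_apply]
  have := (matHom_one_one (χ := χ) (J' := J') i x).2
  split_ifs with h
  · subst h
    simp [matHom, Matrix.mul_apply] at this ⊢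
    exact this
  · simp [matHom, Matrix.mul_apply, h]

theorem kappa_mul_xi (a : Weight n) (i : Fin n) :
    kappa χ J' a * xi χ J' i = χ a (-α i) • (xi χ J' i * kappa χ J' a) := by
  apply dual_ext
  intro x
  have : ∀ x ∈ (⊤ : Submodule k (Bos χ 1 J')), (kappa χ J' a * xi χ J' i) x =
      (χ a (-α i) • (xi χ J' i * kappa χ J' a)) x := by
    rw [← Bos.eq_top_of_left χ 1 J'
      (LinearMap.eqLocus (kappa χ J' a * xi χ J' i).ofConv
        (χ a (-α i) • (xi χ J' i * kappa χ J' a)).ofConv) ?_ ?_ ?_]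
    · intro x hx
      exact hx
    · change (kappa χ J' a * xi χ J' i) 1 = (χ a (-α i) • (xi χ J' i * kappa χ J' a)) 1
      rw [dual_smul_apply, mul_apply_one, mul_apply_one, xi_apply]
      simp
    · intro j x hx
      change (kappa χ J' a * xi χ J' i) _ = (χ a (-α i) • (xi χ J' i * kappa χ J' a)) _
      rw [dual_smul_apply, mul_apply_X, mul_apply_X, translate_X_kappa, translate_X_xi,
        translate_K_kappa]
      split_ifs with h
      · subst h
        rw [χ.neg_comm]
        simp
      · simp
    · intro b x hx
      change (kappa χ J' a * xi χ J' i) x = (χ a (-α i) • (xi χ J' i * kappa χ J' a)) x at hx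
      change (kappa χ J' a * xi χ J' i) _ = (χ a (-α i) • (xi χ J' i * kappa χ J' a)) _
      rw [dual_smul_apply] at hx
      rw [dual_smul_apply, mul_apply_K, mul_apply_K, translate_K_xi, translate_K_kappa,
        smul_mul_smul_comm, smul_mul_smul_comm, dual_smul_apply, dual_smul_apply, hx]
      ring
  exact this x trivial

theorem kappa_zero : kappa χ J' 0 = 1 := by
  apply dual_ext
  intro x
  have : charHom χ J' 0 = Bialgebra.counitAlgHom k (Bos χ 1 J') := by
    apply Bos.hom_ext
    · intro i; simp [charHom]
    · intro a; simp [charHom, χ.zero_left]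
  rw [kappa_apply, this]
  simp

theorem kappa_add (a b : Weight n) :
    kappa χ J' (a + b) = kappa χ J' a * kappa χ J' b := by
  apply dual_ext
  intro x
  have : ∀ x ∈ (⊤ : Submodule k (Bos χ 1 J')), kappa χ J' (a + b) x =
      (kappa χ J' a * kappa χ J' b) x := by
    rw [← Bos.eq_top_of_left χ 1 J'
      (LinearMap.eqLocus (kappa χ J' (a + b)).ofConv (kappa χ J' a * kappa χ J' b).ofConv)
      ?_ ?_ ?_]
    · intro x hx
      exact hx
    · change kappa χ J' (a + b) 1 = (kappa χ J' a * kappa χ J' b) 1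
      rw [mul_apply_one, kappa_apply, kappa_apply, kappa_apply]
      simp
    · intro j x hx
      change kappa χ J' (a + b) _ = (kappa χ J' a * kappa χ J' b) _
      rw [← translate_apply, mul_apply_X, translate_X_kappa, translate_X_kappa,
        translate_X_kappa]
      simp
    · intro c x hx
      change kappa χ J' (a + b) x = (kappa χ J' a * kappa χ J' b) x at hx
      change kappa χ J' (a + b) _ = (kappa χ J' a * kappa χ J' b) _
      rw [← translate_apply, mul_apply_K, translate_K_kappa, translate_K_kappa,
        translate_K_kappa, smul_mul_smul_comm, dual_smul_apply, dual_smul_apply, hx, neg_add,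
        χ.add_left]
  exact this x trivial

/-- The coefficient of `x_j` together with the constant term. -/
def linHom (j : Fin n) : Tens k n →ₐ[k] DualNumber k :=
  polyEval fun i => (if i = j then 1 else 0 : k) • DualNumber.eps

theorem linHom_fst (j : Fin n) (p : Tens k n) :
    (linHom j p).fst = polyEval (fun _ => (0 : k)) p := by
  have : (TrivSqZeroExt.fstHom k k k).comp (linHom (k := k) j) =
      polyEval (fun _ => (0 : k)) := by
    ext i
    by_cases h : i = j <;> simp [linHom, h]
  exact DFunLike.congr_fun this p

/-- The coefficient of `x_j` in a noncommutative polynomial. -/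
def coeffLin (j : Fin n) : Tens k n →ₗ[k] k := TrivSqZeroExt.sndHom k k ∘ₗ (linHom j).toLinearMap

theorem coeffLin_var_mul (i j : Fin n) (a : Tens k n) :
    coeffLin j (var k i * a) = if i = j then polyEval (fun _ => (0 : k)) a else 0 := by
  rw [← linHom_fst j]
  by_cases h : i = j <;> simp [coeffLin, linHom, h]

theorem coeffLin_groupAct (χ : SymmetricBicharacter k n) (i j : Fin n) (a : Tens k n) :
    coeffLin j (groupAct χ i a) = χ (α i) (α j) * coeffLin j a := by
  have h0 : ∀ a : Tens k n, polyEval (fun _ => (0 : k)) (groupAct χ i a) =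
      polyEval (fun _ => (0 : k)) a := by
    intro a
    rw [← AlgHom.comp_apply]
    congr 1
    ext i
    simp [groupAct]
  induction a using FreeAlgebra.induction with
  | grade0 r => simp [coeffLin, TrivSqZeroExt.algebraMap_eq_inl]
  | grade1 l =>
    by_cases h : l = j <;> simp [coeffLin, linHom, groupAct, h]
  | mul a b ha hb =>
    have e : ∀ a b : Tens k n, coeffLin j (a * b) = polyEval (fun _ => (0 : k)) a * coeffLin j b +
        polyEval (fun _ => (0 : k)) b * coeffLin j a := by
      intro a b
      rw [← linHom_fst j, ← linHom_fst j]
      simp [coeffLin, mul_comm]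
    rw [map_mul, e, e, ha, hb, h0, h0]
    ring
  | add a b ha hb => simp [ha, hb, mul_add]

theorem coeffLin_ideal (J : PreNicholsIdeal χ) (j : Fin n) (p : Tens k n) (hp : p ∈ J.ideal) :
    coeffLin j p = 0 := by
  have : linHom j p = 0 := J.polyEval_eq_zero_of_mul _ (by simp) p hp
  simp [coeffLin, this]

/-- The braided derivation with `∂_j(x_i p) = δ_ij p + q_ij x_i ∂_j(p)`. -/
def skewDer (χ : SymmetricBicharacter k n) (j : Fin n) : Tens k n →ₗ[k] Tens k n :=
  (TensorProduct.lid k (Tens k n)).toLinearMap ∘ₗ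
    TensorProduct.map (coeffLin j) LinearMap.id ∘ₗ braidedComul χ

theorem braidedComul_var_mul (i : Fin n) (p : Tens k n) :
    braidedComul χ (var k i * p) = braidedLeftMul χ i (braidedComul χ p) := by
  simp [braidedComul]

theorem skewDer_var_mul (i j : Fin n) (p : Tens k n) : skewDer χ j (var k i * p) =
    (if i = j then 1 else 0 : k) • p + χ (α i) (α j) • (var k i * skewDer χ j p) := by
  have hc : ∀ p : Tens k n, (TensorProduct.lid k (Tens k n)) (TensorProduct.map
      (polyEval fun _ => (0 : k)).toLinearMap LinearMap.id (braidedComul χ p)) = p := by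
    have H : ∀ (p : Tens k n) (t : Tens k n ⊗[k] Tens k n),
        (TensorProduct.lid k (Tens k n)) (TensorProduct.map
        (polyEval fun _ => (0 : k)).toLinearMap LinearMap.id
          (FreeAlgebra.lift k (braidedLeftMul χ) p t)) =
        p * (TensorProduct.lid k (Tens k n)) (TensorProduct.map
        (polyEval fun _ => (0 : k)).toLinearMap LinearMap.id t) := by
      intro p
      induction p using FreeAlgebra.induction with
      | grade0 r =>
        intro t
        rw [AlgHom.commutes, Module.algebraMap_end_apply, map_smul, map_smul, Algebra.smul_def]
      | grade1 i =>
        intro t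
        induction t using TensorProduct.induction_on with
        | zero => simp
        | tmul a b =>
          have : polyEval (fun _ => (0 : k)) (groupAct χ i a) =
              polyEval (fun _ => (0 : k)) a := by
            rw [← AlgHom.comp_apply]
            congr 1
            ext i
            simp [groupAct]
          simp [braidedLeftMul, this]
        | add s t hs ht => simp_all [mul_add]
      | mul a b ha hb => intro t; simp [ha, hb, mul_assoc]
      | add a b ha hb => intro t; simp [ha, hb, add_mul]
    intro p
    have := H p (1 ⊗ₜ 1)
    simpa [braidedComul] using this
  have H : ∀ t : Tens k n ⊗[k] Tens k n, (TensorProduct.lid k (Tens k n))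
      (TensorProduct.map (coeffLin j) LinearMap.id (braidedLeftMul χ i t)) =
      (if i = j then 1 else 0 : k) • (TensorProduct.lid k (Tens k n)) (TensorProduct.map
      (polyEval fun _ => (0 : k)).toLinearMap LinearMap.id t) +
      χ (α i) (α j) • (var k i * (TensorProduct.lid k (Tens k n))
      (TensorProduct.map (coeffLin j) LinearMap.id t)) := by
    intro t
    induction t using TensorProduct.induction_on with
    | zero => simp
    | tmul a b => simp [braidedLeftMul, coeffLin_var_mul, coeffLin_groupAct, mul_smul]
    | add s t hs ht =>
      simp only [map_add, hs, ht, smul_add, mul_add]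
      abel
  have := H (braidedComul χ p)
  rw [hc, ← braidedComul_var_mul] at this
  exact this

theorem skewDer_ideal (J : PreNicholsIdeal χ) (j : Fin n) (p : Tens k n) (hp : p ∈ J.ideal) :
    skewDer χ j p ∈ J.ideal := by
  have : LinearMap.range (TensorProduct.map J.ideal.subtype
        (LinearMap.id (R := k) (M := Tens k n))) ⊔
      LinearMap.range (TensorProduct.map (LinearMap.id (R := k) (M := Tens k n))
        J.ideal.subtype) ≤
      J.ideal.comap ((TensorProduct.lid k (Tens k n)).toLinearMap ∘ₗ
        TensorProduct.map (coeffLin j) LinearMap.id) := by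
    refine sup_le ?_ ?_
    · rintro _ ⟨t, rfl⟩
      induction t using TensorProduct.induction_on with
      | zero => simp
      | tmul a b => simp [coeffLin_ideal J j _ a.2]
      | add s t hs ht => rw [map_add]; exact add_mem hs ht
    · rintro _ ⟨t, rfl⟩
      induction t using TensorProduct.induction_on with
      | zero => simp
      | tmul a b => simpa using J.ideal.smul_mem _ b.2
      | add s t hs ht => rw [map_add]; exact add_mem hs ht
  exact this (J.comul_mem p hp)

theorem translate_X_polyEval (j : Fin n) (p : Tens k n) :
    translate (Bos.X χ 1 J' j) (polyEval (xi χ J') p) = polyEval (xi χ J') (skewDer χ j p) := by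
  have H : ∀ p r : Tens k n,
      translate (Bos.X χ 1 J' j) (polyEval (xi χ J') r) = polyEval (xi χ J') (skewDer χ j r) →
      translate (Bos.X χ 1 J' j) (polyEval (xi χ J') (p * r)) =
        polyEval (xi χ J') (skewDer χ j (p * r)) := by
    intro p
    induction p using FreeAlgebra.induction with
    | grade0 c =>
      intro r h
      apply dual_ext
      intro x
      have := congrArg (fun φ : Dual χ J' => φ x) h
      simp only [translate_apply] at this
      rw [← Algebra.smul_def, map_smul, map_smul, map_smul, translate_apply, dual_smul_apply,
        dual_smul_apply, this]
    | grade1 i =>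
      intro r h
      apply dual_ext
      intro x
      rw [skewDer_var_mul, map_mul, map_add, map_smul, map_smul, map_mul, translate_apply,
        mul_apply_X, h, FreeAlgebra.lift_ι_apply, translate_X_xi, translate_K_xi]
      rw [smul_mul_assoc, dual_add_apply]
      split_ifs <;> simp
    | mul a b ha hb => intro r h; rw [mul_assoc]; exact ha _ (hb _ h)
    | add a b ha hb =>
      intro r h
      apply dual_ext
      intro x
      have h1 := congrArg (fun φ : Dual χ J' => φ x) (ha r h)
      have h2 := congrArg (fun φ : Dual χ J' => φ x) (hb r h)
      simp only [translate_apply] at h1 h2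
      rw [add_mul, map_add, map_add, map_add, translate_apply, dual_add_apply, dual_add_apply,
        h1, h2]
  have := H p 1 ?_
  · rwa [mul_one] at this
  · apply dual_ext
    intro x
    have : skewDer χ j (1 : Tens k n) = 0 := by
      simp [skewDer, braidedComul, coeffLin, linHom]
    rw [this, translate_apply, map_one, map_zero, LinearMap.convOne_apply]
    simp

theorem translate_K_polyEval (b : Weight n) {μ : Weight n} {p : Tens k n}
    (hp : p ∈ weightSpan k (var k) μ) :
    translate (Bos.K χ 1 J' b) (polyEval (xi χ J') p) = χ μ b • polyEval (xi χ J') p := by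
  apply dual_ext
  intro x
  rw [translate_apply, dual_smul_apply]
  induction hp using Submodule.span_induction with
  | mem p hp =>
    obtain ⟨l, rfl, rfl⟩ := hp
    rw [polyEval_word]
    induction l generalizing x with
    | nil =>
      simp [word, wordWeight, χ.zero_left]
    | cons i l ih =>
      have e1 : word (xi χ J') (i :: l) = xi χ J' i * word (xi χ J') l := by simp [word]
      have e2 : wordWeight (i :: l) = α i + wordWeight l := by simp [wordWeight]
      have ih' : translate (Bos.K χ 1 J' b) (word (xi χ J') l) =
          χ (wordWeight l) b • word (xi χ J') l := dual_ext fun y => by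
        rw [translate_apply, dual_smul_apply, ih]
      rw [e1, e2, mul_apply_K, translate_K_xi, ih', smul_mul_smul_comm, dual_smul_apply,
        χ.add_left]
  | zero => simp
  | add p r _ _ hp hr => rw [map_add, dual_add_apply, dual_add_apply, hp, hr, mul_add]
  | smul c p _ hp =>
    rw [map_smul, dual_smul_apply, dual_smul_apply, hp]
    ring

theorem polyEval_xi (p : Tens k n) (hp : p ∈ J.ideal) : polyEval (xi χ J') p = 0 := by
  apply dual_ext
  intro x
  have : ∀ x ∈ (⊤ : Submodule k (Bos χ 1 J')), ∀ p ∈ J.ideal, polyEval (xi χ J') p x = 0 := by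
    rw [← Bos.eq_top_of_left χ 1 J'
      { carrier := {x | ∀ p ∈ J.ideal, polyEval (xi χ J') p x = 0}
        add_mem' := fun {a b} ha hb p hp => by
          have : polyEval (xi χ J') p (a + b) =
            polyEval (xi χ J') p a + polyEval (xi χ J') p b := map_add _ _ _
          rw [this, ha p hp, hb p hp, add_zero]
        zero_mem' := fun p hp => map_zero (polyEval (xi χ J') p).ofConv
        smul_mem' := fun r x hx p hp => by
          have : polyEval (xi χ J') p (r • x) = r * polyEval (xi χ J') p x := map_smul _ _ _
          rw [this, hx p hp, mul_zero] } ?_ ?_ ?_]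
    · intro x hx
      exact hx
    · intro p hp
      let ev : Dual χ J' →ₐ[k] k :=
        { toFun := fun φ => φ 1
          map_one' := by simp
          map_mul' := fun φ ψ => mul_apply_one φ ψ
          map_zero' := rfl
          map_add' := fun φ ψ => rfl
          commutes' := fun r => by
            rw [LinearMap.convAlgebraMap_apply]
            simp }
      have : ev (polyEval (xi χ J') p) = (ev.comp (polyEval (xi χ J'))) p := rfl
      change ev (polyEval (xi χ J') p) = 0
      rw [this, show ev.comp (polyEval (xi χ J')) = polyEval (fun _ => (0 : k)) by
        ext i
        have : ev (xi χ J' i) = 0 := by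
          change xi χ J' i 1 = 0
          simp [xi_apply]
        simp only [Function.comp_apply, AlgHom.comp_apply, FreeAlgebra.lift_ι_apply, this]]
      exact J.polyEval_eq_zero_of_mul _ (by simp) p hp
    · intro j x hx p hp
      rw [← translate_apply, translate_X_polyEval]
      exact hx _ (skewDer_ideal J j p hp)
    · intro b x hx p hp
      have : J.ideal ≤ LinearMap.ker
          (LinearMap.applyₗ (Bos.K χ 1 J' b * x) ∘ₗ
            (WithConv.linearEquiv k (Bos χ 1 J' →ₗ[k] k)).toLinearMap ∘ₗ
            (polyEval (xi χ J')).toLinearMap) := by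
        refine J.le_of_homogeneous _ ?_
        intro μ p hp hμ
        change polyEval (xi χ J') p (Bos.K χ 1 J' b * x) = 0
        rw [← translate_apply, translate_K_polyEval b hμ, dual_smul_apply, hx p hp, mul_zero]
      exact this hp
  exact this x trivial p hp

variable (χ J')

theorem hom_isLift : Bos.IsLift χ (-1) J (xi χ J') (kappa χ J') :=
  ⟨kappa_zero, kappa_add, fun a i => by
    rw [kappa_mul_xi, show (-1 : ℤˣ) • α i = -α i by rw [Units.smul_def]; simp],
    polyEval_xi J⟩

/-- The map `y ↦ ⟨y, ·⟩` from `(U⁻ ⋊ H)^cop` to the functionals on `U⁺ ⋊ H`. It is an algebra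
homomorphism for the convolution product, as `⟨y y', x⟩ = ⟨y, x₍₁₎⟩ ⟨y', x₍₂₎⟩`. -/
def hom : Bos χ (-1) J →ₐ[k] Dual χ J' := Bos.lift (hom_isLift χ J J')

end Pairing

variable (χ : SymmetricBicharacter k n) (J J' : PreNicholsIdeal χ)

/-- The skew-Hopf pairing of `(U⁻ ⋊ H)^cop` and `U⁺ ⋊ H`. -/
def pairing : Bos χ (-1) J →ₗ[k] Bos χ 1 J' →ₗ[k] k :=
  (WithConv.linearEquiv k (Bos χ 1 J' →ₗ[k] k)).toLinearMap ∘ₗ (Pairing.hom χ J J').toLinearMap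

/-! ## The actions on `H ⋉ U⁻` -/

section Actions

variable (χ : SymmetricBicharacter k n) (J : PreNicholsIdeal χ)

/-- The coproduct of `H ⋉ U⁻ = (U⁻ ⋊ H)^cop`, which is the restriction of the coproduct of `U(χ)`:
`F_i ↦ 1 ⊗ F_i + F_i ⊗ K_i⁻¹` and `K_λ ↦ K_λ ⊗ K_λ`. -/
def copComul : Bos χ (-1) J →ₗ[k] Bos χ (-1) J ⊗[k] Bos χ (-1) J :=
  (TensorProduct.comm k _ _).toLinearMap ∘ₗ Coalgebra.comul

/-- The functional `y ↦ ⟨π_max(y), e⟩_max` on `H ⋉ U⁻`. -/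
def pairMax (e : Bos χ 1 (maxIdeal χ)) : Bos χ (-1) J →ₗ[k] k :=
  (pairing χ (maxIdeal χ) (maxIdeal χ)).flip e ∘ₗ
    (Bos.proj χ (-1) (le_maxIdeal J)).toLinearMap

/-- The left action `e ▷ f = ⟨π_max(f₍₁₎), e⟩_max f₍₂₎`. -/
def leftAct (e : Bos χ 1 (maxIdeal χ)) : Bos χ (-1) J →ₗ[k] Bos χ (-1) J :=
  (TensorProduct.lid k _).toLinearMap ∘ₗ
    TensorProduct.map (pairMax χ J e) LinearMap.id ∘ₗ copComul χ J

/-- The right action `f ◁ e = ⟨π_max(f₍₂₎), e⟩_max f₍₁₎`. -/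
def rightAct (e : Bos χ 1 (maxIdeal χ)) : Bos χ (-1) J →ₗ[k] Bos χ (-1) J :=
  (TensorProduct.rid k _).toLinearMap ∘ₗ
    TensorProduct.map LinearMap.id (pairMax χ J e) ∘ₗ copComul χ J

end Actions

/-! ## Dual bases -/

/-- For every `μ ∈ ℕⁿ` a basis `F_{μ,j}` of `(U⁻_max)_{-μ}` and a basis `E_{μ,j}` of `(U⁺_max)_μ`
which are dual to each other with respect to the pairing. The basis elements are given by
noncommutative polynomials: `F_{μ,j} = f_{μ,j}(F_1, …, F_n)` and
`E_{μ,j} = e_{μ,j}(E_1, …, E_n)`. -/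
structure DualBases (χ : SymmetricBicharacter k n) where
  dim : (Fin n → ℕ) → ℕ
  f : ∀ μ, Fin (dim μ) → Tens k n
  e : ∀ μ, Fin (dim μ) → Tens k n
  f_mem : ∀ μ j, f μ j ∈ weightSpan k (var k) (natWeight μ)
  e_mem : ∀ μ j, e μ j ∈ weightSpan k (var k) (natWeight μ)
  f_indep : ∀ μ, LinearIndependent k fun j => polyEval (Bos.X χ (-1) (maxIdeal χ)) (f μ j)
  e_indep : ∀ μ, LinearIndependent k fun j => polyEval (Bos.X χ 1 (maxIdeal χ)) (e μ j)
  f_span : ∀ μ, Submodule.span k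
      (Set.range fun j => polyEval (Bos.X χ (-1) (maxIdeal χ)) (f μ j)) =
    weightSpan k (Bos.X χ (-1) (maxIdeal χ)) (natWeight μ)
  e_span : ∀ μ, Submodule.span k
      (Set.range fun j => polyEval (Bos.X χ 1 (maxIdeal χ)) (e μ j)) =
    weightSpan k (Bos.X χ 1 (maxIdeal χ)) (natWeight μ)
  dual : ∀ μ i j, pairing χ (maxIdeal χ) (maxIdeal χ)
      (polyEval (Bos.X χ (-1) (maxIdeal χ)) (f μ i)) (polyEval (Bos.X χ 1 (maxIdeal χ)) (e μ j)) =
    if i = j then 1 else 0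

/-- The algebra homomorphism with `F_i ↦ c_τ(i) K_i E_τ(i)`, composed with the canonical projection
from the tensor algebra to `U⁻_max`. -/
def sigmaBar (χ : SymmetricBicharacter k n) (τ : Equiv.Perm (Fin n)) (c : Fin n → k) :
    Tens k n →ₐ[k] Bos χ 1 (maxIdeal χ) :=
  polyEval fun i => c (τ i) • (Bos.K χ 1 (maxIdeal χ) (α i) * Bos.X χ 1 (maxIdeal χ) (τ i))

/-- The restriction of the inverse antipode to `U⁺_max`, composed with the canonical projection from
the tensor algebra to `U⁺_max`: the algebra antihomomorphism with `E_i ↦ - E_i K_i⁻¹`. -/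
def antipodeInv (χ : SymmetricBicharacter k n) (p : Tens k n) : Bos χ 1 (maxIdeal χ) :=
  MulOpposite.unop (polyEval (fun i => MulOpposite.op
    (-(Bos.X χ 1 (maxIdeal χ) i * Bos.K χ 1 (maxIdeal χ) (-α i)))) p)

/-! ## The partial bosonization, the twist product and the twisted coaction -/

/-- Membership in `ℤⁿ_θ = {λ | -τ(λ) = λ}`, where `τ(α_i) = α_τ(i)`. -/
def IsTheta (τ : Equiv.Perm (Fin n)) (a : Weight n) : Prop := ∀ i, a (τ i) = -a i

section Twist

variable (χ : SymmetricBicharacter k n) (τ : Equiv.Perm (Fin n)) (c : Fin n → k)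
  (J : PreNicholsIdeal χ)

/-- The partial bosonization `H_θ ⋉ U⁻`: the subalgebra of `H ⋉ U⁻` generated by
`K_i K_τ(i)⁻¹` and `F_i` for `i = 1, …, n`. -/
def PartialBos : Subalgebra k (Bos χ (-1) J) :=
  Algebra.adjoin k (Set.range (fun i => Bos.K χ (-1) J (α i - α (τ i))) ∪
    Set.range (Bos.X χ (-1) J))

/-- The summand for `ρ` in the definition of the twist product, that is
`(-1)^|ρ| (σ(F_ρ) ▷ f) K_ρ (g ◁ (S⁻¹(E_ρ) K_ρ))`, where the sum over the dual bases of weight `ρ`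
is taken. -/
def twistTerm (D : DualBases χ) (f g : Bos χ (-1) J) (ρ : Fin n → ℕ) : Bos χ (-1) J :=
  ∑ j, (-1 : k) ^ (∑ i, ρ i) •
    (leftAct χ J (sigmaBar χ τ c (D.f ρ j)) f * Bos.K χ (-1) J (natWeight ρ) *
      rightAct χ J (antipodeInv χ (D.e ρ j) * Bos.K χ 1 (maxIdeal χ) (natWeight ρ)) g)

/-- The bilinear operation `⋆` is the twist product on `H_θ ⋉ U⁻`:
`(K_λ f) ⋆ (K_μ g) = χ(a, μ) K_{λ+μ} (f ⋆ g)` for all `λ, μ ∈ ℤⁿ_θ`, `f ∈ U⁻_{-a}`, `g ∈ U⁻`, where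
`f ⋆ g = ∑_ρ (-1)^|ρ| (σ(F_ρ) ▷ f) K_ρ (g ◁ (S⁻¹(E_ρ) K_ρ))` with only finitely many nonzero
summands, for every choice of dual bases. -/
def IsTwistProduct (star : PartialBos χ τ J →ₗ[k] PartialBos χ τ J →ₗ[k] PartialBos χ τ J) : Prop :=
  ∀ (D : DualBases χ) (l m : Weight n), IsTheta τ l → IsTheta τ m →
    ∀ (a : Fin n → ℕ), ∀ f ∈ weightSpan k (Bos.X χ (-1) J) (natWeight a),
    ∀ g ∈ Algebra.adjoin k (Set.range (Bos.X χ (-1) J)),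
    ∀ x y : PartialBos χ τ J,
      (x : Bos χ (-1) J) = Bos.K χ (-1) J l * f → (y : Bos χ (-1) J) = Bos.K χ (-1) J m * g →
      (Function.support (twistTerm χ τ c J D f g)).Finite ∧
      (star x y : Bos χ (-1) J) =
        χ (natWeight a) m • (Bos.K χ (-1) J (l + m) * ∑ᶠ ρ, twistTerm χ τ c J D f g ρ)

/-- The summand for `(λ, μ)` in the definition of the twisted coaction on `K_ν f`, that is
`K_ν (σ(F_λ) ▷ f ◁ E_μ) K_λ ⊗ K_ν F_μ K_{μ-a} E_λ`, where the sum over the dual bases of weight `λ`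
and of weight `μ` is taken. -/
def coactTerm (D : DualBases χ) (v : Weight n) (a : Fin n → ℕ) (f : Bos χ (-1) J)
    (w : (Fin n → ℕ) × (Fin n → ℕ)) : Bos χ (-1) J ⊗[k] U χ (maxIdeal χ) :=
  ∑ i, ∑ j, (Bos.K χ (-1) J v *
      leftAct χ J (sigmaBar χ τ c (D.f w.1 i))
        (rightAct χ J (polyEval (Bos.X χ 1 (maxIdeal χ)) (D.e w.2 j)) f) *
      Bos.K χ (-1) J (natWeight w.1)) ⊗ₜ[k]
    (U.K χ (maxIdeal χ) v * polyEval (U.F χ (maxIdeal χ)) (D.f w.2 j) *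
      U.K χ (maxIdeal χ) (natWeight w.2 - natWeight a) *
      polyEval (U.E χ (maxIdeal χ)) (D.e w.1 i))

/-- The linear map `Δ_⋆ : H_θ ⋉ U⁻ → (H_θ ⋉ U⁻) ⊗ U(χ)_max` is given by
`Δ_⋆(K_ν f) = ∑_{λ,μ} K_ν (σ(F_λ) ▷ f ◁ E_μ) K_λ ⊗ K_ν F_μ K_{μ-a} E_λ` for all `ν ∈ ℤⁿ_θ` and
`f ∈ U⁻_{-a}`, with only finitely many nonzero summands, for every choice of dual bases. -/
def IsTwistedCoaction (Δ : PartialBos χ τ J →ₗ[k] PartialBos χ τ J ⊗[k] U χ (maxIdeal χ)) : Prop :=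
  ∀ (D : DualBases χ) (v : Weight n), IsTheta τ v →
    ∀ (a : Fin n → ℕ), ∀ f ∈ weightSpan k (Bos.X χ (-1) J) (natWeight a),
    ∀ x : PartialBos χ τ J, (x : Bos χ (-1) J) = Bos.K χ (-1) J v * f →
      (Function.support (coactTerm χ τ c J D v a f)).Finite ∧
      TensorProduct.map (PartialBos χ τ J).val.toLinearMap LinearMap.id (Δ x) =
        ∑ᶠ w, coactTerm χ τ c J D v a f w

end Twist

/-! ## Comodule algebras -/

section Comodule

variable {C : Type*} [Ring C] [Bialgebra k C]

/-- A multiplication `m` with unit `one` and a coaction `ρ` turn the vector space `A` into a right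
comodule algebra over the bialgebra `C`. -/
structure IsComoduleAlgebra {A : Type*} [AddCommGroup A] [Module k A] (m : A →ₗ[k] A →ₗ[k] A)
    (one : A) (ρ : A →ₗ[k] A ⊗[k] C) : Prop where
  mul_assoc : ∀ a b c, m (m a b) c = m a (m b c)
  one_mul : ∀ a, m one a = a
  mul_one : ∀ a, m a one = a
  coassoc : ∀ a, TensorProduct.assoc k A C C (TensorProduct.map ρ LinearMap.id (ρ a)) =
    TensorProduct.map LinearMap.id (Coalgebra.comul (R := k) (A := C)) (ρ a)
  counit : ∀ a, TensorProduct.rid k A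
    (TensorProduct.map LinearMap.id (Coalgebra.counit (R := k) (A := C)) (ρ a)) = a
  map_mul : ∀ a b, ρ (m a b) = TensorProduct.map₂ m (LinearMap.mul k C) (ρ a) (ρ b)
  map_one : ρ one = one ⊗ₜ 1

/-- A linear map is an isomorphism of right comodule algebras. -/
structure IsComoduleAlgebraIso {A A' : Type*} [AddCommGroup A] [Module k A] [AddCommGroup A']
    [Module k A'] (m : A →ₗ[k] A →ₗ[k] A) (one : A) (ρ : A →ₗ[k] A ⊗[k] C)
    (m' : A' →ₗ[k] A' →ₗ[k] A') (one' : A') (ρ' : A' →ₗ[k] A' ⊗[k] C) (φ : A →ₗ[k] A') : Prop where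
  bijective : Function.Bijective φ
  map_mul : ∀ a b, φ (m a b) = m' (φ a) (φ b)
  map_one : φ one = one'
  map_coact : ∀ a, ρ' (φ a) = TensorProduct.map φ LinearMap.id (ρ a)

end Comodule

/-! ## The coideal subalgebra and the projection `ψ` -/

section Coideal

variable (χ : SymmetricBicharacter k n) (τ : Equiv.Perm (Fin n)) (c : Fin n → k)
  (J : PreNicholsIdeal χ)

/-- The elements `B_i = F_i + c_i E_τ(i) K_i⁻¹`. -/
def genB (i : Fin n) : U χ J := U.F χ J i + c i • (U.E χ J (τ i) * U.K χ J (-α i))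

/-- The subalgebra `B_c` of `U(χ)` generated by `H_θ` and the elements `B_i`. -/
def Bc : Subalgebra k (U χ J) :=
  Algebra.adjoin k (Set.range (fun i => U.K χ J (α i - α (τ i))) ∪ Set.range (genB χ τ c J))

/-- The subalgebra `U(χ)^poly` of `U(χ)` generated by `F_i`, `E_i K_i⁻¹`, `K_i⁻¹` and
`K_i K_τ(i)⁻¹`. -/
def Upoly : Subalgebra k (U χ J) :=
  Algebra.adjoin k (Set.range (U.F χ J) ∪ Set.range (fun i => U.E χ J i * U.K χ J (-α i)) ∪
    Set.range (fun i => U.K χ J (-α i)) ∪ Set.range (fun i => U.K χ J (α i - α (τ i))))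

theorem Bc_le_Upoly (hτ : ∀ i, τ (τ i) = i) : Bc χ τ c J ≤ Upoly χ τ J := by
  have hF : ∀ i, U.F χ J i ∈ Upoly χ τ J := fun i => Algebra.subset_adjoin (by simp)
  have hE : ∀ i, U.E χ J i * U.K χ J (-α i) ∈ Upoly χ τ J := fun i =>
    Algebra.subset_adjoin (by simp)
  have hK : ∀ i, U.K χ J (α i - α (τ i)) ∈ Upoly χ τ J := fun i =>
    Algebra.subset_adjoin (by simp)
  refine Algebra.adjoin_le ?_
  rintro _ (⟨i, rfl⟩ | ⟨i, rfl⟩)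
  · exact hK i
  · refine add_mem (hF i) (Subalgebra.smul_mem _ ?_ _)
    have := mul_mem (hE (τ i)) (hK (τ i))
    rwa [mul_assoc, ← U.K_add, hτ,
      show -α (τ i) + (α (τ i) - α i) = -α i by abel] at this

/-- The coaction `(id ⊗ π_max) ∘ Δ : U(χ) → U(χ) ⊗ U(χ)_max`. -/
def coactU : U χ J →ₐ[k] U χ J ⊗[k] U χ (maxIdeal χ) :=
  (Algebra.TensorProduct.map (AlgHom.id k _) (U.proj χ (le_maxIdeal J))).comp
    (Bialgebra.comulAlgHom k (U χ J))

/-- The inclusion of `B_c ⊗ U(χ)_max` in `U(χ) ⊗ U(χ)_max`. -/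
def inclB : Bc χ τ c J ⊗[k] U χ (maxIdeal χ) →ₐ[k] U χ J ⊗[k] U χ (maxIdeal χ) :=
  Algebra.TensorProduct.map (Bc χ τ c J).val (AlgHom.id k _)

theorem inclB_injective : Function.Injective (inclB χ τ c J) :=
  Module.Flat.rTensor_preserves_injective_linearMap (M := U χ (maxIdeal χ))
    (Bc χ τ c J).val.toLinearMap Subtype.val_injective

theorem coactU_mem (hτ : ∀ i, τ (τ i) = i) (x : Bc χ τ c J) :
    coactU χ J x ∈ (inclB χ τ c J).range := by
  have hK : ∀ i, U.K χ J (α i - α (τ i)) ∈ Bc χ τ c J := fun i => Algebra.subset_adjoin (by simp)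
  have hB : ∀ i, genB χ τ c J i ∈ Bc χ τ c J := fun i => Algebra.subset_adjoin (by simp)
  have mem : ∀ (x : U χ J) (_ : x ∈ Bc χ τ c J) (y : U χ (maxIdeal χ)),
      x ⊗ₜ[k] y ∈ (inclB χ τ c J).range := fun x hx y => ⟨⟨x, hx⟩ ⊗ₜ y, by simp [inclB]⟩
  have : Bc χ τ c J ≤ (inclB χ τ c J).range.comap (coactU χ J) := by
    refine Algebra.adjoin_le ?_
    rintro _ (⟨i, rfl⟩ | ⟨i, rfl⟩)
    · simp only [Subalgebra.coe_comap, Set.mem_preimage, SetLike.mem_coe]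
      simp only [coactU, AlgHom.comp_apply, Bialgebra.comulAlgHom_apply, U.comul_K,
        Algebra.TensorProduct.map_tmul]
      exact mem _ (hK i) _
    · simp only [Subalgebra.coe_comap, Set.mem_preimage, SetLike.mem_coe]
      have : coactU χ J (genB χ τ c J i) =
          genB χ τ c J i ⊗ₜ U.K χ (maxIdeal χ) (-α i) + 1 ⊗ₜ U.F χ (maxIdeal χ) i +
          U.K χ J (α (τ i) - α i) ⊗ₜ
            (c i • (U.E χ (maxIdeal χ) (τ i) * U.K χ (maxIdeal χ) (-α i))) := by
        simp [coactU, genB, U.proj, add_mul, TensorProduct.add_tmul, sub_eq_add_neg, U.K_add,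
          TensorProduct.smul_tmul']
        abel
      rw [this]
      refine add_mem (add_mem (mem _ (hB i) _) (mem _ (one_mem _) _)) (mem _ ?_ _)
      have := hK (τ i)
      rwa [hτ] at this
  exact this x.2

/-- The right coaction `(id ⊗ π_max) ∘ Δ : B_c → B_c ⊗ U(χ)_max`. -/
def coactB (hτ : ∀ i, τ (τ i) = i) : Bc χ τ c J →ₐ[k] Bc χ τ c J ⊗[k] U χ (maxIdeal χ) :=
  (AlgEquiv.ofInjective (inclB χ τ c J) (inclB_injective χ τ c J)).symm.toAlgHom.comp
    (((coactU χ J).comp (Bc χ τ c J).val).codRestrict (inclB χ τ c J).range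
      (coactU_mem χ τ c J hτ))

/-- The linear map `ψ : U(χ)^poly → H_θ ⋉ U⁻` is the projection for the decomposition
`U(χ)^poly = (H_θ ⋉ U⁻) ⊕ U(χ)^poly span{E_i K_i⁻¹, K_i⁻¹ | i = 1, …, n}`. -/
def IsPsi (ψ : Upoly χ τ J →ₗ[k] PartialBos χ τ J) : Prop :=
  (∀ (x : Upoly χ τ J) (a : PartialBos χ τ J), (x : U χ J) = U.ofBos χ J a → ψ x = a) ∧
  (∀ (x y : Upoly χ τ J) (i : Fin n), (x : U χ J) = y * (U.E χ J i * U.K χ J (-α i)) → ψ x = 0) ∧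
  (∀ (x y : Upoly χ τ J) (i : Fin n), (x : U χ J) = y * U.K χ J (-α i) → ψ x = 0)

/-! ## The condition on the parameters -/

/-- `y` is the component of `x` in `V i` for a direct sum decomposition `⨁ V i`. -/
def IsComponent {M ι : Type*} [AddCommGroup M] [Module k M] (V : ι → Submodule k M) (i : ι)
    (x y : M) : Prop :=
  y ∈ V i ∧ x - y ∈ ⨆ j, ⨆ _ : j ≠ i, V j

/-- The summand `U⁺ K_λ G⁻` of `U(χ)`, where `G⁻` is the subalgebra generated by the elements
`F_i K_i`. -/
def UKG (l : Weight n) : Submodule k (U χ J) :=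
  Subalgebra.toSubmodule (Algebra.adjoin k (Set.range (U.E χ J))) * Submodule.span k {U.K χ J l} *
    Subalgebra.toSubmodule (Algebra.adjoin k (Set.range fun i => U.F χ J i * U.K χ J (α i)))

/-- The summand `U⁺_a H U⁻_{-b}` of `U(χ)`. -/
def UHU (w : (Fin n → ℕ) × (Fin n → ℕ)) : Submodule k (U χ J) :=
  weightSpan k (U.E χ J) (natWeight w.1) * Submodule.span k (Set.range (U.K χ J)) *
    weightSpan k (U.F χ J) (natWeight w.2)

/-- The ideal `J` is generated by homogeneous noncommutative polynomials `p` such that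
`π_{0,0}(P_{-λ}(p(B_1, …, B_n))) = 0`, where `λ ∈ ℕⁿ` is the degree of `p`, `P_{-λ}` is the projection
of `U(χ) = ⨁_λ U⁺ K_λ G⁻` onto `U⁺ K_{-λ} G⁻`, and `π_{0,0}` is the projection of
`U(χ) = ⨁_{a,b} U⁺_a H U⁻_{-b}` onto `U⁺_0 H U⁻_0`. -/
def ConditionC : Prop :=
  ∃ S : Set (Tens k n),
    J.ideal = Submodule.span k {x | ∃ p ∈ S, ∃ a b, x = a * p * b} ∧
    ∀ p ∈ S, ∃ l : Fin n → ℕ, p ∈ weightSpan k (var k) (natWeight l) ∧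
      ∃ y, IsComponent (UKG χ J) (-natWeight l) (polyEval (genB χ τ c J) p) y ∧
        IsComponent (UHU χ J) (0, 0) y 0

end Coideal

end

end StarProduct

open StarProduct

namespace StarProduct

noncomputable section

/-! ### Words, weights and heights. -/

variable {k : Type*} [Field k] {n : ℕ}

/-! Both `B_c` and `H_θ ⋉ U⁻` with `⋆` are generated from `1` by operators of left multiplication,
one for each `B_i` and one for each `K_a` with `a` in `ℤⁿ_θ`. Once these operators are known, every
axiom becomes an equality of two linear maps that agree at `1` and change in the same way under the
operators. `IsTwistedComodule` records exactly the data needed for this principle.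

The dual bases are first eliminated from the formula for `⋆`. Since `S⁻¹(E_i) = -E_i K_i⁻¹`, the
operator `(-1)^|ρ| K_ρ (· ◁ S⁻¹(E_ρ) K_ρ)` is the image of `E_ρ` under an algebra homomorphism
`kderHom` with `E_j ↦ K_j (· ◁ E_j)`; see `kderHom_word`. The other half of the formula, `∑ σ(F_ρ) ▷
x ⊗ E_ρ`, is a map `ccoact` defined on generators; contracting its second leg recovers the left
action (`rid_map_dualFun_ccoact`). Left multiplication by `F_i` then becomes `starF`, which sends
`y` to `F_i y` plus a multiple of `K_i⁻¹ K_τ(i) (y ◁ E_τ(i))`. `starA_starF` states that this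
operator commutes with right `⋆`-multiplications, which is associativity. `starCoact_starF` states
that the coaction transforms under it as prescribed by the coproduct of `B_i`; the essential input
is the commutation rule of `E_j` with `H ⋉ U⁻`. The formulas with dual bases are recovered
afterwards by expanding tensors. Dual bases exist because the radical of the pairing is itself a
pre-Nichols ideal, hence lies in the maximal one.

For `ψ`, let `U(χ)` act on `H ⋉ U⁻` with `F_i` and `K_a` acting by left multiplication and `E_j` by
`kder - lder`. Then `ψ(x)` is the part of `x · 1` in which the factors `K_a` have height `0`. The
part `lder` of `E_j K_j⁻¹` lowers this height by two and is discarded, so `ψ` turns left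
multiplication by `B_i` into `starF` (`psiU_genB_mul`).

It remains to show that `ψ` is bijective on `B_c`. With respect to the number of factors, `ψ(B_{l_1}
⋯ B_{l_r})` has leading term `F_{l_1} ⋯ F_{l_r}`, which gives surjectivity. Injectivity needs that
`p(B)` drops in the filtration whenever `p` is a homogeneous relation of degree `μ`. Subtract from
`p(B)` a shorter element with the same image under `ψ`, and let `Z` be the difference. Comparing
coproducts, with injectivity known in lower filtration degree, gives `Δ(Z) = Z ⊗ K_{-μ}`, so `Z` is
a multiple of `K_{-μ}`. Its coefficient is the one that condition (c) makes zero
(`polyEval_mem_filtB_of_condition`, `psiU_injOn_filtB`). -/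

theorem word_nil {A : Type*} [Monoid A] (x : Fin n → A) : word x [] = 1 := rfl

theorem word_cons {A : Type*} [Monoid A] (x : Fin n → A) (i : Fin n) (l : List (Fin n)) :
    word x (i :: l) = x i * word x l := by simp [word]

theorem word_append {A : Type*} [Monoid A] (x : Fin n → A) (l l' : List (Fin n)) :
    word x (l ++ l') = word x l * word x l' := by simp [word]

theorem wordWeight_nil : wordWeight ([] : List (Fin n)) = 0 := rfl

theorem wordWeight_cons (i : Fin n) (l : List (Fin n)) :
    wordWeight (i :: l) = α i + wordWeight l := by simp [wordWeight]

theorem wordWeight_append (l l' : List (Fin n)) :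
    wordWeight (l ++ l') = wordWeight l + wordWeight l' := by simp [wordWeight]

theorem wordWeight_apply (l : List (Fin n)) (i : Fin n) : wordWeight l i = l.count i := by
  induction l with
  | nil => simp [wordWeight_nil]
  | cons j l ih =>
    rw [wordWeight_cons, Pi.add_apply, ih, List.count_cons]
    by_cases h : j = i
    · subst h; simp [α, add_comm]
    · simp [α, h, Ne.symm h]

theorem wordWeight_eq_natWeight (l : List (Fin n)) :
    wordWeight l = natWeight fun i => l.count i := by
  ext i; simp [wordWeight_apply, natWeight]

theorem natWeight_injective : Function.Injective (natWeight (n := n)) := by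
  intro a b h
  ext i
  have := congrFun h i
  simpa [natWeight] using this

/-- A weight records the multiplicities of the letters and nothing else. Hence factors that commute
contribute the same product to all words in a homogeneous polynomial. -/
theorem perm_of_wordWeight_eq {l l' : List (Fin n)} (h : wordWeight l = wordWeight l') :
    l.Perm l' := by
  rw [List.perm_iff_count]
  intro i
  have := congrFun h i
  rw [wordWeight_apply, wordWeight_apply] at this
  exact_mod_cast this

/-- The sum of the coordinates of a weight. -/
def height : Weight n →+ ℤ where
  toFun a := ∑ i, a i
  map_zero' := by simp
  map_add' a b := by simp [Finset.sum_add_distrib]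

theorem height_α (i : Fin n) : height (α i) = 1 := by simp [height, α]

theorem height_wordWeight (l : List (Fin n)) : height (wordWeight l) = l.length := by
  induction l with
  | nil => simp [wordWeight_nil]
  | cons i l ih => rw [wordWeight_cons, map_add, height_α, ih]; push_cast [List.length_cons]; ring

theorem height_natWeight (μ : Fin n → ℕ) : height (natWeight μ) = (∑ i, μ i : ℕ) := by
  simp [height, natWeight]

/-- Words form a basis of the tensor algebra. -/
theorem span_words : Submodule.span k (Set.range (word (var k (n := n)))) = ⊤ := by
  rw [eq_top_iff]
  rintro p -
  induction p using FreeAlgebra.induction with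
  | grade0 r =>
    rw [Algebra.algebraMap_eq_smul_one]
    exact Submodule.smul_mem _ _ (Submodule.subset_span ⟨[], rfl⟩)
  | grade1 i => exact Submodule.subset_span ⟨[i], by simp [word]⟩
  | mul a b ha hb =>
    have := Submodule.mul_mem_mul ha hb
    rw [Submodule.span_mul_span] at this
    refine Submodule.span_mono ?_ this
    rintro _ ⟨_, ⟨l, rfl⟩, _, ⟨l', rfl⟩, rfl⟩
    exact ⟨l ++ l', word_append _ _ _⟩
  | add a b ha hb => exact add_mem ha hb

/-- Most maps below are defined by what they do to a letter on the left. Induction over words fits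
this recursion better than induction over the ring operations. -/
theorem tens_induction {P : Tens k n → Prop} (hw : ∀ l, P (word (var k) l))
    (hadd : ∀ p q, P p → P q → P (p + q)) (hsmul : ∀ (r : k) p, P p → P (r • p)) (p : Tens k n) :
    P p := by
  have : p ∈ Submodule.span k (Set.range (word (var k (n := n)))) := by
    rw [span_words]; trivial
  induction this using Submodule.span_induction with
  | mem x hx => obtain ⟨l, rfl⟩ := hx; exact hw l
  | zero => simpa using hsmul 0 _ (hw [])
  | add x y _ _ hx hy => exact hadd _ _ hx hy
  | smul r x _ hx => exact hsmul r _ hx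

theorem tens_linearMap_ext {V : Type*} [AddCommMonoid V] [Module k V] {f g : Tens k n →ₗ[k] V}
    (h : ∀ l, f (word (var k) l) = g (word (var k) l)) : f = g := by
  ext p
  induction p using tens_induction with
  | hw l => exact h l
  | hadd p q hp hq => rw [map_add, map_add, hp, hq]
  | hsmul r p hp => rw [map_smul, map_smul, hp]

theorem weightSpan_word_mem {A : Type*} [Ring A] [Algebra k A] (x : Fin n → A)
    (l : List (Fin n)) : word x l ∈ weightSpan k x (wordWeight l) :=
  Submodule.subset_span ⟨l, rfl, rfl⟩

theorem mul_mem_weightSpan {A : Type*} [Ring A] [Algebra k A] (x : Fin n → A) {a b : A}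
    {μ ν : Weight n} (ha : a ∈ weightSpan k x μ) (hb : b ∈ weightSpan k x ν) :
    a * b ∈ weightSpan k x (μ + ν) := by
  have := Submodule.mul_mem_mul ha hb
  rw [weightSpan, weightSpan, Submodule.span_mul_span] at this
  refine Submodule.span_mono ?_ this
  rintro _ ⟨_, ⟨l, rfl, rfl⟩, _, ⟨l', rfl, rfl⟩, rfl⟩
  exact ⟨l ++ l', wordWeight_append _ _, word_append _ _ _⟩

theorem gen_mem_weightSpan {A : Type*} [Ring A] [Algebra k A] (x : Fin n → A) (i : Fin n) :
    x i ∈ weightSpan k x (α i) := by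
  have := weightSpan_word_mem (k := k) x [i]
  rwa [word_cons, word_nil, mul_one, wordWeight_cons, wordWeight_nil, add_zero] at this

theorem map_weightSpan {A B : Type*} [Ring A] [Algebra k A] [Ring B] [Algebra k B]
    (f : A →ₐ[k] B) (x : Fin n → A) (μ : Weight n) :
    (weightSpan k x μ).map f.toLinearMap = weightSpan k (fun i => f (x i)) μ := by
  rw [weightSpan, Submodule.map_span, weightSpan]
  congr 1
  ext b
  constructor
  · rintro ⟨_, ⟨l, hl, rfl⟩, rfl⟩
    exact ⟨l, hl, by simp [word, map_list_prod, Function.comp_def]⟩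
  · rintro ⟨l, hl, rfl⟩
    exact ⟨_, ⟨l, hl, rfl⟩, by simp [word, map_list_prod, Function.comp_def]⟩

theorem map_polyEval_weightSpan {A : Type*} [Ring A] [Algebra k A] (x : Fin n → A)
    (μ : Weight n) :
    (weightSpan k (var k) μ).map (polyEval x).toLinearMap = weightSpan k x μ := by
  rw [map_weightSpan]; simp

theorem exists_polyEval_of_mem_weightSpan {A : Type*} [Ring A] [Algebra k A] {x : Fin n → A}
    {μ : Weight n} {y : A} (hy : y ∈ weightSpan k x μ) :
    ∃ p ∈ weightSpan k (var k) μ, polyEval x p = y := by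
  rw [← map_polyEval_weightSpan] at hy
  exact hy

theorem alghom_polyEval {A B : Type*} [Ring A] [Algebra k A] [Ring B] [Algebra k B]
    (f : A →ₐ[k] B) (x : Fin n → A) (p : Tens k n) :
    f (polyEval x p) = polyEval (fun i => f (x i)) p := by
  rw [← AlgHom.comp_apply]
  congr 1
  ext i
  simp

/-- If some word has the given weight, the others are its permutations; if none has, the space is
zero. -/
instance finite_weightSpan (μ : Weight n) : Module.Finite k (weightSpan k (var k) μ) := by
  by_cases hl : ∃ l : List (Fin n), wordWeight l = μ
  · classical
    obtain ⟨l₀, hl₀⟩ := hl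
    refine Module.Finite.iff_fg.2 ⟨(l₀.permutations.map (word (var k))).toFinset, ?_⟩
    rw [weightSpan]
    congr 1
    ext a
    simp only [List.coe_toFinset, List.mem_map, List.mem_permutations, Set.mem_ofPred_eq]
    constructor
    · rintro ⟨l, hl, rfl⟩
      refine ⟨l, ?_, rfl⟩
      rw [← hl₀]
      ext i; rw [wordWeight_apply, wordWeight_apply, hl.count_eq]
    · rintro ⟨l, hl, rfl⟩
      exact ⟨l, perm_of_wordWeight_eq (hl.trans hl₀.symm), rfl⟩
  · have : weightSpan k (var k) μ = ⊥ := by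
      rw [weightSpan, Submodule.span_eq_bot]
      rintro _ ⟨l, hl', rfl⟩
      exact absurd ⟨l, hl'⟩ hl
    rw [this]
    infer_instance

/-! ### The involution on weights and the lattice of anti-invariant weights. -/

namespace SymmetricBicharacter

variable (χ : SymmetricBicharacter k n)

theorem neg_left (a b : Weight n) : χ (-a) b = (χ a b)⁻¹ := U.val_neg_left χ a b
theorem neg_right (a b : Weight n) : χ a (-b) = (χ a b)⁻¹ := U.val_neg_right χ a b

/-- Precomposition with `τ` sends `α i` to `α (τ i)`, so both sides are additive in `a` and agree on
the standard basis. -/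
theorem comp_perm (τ : Equiv.Perm (Fin n)) (hτ : ∀ i, τ (τ i) = i)
    (hχτ : ∀ i j, χ (α (τ i)) (α (τ j)) = χ (α i) (α j)) (a : Weight n) (j : Fin n) :
    χ (fun i => a (τ i)) (α j) = χ a (α (τ j)) := by
  let P : Weight n →+ Weight n :=
    { toFun := fun a i => a (τ i), map_zero' := rfl, map_add' := fun _ _ => rfl }
  have hP : ∀ i, P (α i) = α (τ i) := by
    intro i
    ext l
    simp only [P, AddMonoidHom.coe_mk, ZeroHom.coe_mk, α, Pi.single_apply]
    congr 1
    exact propext ⟨fun h => by rw [← h, hτ], fun h => by rw [h, hτ]⟩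
  have : (χ.toHom.flip (α j)).comp P = χ.toHom.flip (α (τ j)) := by
    ext i
    change (((χ.toHom (P (α i)) (α j)).toMul : kˣ) : k) = (((χ.toHom (α i) (α (τ j))).toMul : kˣ) : k)
    have := hχτ i (τ j)
    rw [hτ] at this
    rw [hP]
    exact this
  exact congrArg (fun z => ((z.toMul : kˣ) : k)) (DFunLike.congr_fun this a)

/-- This inversion is the reason why `K_a` with `a` in `ℤⁿ_θ` commutes with `F_i` and with `E_τ(i)
K_i⁻¹` up to the same scalar. -/
theorem theta_perm (τ : Equiv.Perm (Fin n)) (hτ : ∀ i, τ (τ i) = i)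
    (hχτ : ∀ i j, χ (α (τ i)) (α (τ j)) = χ (α i) (α j)) {a : Weight n} (ha : IsTheta τ a)
    (j : Fin n) : χ a (α (τ j)) = (χ a (α j))⁻¹ := by
  rw [← χ.comp_perm τ hτ hχτ, ← χ.neg_left]
  congr 1
  ext i
  exact ha i

end SymmetricBicharacter

theorem isTheta_zero (τ : Equiv.Perm (Fin n)) : IsTheta τ 0 := fun i => by simp

theorem IsTheta.add {τ : Equiv.Perm (Fin n)} {a b : Weight n} (ha : IsTheta τ a)
    (hb : IsTheta τ b) : IsTheta τ (a + b) := fun i => by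
  simp [ha i, hb i, add_comm]

/-- The sum of the coordinates is invariant under `τ`, hence equal to its own negative. So elements
of `H_θ` have height `0`, in contrast to `K_i⁻¹`; this separates the two summands in the definition
of `ψ`. -/
theorem IsTheta.height {τ : Equiv.Perm (Fin n)} {a : Weight n} (ha : IsTheta τ a) :
    height a = 0 := by
  have h1 : ∑ i, a (τ i) = ∑ i, a i := Equiv.sum_comp τ a
  have h2 : ∑ i, a (τ i) = - ∑ i, a i := by
    rw [← Finset.sum_neg_distrib]; exact Finset.sum_congr rfl fun i _ => ha i
  change ∑ i, a i = 0
  omega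

theorem isTheta_sub (τ : Equiv.Perm (Fin n)) (hτ : ∀ i, τ (τ i) = i) (i : Fin n) :
    IsTheta τ (α i - α (τ i)) := by
  intro l
  have e1 : τ l = i ↔ l = τ i := ⟨fun h => by rw [← h, hτ], fun h => by rw [h, hτ]⟩
  have e2 : τ l = τ i ↔ l = i := τ.injective.eq_iff
  simp only [Pi.sub_apply, α, Pi.single_apply, e1, e2]
  ring

/-- The lattice of weights `λ` with `τ(λ) = -λ` is generated by the weights `α_i - α_τ(i)`. -/
theorem theta_induction {τ : Equiv.Perm (Fin n)} (hτ : ∀ i, τ (τ i) = i) {P : Weight n → Prop}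
    (h0 : P 0) (hα : ∀ i, P (α i - α (τ i))) (hadd : ∀ a b, P a → P b → P (a + b))
    {a : Weight n} (ha : IsTheta τ a) : P a := by
  have hneg : ∀ i, P (-(α i - α (τ i))) := fun i => by
    have := hα (τ i); rw [hτ] at this; rwa [neg_sub]
  have hsmul : ∀ (m : ℤ) i, P (m • (α i - α (τ i))) := by
    intro m i
    induction m with
    | zero => simpa using h0
    | succ m ih => rw [add_smul, one_smul]; exact hadd _ _ ih (hα i)
    | pred m ih => rw [sub_smul, one_smul, sub_eq_add_neg]; exact hadd _ _ ih (hneg i)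
  have hsum : ∀ s : Finset (Fin n), P (∑ i ∈ s, a i • (α i - α (τ i))) := by
    intro s
    induction s using Finset.induction_on with
    | empty => simpa using h0
    | insert i s hi ih => rw [Finset.sum_insert hi]; exact hadd _ _ (hsmul _ _) ih
  -- Each orbit with two elements is counted once, through its smaller element; at fixed points of
  -- `τ` the coordinate of `a` vanishes.
  have key : a = ∑ i ∈ Finset.univ.filter (fun i => i < τ i), a i • (α i - α (τ i)) := by
    ext l
    have e1 : ∀ x, l = τ x ↔ x = τ l := fun x =>
      ⟨fun h => by rw [h, hτ], fun h => by rw [h, hτ]⟩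
    rw [Finset.sum_filter, Finset.sum_apply]
    have : ∀ x : Fin n, (if x < τ x then a x • (α x - α (τ x)) else (0 : Weight n)) l =
        (if x = l then (if l < τ l then a l else 0) else 0) -
        (if x = τ l then (if τ l < l then a (τ l) else 0) else 0) := by
      intro x
      by_cases h : x < τ x
      · simp only [h, if_true, Pi.smul_apply, Pi.sub_apply, α, Pi.single_apply, smul_eq_mul,
          eq_comm (a := l) (b := x), e1]
        by_cases hx : x = l
        · subst hx
          have : x ≠ τ x := h.ne
          simp [h, this]
        · by_cases hx' : x = τ l
          · subst hx'
            rw [hτ] at h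
            simp [hx, h]
          · simp [hx, hx']
      · simp only [h, if_false, Pi.zero_apply]
        by_cases hx : x = l
        · subst hx
          by_cases hx' : x = τ x
          · simp [← hx']
          · simp [h, hx']
        · by_cases hx' : x = τ l
          · subst hx'
            rw [hτ] at h
            simp [hx, h]
          · simp [hx, hx']
    rw [Finset.sum_congr rfl fun x _ => this x, Finset.sum_sub_distrib]
    simp only [Finset.sum_ite_eq', Finset.mem_univ, if_true]
    have := ha l
    rcases lt_trichotomy l (τ l) with h | h | h
    · simp [h, h.not_gt]
    · rw [← h] at this ⊢
      simp; omega
    · simp [h, h.not_gt, this]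
  rw [key]
  exact hsum _

theorem neg_one_smul_weight (a : Weight n) : (-1 : ℤˣ) • a = -a := by
  rw [Units.smul_def]; simp

/-! ### Slicing the pairing by the functionals of `F_i` and `K_a`. -/

namespace Pairing

variable {χ : SymmetricBicharacter k n} {J' : PreNicholsIdeal χ}

/-- The map `e ↦ φ(e₍₁₎) e₍₂₎`. -/
def slice (φ : Dual χ J') : Bos χ 1 J' →ₗ[k] Bos χ 1 J' :=
  (TensorProduct.lid k _).toLinearMap ∘ₗ TensorProduct.map φ.ofConv LinearMap.id ∘ₗ
    Coalgebra.comul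

/-- Slicing is the transpose of left convolution. It moves a left factor in `H ⋉ U⁻` over to the
other side of the pairing, and all recursive formulas for the two actions come from it. -/
theorem convMul_eq_slice (φ ψ : Dual χ J') (e : Bos χ 1 J') : (φ * ψ) e = ψ (slice φ e) := by
  rw [LinearMap.convMul_apply]
  simp only [slice, LinearMap.comp_apply]
  induction (Coalgebra.comul (R := k) e) using TensorProduct.induction_on with
  | zero => exact ((map_zero ψ.ofConv).symm)
  | tmul u v => exact (map_smul ψ.ofConv (φ u) v).symm
  | add s t hs ht =>
    simp only [map_add, hs, ht]

theorem slice_one (φ : Dual χ J') : slice φ 1 = φ 1 • 1 := by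
  simp [slice, Algebra.TensorProduct.one_def]

/-- The functional of `K_a` is a character, so its slice is an algebra endomorphism. -/
theorem slice_kappa_mul (a : Weight n) (e e' : Bos χ 1 J') :
    slice (kappa χ J' a) (e * e') = slice (kappa χ J' a) e * slice (kappa χ J' a) e' := by
  simp only [slice, LinearMap.comp_apply, Bialgebra.comul_mul]
  generalize Coalgebra.comul (R := k) e = s
  generalize Coalgebra.comul (R := k) e' = t
  induction s using TensorProduct.induction_on with
  | zero => simp
  | tmul u v =>
    induction t using TensorProduct.induction_on with
    | zero => simp
    | tmul u' v' => simp [kappa, smul_smul, mul_comm]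
    | add s t hs ht => simp only [mul_add, map_add, hs, ht]
  | add s t hs ht => simp only [add_mul, map_add, hs, ht]

theorem matHom_zero_zero (i : Fin n) (x : Bos χ 1 J') :
    matHom χ J' i x 0 0 = charHom χ J' (-α i) x := by
  have : ∀ x ∈ (⊤ : Submodule k (Bos χ 1 J')),
      matHom χ J' i x 0 0 = charHom χ J' (-α i) x ∧ matHom χ J' i x 1 0 = 0 := by
    rw [← Bos.eq_top_of_left χ 1 J'
      { carrier := {x | matHom χ J' i x 0 0 = charHom χ J' (-α i) x ∧ matHom χ J' i x 1 0 = 0}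
        add_mem' := fun {a b} ha hb => by simp_all
        zero_mem' := by simp
        smul_mem' := fun r x hx => by simp_all } ?_ ?_ ?_]
    · intro x hx
      exact hx
    · simp
    · rintro j x ⟨h1, h2⟩
      simp [matHom, charHom, Matrix.mul_apply] at h1 h2 ⊢
      simp [h2]
    · rintro a x ⟨h1, h2⟩
      simp [matHom, charHom, Matrix.mul_apply] at h1 h2 ⊢
      simp [h1, h2]
  exact (this x trivial).1

/-- The functional is the off-diagonal coefficient of an upper triangular representation, whose
diagonal consists of the character of `K_i⁻¹` and the counit. -/
theorem xi_mul (i : Fin n) (e e' : Bos χ 1 J') : xi χ J' i (e * e') =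
    kappa χ J' (-α i) e * xi χ J' i e' + xi χ J' i e * Coalgebra.counit (R := k) e' := by
  rw [xi_apply, xi_apply, xi_apply, map_mul, Matrix.mul_apply, Fin.sum_univ_two,
    matHom_zero_zero, (matHom_one_one i e').2]
  rfl

theorem slice_xi_mul (i : Fin n) (e e' : Bos χ 1 J') :
    slice (xi χ J' i) (e * e') =
      slice (kappa χ J' (-α i)) e * slice (xi χ J' i) e' + slice (xi χ J' i) e * e' := by
  -- Writing the bare factor `e'` as a contraction of its coproduct makes the claim bilinear in the
  -- two coproducts, which may then be replaced by arbitrary tensors.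
  have h : e' = (TensorProduct.lid k _) (TensorProduct.map (Coalgebra.counit (R := k))
      LinearMap.id (Coalgebra.comul (R := k) e')) := by
    have := Coalgebra.rTensor_counit_comul (R := k) e'
    rw [LinearMap.rTensor] at this
    rw [this]; simp
  suffices H : slice (xi χ J' i) (e * e') =
      slice (kappa χ J' (-α i)) e * slice (xi χ J' i) e' + slice (xi χ J' i) e *
      (TensorProduct.lid k _) (TensorProduct.map (Coalgebra.counit (R := k))
      LinearMap.id (Coalgebra.comul (R := k) e')) by
    rwa [← h] at H
  clear h
  simp only [slice, LinearMap.comp_apply, Bialgebra.comul_mul, LinearEquiv.coe_coe]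
  generalize Coalgebra.comul (R := k) e = s
  generalize Coalgebra.comul (R := k) e' = t
  induction s using TensorProduct.induction_on with
  | zero => simp
  | tmul u v =>
    induction t using TensorProduct.induction_on with
    | zero => simp
    | tmul u' v' =>
      have := xi_mul i u u'
      simp only [Algebra.TensorProduct.tmul_mul_tmul, TensorProduct.map_tmul, LinearMap.id_apply,
        TensorProduct.lid_tmul, smul_mul_smul_comm]
      rw [← add_smul]
      exact congrArg (· • (v * v')) this
    | add s t hs ht =>
      simp only [mul_add, map_add, hs, ht]
      abel
  | add s t hs ht =>
    simp only [add_mul, map_add, hs, ht]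
    abel

theorem slice_kappa_X (a : Weight n) (j : Fin n) :
    slice (kappa χ J' a) (Bos.X χ 1 J' j) = χ (-a) (α j) • Bos.X χ 1 J' j := by
  simp [slice, kappa, charHom]

theorem slice_kappa_K (a b : Weight n) :
    slice (kappa χ J' a) (Bos.K χ 1 J' b) = χ (-a) b • Bos.K χ 1 J' b := by
  simp [slice, kappa, charHom]

theorem slice_xi_X (i j : Fin n) :
    slice (xi χ J' i) (Bos.X χ 1 J' j) = if i = j then 1 else 0 := by
  simp [slice, xi, matHom]

theorem slice_xi_K (i : Fin n) (b : Weight n) :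
    slice (xi χ J' i) (Bos.K χ 1 J' b) = 0 := by
  simp [slice, xi, matHom]

@[simp] theorem hom_X (J : PreNicholsIdeal χ) (i : Fin n) :
    hom χ J J' (Bos.X χ (-1) J i) = xi χ J' i := Bos.lift_X _ i

@[simp] theorem hom_K (J : PreNicholsIdeal χ) (a : Weight n) :
    hom χ J J' (Bos.K χ (-1) J a) = kappa χ J' a := Bos.lift_K _ a

end Pairing

open Pairing

/-! ### The two actions on `H ⋉ U⁻` and the skew derivations they define. -/

section Actions

variable (χ : SymmetricBicharacter k n) (J : PreNicholsIdeal χ)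

/-- The generators of `H ⋉ U⁻`. -/
abbrev FA (i : Fin n) : Bos χ (-1) J := Bos.X χ (-1) J i

/-- The group-like elements of `H ⋉ U⁻`. -/
abbrev KA (a : Weight n) : Bos χ (-1) J := Bos.K χ (-1) J a

variable {χ J}

theorem KA_FA (a : Weight n) (i : Fin n) :
    KA χ J a * FA χ J i = (χ a (α i))⁻¹ • (FA χ J i * KA χ J a) := by
  rw [KA, FA, Bos.K_X, neg_one_smul_weight, χ.neg_right]

theorem KA_comm (a b : Weight n) : KA χ J a * KA χ J b = KA χ J b * KA χ J a := by
  rw [KA, KA, ← Bos.K_add, ← Bos.K_add, add_comm]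

theorem FA_KA (a : Weight n) (i : Fin n) :
    FA χ J i * KA χ J a = χ a (α i) • (KA χ J a * FA χ J i) := by
  rw [KA_FA, smul_smul, mul_inv_cancel₀ (χ.ne_zero _ _), one_smul]

/-- Induction along left multiplication by generators. -/
theorem bos_induction {s : ℤˣ} {P : Bos χ s J → Prop} (one : P 1)
    (X : ∀ i y, P y → P (Bos.X χ s J i * y)) (K : ∀ a y, P y → P (Bos.K χ s J a * y))
    (add : ∀ y z, P y → P z → P (y + z)) (smul : ∀ (r : k) y, P y → P (r • y))
    (y : Bos χ s J) : P y := by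
  let S : Submodule k (Bos χ s J) :=
    { carrier := {y | P y}
      add_mem' := fun {a b} ha hb => add a b ha hb
      zero_mem' := by simpa using smul 0 1 one
      smul_mem' := fun r x hx => smul r x hx }
  have : S = ⊤ := Bos.eq_top_of_left χ s J S one X K
  have h : y ∈ S := by rw [this]; trivial
  exact h

theorem copComul_mul (x y : Bos χ (-1) J) :
    copComul χ J (x * y) = copComul χ J x * copComul χ J y :=
  map_mul ((Algebra.TensorProduct.comm k _ _).toAlgHom.comp
    (Bialgebra.comulAlgHom k (Bos χ (-1) J))) x y

theorem copComul_one : copComul χ J 1 = 1 ⊗ₜ 1 :=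
  map_one ((Algebra.TensorProduct.comm k _ _).toAlgHom.comp
    (Bialgebra.comulAlgHom k (Bos χ (-1) J)))

theorem copComul_F (i : Fin n) : copComul χ J (FA χ J i) =
    1 ⊗ₜ FA χ J i + FA χ J i ⊗ₜ KA χ J (-α i) := by
  simp [copComul]

theorem copComul_K (a : Weight n) : copComul χ J (KA χ J a) = KA χ J a ⊗ₜ KA χ J a := by
  simp [copComul]

@[simp] theorem proj_X {s : ℤˣ} {J' : PreNicholsIdeal χ} (h : J.ideal ≤ J'.ideal) (i : Fin n) :
    Bos.proj χ s h (Bos.X χ s J i) = Bos.X χ s J' i := Bos.lift_X _ i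

@[simp] theorem proj_K {s : ℤˣ} {J' : PreNicholsIdeal χ} (h : J.ideal ≤ J'.ideal) (a : Weight n) :
    Bos.proj χ s h (Bos.K χ s J a) = Bos.K χ s J' a := Bos.lift_K _ a

theorem pairMax_apply (e : Bos χ 1 (maxIdeal χ)) (y : Bos χ (-1) J) : pairMax χ J e y =
    hom χ (maxIdeal χ) (maxIdeal χ) (Bos.proj χ (-1) (le_maxIdeal J) y) e := rfl

theorem pairMax_F_mul (e : Bos χ 1 (maxIdeal χ)) (i : Fin n) (y : Bos χ (-1) J) :
    pairMax χ J e (FA χ J i * y) = pairMax χ J (slice (xi χ _ i) e) y := by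
  rw [pairMax_apply, map_mul, map_mul, convMul_eq_slice, proj_X, hom_X, pairMax_apply]

theorem pairMax_K_mul (e : Bos χ 1 (maxIdeal χ)) (a : Weight n) (y : Bos χ (-1) J) :
    pairMax χ J e (KA χ J a * y) = pairMax χ J (slice (kappa χ _ a) e) y := by
  rw [pairMax_apply, map_mul, map_mul, convMul_eq_slice, proj_K, hom_K, pairMax_apply]

theorem pairMax_one (e : Bos χ 1 (maxIdeal χ)) :
    pairMax χ J e 1 = Coalgebra.counit (R := k) e := by
  rw [pairMax_apply, map_one, map_one, LinearMap.convOne_apply]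
  simp

theorem leftAct_one_right (e : Bos χ 1 (maxIdeal χ)) :
    leftAct χ J e 1 = Coalgebra.counit (R := k) e • 1 := by
  simp [leftAct, copComul_one, pairMax_one]

theorem rightAct_one_right (e : Bos χ 1 (maxIdeal χ)) :
    rightAct χ J e 1 = Coalgebra.counit (R := k) e • 1 := by
  simp [rightAct, copComul_one, pairMax_one]

/-- The summand `1 ⊗ F_i` of the coproduct multiplies the surviving leg, while `F_i ⊗ K_i⁻¹` is
absorbed by the slice of `e` and leaves `K_i⁻¹` behind. -/
theorem leftAct_F_mul (e : Bos χ 1 (maxIdeal χ)) (i : Fin n) (y : Bos χ (-1) J) :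
    leftAct χ J e (FA χ J i * y) = FA χ J i * leftAct χ J e y +
      KA χ J (-α i) * leftAct χ J (slice (xi χ _ i) e) y := by
  simp only [leftAct, LinearMap.comp_apply, copComul_mul, copComul_F]
  induction copComul χ J y using TensorProduct.induction_on with
  | zero => simp
  | tmul u v => simp [add_mul, pairMax_F_mul]
  | add s t hs ht => simp only [mul_add, map_add, hs, ht]; abel

theorem leftAct_K_mul (e : Bos χ 1 (maxIdeal χ)) (a : Weight n) (y : Bos χ (-1) J) :
    leftAct χ J e (KA χ J a * y) = KA χ J a * leftAct χ J (slice (kappa χ _ a) e) y := by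
  simp only [leftAct, LinearMap.comp_apply, copComul_mul, copComul_K]
  induction copComul χ J y using TensorProduct.induction_on with
  | zero => simp
  | tmul u v => simp [pairMax_K_mul]
  | add s t hs ht => simp only [mul_add, map_add, hs, ht]

theorem rightAct_F_mul (e : Bos χ 1 (maxIdeal χ)) (i : Fin n) (y : Bos χ (-1) J) :
    rightAct χ J e (FA χ J i * y) = rightAct χ J (slice (xi χ _ i) e) y +
      FA χ J i * rightAct χ J (slice (kappa χ _ (-α i)) e) y := by
  simp only [rightAct, LinearMap.comp_apply, copComul_mul, copComul_F]
  induction copComul χ J y using TensorProduct.induction_on with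
  | zero => simp
  | tmul u v => simp [add_mul, pairMax_F_mul, pairMax_K_mul]
  | add s t hs ht => simp only [mul_add, map_add, hs, ht]; abel

theorem rightAct_K_mul (e : Bos χ 1 (maxIdeal χ)) (a : Weight n) (y : Bos χ (-1) J) :
    rightAct χ J e (KA χ J a * y) = KA χ J a * rightAct χ J (slice (kappa χ _ a) e) y := by
  simp only [rightAct, LinearMap.comp_apply, copComul_mul, copComul_K]
  induction copComul χ J y using TensorProduct.induction_on with
  | zero => simp
  | tmul u v => simp [pairMax_K_mul]
  | add s t hs ht => simp only [mul_add, map_add, hs, ht]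

theorem pairMax_add (e e' : Bos χ 1 (maxIdeal χ)) :
    pairMax χ J (e + e') = pairMax χ J e + pairMax χ J e' := by
  ext y
  simp [pairMax]

theorem pairMax_smul (r : k) (e : Bos χ 1 (maxIdeal χ)) :
    pairMax χ J (r • e) = r • pairMax χ J e := by
  ext y
  simp [pairMax]

variable (χ J) in
/-- The left action as a linear map. -/
def leftActLin : Bos χ 1 (maxIdeal χ) →ₗ[k] Module.End k (Bos χ (-1) J) where
  toFun := leftAct χ J
  map_add' e e' := by
    rw [leftAct, pairMax_add, TensorProduct.map_add_left, LinearMap.add_comp, LinearMap.comp_add]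
    rfl
  map_smul' r e := by
    rw [leftAct, pairMax_smul, TensorProduct.map_smul_left, LinearMap.smul_comp,
      LinearMap.comp_smul]
    rfl

variable (χ J) in
/-- The right action as a linear map. -/
def rightActLin : Bos χ 1 (maxIdeal χ) →ₗ[k] Module.End k (Bos χ (-1) J) where
  toFun := rightAct χ J
  map_add' e e' := by
    rw [rightAct, pairMax_add, TensorProduct.map_add_right, LinearMap.add_comp,
      LinearMap.comp_add]
    rfl
  map_smul' r e := by
    rw [rightAct, pairMax_smul, TensorProduct.map_smul_right, LinearMap.smul_comp,
      LinearMap.comp_smul]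
    rfl

theorem leftAct_add (e e' : Bos χ 1 (maxIdeal χ)) :
    leftAct χ J (e + e') = leftAct χ J e + leftAct χ J e' := map_add (leftActLin χ J) e e'
theorem leftAct_smul (r : k) (e : Bos χ 1 (maxIdeal χ)) :
    leftAct χ J (r • e) = r • leftAct χ J e := map_smul (leftActLin χ J) r e
theorem leftAct_zero : leftAct χ J 0 = 0 := map_zero (leftActLin χ J)
theorem rightAct_add (e e' : Bos χ 1 (maxIdeal χ)) :
    rightAct χ J (e + e') = rightAct χ J e + rightAct χ J e' := map_add (rightActLin χ J) e e'
theorem rightAct_smul (r : k) (e : Bos χ 1 (maxIdeal χ)) :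
    rightAct χ J (r • e) = r • rightAct χ J e := map_smul (rightActLin χ J) r e
theorem rightAct_zero : rightAct χ J 0 = 0 := map_zero (rightActLin χ J)

/-- Both sides obey the same recursion in `y`, because slices by `K_a` are multiplicative and slices
by `F_i` are skew derivations. The same argument serves for the right action, which reverses the
order of the factors. -/
theorem leftAct_mul (e e' : Bos χ 1 (maxIdeal χ)) (y : Bos χ (-1) J) :
    leftAct χ J (e * e') y = leftAct χ J e (leftAct χ J e' y) := by
  induction y using bos_induction generalizing e e' with
  | one => simp [leftAct_one_right, smul_smul, mul_comm]
  | X i y h =>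
    rw [leftAct_F_mul, leftAct_F_mul, map_add, leftAct_F_mul, leftAct_K_mul, slice_xi_mul,
      leftAct_add, LinearMap.add_apply, h, h, h]
    noncomm_ring
  | K a y h => rw [leftAct_K_mul, leftAct_K_mul, leftAct_K_mul, slice_kappa_mul, h]
  | add y z hy hz => simp only [map_add, hy, hz]
  | smul r y hy => simp only [map_smul, hy]

theorem rightAct_mul (e e' : Bos χ 1 (maxIdeal χ)) (y : Bos χ (-1) J) :
    rightAct χ J (e * e') y = rightAct χ J e' (rightAct χ J e y) := by
  induction y using bos_induction generalizing e e' with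
  | one => simp [rightAct_one_right, smul_smul]
  | X i y h =>
    rw [rightAct_F_mul, rightAct_F_mul, map_add, rightAct_F_mul, slice_xi_mul, slice_kappa_mul,
      rightAct_add, LinearMap.add_apply, h, h, h]
    abel
  | K a y h => rw [rightAct_K_mul, rightAct_K_mul, rightAct_K_mul, slice_kappa_mul, h]
  | add y z hy hz => simp only [map_add, hy, hz]
  | smul r y hy => simp only [map_smul, hy]

theorem leftAct_one (y : Bos χ (-1) J) : leftAct χ J 1 y = y := by
  induction y using bos_induction with
  | one => simp [leftAct_one_right]
  | X i y h =>
    rw [leftAct_F_mul, slice_one, xi_apply, h, map_one]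
    simp [leftAct_zero]
  | K a y h =>
    rw [leftAct_K_mul, slice_one, kappa_apply, map_one, one_smul, h]
  | add y z hy hz => simp only [map_add, hy, hz]
  | smul r y hy => simp only [map_smul, hy]

theorem rightAct_one (y : Bos χ (-1) J) : rightAct χ J 1 y = y := by
  induction y using bos_induction with
  | one => simp [rightAct_one_right]
  | X i y h =>
    rw [rightAct_F_mul, slice_one, slice_one, xi_apply, kappa_apply, map_one, map_one, one_smul, h]
    simp [rightAct_zero]
  | K a y h =>
    rw [rightAct_K_mul, slice_one, kappa_apply, map_one, one_smul, h]
  | add y z hy hz => simp only [map_add, hy, hz]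
  | smul r y hy => simp only [map_smul, hy]

variable (χ J) in
/-- The left action as an algebra homomorphism. -/
def leftActHom : Bos χ 1 (maxIdeal χ) →ₐ[k] Module.End k (Bos χ (-1) J) :=
  AlgHom.ofLinearMap (leftActLin χ J) (LinearMap.ext leftAct_one)
    fun e e' => LinearMap.ext (leftAct_mul e e')

variable (χ J) in
/-- The skew derivation `y ↦ y ◁ E_j`. -/
def rder (j : Fin n) : Module.End k (Bos χ (-1) J) := rightAct χ J (Bos.X χ 1 (maxIdeal χ) j)

variable (χ J) in
/-- The skew derivation `y ↦ E_j ▷ y`. -/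
def lder (j : Fin n) : Module.End k (Bos χ (-1) J) := leftAct χ J (Bos.X χ 1 (maxIdeal χ) j)

variable (χ J) in
/-- The automorphism `y ↦ K_a ▷ y`. -/
def lgrp (a : Weight n) : Module.End k (Bos χ (-1) J) := leftAct χ J (Bos.K χ 1 (maxIdeal χ) a)

variable (χ J) in
/-- The automorphism `y ↦ y ◁ K_a`. -/
def rgrp (a : Weight n) : Module.End k (Bos χ (-1) J) := rightAct χ J (Bos.K χ 1 (maxIdeal χ) a)

@[simp] theorem rder_one (j : Fin n) : rder χ J j 1 = 0 := by simp [rder, rightAct_one_right]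
@[simp] theorem lder_one (j : Fin n) : lder χ J j 1 = 0 := by simp [lder, leftAct_one_right]
@[simp] theorem lgrp_one (a : Weight n) : lgrp χ J a 1 = 1 := by simp [lgrp, leftAct_one_right]
@[simp] theorem rgrp_one (a : Weight n) : rgrp χ J a 1 = 1 := by simp [rgrp, rightAct_one_right]

theorem rder_F_mul (i j : Fin n) (y : Bos χ (-1) J) : rder χ J j (FA χ J i * y) =
    (if i = j then 1 else 0 : k) • y + χ (α i) (α j) • (FA χ J i * rder χ J j y) := by
  rw [rder, rightAct_F_mul, slice_xi_X, slice_kappa_X, _root_.neg_neg, rightAct_smul]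
  split_ifs <;> simp [rightAct_one, rightAct_zero]

theorem rder_K_mul (a : Weight n) (j : Fin n) (y : Bos χ (-1) J) : rder χ J j (KA χ J a * y) =
    (χ a (α j))⁻¹ • (KA χ J a * rder χ J j y) := by
  rw [rder, rightAct_K_mul, slice_kappa_X, rightAct_smul, χ.neg_left]
  simp

theorem lder_F_mul (i j : Fin n) (y : Bos χ (-1) J) : lder χ J j (FA χ J i * y) =
    (if i = j then 1 else 0 : k) • (KA χ J (-α i) * y) + FA χ J i * lder χ J j y := by
  rw [lder, leftAct_F_mul, slice_xi_X, add_comm]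
  split_ifs <;> simp [leftAct_one, leftAct_zero]

theorem lder_K_mul (a : Weight n) (j : Fin n) (y : Bos χ (-1) J) : lder χ J j (KA χ J a * y) =
    (χ a (α j))⁻¹ • (KA χ J a * lder χ J j y) := by
  rw [lder, leftAct_K_mul, slice_kappa_X, leftAct_smul, χ.neg_left]
  simp

theorem lgrp_F_mul (a : Weight n) (i : Fin n) (y : Bos χ (-1) J) :
    lgrp χ J a (FA χ J i * y) = FA χ J i * lgrp χ J a y := by
  rw [lgrp, leftAct_F_mul, slice_xi_K, leftAct_zero]
  simp

theorem lgrp_K_mul (a b : Weight n) (y : Bos χ (-1) J) :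
    lgrp χ J a (KA χ J b * y) = (χ b a)⁻¹ • (KA χ J b * lgrp χ J a y) := by
  rw [lgrp, leftAct_K_mul, slice_kappa_K, leftAct_smul, χ.neg_left]
  simp

theorem rgrp_F_mul (a : Weight n) (i : Fin n) (y : Bos χ (-1) J) :
    rgrp χ J a (FA χ J i * y) = χ (α i) a • (FA χ J i * rgrp χ J a y) := by
  rw [rgrp, rightAct_F_mul, slice_xi_K, slice_kappa_K, rightAct_smul, _root_.neg_neg, rightAct_zero]
  simp

theorem rgrp_K_mul (a b : Weight n) (y : Bos χ (-1) J) :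
    rgrp χ J a (KA χ J b * y) = (χ b a)⁻¹ • (KA χ J b * rgrp χ J a y) := by
  rw [rgrp, rightAct_K_mul, slice_kappa_K, rightAct_smul, χ.neg_left]
  simp

/-- The left and right actions of `K_a` differ by conjugation with `K_a`. This allows a factor `K_a`
to be carried from the right end of a product to its left end. -/
theorem K_mul_rgrp (a : Weight n) (y : Bos χ (-1) J) :
    KA χ J a * rgrp χ J a y = lgrp χ J a y * KA χ J a := by
  induction y using bos_induction with
  | one => simp
  | X i y h =>
    rw [rgrp_F_mul, lgrp_F_mul, mul_assoc, ← h, mul_smul_comm, ← mul_assoc, ← mul_assoc, FA_KA,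
      smul_mul_assoc, χ.symm_all]
  | K b y h =>
    rw [rgrp_K_mul, lgrp_K_mul, smul_mul_assoc, mul_assoc, ← h, mul_smul_comm, ← mul_assoc,
      ← mul_assoc, KA_comm]
  | add y z hy hz => simp only [map_add, mul_add, add_mul, hy, hz]
  | smul r y hy => simp only [map_smul, mul_smul_comm, smul_mul_assoc, hy]

theorem lgrp_mul (a : Weight n) (y z : Bos χ (-1) J) :
    lgrp χ J a (y * z) = lgrp χ J a y * lgrp χ J a z := by
  induction y using bos_induction with
  | one => simp
  | X i y h => rw [mul_assoc, lgrp_F_mul, lgrp_F_mul, h, mul_assoc]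
  | K b y h => rw [mul_assoc, lgrp_K_mul, lgrp_K_mul, h, smul_mul_assoc, mul_assoc]
  | add y z hy hz => simp only [map_add, add_mul, hy, hz]
  | smul r y hy => simp only [map_smul, smul_mul_assoc, hy]

variable (χ J) in
/-- The operator `y ↦ K_j (y ◁ E_j)`, the main part of the action of `E_j`. -/
def kder (j : Fin n) : Module.End k (Bos χ (-1) J) :=
  LinearMap.mulLeft k (KA χ J (α j)) ∘ₗ rder χ J j

theorem kder_apply (j : Fin n) (y : Bos χ (-1) J) :
    kder χ J j y = KA χ J (α j) * rder χ J j y := rfl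

@[simp] theorem kder_one (j : Fin n) : kder χ J j 1 = 0 := by simp [kder_apply]

/-- The factor `K_j` absorbs the scalar `q_ij` of the right skew derivation. What remains is the
positive half of the commutator of `E_j` with `F_i`. -/
theorem kder_F_mul (i j : Fin n) (y : Bos χ (-1) J) : kder χ J j (FA χ J i * y) =
    (if i = j then 1 else 0 : k) • (KA χ J (α i) * y) + FA χ J i * kder χ J j y := by
  rw [kder_apply, kder_apply, rder_F_mul, mul_add, mul_smul_comm, mul_smul_comm, ← mul_assoc,
    KA_FA, smul_mul_assoc, smul_smul, χ.symm_simple i j, mul_inv_cancel₀ (χ.ne_zero _ _), one_smul,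
    mul_assoc]
  split_ifs with h
  · rw [h]
  · simp

theorem kder_K_mul (a : Weight n) (j : Fin n) (y : Bos χ (-1) J) : kder χ J j (KA χ J a * y) =
    (χ a (α j))⁻¹ • (KA χ J a * kder χ J j y) := by
  rw [kder_apply, kder_apply, rder_K_mul, mul_smul_comm, ← mul_assoc, KA_comm, mul_assoc]

/-- The Leibniz rule for arbitrary products, with the twist on the left factor. It is what makes the
twist product associative. -/
theorem kder_mul (j : Fin n) (y z : Bos χ (-1) J) : kder χ J j (y * z) =
    kder χ J j y * z + lgrp χ J (α j) y * kder χ J j z := by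
  induction y using bos_induction with
  | one => simp
  | X i y h =>
    rw [mul_assoc, kder_F_mul, h, kder_F_mul, lgrp_F_mul]
    simp only [mul_add, add_mul, smul_mul_assoc, mul_assoc]
    abel
  | K b y h =>
    rw [mul_assoc, kder_K_mul, h, kder_K_mul, lgrp_K_mul]
    simp only [mul_add, smul_add, smul_mul_assoc, mul_assoc]
  | add y z hy hz => simp only [map_add, add_mul, hy, hz]; abel
  | smul r y hy => simp only [map_smul, smul_mul_assoc, hy, smul_add]

theorem rder_mul_K (j : Fin n) (y : Bos χ (-1) J) (a : Weight n) :
    rder χ J j (y * KA χ J a) = rder χ J j y * KA χ J a := by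
  have e : rder χ J j (KA χ J a) = 0 := by
    rw [← mul_one (KA χ J a), rder_K_mul]; simp
  induction y using bos_induction with
  | one => simp [e]
  | X i y h => rw [mul_assoc, rder_F_mul, h, rder_F_mul]; simp only [add_mul, smul_mul_assoc, mul_assoc]
  | K b y h => rw [mul_assoc, rder_K_mul, h, rder_K_mul, smul_mul_assoc, mul_assoc]
  | add y z hy hz => simp only [map_add, add_mul, hy, hz]
  | smul r y hy => simp only [map_smul, smul_mul_assoc, hy]

theorem kder_mul_K (j : Fin n) (y : Bos χ (-1) J) (a : Weight n) :
    kder χ J j (y * KA χ J a) = kder χ J j y * KA χ J a := by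
  rw [kder_apply, kder_apply, rder_mul_K, mul_assoc]

theorem lder_mul_K (j : Fin n) (y : Bos χ (-1) J) (a : Weight n) :
    lder χ J j (y * KA χ J a) = lder χ J j y * KA χ J a := by
  have e : lder χ J j (KA χ J a) = 0 := by
    rw [← mul_one (KA χ J a), lder_K_mul]; simp
  induction y using bos_induction with
  | one => simp [e]
  | X i y h => rw [mul_assoc, lder_F_mul, h, lder_F_mul]; simp only [add_mul, smul_mul_assoc, mul_assoc]
  | K b y h => rw [mul_assoc, lder_K_mul, h, lder_K_mul, smul_mul_assoc, mul_assoc]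
  | add y z hy hz => simp only [map_add, add_mul, hy, hz]
  | smul r y hy => simp only [map_smul, smul_mul_assoc, hy]

/-- Left and right actions commute by coassociativity; here this is read off from the recursions on
generators. -/
theorem lder_rder (i j : Fin n) (y : Bos χ (-1) J) :
    lder χ J i (rder χ J j y) = rder χ J j (lder χ J i y) := by
  induction y using bos_induction with
  | one => simp
  | X l y h =>
    simp only [rder_F_mul, lder_F_mul, map_add, map_smul, h, rder_K_mul, χ.neg_left, inv_inv,
      smul_add]
    rw [smul_comm (χ (α l) (α j))]
    abel
  | K b y h =>
    rw [rder_K_mul, map_smul, lder_K_mul, h, lder_K_mul, map_smul, rder_K_mul, smul_comm]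
  | add y z hy hz => simp only [map_add, hy, hz]
  | smul r y hy => simp only [map_smul, hy]

end Actions

/-! ### Separating functionals and homogeneous components. -/

/-- A tensor on which all products of functionals from two separating families vanish is zero. -/
theorem tensor_eq_zero_of_separating {V W A B : Type*} [AddCommGroup V] [Module k V]
    [AddCommGroup W] [Module k W] (f : A → V →ₗ[k] k) (g : B → W →ₗ[k] k)
    (hf : ∀ v, (∀ a, f a v = 0) → v = 0) (hg : ∀ w, (∀ b, g b w = 0) → w = 0) (t : V ⊗[k] W)
    (h : ∀ a b, TensorProduct.lid k k (TensorProduct.map (f a) (g b) t) = 0) : t = 0 := by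
  classical
  let bV := Module.Basis.ofVectorSpace k V
  refine (TensorProduct.equivFinsuppOfBasisLeft bV).injective ?_
  rw [map_zero]
  ext i
  rw [TensorProduct.equivFinsuppOfBasisLeft_apply, Finsupp.zero_apply]
  refine hg _ fun b => ?_
  -- Contracting the second leg first gives a vector that every `f a` kills; its coordinates are the
  -- values of `g b` on the coefficients of `t` in the basis of `V`.
  have h1 : TensorProduct.rid k V (TensorProduct.map LinearMap.id (g b) t) = 0 := by
    refine hf _ fun a => ?_
    rw [← h a b]
    generalize t = t
    induction t using TensorProduct.induction_on with
    | zero => simp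
    | tmul v w => simp [mul_comm]
    | add s t hs ht => simp only [map_add, hs, ht]
  have h2 : g b (TensorProduct.lid k W ((bV.coord i).rTensor W t)) =
      bV.coord i (TensorProduct.rid k V (TensorProduct.map LinearMap.id (g b) t)) := by
    generalize t = t
    induction t using TensorProduct.induction_on with
    | zero => simp
    | tmul v w => simp [mul_comm]
    | add s t hs ht => simp only [map_add, hs, ht]
  rw [h2, h1, map_zero]

/-- Right exactness of the tensor product in both variables, applied to the surjection onto the
range. -/
theorem ker_map_rangeRestrict {V W : Type*} [AddCommGroup V] [Module k V] [AddCommGroup W]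
    [Module k W] (Φ : V →ₗ[k] W) :
    LinearMap.ker (TensorProduct.map Φ.rangeRestrict Φ.rangeRestrict) =
    LinearMap.range (TensorProduct.map (LinearMap.ker Φ).subtype (LinearMap.id (R := k) (M := V))) ⊔
    LinearMap.range (TensorProduct.map (LinearMap.id (R := k) (M := V))
      (LinearMap.ker Φ).subtype) := by
  have hex : Function.Exact (LinearMap.ker Φ).subtype Φ.rangeRestrict := by
    rw [LinearMap.exact_iff, LinearMap.ker_rangeRestrict, Submodule.range_subtype]
  have hs : Function.Surjective Φ.rangeRestrict := Φ.surjective_rangeRestrict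
  have h1 := TensorProduct.map_ker hex hs hex hs
  rwa [LinearMap.lTensor, LinearMap.rTensor, sup_comm] at h1

/-- The functionals descend to the range of `Φ` and separate points there, so the image of `t` in
the tensor square of the range vanishes. In this form the coideal property of the radical can be
tested on functionals. -/
theorem mem_ker_sup_of_separating {V W A : Type*} [AddCommGroup V] [Module k V] [AddCommGroup W]
    [Module k W] (Φ : V →ₗ[k] W) (e : A → V →ₗ[k] k) (hker : ∀ a, ∀ v ∈ LinearMap.ker Φ, e a v = 0)
    (hsep : ∀ v, (∀ a, e a v = 0) → v ∈ LinearMap.ker Φ) (t : V ⊗[k] V)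
    (h : ∀ a b, TensorProduct.lid k k (TensorProduct.map (e a) (e b) t) = 0) :
    t ∈ LinearMap.range (TensorProduct.map (LinearMap.ker Φ).subtype
        (LinearMap.id (R := k) (M := V))) ⊔
      LinearMap.range (TensorProduct.map (LinearMap.id (R := k) (M := V))
        (LinearMap.ker Φ).subtype) := by
  rw [← ker_map_rangeRestrict, LinearMap.mem_ker]
  let ev : A → LinearMap.range Φ →ₗ[k] k := fun a =>
    ((LinearMap.ker Φ).liftQ (e a) (hker a)) ∘ₗ Φ.quotKerEquivRange.symm.toLinearMap
  have hev : ∀ a, ev a ∘ₗ Φ.rangeRestrict = e a := by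
    intro a
    ext v
    have : Φ.quotKerEquivRange.symm (Φ.rangeRestrict v) = (LinearMap.ker Φ).mkQ v := by
      rw [LinearEquiv.symm_apply_eq]; rfl
    simp only [ev, LinearMap.comp_apply, LinearEquiv.coe_coe, this]
    exact Submodule.liftQ_apply _ _ _
  have hsep' : ∀ v, (∀ a, ev a v = 0) → v = 0 := by
    rintro ⟨_, q, rfl⟩ h
    refine Subtype.ext ?_
    refine LinearMap.mem_ker.1 (hsep q fun a => ?_)
    rw [← hev]
    exact h a
  refine tensor_eq_zero_of_separating ev ev hsep' hsep' _ fun a b => ?_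
  rw [← LinearMap.comp_apply, ← TensorProduct.map_comp, hev, hev, h]

theorem exists_homogeneous_decomposition (p : Tens k n) :
    ∃ f : Weight n →₀ Tens k n, (∀ μ, f μ ∈ weightSpan k (var k) μ) ∧
      (f.sum fun _ x => x) = p := by
  rw [← Submodule.mem_iSup_iff_exists_finsupp]
  induction p using tens_induction with
  | hw l => exact Submodule.mem_iSup_of_mem _ (weightSpan_word_mem (var k) l)
  | hadd p q hp hq => exact add_mem hp hq
  | hsmul r p hp => exact Submodule.smul_mem _ _ hp

/-! ### The radical of the pairing and the existence of dual bases. -/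

namespace Pairing

variable {χ : SymmetricBicharacter k n}

theorem skewDer_one (j : Fin n) : skewDer χ j 1 = 0 := by
  simp [skewDer, braidedComul, coeffLin, linHom]

theorem skewDer_mem (j : Fin n) {μ : Weight n} {p : Tens k n}
    (hp : p ∈ weightSpan k (var k) μ) : skewDer χ j p ∈ weightSpan k (var k) (μ - α j) := by
  induction hp using Submodule.span_induction with
  | mem p hp =>
    obtain ⟨l, rfl, rfl⟩ := hp
    induction l with
    | nil => rw [word_nil, skewDer_one]; exact zero_mem _
    | cons i l ih =>
      rw [word_cons, skewDer_var_mul, wordWeight_cons]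
      refine add_mem ?_ (Submodule.smul_mem _ _ ?_)
      · split_ifs with h
        · subst h
          rw [add_sub_cancel_left, one_smul]
          exact weightSpan_word_mem _ _
        · simp
      · rw [add_sub_assoc]
        exact mul_mem_weightSpan _ (gen_mem_weightSpan _ i) ih
  | zero => rw [map_zero]; exact zero_mem _
  | add p q _ _ hp hq => rw [map_add]; exact add_mem hp hq
  | smul r p _ hp => rw [map_smul]; exact Submodule.smul_mem _ _ hp

theorem skewDer_groupAct (i j : Fin n) (p : Tens k n) :
    skewDer χ j (groupAct χ i p) = χ (α i) (α j) • groupAct χ i (skewDer χ j p) := by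
  have hg : ∀ l, groupAct χ i (var k l) = χ (α i) (α l) • var k l := fun l => by simp [groupAct]
  induction p using tens_induction with
  | hw l =>
    induction l with
    | nil => simp [word_nil, skewDer_one]
    | cons l w ih =>
      rw [word_cons, map_mul, hg, smul_mul_assoc, map_smul, skewDer_var_mul, skewDer_var_mul, ih,
        map_add, map_smul, map_smul, map_mul, hg]
      split_ifs with h
      · subst h
        simp only [smul_add, smul_smul, mul_smul_comm, smul_mul_assoc]
      · simp only [smul_smul, mul_smul_comm, smul_mul_assoc, zero_smul, zero_add]
        congr 1
        ring
  | hadd p q hp hq => simp only [map_add, hp, hq, smul_add]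
  | hsmul r p hp => simp only [map_smul, hp, smul_comm r]

/-- The derivation contracts the first leg of the coproduct with the coefficient of `x_j`, so this
is the instance of braided coassociativity that is needed. It is proved from the recursion in the
first letter. -/
theorem braidedComul_skewDer (j : Fin n) (p : Tens k n) : braidedComul χ (skewDer χ j p) =
    TensorProduct.map (skewDer χ j) LinearMap.id (braidedComul χ p) := by
  have key : ∀ i (t : Tens k n ⊗[k] Tens k n),
      TensorProduct.map (skewDer χ j) LinearMap.id (braidedLeftMul χ i t) =
      (if i = j then 1 else 0 : k) • t + χ (α i) (α j) • braidedLeftMul χ i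
        (TensorProduct.map (skewDer χ j) LinearMap.id t) := by
    intro i t
    induction t using TensorProduct.induction_on with
    | zero => simp
    | tmul a b =>
      simp only [braidedLeftMul, LinearMap.add_apply, TensorProduct.map_tmul, map_add,
        LinearMap.mulLeft_apply, LinearMap.id_apply, AlgHom.toLinearMap_apply, skewDer_var_mul,
        skewDer_groupAct, TensorProduct.add_tmul, TensorProduct.smul_tmul', smul_add]
      abel
    | add s t hs ht => simp only [map_add, hs, ht, smul_add]; abel
  induction p using tens_induction with
  | hw l =>
    induction l with
    | nil =>
      rw [word_nil, skewDer_one, map_zero]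
      simp [braidedComul, skewDer_one]
    | cons i w ih =>
      rw [word_cons, skewDer_var_mul, map_add, map_smul, map_smul, braidedComul_var_mul, ih,
        braidedComul_var_mul, key]
  | hadd p q hp hq => simp only [map_add, hp, hq]
  | hsmul r p hp => simp only [map_smul, hp]

variable {J' : PreNicholsIdeal χ}

theorem polyEval_xi_X_mul (p : Tens k n) (j : Fin n) (x : Bos χ 1 J') :
    polyEval (xi χ J') p (Bos.X χ 1 J' j * x) = polyEval (xi χ J') (skewDer χ j p) x := by
  rw [← translate_X_polyEval, translate_apply]

theorem polyEval_xi_K_mul {μ : Weight n} {p : Tens k n} (hp : p ∈ weightSpan k (var k) μ)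
    (a : Weight n) (x : Bos χ 1 J') :
    polyEval (xi χ J') p (Bos.K χ 1 J' a * x) = χ μ a * polyEval (xi χ J') p x := by
  rw [← translate_apply, translate_K_polyEval a hp, dual_smul_apply]

theorem polyEval_xi_add (p q : Tens k n) (x : Bos χ 1 J') : polyEval (xi χ J') (p + q) x =
    polyEval (xi χ J') p x + polyEval (xi χ J') q x := by rw [map_add]; rfl

theorem polyEval_xi_smul (r : k) (p : Tens k n) (x : Bos χ 1 J') :
    polyEval (xi χ J') (r • p) x = r * polyEval (xi χ J') p x := by rw [map_smul]; rfl

/-- Evaluation of functionals, as a linear map in the noncommutative polynomial. -/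
def evalXi (J' : PreNicholsIdeal χ) (x : Bos χ 1 J') : Tens k n →ₗ[k] k where
  toFun p := polyEval (xi χ J') p x
  map_add' p q := polyEval_xi_add p q x
  map_smul' r p := polyEval_xi_smul r p x

theorem evalXi_apply (x : Bos χ 1 J') (p : Tens k n) : evalXi J' x p = polyEval (xi χ J') p x := rfl

/-- Removing a letter from the word lowers the weight of `p` by that letter, and the empty word sees
only the constant term. -/
theorem evalXi_word_of_ne {μ : Weight n} {p : Tens k n} (hp : p ∈ weightSpan k (var k) μ)
    (l : List (Fin n)) (hl : wordWeight l ≠ μ) : evalXi J' (word (Bos.X χ 1 J') l) p = 0 := by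
  induction l generalizing p μ with
  | nil =>
    have : weightSpan k (var k) μ ≤ LinearMap.ker (evalXi J' 1) := by
      refine Submodule.span_le.2 ?_
      rintro _ ⟨l, rfl, rfl⟩
      rw [SetLike.mem_coe, LinearMap.mem_ker, evalXi_apply, polyEval_word]
      cases l with
      | nil => exact absurd rfl hl
      | cons i l =>
        rw [word_cons, mul_apply_one, xi_apply, map_one]
        simp
    exact this hp
  | cons i l ih =>
    rw [word_cons, evalXi_apply, polyEval_xi_X_mul]
    refine ih (skewDer_mem i hp) fun h => hl ?_
    rw [wordWeight_cons, h]
    abel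

/-- On a homogeneous polynomial a factor `K_a` of the argument acts by a scalar, so the values on
words in the `E_i` already decide. -/
theorem polyEval_xi_eq_zero_of_homogeneous {μ : Weight n} {p : Tens k n}
    (hp : p ∈ weightSpan k (var k) μ) (h : ∀ l, evalXi J' (word (Bos.X χ 1 J') l) p = 0) :
    polyEval (xi χ J') p = 0 := by
  apply dual_ext
  intro x
  change polyEval (xi χ J') p x = 0
  induction x using bos_induction generalizing μ p with
  | one => exact h []
  | X i y ih =>
    rw [polyEval_xi_X_mul]
    refine ih (skewDer_mem i hp) fun l => ?_
    have := h (i :: l)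
    rwa [word_cons, evalXi_apply, polyEval_xi_X_mul] at this
  | K a y ih => rw [polyEval_xi_K_mul hp, ih hp h, mul_zero]
  | add y z hy hz => rw [show polyEval (xi χ J') p (y + z) = polyEval (xi χ J') p y +
      polyEval (xi χ J') p z from map_add _ _ _, hy hp h, hz hp h, add_zero]
  | smul r y hy => rw [show polyEval (xi χ J') p (r • y) = r • polyEval (xi χ J') p y from
      map_smul _ _ _, hy hp h, smul_zero]

theorem evalXi_component {f : Weight n →₀ Tens k n} (hf : ∀ μ, f μ ∈ weightSpan k (var k) μ)
    (l : List (Fin n)) : evalXi J' (word (Bos.X χ 1 J') l) (f.sum fun _ x => x) =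
      evalXi J' (word (Bos.X χ 1 J') l) (f (wordWeight l)) := by
  rw [Finsupp.sum, map_sum]
  refine Finset.sum_eq_single _ (fun μ _ hμ => evalXi_word_of_ne (hf μ) l (Ne.symm hμ)) ?_
  intro h
  rw [Finsupp.notMem_support_iff.1 h, map_zero]

/-- A word pairs only with the component of its own weight, so the vanishing passes from the sum to
each component. This is why the radical is graded. -/
theorem polyEval_xi_component_eq_zero {f : Weight n →₀ Tens k n}
    (hf : ∀ μ, f μ ∈ weightSpan k (var k) μ)
    (h : ∀ l, evalXi J' (word (Bos.X χ 1 J') l) (f.sum fun _ x => x) = 0) (μ : Weight n) :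
    polyEval (xi χ J') (f μ) = 0 := by
  refine polyEval_xi_eq_zero_of_homogeneous (hf μ) fun l => ?_
  by_cases hl : wordWeight l = μ
  · subst hl
    rw [← evalXi_component hf]
    exact h l
  · exact evalXi_word_of_ne (hf μ) l hl

theorem polyEval_xi_eq_zero {p : Tens k n}
    (h : ∀ l, evalXi J' (word (Bos.X χ 1 J') l) p = 0) : polyEval (xi χ J') p = 0 := by
  obtain ⟨f, hf, rfl⟩ := exists_homogeneous_decomposition p
  rw [Finsupp.sum, map_sum]
  exact Finset.sum_eq_zero fun μ _ => polyEval_xi_component_eq_zero hf h μ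

/-- The functional on a product is computed by the braided coproduct. -/
theorem evalXi_mul (p : Tens k n) (l l' : List (Fin n)) :
    evalXi J' (word (Bos.X χ 1 J') l * word (Bos.X χ 1 J') l') p =
      TensorProduct.lid k k (TensorProduct.map (evalXi J' (word (Bos.X χ 1 J') l))
        (evalXi J' (word (Bos.X χ 1 J') l')) (braidedComul χ p)) := by
  induction l generalizing p with
  | nil =>
    have hc : ∀ p : Tens k n, TensorProduct.lid k (Tens k n) (TensorProduct.map (evalXi J' 1)
        LinearMap.id (braidedComul χ p)) = p := by
      have e0 : ∀ i p, evalXi J' 1 (var k i * p) = 0 := by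
        intro i p
        rw [evalXi_apply, map_mul, mul_apply_one, FreeAlgebra.lift_ι_apply, xi_apply, map_one]
        simp
      have e1 : ∀ i p, evalXi J' 1 (groupAct χ i p) = evalXi J' 1 p := by
        intro i p
        induction p using tens_induction with
        | hw l =>
          cases l with
          | nil => simp [word_nil]
          | cons j l =>
            rw [word_cons, map_mul, e0,
              show groupAct χ i (var k j) = χ (α i) (α j) • var k j by simp [groupAct],
              smul_mul_assoc, map_smul, e0, smul_zero]
        | hadd p q hp hq => simp only [map_add, hp, hq]
        | hsmul r p hp => simp only [map_smul, hp]
      intro p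
      induction p using tens_induction with
      | hw l =>
        induction l with
        | nil =>
          have : evalXi J' 1 (1 : Tens k n) = 1 := by
            rw [evalXi_apply, map_one (polyEval (xi χ J')), LinearMap.convOne_apply]
            simp
          simp [word_nil, braidedComul, this]
        | cons i l ih =>
          rw [word_cons, braidedComul_var_mul]
          conv_rhs => rw [← ih]
          induction braidedComul χ (word (var k) l) using TensorProduct.induction_on with
          | zero => simp
          | tmul a b => simp [braidedLeftMul, e0, e1]
          | add s t hs ht => simp only [map_add, mul_add, hs, ht]
      | hadd p q hp hq => simp only [map_add, hp, hq]
      | hsmul r p hp => simp only [map_smul, hp]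
    rw [word_nil, one_mul]
    conv_lhs => rw [← hc p]
    induction braidedComul χ p using TensorProduct.induction_on with
    | zero => simp
    | tmul a b => simp
    | add s t hs ht => simp only [map_add, hs, ht]
  | cons i l ih =>
    rw [word_cons, mul_assoc, evalXi_apply, polyEval_xi_X_mul, ← evalXi_apply, ih,
      braidedComul_skewDer, ← LinearMap.comp_apply, ← TensorProduct.map_comp]
    congr 3
    ext p
    exact (polyEval_xi_X_mul p i _).symm

/-- The radical of the pairing on the tensor algebra is a pre-Nichols ideal. -/
def radical (J' : PreNicholsIdeal χ) : PreNicholsIdeal χ where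
  ideal := LinearMap.ker (polyEval (xi χ J')).toLinearMap
  mul_left a p hp := by
    simp only [LinearMap.mem_ker, AlgHom.toLinearMap_apply] at hp ⊢
    rw [map_mul, hp, mul_zero]
  mul_right a p hp := by
    simp only [LinearMap.mem_ker, AlgHom.toLinearMap_apply] at hp ⊢
    rw [map_mul, hp, zero_mul]
  graded p hp := by
    obtain ⟨f, hf, rfl⟩ := exists_homogeneous_decomposition p
    refine sum_mem fun μ _ => Submodule.mem_iSup_of_mem μ ⟨?_, hf μ⟩
    refine polyEval_xi_component_eq_zero hf (fun l => ?_) μ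
    rw [LinearMap.mem_ker, AlgHom.toLinearMap_apply] at hp
    rw [evalXi_apply, hp]
    rfl
  two_le p hp := by
    obtain ⟨f, hf, rfl⟩ := exists_homogeneous_decomposition p
    rw [LinearMap.mem_ker, AlgHom.toLinearMap_apply] at hp
    have hz := polyEval_xi_component_eq_zero (J' := J') hf (fun l => by
      rw [evalXi_apply, hp]; rfl)
    refine sum_mem fun μ _ => ?_
    have e1 : evalXi J' 1 (1 : Tens k n) = 1 := by
      rw [evalXi_apply, map_one (polyEval (xi χ J')), LinearMap.convOne_apply]
      simp
    -- A weight of a word of length at most one has no other words, and such a word pairs to `1`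
    -- with itself; so a component of that weight in the radical is zero.
    have small : ∀ l₀ : List (Fin n), wordWeight l₀ = μ →
        (∀ l, wordWeight l = μ → l = l₀) →
        (evalXi J' (word (Bos.X χ 1 J') l₀) (word (var k) l₀) = 1) → f μ = 0 := by
      intro l₀ _ hl₀ h1
      have hs : weightSpan k (var k) μ ≤ Submodule.span k {word (var k) l₀} := by
        refine Submodule.span_le.2 ?_
        rintro _ ⟨l, hl, rfl⟩
        rw [hl₀ l hl]
        exact Submodule.mem_span_singleton_self _
      obtain ⟨r, hr⟩ := Submodule.mem_span_singleton.1 (hs (hf μ))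
      have : evalXi J' (word (Bos.X χ 1 J') l₀) (f μ) = 0 := by rw [evalXi_apply, hz]; rfl
      rw [← hr, map_smul, h1, smul_eq_mul, mul_one] at this
      rw [← hr, this, zero_smul]
    by_cases h2 : ∀ l : List (Fin n), wordWeight l = μ → 2 ≤ l.length
    · refine Submodule.span_mono ?_ (hf μ)
      rintro _ ⟨l, hl, rfl⟩
      exact ⟨l, h2 l hl, rfl⟩
    · push Not at h2
      obtain ⟨l₀, hl₀, h2⟩ := h2
      rw [small l₀ hl₀ ?_ ?_]
      · exact zero_mem _
      · intro l hl
        have hp := perm_of_wordWeight_eq (hl.trans hl₀.symm)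
        match l₀, h2 with
        | [], _ => exact hp.eq_nil
        | [i], _ => exact List.perm_singleton.1 hp
      · match l₀, h2 with
        | [], _ => exact e1
        | [i], _ =>
          rw [word_cons, word_nil, mul_one, word_cons, word_nil, mul_one, evalXi_apply,
            FreeAlgebra.lift_ι_apply, xi_apply]
          simp [matHom]
  comul_mem p hp := by
    -- Evaluations at words separate modulo the radical, and a pair of them on the coproduct of `p`
    -- is the value of `p` at the concatenated word, which vanishes.
    refine mem_ker_sup_of_separating (polyEval (k := k) (xi χ J')).toLinearMap
      (fun l => evalXi J' (word (Bos.X χ 1 J') l)) ?_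
      (fun q hq => polyEval_xi_eq_zero hq) _ fun l l' => ?_
    · intro l q hq
      rw [LinearMap.mem_ker, AlgHom.toLinearMap_apply] at hq
      rw [evalXi_apply, hq]
      rfl
    · rw [LinearMap.mem_ker, AlgHom.toLinearMap_apply] at hp
      rw [← evalXi_mul, evalXi_apply, hp]
      rfl

/-- The radical is a pre-Nichols ideal, so it is contained in the maximal one; conversely every
pre-Nichols ideal pairs to zero. Thus the pairing has no radical on the maximal quotient. -/
theorem polyEval_xi_eq_zero_iff (p : Tens k n) :
    polyEval (xi χ J') p = 0 ↔ p ∈ (maxIdeal χ).ideal :=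
  ⟨fun h => le_maxIdeal (radical J') h, fun h => polyEval_xi (maxIdeal χ) p h⟩

theorem pairing_polyEval (J : PreNicholsIdeal χ) (p : Tens k n) (e : Bos χ 1 J') :
    pairing χ J J' (polyEval (Bos.X χ (-1) J) p) e = polyEval (xi χ J') p e := by
  change hom χ J J' (polyEval (Bos.X χ (-1) J) p) e = _
  rw [alghom_polyEval]
  simp only [hom_X]

/-- The functional of `K_a` vanishes after any `E_i`, so only the first leg of the coproduct sees
the letters. Hence factors `K_a` on the right of an element of `U⁻` are invisible to `U⁺`. -/
theorem mul_kappa_word (φ : Dual χ J') (a : Weight n) (l : List (Fin n)) :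
    (φ * kappa χ J' a) (word (Bos.X χ 1 J') l) = φ (word (Bos.X χ 1 J') l) := by
  induction l generalizing φ with
  | nil => rw [word_nil, mul_apply_one, kappa_apply, map_one (charHom χ J' a), mul_one]
  | cons i l ih =>
    rw [word_cons, mul_apply_X, translate_X_kappa, ih, mul_zero, translate_apply]
    exact add_zero _

end Pairing

/-- In each weight the pairing is injective on the `U⁻` side by the description of its radical.
Equality of dimensions turns this into a perfect pairing, and any basis of the `U⁺` side then has a
dual one. Representing polynomials are chosen afterwards. -/
theorem nonempty_dualBases (χ : SymmetricBicharacter k n) : Nonempty (DualBases χ) := by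
  classical
  let m := maxIdeal χ
  let Xm := Bos.X χ (-1) m
  let Xp := Bos.X χ 1 m
  have hfin : ∀ (s : ℤˣ) (μ : Weight n), Module.Finite k (weightSpan k (Bos.X χ s m) μ) := by
    intro s μ
    rw [← map_polyEval_weightSpan]
    infer_instance
  let B : ∀ μ : Fin n → ℕ, weightSpan k Xm (natWeight μ) →ₗ[k]
      Module.Dual k (weightSpan k Xp (natWeight μ)) := fun μ =>
    (pairing χ m m).domRestrict₁₂ (weightSpan k Xm (natWeight μ)) (weightSpan k Xp (natWeight μ))
  have hB : ∀ μ, Function.Injective (B μ) := by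
    intro μ
    rw [← LinearMap.ker_eq_bot, LinearMap.ker_eq_bot']
    rintro ⟨y, hy⟩ h
    obtain ⟨p, hp, rfl⟩ := exists_polyEval_of_mem_weightSpan hy
    have : polyEval (xi χ m) p = 0 := by
      refine polyEval_xi_eq_zero_of_homogeneous hp fun l => ?_
      by_cases hl : wordWeight l = natWeight μ
      · have := LinearMap.congr_fun h ⟨word Xp l, by rw [← hl]; exact weightSpan_word_mem Xp l⟩
        rw [evalXi_apply, ← pairing_polyEval m]
        exact this
      · exact evalXi_word_of_ne hp l hl
    rw [polyEval_xi_eq_zero_iff] at this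
    exact Subtype.ext (Bos.polyEval_X χ (-1) m p this)
  -- Both weight spaces are images of the same weight space of the tensor algebra. A polynomial that
  -- dies in `U⁻` lies in the radical, hence in the maximal ideal, and so dies in `U⁺` as well.
  have hdim : ∀ μ : Fin n → ℕ, Module.finrank k (weightSpan k Xp (natWeight μ)) ≤
      Module.finrank k (weightSpan k Xm (natWeight μ)) := by
    intro μ
    let T := weightSpan k (var k (n := n)) (natWeight μ)
    let gm : T →ₗ[k] Bos χ (-1) m := (polyEval Xm).toLinearMap ∘ₗ T.subtype
    let gp : T →ₗ[k] Bos χ 1 m := (polyEval Xp).toLinearMap ∘ₗ T.subtype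
    have rm : LinearMap.range gm = weightSpan k Xm (natWeight μ) := by
      rw [← map_polyEval_weightSpan, LinearMap.range_comp, Submodule.range_subtype]
    have rp : LinearMap.range gp = weightSpan k Xp (natWeight μ) := by
      rw [← map_polyEval_weightSpan, LinearMap.range_comp, Submodule.range_subtype]
    have hk : LinearMap.ker gm ≤ LinearMap.ker gp := by
      rintro ⟨p, hp⟩ h
      have h' : polyEval Xm p = 0 := h
      have : polyEval (xi χ m) p = 0 := by
        apply dual_ext
        intro e
        rw [← pairing_polyEval m, h', map_zero]
        rfl
      rw [polyEval_xi_eq_zero_iff] at this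
      exact Bos.polyEval_X χ 1 m p this
    have h1 := LinearMap.finrank_range_add_finrank_ker gm
    have h2 := LinearMap.finrank_range_add_finrank_ker gp
    have h3 := Submodule.finrank_mono hk
    rw [rm] at h1
    rw [rp] at h2
    omega
  have heq : ∀ μ : Fin n → ℕ, Module.finrank k (weightSpan k Xm (natWeight μ)) =
      Module.finrank k (Module.Dual k (weightSpan k Xp (natWeight μ))) := by
    intro μ
    have := hfin 1 (natWeight μ)
    refine le_antisymm (LinearMap.finrank_le_finrank_of_injective (hB μ)) ?_
    rw [Subspace.dual_finrank_eq]
    exact hdim μ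
  have main : ∀ μ : Fin n → ℕ, ∃ (d : ℕ) (f e : Fin d → Tens k n),
      (∀ j, f j ∈ weightSpan k (var k) (natWeight μ)) ∧
      (∀ j, e j ∈ weightSpan k (var k) (natWeight μ)) ∧
      (LinearIndependent k fun j => polyEval Xm (f j)) ∧
      (LinearIndependent k fun j => polyEval Xp (e j)) ∧
      (Submodule.span k (Set.range fun j => polyEval Xm (f j)) =
        weightSpan k Xm (natWeight μ)) ∧
      (Submodule.span k (Set.range fun j => polyEval Xp (e j)) =
        weightSpan k Xp (natWeight μ)) ∧
      (∀ i j, pairing χ m m (polyEval Xm (f i)) (polyEval Xp (e j)) = if i = j then 1 else 0) := by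
    intro μ
    have := hfin 1 (natWeight μ)
    have := hfin (-1) (natWeight μ)
    let bE := Module.finBasis k (weightSpan k Xp (natWeight μ))
    -- The dual basis of the linear dual is carried back along this isomorphism to give the elements
    -- `F_{μ,j}`.
    let eq := LinearEquiv.ofInjectiveOfFinrankEq (B μ) (hB μ) (heq μ)
    let bF := bE.dualBasis.map eq.symm
    have hspan : ∀ {A : Type _} [AddCommGroup A] [Module k A] (W : Submodule k A) {ι : Type}
        (b : Module.Basis ι k W), Submodule.span k (Set.range fun j => (b j : A)) = W := by
      intro A _ _ W ι b
      have := congrArg (Submodule.map W.subtype) b.span_eq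
      rw [Submodule.map_span, Submodule.map_top, Submodule.range_subtype, ← Set.range_comp] at this
      exact this
    choose f hf hf' using fun j => exists_polyEval_of_mem_weightSpan (bF j).2
    choose e he he' using fun j => exists_polyEval_of_mem_weightSpan (bE j).2
    refine ⟨_, f, e, hf, he, ?_, ?_, ?_, ?_, ?_⟩
    · simp only [Xm, hf']
      exact bF.linearIndependent.map' (Submodule.subtype _) (Submodule.ker_subtype _)
    · simp only [Xp, he']
      exact bE.linearIndependent.map' (Submodule.subtype _) (Submodule.ker_subtype _)
    · simp only [Xm, hf']
      exact hspan _ bF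
    · simp only [Xp, he']
      exact hspan _ bE
    · intro i j
      simp only [Xm, Xp, hf', he']
      have h1 : B μ (bF i) = bE.dualBasis i := by
        have : eq (bF i) = bE.dualBasis i := by simp [bF]
        exact this
      have h2 : B μ (bF i) (bE j) = if i = j then 1 else 0 := by
        rw [h1, Module.Basis.dualBasis_apply_self]
        simp only [eq_comm]
      exact h2
  choose d f e h1 h2 h3 h4 h5 h6 h7 using main
  exact ⟨⟨d, f, e, h1, h2, h3, h4, h5, h6, h7⟩⟩

/-! ### Right braided derivations of the tensor algebra. -/

namespace Pairing

variable {χ : SymmetricBicharacter k n}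

/-- The right braided derivation, with `∂_j(x_i p) = x_i ∂_j(p) + δ_ij K_i · p`. -/
def rightDer (χ : SymmetricBicharacter k n) (j : Fin n) : Tens k n →ₗ[k] Tens k n :=
  (TensorProduct.rid k (Tens k n)).toLinearMap ∘ₗ
    TensorProduct.map LinearMap.id (coeffLin j) ∘ₗ braidedComul χ

theorem rid_braidedComul (p : Tens k n) : (TensorProduct.rid k (Tens k n)) (TensorProduct.map
    LinearMap.id (polyEval fun _ => (0 : k)).toLinearMap (braidedComul χ p)) = p := by
  induction p using tens_induction with
  | hw l =>
    induction l with
    | nil => simp [word_nil, braidedComul]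
    | cons i l ih =>
      rw [word_cons, braidedComul_var_mul]
      conv_rhs => rw [← ih]
      induction braidedComul χ (word (var k) l) using TensorProduct.induction_on with
      | zero => simp
      | tmul a b => simp [braidedLeftMul]
      | add s t hs ht => simp only [map_add, mul_add, hs, ht]
  | hadd p q hp hq => simp only [map_add, hp, hq]
  | hsmul r p hp => simp only [map_smul, hp]

theorem rightDer_one (j : Fin n) : rightDer χ j 1 = 0 := by
  simp [rightDer, braidedComul, coeffLin, linHom]

theorem rightDer_var_mul (i j : Fin n) (p : Tens k n) : rightDer χ j (var k i * p) =
    var k i * rightDer χ j p + (if i = j then 1 else 0 : k) • groupAct χ i p := by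
  have H : ∀ t : Tens k n ⊗[k] Tens k n, (TensorProduct.rid k (Tens k n))
      (TensorProduct.map LinearMap.id (coeffLin j) (braidedLeftMul χ i t)) =
      var k i * (TensorProduct.rid k (Tens k n)) (TensorProduct.map LinearMap.id (coeffLin j) t) +
      (if i = j then 1 else 0 : k) • groupAct χ i ((TensorProduct.rid k (Tens k n))
        (TensorProduct.map LinearMap.id (polyEval fun _ => (0 : k)).toLinearMap t)) := by
    intro t
    induction t using TensorProduct.induction_on with
    | zero => simp
    | tmul a b => split_ifs with h <;> simp [braidedLeftMul, coeffLin_var_mul, h]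
    | add s t hs ht =>
      simp only [map_add, hs, ht, smul_add, mul_add]
      abel
  have := H (braidedComul χ p)
  rw [rid_braidedComul, ← braidedComul_var_mul] at this
  exact this

/-- The ideal is a coideal without linear terms, so contracting one leg of the coproduct with a
linear coefficient does not leave it. -/
theorem rightDer_ideal (J : PreNicholsIdeal χ) (j : Fin n) (p : Tens k n) (hp : p ∈ J.ideal) :
    rightDer χ j p ∈ J.ideal := by
  have : LinearMap.range (TensorProduct.map J.ideal.subtype
        (LinearMap.id (R := k) (M := Tens k n))) ⊔
      LinearMap.range (TensorProduct.map (LinearMap.id (R := k) (M := Tens k n))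
        J.ideal.subtype) ≤
      J.ideal.comap ((TensorProduct.rid k (Tens k n)).toLinearMap ∘ₗ
        TensorProduct.map LinearMap.id (coeffLin j)) := by
    refine sup_le ?_ ?_
    · rintro _ ⟨t, rfl⟩
      induction t using TensorProduct.induction_on with
      | zero => simp
      | tmul a b => simpa using J.ideal.smul_mem _ a.2
      | add s t hs ht => rw [map_add]; exact add_mem hs ht
    · rintro _ ⟨t, rfl⟩
      induction t using TensorProduct.induction_on with
      | zero => simp
      | tmul a b => simp [coeffLin_ideal J j _ b.2]
      | add s t hs ht => rw [map_add]; exact add_mem hs ht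
  exact this (J.comul_mem p hp)

end Pairing

theorem polyEval_var_mul_apply {V : Type*} [AddCommGroup V] [Module k V]
    (x : Fin n → Module.End k V) (i : Fin n) (p : Tens k n) (v : V) :
    polyEval x (var k i * p) v = x i (polyEval x p v) := by
  rw [map_mul, Module.End.mul_apply, FreeAlgebra.lift_ι_apply]

/-! ### The representation of `U⁺_max ⋊ H` by the operators `kder`. -/

section KDer

variable {χ : SymmetricBicharacter k n} {J : PreNicholsIdeal χ}

theorem polyEval_kder_groupAct (i : Fin n) (p : Tens k n) (y : Bos χ (-1) J) :
    polyEval (kder χ J) (groupAct χ i p) (KA χ J (α i) * y) =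
      KA χ J (α i) * polyEval (kder χ J) p y := by
  have hg : ∀ l, groupAct χ i (var k l) = χ (α i) (α l) • var k l := fun l => by simp [groupAct]
  induction p using tens_induction with
  | hw l =>
    induction l with
    | nil => simp [word_nil]
    | cons j l ih =>
      rw [word_cons, map_mul (groupAct χ i), hg, smul_mul_assoc, map_smul, LinearMap.smul_apply,
        polyEval_var_mul_apply, polyEval_var_mul_apply, ih, kder_K_mul, smul_smul,
        mul_inv_cancel₀ (χ.ne_zero _ _), one_smul]
  | hadd p q hp hq => simp only [map_add, LinearMap.add_apply, hp, hq, mul_add]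
  | hsmul r p hp => simp only [map_smul, LinearMap.smul_apply, hp, mul_smul_comm]

/-- When `F_i` moves left past the letters of `p`, each letter `x_i` leaves a factor `K_i`. Carrying
it to the right through the remaining letters costs exactly the braiding, so the correction terms
sum up to the right derivative. -/
theorem polyEval_kder_F_mul (p : Tens k n) (i : Fin n) (y : Bos χ (-1) J) :
    polyEval (kder χ J) p (FA χ J i * y) = FA χ J i * polyEval (kder χ J) p y +
      polyEval (kder χ J) (rightDer χ i p) (KA χ J (α i) * y) := by
  induction p using tens_induction with
  | hw l =>
    induction l with
    | nil => simp [word_nil, rightDer_one]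
    | cons j l ih =>
      rw [word_cons, polyEval_var_mul_apply, ih, rightDer_var_mul, polyEval_var_mul_apply,
        map_add, kder_F_mul, map_add, map_smul, LinearMap.add_apply, LinearMap.smul_apply,
        polyEval_var_mul_apply]
      by_cases h : i = j
      · subst h
        rw [polyEval_kder_groupAct, if_pos rfl]
        abel
      · rw [if_neg h, if_neg (Ne.symm h), zero_smul, zero_smul]
        abel
  | hadd p q hp hq => simp only [map_add, LinearMap.add_apply, hp, hq, mul_add]; abel
  | hsmul r p hp => simp only [map_smul, LinearMap.smul_apply, hp, mul_smul_comm, smul_add]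

theorem polyEval_kder_K_mul {μ : Weight n} {p : Tens k n} (hp : p ∈ weightSpan k (var k) μ)
    (a : Weight n) (y : Bos χ (-1) J) : polyEval (kder χ J) p (KA χ J a * y) =
      (χ a μ)⁻¹ • (KA χ J a * polyEval (kder χ J) p y) := by
  induction hp using Submodule.span_induction with
  | mem p hp =>
    obtain ⟨l, rfl, rfl⟩ := hp
    induction l with
    | nil => simp [word_nil, wordWeight_nil, χ.zero_right]
    | cons i l ih =>
      rw [word_cons, polyEval_var_mul_apply, polyEval_var_mul_apply, ih, map_smul, kder_K_mul, wordWeight_cons, χ.add_right, smul_smul, mul_inv,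
        mul_comm (χ a (α i))⁻¹]
  | zero => simp
  | add a b _ _ ha hb => simp only [map_add, LinearMap.add_apply, ha, hb, mul_add, smul_add]
  | smul r a _ ha => rw [map_smul, LinearMap.smul_apply, ha, LinearMap.smul_apply, mul_smul_comm,
      smul_comm r]

/-- Induction on the argument: a factor `F_i` replaces `p` by its right derivative, which is again
in the ideal, and a factor `K_a` rescales homogeneous elements, which suffices as the ideal is
graded. -/
theorem polyEval_kder_eq_zero (p : Tens k n) (hp : p ∈ (maxIdeal χ).ideal) :
    polyEval (kder χ J) p = 0 := by
  have hK : ∀ y : Bos χ (-1) J, (∀ p ∈ (maxIdeal χ).ideal, polyEval (kder χ J) p y = 0) →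
      ∀ a, ∀ p ∈ (maxIdeal χ).ideal, polyEval (kder χ J) p (KA χ J a * y) = 0 := by
    intro y h a p hp
    have : (maxIdeal χ).ideal ≤ LinearMap.ker
        (LinearMap.applyₗ (KA χ J a * y) ∘ₗ (polyEval (kder χ J)).toLinearMap) := by
      refine (maxIdeal χ).le_of_homogeneous _ fun μ p hp hμ => ?_
      change polyEval (kder χ J) p (KA χ J a * y) = 0
      rw [polyEval_kder_K_mul hμ, h p hp, mul_zero, smul_zero]
    exact this hp
  ext y
  rw [LinearMap.zero_apply]
  induction y using bos_induction generalizing p with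
  | one =>
    have : (maxIdeal χ).ideal ≤
        LinearMap.ker (LinearMap.applyₗ (1 : Bos χ (-1) J) ∘ₗ (polyEval (kder χ J)).toLinearMap) := by
      -- A single letter already kills `1`, and the ideal has no constant terms.
      refine (maxIdeal χ).two_le.trans (Submodule.span_le.2 ?_)
      rintro _ ⟨l, hl, rfl⟩
      rw [SetLike.mem_coe, LinearMap.mem_ker]
      change polyEval (kder χ J) (word (var k) l) 1 = 0
      rw [polyEval_word]
      have : ∀ i l, word (kder χ J) (i :: l) (1 : Bos χ (-1) J) = 0 := by
        intro i l
        induction l generalizing i with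
        | nil => simp [word_cons, word_nil]
        | cons j l ih => rw [word_cons, Module.End.mul_apply, ih, map_zero]
      match l, hl with
      | i :: l, _ => exact this i l
    exact this hp
  | X i y h => rw [polyEval_kder_F_mul, h p hp, hK y h _ _ (rightDer_ideal _ i p hp), mul_zero,
      add_zero]
  | K a y h => exact hK y h a p hp
  | add y z hy hz => rw [map_add, hy p hp, hz p hp, add_zero]
  | smul r y hy => rw [map_smul, hy p hp, smul_zero]

variable (χ J) in
theorem kderHom_isLift : Bos.IsLift χ 1 (maxIdeal χ) (kder χ J)
    (fun a => LinearMap.mulLeft k (KA χ J a)) where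
  g_zero := by ext y; simp [KA, Bos.K_zero]
  g_add a b := by ext y; simp [KA, Bos.K_add]
  g_x a i := by
    ext y
    simp only [Module.End.mul_apply, LinearMap.mulLeft_apply, LinearMap.smul_apply, kder_K_mul,
      one_smul]
    rw [smul_smul, mul_inv_cancel₀ (χ.ne_zero _ _), one_smul]
  ideal := polyEval_kder_eq_zero

variable (χ J) in
/-- The algebra homomorphism with `E_j ↦ K_j (· ◁ E_j)` and `K_a ↦ K_a ·`. -/
def kderHom : Bos χ 1 (maxIdeal χ) →ₐ[k] Module.End k (Bos χ (-1) J) :=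
  Bos.lift (kderHom_isLift χ J)

@[simp] theorem kderHom_X (i : Fin n) : kderHom χ J (Bos.X χ 1 _ i) = kder χ J i := Bos.lift_X _ i

@[simp] theorem kderHom_K (a : Weight n) :
    kderHom χ J (Bos.K χ 1 _ a) = LinearMap.mulLeft k (KA χ J a) := Bos.lift_K _ a

end KDer

/-! ### Gradings of `H ⋉ U⁻` by coactions of group algebras. -/

section Grading

variable {N : Type*} [AddCommGroup N] (χ : SymmetricBicharacter k n) (J : PreNicholsIdeal χ)

/-- A grading is encoded as an algebra homomorphism to a group algebra over `H ⋉ U⁻`, so it can be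
defined on generators. Keeping the degrees of `F_i` and `K_a` independent allows the same
construction to count factors `K_a`, or letters, or both. -/
theorem gradHom_isLift (u v : Weight n →+ N) : Bos.IsLift χ (-1) J
    (fun i => (AddMonoidAlgebra.single (u (α i)) (FA χ J i) : AddMonoidAlgebra (Bos χ (-1) J) N))
    (fun a => AddMonoidAlgebra.single (v a) (KA χ J a)) where
  g_zero := by rw [map_zero, KA, Bos.K_zero]; rfl
  g_add a b := by rw [map_add, KA, Bos.K_add, AddMonoidAlgebra.single_mul_single]
  g_x a i := by
    rw [AddMonoidAlgebra.single_mul_single, AddMonoidAlgebra.single_mul_single, Bos.K_X,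
      add_comm, AddMonoidAlgebra.smul_single]
  ideal p hp := by
    have e : (fun i => (AddMonoidAlgebra.single (u (α i)) (FA χ J i) :
        AddMonoidAlgebra (Bos χ (-1) J) N)) =
        fun i => AddMonoidAlgebra.single (u (α i)) 1 * AddMonoidAlgebra.single 0 (FA χ J i) := by
      ext1 i; rw [AddMonoidAlgebra.single_mul_single, add_zero, one_mul]
    rw [e]
    refine J.polyEval_twist_eq_zero (fun a => AddMonoidAlgebra.single (u a) 1) ?_ ?_
      (fun i => AddMonoidAlgebra.single 0 (FA χ J i)) ?_ ?_ p hp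
    · rw [map_zero]; rfl
    · intro a b; rw [map_add, AddMonoidAlgebra.single_mul_single, one_mul]
    · intro a i
      rw [AddMonoidAlgebra.single_mul_single, AddMonoidAlgebra.single_mul_single, add_comm, one_mul,
        mul_one]
    · intro p hp
      have : polyEval (fun i => (AddMonoidAlgebra.single 0 (FA χ J i) :
          AddMonoidAlgebra (Bos χ (-1) J) N)) =
          (AddMonoidAlgebra.singleZeroAlgHom (R := k) (A := Bos χ (-1) J) (M := N)).comp (polyEval (k := k) (FA χ J)) := by
        ext i : 2
        simp
      rw [this, AlgHom.comp_apply, Bos.polyEval_X χ (-1) J p hp, map_zero]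

/-- The grading of `H ⋉ U⁻` in which `F_i` has degree `u(α_i)` and `K_a` has degree `v(a)`. -/
def gradHom (u v : Weight n →+ N) : Bos χ (-1) J →ₐ[k] AddMonoidAlgebra (Bos χ (-1) J) N :=
  Bos.lift (gradHom_isLift χ J u v)

/-- The component of degree `d` for the grading in which `F_i` has degree `u(α_i)` and `K_a` has
degree `v(a)`. -/
def gradComp (u v : Weight n →+ N) (d : N) : Module.End k (Bos χ (-1) J) where
  toFun y := (gradHom χ J u v y).coeff d
  map_add' y z := by rw [map_add]; rfl
  map_smul' r y := by rw [map_smul]; rfl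

variable {χ J}

theorem gradComp_one (u v : Weight n →+ N) (d : N) [Decidable (d = 0)] :
    gradComp χ J u v d 1 = if d = 0 then 1 else 0 := by
  classical
  change (gradHom χ J u v 1).coeff d = _
  rw [map_one, AddMonoidAlgebra.one_def, AddMonoidAlgebra.coeff_single, Finsupp.single_apply]
  simp only [eq_comm]

theorem gradComp_F_mul (u v : Weight n →+ N) (d : N) (i : Fin n) (y : Bos χ (-1) J) :
    gradComp χ J u v d (FA χ J i * y) = FA χ J i * gradComp χ J u v (d - u (α i)) y := by
  change (gradHom χ J u v (FA χ J i * y)).coeff d = FA χ J i * (gradHom χ J u v y).coeff _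
  rw [map_mul, gradHom, Bos.lift_X]
  exact AddMonoidAlgebra.coeff_single_mul_eq_mul_coeff _ (fun m _ => ⟨fun h => by rw [← h]; abel, fun h => by rw [h]; abel⟩)

theorem gradComp_K_mul (u v : Weight n →+ N) (d : N) (a : Weight n) (y : Bos χ (-1) J) :
    gradComp χ J u v d (KA χ J a * y) = KA χ J a * gradComp χ J u v (d - v a) y := by
  change (gradHom χ J u v (KA χ J a * y)).coeff d = KA χ J a * (gradHom χ J u v y).coeff _
  rw [map_mul, gradHom, Bos.lift_K]
  exact AddMonoidAlgebra.coeff_single_mul_eq_mul_coeff _ (fun m _ => ⟨fun h => by rw [← h]; abel, fun h => by rw [h]; abel⟩)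

end Grading

/-! ### There are no relations in `U⁻` beyond the given ideal. -/

section Faithful

variable (χ : SymmetricBicharacter k n) (J : PreNicholsIdeal χ)

/-- The automorphism of the tensor algebra with `x_i ↦ χ(a, α_i)⁻¹ x_i`. -/
def weightAut (a : Weight n) : Tens k n →ₐ[k] Tens k n :=
  polyEval fun i => χ a (-α i) • var k i

theorem weightAut_word (a : Weight n) (l : List (Fin n)) :
    weightAut χ a (word (var k) l) = χ a (-wordWeight l) • word (var k) l := by
  induction l with
  | nil => simp [word_nil, wordWeight_nil, χ.zero_right]
  | cons i l ih =>
    rw [word_cons, map_mul, ih, wordWeight_cons, neg_add, χ.add_right,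
      show weightAut χ a (var k i) = χ a (-α i) • var k i by simp [weightAut], smul_mul_smul_comm]

theorem weightAut_mem (a : Weight n) :
    J.ideal ≤ J.ideal.comap (weightAut χ a).toLinearMap := by
  refine J.le_of_homogeneous _ fun μ p hp hμ => ?_
  have : weightSpan k (var k) μ ≤
      LinearMap.eqLocus (weightAut χ a).toLinearMap (χ a (-μ) • LinearMap.id) := by
    refine Submodule.span_le.2 ?_
    rintro _ ⟨l, rfl, rfl⟩
    simpa using weightAut_word χ a l
  have e : weightAut χ a p = χ a (-μ) • p := this hμ
  rw [Submodule.mem_comap, AlgHom.toLinearMap_apply, e]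
  exact J.ideal.smul_mem _ hp

/-- `H ⋉ U⁻` acts on the quotient of the tensor algebra, `F_i` by left multiplication and `K_a` by
weight scalars. Acting on the class of `1` recovers a polynomial modulo the ideal. -/
theorem regularRep_isLift : Bos.IsLift χ (-1) J
    (fun i => (J.ideal.mapQ J.ideal (LinearMap.mulLeft k (var k i))
      (fun p hp => J.mul_left _ p hp) : Module.End k (Tens k n ⧸ J.ideal)))
    (fun a => J.ideal.mapQ J.ideal (weightAut χ a).toLinearMap (weightAut_mem χ J a)) where
  g_zero := by
    refine Submodule.linearMap_qext _ (tens_linearMap_ext fun l => ?_)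
    simp [weightAut_word, χ.zero_left]
  g_add a b := by
    refine Submodule.linearMap_qext _ (tens_linearMap_ext fun l => ?_)
    simp [weightAut_word, χ.add_left, smul_smul, mul_comm]
  g_x a i := by
    refine Submodule.linearMap_qext _ (tens_linearMap_ext fun l => ?_)
    change J.ideal.mkQ (weightAut χ a (var k i * word (var k) l)) = χ a ((-1 : ℤˣ) • α i) •
      J.ideal.mkQ (var k i * weightAut χ a (word (var k) l))
    rw [map_mul, show weightAut χ a (var k i) = χ a (-α i) • var k i by simp [weightAut],
      neg_one_smul_weight, smul_mul_assoc, map_smul]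
  ideal p hp := by
    refine Submodule.linearMap_qext _ (LinearMap.ext fun q => ?_)
    have : ∀ p : Tens k n, polyEval (fun i => (J.ideal.mapQ J.ideal (LinearMap.mulLeft k (var k i))
      (fun p hp => J.mul_left _ p hp) : Module.End k (Tens k n ⧸ J.ideal))) p (J.ideal.mkQ q) =
        J.ideal.mkQ (p * q) := by
      intro p
      induction p using tens_induction with
      | hw l =>
        induction l with
        | nil => simp [word_nil]
        | cons i l ih =>
          rw [word_cons, polyEval_var_mul_apply, ih, mul_assoc]
          rfl
      | hadd p q hp hq => simp only [map_add, LinearMap.add_apply, hp, hq, add_mul]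
      | hsmul r p hp => simp only [map_smul, LinearMap.smul_apply, hp, smul_mul_assoc]
    rw [LinearMap.comp_apply, this, LinearMap.comp_apply, LinearMap.zero_apply]
    exact (Submodule.Quotient.mk_eq_zero _).2 (J.mul_right q p hp)

variable {χ J} in
/-- The relations of `U⁻` are the elements of the given ideal. -/
theorem mem_of_polyEval_F_eq_zero {p : Tens k n} (h : polyEval (FA χ J) p = 0) : p ∈ J.ideal := by
  have h1 := congrArg (fun y => Bos.lift (regularRep_isLift χ J) y (J.ideal.mkQ 1)) h
  simp only [alghom_polyEval, Bos.lift_X, map_zero, LinearMap.zero_apply] at h1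
  have : ∀ p : Tens k n, polyEval (fun i => (J.ideal.mapQ J.ideal (LinearMap.mulLeft k (var k i))
      (fun p hp => J.mul_left _ p hp) : Module.End k (Tens k n ⧸ J.ideal))) p (J.ideal.mkQ 1) =
        J.ideal.mkQ p := by
    intro p
    induction p using tens_induction with
    | hw l =>
      induction l with
      | nil => simp [word_nil]
      | cons i l ih =>
        rw [word_cons, polyEval_var_mul_apply, ih]
        rfl
    | hadd p q hp hq => simp only [map_add, LinearMap.add_apply, hp, hq]
    | hsmul r p hp => simp only [map_smul, LinearMap.smul_apply, hp]
  rw [this] at h1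
  exact (Submodule.Quotient.mk_eq_zero _).1 h1

end Faithful

/-! ### The action of `U(χ)` on `H ⋉ U⁻`. -/

section UAction

variable (χ : SymmetricBicharacter k n) (J : PreNicholsIdeal χ)

/-- The sign depends only on the height, so it factors out of homogeneous polynomials; without it
the claim is the relation for the left action. -/
theorem polyEval_neg_lder_eq_zero (p : Tens k n) (hp : p ∈ J.ideal) :
    polyEval (fun i => -lder χ J i) p = 0 := by
  have e : (fun i => -lder χ J i) = fun i => algebraMap k (Module.End k (Bos χ (-1) J))
      (((-1 : kˣ) ^ height (α i) : kˣ) : k) * lder χ J i := by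
    ext1 i; simp [height_α]
    exact (neg_one_mul (lder χ J i)).symm
  rw [e]
  refine J.polyEval_twist_eq_zero
    (fun a => algebraMap k (Module.End k (Bos χ (-1) J)) (((-1 : kˣ) ^ height a : kˣ) : k))
    (by simp) (fun a b => by rw [map_add, zpow_add, Units.val_mul, map_mul]) (lder χ J)
    (fun a i => Algebra.commutes _ _) ?_ p hp
  intro p hp
  have : polyEval (lder χ J) p = leftActHom χ J (polyEval (Bos.X χ 1 (maxIdeal χ)) p) := by
    rw [alghom_polyEval]; rfl
  rw [this, Bos.polyEval_X χ 1 _ p (le_maxIdeal J hp), map_zero]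

/-- The two parts of `E_j` contribute the terms `K_j` and `-K_j⁻¹` of the commutator with `F_j`, and
both scale in the same way under `K_a`. -/
theorem uAct_isLift : U.IsLift χ J (fun j => -lder χ J j + kder χ J j)
    (fun i => LinearMap.mulLeft k (FA χ J i)) (fun a => LinearMap.mulLeft k (KA χ J a)) where
  g_zero := by ext y; simp [KA, Bos.K_zero]
  g_add a b := by ext y; simp [KA, Bos.K_add]
  g_e a j := by
    ext y
    simp only [Module.End.mul_apply, LinearMap.mulLeft_apply, LinearMap.smul_apply, kder_K_mul,
      lder_K_mul, LinearMap.add_apply, LinearMap.neg_apply, smul_add, smul_neg, smul_smul,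
      mul_inv_cancel₀ (χ.ne_zero _ _), one_smul, mul_add, mul_neg]
  g_f a i := by
    ext y
    simp only [Module.End.mul_apply, LinearMap.mulLeft_apply, LinearMap.smul_apply]
    rw [← mul_assoc, KA_FA, smul_mul_assoc, mul_assoc]
  e_f j i := by
    ext y
    simp only [Module.End.mul_apply, LinearMap.mulLeft_apply, LinearMap.sub_apply, kder_F_mul,
      lder_F_mul, LinearMap.add_apply, LinearMap.neg_apply, mul_add, mul_neg]
    by_cases h : j = i
    · subst h
      simp only [if_true, one_smul, LinearMap.sub_apply, LinearMap.mulLeft_apply]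
      abel
    · simp only [if_neg h, if_neg (Ne.symm h), zero_smul, LinearMap.zero_apply]
      abel
  ideal_e := by
    -- Left and right derivations commute, so the two parts commute up to `q_ij` because of the
    -- factor `K_i` in `kder`. Then the braided coproduct reduces the relations for the sum to those
    -- of the parts.
    refine J.polyEval_add_eq_zero _ _ ?_ (polyEval_neg_lder_eq_zero χ J)
      (fun p hp => polyEval_kder_eq_zero p (le_maxIdeal J hp))
    intro i j
    ext y
    simp only [Module.End.mul_apply, LinearMap.smul_apply, LinearMap.neg_apply, map_neg,
      kder_apply, lder_K_mul, lder_rder, smul_neg, smul_smul, mul_inv_cancel₀ (χ.ne_zero _ _),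
      one_smul]
  ideal_f p hp := by
    have : polyEval (fun i => LinearMap.mulLeft k (FA χ J i)) p =
        Algebra.lmul k (Bos χ (-1) J) (polyEval (FA χ J) p) := by
      rw [alghom_polyEval]; rfl
    rw [this, Bos.polyEval_X χ (-1) J p hp, map_zero]

/-- The action of `U(χ)` on the Verma type module `H ⋉ U⁻`. -/
def uAct : U χ J →ₐ[k] Module.End k (Bos χ (-1) J) := U.lift (uAct_isLift χ J)

variable {χ J}

theorem uAct_E (j : Fin n) (y : Bos χ (-1) J) :
    uAct χ J (U.E χ J j) y = kder χ J j y - lder χ J j y := by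
  rw [uAct, U.lift_E, LinearMap.add_apply, LinearMap.neg_apply]; abel

theorem uAct_F (j : Fin n) (y : Bos χ (-1) J) : uAct χ J (U.F χ J j) y = FA χ J j * y := by
  rw [uAct, U.lift_F, LinearMap.mulLeft_apply]

theorem uAct_K (a : Weight n) (y : Bos χ (-1) J) : uAct χ J (U.K χ J a) y = KA χ J a * y := by
  rw [uAct, U.lift_K, LinearMap.mulLeft_apply]

theorem uAct_mul (x x' : U χ J) (y : Bos χ (-1) J) :
    uAct χ J (x * x') y = uAct χ J x (uAct χ J x' y) := by
  rw [map_mul (uAct χ J), Module.End.mul_apply]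

theorem uAct_ofBos (a y : Bos χ (-1) J) : uAct χ J (U.ofBos χ J a) y = a * y := by
  induction a using bos_induction with
  | one => simp
  | X i a h => rw [map_mul (U.ofBos χ J), uAct_mul, h, U.ofBos_X, uAct_F, mul_assoc]
  | K b a h => rw [map_mul (U.ofBos χ J), uAct_mul, h, U.ofBos_K, uAct_K, mul_assoc]
  | add a b ha hb => simp only [map_add, LinearMap.add_apply, add_mul, ha, hb]
  | smul r a ha => simp only [map_smul, LinearMap.smul_apply, smul_mul_assoc, ha]

/-- The commutation rule of `E_j` with the elements of `H ⋉ U⁻`. -/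
theorem E_mul_ofBos (j : Fin n) (y : Bos χ (-1) J) : U.E χ J j * U.ofBos χ J y =
    U.ofBos χ J (lgrp χ J (α j) y) * U.E χ J j + U.K χ J (α j) * U.ofBos χ J (rder χ J j y) -
      U.ofBos χ J (lder χ J j y) := by
  induction y using bos_induction with
  | one => simp
  | X i y h =>
    have h1 : U.E χ J j * U.F χ J i = U.F χ J i * U.E χ J j +
        if j = i then U.K χ J (α j) - U.K χ J (-α j) else 0 := by rw [← U.E_F]; abel
    rw [map_mul, U.ofBos_X, ← mul_assoc, h1, add_mul, mul_assoc, h, lgrp_F_mul, rder_F_mul,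
      lder_F_mul]
    simp only [map_add, map_smul, map_mul, U.ofBos_X, U.ofBos_K, mul_add, mul_sub, mul_smul_comm]
    rw [← mul_assoc (U.K χ J (α j)) (U.F χ J i), U.K_F, smul_mul_assoc, smul_smul,
      χ.symm_simple i j, mul_inv_cancel₀ (χ.ne_zero _ _), one_smul]
    by_cases hij : i = j
    · subst hij
      simp only [if_true, one_smul, sub_mul, mul_assoc]
      abel
    · simp only [if_neg hij, if_neg (Ne.symm hij), zero_smul, zero_mul, mul_assoc]
      abel
  | K b y h =>
    rw [map_mul, U.ofBos_K, ← mul_assoc, U.E_K, smul_mul_assoc, mul_assoc, h, lgrp_K_mul,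
      rder_K_mul, lder_K_mul]
    simp only [map_smul, map_mul, U.ofBos_K, mul_add, mul_sub, smul_add, smul_sub, mul_smul_comm,
      smul_mul_assoc, mul_assoc]
    rw [← mul_assoc (U.K χ J (α j)), ← U.K_add, add_comm (α j), U.K_add, mul_assoc]
  | add y z hy hz => simp only [map_add, mul_add, add_mul, hy, hz]; abel
  | smul r y hy => simp only [map_smul, mul_smul_comm, smul_mul_assoc, hy, smul_add, smul_sub]

variable {N : Type*} [AddCommGroup N]

/-- Degree bookkeeping: `rder` removes a letter `F_j`; in the next two lemmas `lder` in addition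
leaves a factor `K_j⁻¹`, and `kder` a factor `K_j`. -/
theorem gradComp_rder (u v : Weight n →+ N) (d : N) (j : Fin n) (y : Bos χ (-1) J) :
    gradComp χ J u v d (rder χ J j y) = rder χ J j (gradComp χ J u v (d + u (α j)) y) := by
  classical
  induction y using bos_induction generalizing d with
  | one => rw [rder_one, map_zero, gradComp_one]; split_ifs <;> simp
  | X i y h =>
    rw [rder_F_mul, map_add, map_smul, map_smul, gradComp_F_mul, gradComp_F_mul, h, rder_F_mul,
      add_sub_right_comm]
    by_cases hij : i = j
    · subst hij; simp
    · simp [hij]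
  | K a y h =>
    rw [rder_K_mul, map_smul, gradComp_K_mul, gradComp_K_mul, h, rder_K_mul, add_sub_right_comm]
  | add y z hy hz => simp only [map_add, hy, hz]
  | smul r y hy => simp only [map_smul, hy]

theorem gradComp_lder (u v : Weight n →+ N) (d : N) (j : Fin n) (y : Bos χ (-1) J) :
    gradComp χ J u v d (lder χ J j y) = lder χ J j (gradComp χ J u v (d + u (α j) + v (α j)) y) := by
  classical
  induction y using bos_induction generalizing d with
  | one => rw [lder_one, map_zero, gradComp_one]; split_ifs <;> simp
  | X i y h =>
    rw [lder_F_mul, map_add, map_smul, gradComp_K_mul, gradComp_F_mul, gradComp_F_mul, h,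
      lder_F_mul, map_neg, sub_neg_eq_add]
    by_cases hij : i = j
    · subst hij
      rw [show d + u (α i) + v (α i) - u (α i) = d + v (α i) by abel,
        show d - u (α i) + u (α i) + v (α i) = d + v (α i) by abel]
    · rw [if_neg hij, zero_smul, zero_smul,
        show d - u (α i) + u (α j) + v (α j) = d + u (α j) + v (α j) - u (α i) by abel]
  | K a y h =>
    rw [lder_K_mul, map_smul, gradComp_K_mul, gradComp_K_mul, h, lder_K_mul,
      show d - v a + u (α j) + v (α j) = d + u (α j) + v (α j) - v a by abel]
  | add y z hy hz => simp only [map_add, hy, hz]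
  | smul r y hy => simp only [map_smul, hy]

theorem gradComp_kder (u v : Weight n →+ N) (d : N) (j : Fin n) (y : Bos χ (-1) J) :
    gradComp χ J u v d (kder χ J j y) = kder χ J j (gradComp χ J u v (d + u (α j) - v (α j)) y) := by
  rw [kder_apply, kder_apply, gradComp_K_mul, gradComp_rder, add_sub_right_comm]

end UAction

/-! ### The Chevalley involution and the coefficient of `K_{-l}`. -/

section Flip

variable (χ : SymmetricBicharacter k n) (J : PreNicholsIdeal χ)

theorem chevalley_isLift : U.IsLift χ J (U.F χ J) (U.E χ J) (fun a => U.K χ J (-a)) where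
  g_zero := by rw [neg_zero, U.K_zero]
  g_add a b := by rw [neg_add, U.K_add]
  g_e a i := by rw [U.K_F, χ.neg_left, inv_inv]
  g_f a i := by rw [U.K_E, χ.neg_left]
  e_f i j := by
    have := U.E_F χ J j i
    rw [← neg_sub, this, _root_.neg_neg]
    by_cases h : i = j
    · subst h; simp
    · simp [h, Ne.symm h]
  ideal_e := U.polyEval_F χ J
  ideal_f := U.polyEval_E χ J

/-- The involution of `U(χ)` with `E_i ↦ F_i`, `F_i ↦ E_i`, `K_a ↦ K_a⁻¹`. -/
def chevalley : U χ J →ₐ[k] U χ J := U.lift (chevalley_isLift χ J)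

@[simp] theorem chevalley_E (i : Fin n) : chevalley χ J (U.E χ J i) = U.F χ J i := U.lift_E _ i
@[simp] theorem chevalley_F (i : Fin n) : chevalley χ J (U.F χ J i) = U.E χ J i := U.lift_F _ i
@[simp] theorem chevalley_K (a : Weight n) : chevalley χ J (U.K χ J a) = U.K χ J (-a) :=
  U.lift_K _ a

/-- The action of `U(χ)` on `H ⋉ U⁻` twisted by the involution. -/
def flipAct : U χ J →ₐ[k] Module.End k (Bos χ (-1) J) := (uAct χ J).comp (chevalley χ J)

variable {χ J}

theorem flipAct_mul (x x' : U χ J) (y : Bos χ (-1) J) :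
    flipAct χ J (x * x') y = flipAct χ J x (flipAct χ J x' y) := by
  rw [map_mul (flipAct χ J), Module.End.mul_apply]

theorem flipAct_E (i : Fin n) (y : Bos χ (-1) J) :
    flipAct χ J (U.E χ J i) y = FA χ J i * y := by
  rw [flipAct, AlgHom.comp_apply, chevalley_E, uAct_F]

theorem flipAct_F (i : Fin n) (y : Bos χ (-1) J) :
    flipAct χ J (U.F χ J i) y = kder χ J i y - lder χ J i y := by
  rw [flipAct, AlgHom.comp_apply, chevalley_F, uAct_E]

theorem flipAct_K (a : Weight n) (y : Bos χ (-1) J) :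
    flipAct χ J (U.K χ J a) y = KA χ J (-a) * y := by
  rw [flipAct, AlgHom.comp_apply, chevalley_K, uAct_K]

variable (χ J) in
/-- The coefficient of `K_{-l}` of the component of an element of `U(χ)` in `H`. -/
def cartanCoeff (l : Weight n) : U χ J →ₗ[k] k :=
  Coalgebra.counit (R := k) (A := Bos χ (-1) J) ∘ₗ gradComp χ J 0 (AddMonoidHom.id _) l ∘ₗ
    LinearMap.applyₗ (1 : Bos χ (-1) J) ∘ₗ (flipAct χ J).toLinearMap

theorem cartanCoeff_apply (l : Weight n) (x : U χ J) : cartanCoeff χ J l x =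
    Coalgebra.counit (R := k) (gradComp χ J 0 (AddMonoidHom.id _) l (flipAct χ J x 1)) := rfl

theorem cartanCoeff_K (l : Weight n) : cartanCoeff χ J l (U.K χ J (-l)) = 1 := by
  classical
  rw [cartanCoeff_apply, flipAct_K, gradComp_K_mul, gradComp_one]
  simp

/-- In the flipped module `E_i` multiplies by `F_i` on the left, which the counit kills, and `F_i`
kills `1`. A nonzero weight on either side therefore gives zero. -/
theorem cartanCoeff_UHU (l : Weight n) {w : (Fin n → ℕ) × (Fin n → ℕ)} (hw : w ≠ (0, 0)) :
    UHU χ J w ≤ LinearMap.ker (cartanCoeff χ J l) := by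
  have h0 : ∀ μ : Fin n → ℕ, μ ≠ 0 → ∀ m : List (Fin n), wordWeight m = natWeight μ → m ≠ [] := by
    rintro μ hμ m hm rfl
    refine hμ (natWeight_injective ?_)
    rw [← hm]; ext i; simp [natWeight, wordWeight_nil]
  rw [UHU, weightSpan, weightSpan, Submodule.span_mul_span, Submodule.span_mul_span,
    Submodule.span_le]
  rintro _ ⟨_, ⟨_, ⟨m, hm, rfl⟩, _, ⟨a, rfl⟩, rfl⟩, _, ⟨m', hm', rfl⟩, rfl⟩
  rw [SetLike.mem_coe, LinearMap.mem_ker, cartanCoeff_apply]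
  by_cases h2 : w.2 = 0
  · have h1 : w.1 ≠ 0 := fun h => hw (Prod.ext h h2)
    obtain ⟨i, m, rfl⟩ := List.exists_cons_of_ne_nil (h0 _ h1 m hm)
    simp only [word_cons, mul_assoc, flipAct_mul, flipAct_E, gradComp_F_mul, Bialgebra.counit_mul,
      Bos.counit_X, zero_mul]
  · have h1 := h0 _ h2 m' hm'
    rw [← List.dropLast_append_getLast h1, word_append, word_cons, word_nil, mul_one,
      flipAct_mul, flipAct_mul _ (U.F χ J _), flipAct_F]
    simp

/-- Each `F_i K_i` kills `1`, so `G⁻` acts on `1` by scalars. Then `K_a` produces `K_{-a}`, and the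
`E_i` do not change the degree in the factors `K`. Hence only degree `-a` occurs. -/
theorem cartanCoeff_UKG (l : Weight n) {a : Weight n} (ha : a ≠ -l) :
    UKG χ J a ≤ LinearMap.ker (cartanCoeff χ J l) := by
  classical
  have hG : ∀ g ∈ Algebra.adjoin k (Set.range fun i => U.F χ J i * U.K χ J (α i)),
      ∃ r : k, flipAct χ J g 1 = r • 1 := by
    intro g hg
    induction hg using Algebra.adjoin_induction with
    | mem x hx =>
      obtain ⟨i, rfl⟩ := hx
      refine ⟨0, ?_⟩
      dsimp only
      rw [flipAct_mul, flipAct_K, flipAct_F, kder_K_mul, lder_K_mul]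
      simp
    | algebraMap r => exact ⟨r, by rw [AlgHom.commutes, Module.algebraMap_end_apply]⟩
    | add x y _ _ hx hy =>
      obtain ⟨r, hr⟩ := hx
      obtain ⟨s, hs⟩ := hy
      exact ⟨r + s, by rw [map_add, LinearMap.add_apply, hr, hs, add_smul]⟩
    | mul x y _ _ hx hy =>
      obtain ⟨r, hr⟩ := hx
      obtain ⟨s, hs⟩ := hy
      exact ⟨s * r, by rw [flipAct_mul, hs, map_smul, hr, smul_smul]⟩
  have hE : ∀ x ∈ Algebra.adjoin k (Set.range (U.E χ J)), ∀ y : Bos χ (-1) J,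
      gradComp χ J 0 (AddMonoidHom.id _) l (flipAct χ J x y) =
        flipAct χ J x (gradComp χ J 0 (AddMonoidHom.id _) l y) := by
    intro x hx
    induction hx using Algebra.adjoin_induction with
    | mem x hx =>
      obtain ⟨i, rfl⟩ := hx
      intro y
      rw [flipAct_E, gradComp_F_mul, flipAct_E, AddMonoidHom.zero_apply, sub_zero]
    | algebraMap r =>
      intro y
      rw [AlgHom.commutes, Module.algebraMap_end_apply, map_smul,
        Module.algebraMap_end_apply]
    | add x x' _ _ hx hx' =>
      intro y
      simp only [map_add, LinearMap.add_apply, hx, hx']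
    | mul x x' _ _ hx hx' =>
      intro y
      rw [flipAct_mul, hx, hx', flipAct_mul]
  rw [UKG, Submodule.mul_le]
  intro z hz g hg
  obtain ⟨r, hr⟩ := hG g hg
  rw [LinearMap.mem_ker, cartanCoeff_apply, flipAct_mul, hr, map_smul, map_smul, map_smul,
    ← cartanCoeff_apply]
  refine (congrArg (r • ·) (LinearMap.mem_ker.1 ?_)).trans (smul_zero r)
  have : Subalgebra.toSubmodule (Algebra.adjoin k (Set.range (U.E χ J))) *
      Submodule.span k {U.K χ J a} ≤ LinearMap.ker (cartanCoeff χ J l) := by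
    refine Submodule.mul_le.2 fun x hx y hy => ?_
    obtain ⟨s, rfl⟩ := Submodule.mem_span_singleton.1 hy
    rw [mul_smul_comm, LinearMap.mem_ker, map_smul, cartanCoeff_apply, flipAct_mul, hE x hx,
      flipAct_K, gradComp_K_mul, gradComp_one, if_neg]
    · simp
    · rw [AddMonoidHom.id_apply, sub_neg_eq_add]
      intro h
      exact ha (eq_neg_of_add_eq_zero_right h)
  exact this hz

/-- The coefficient of `K_{-l}` vanishes under the condition on the components. -/
theorem cartanCoeff_eq_zero_of_isComponent {l : Weight n} {x y : U χ J}
    (h1 : IsComponent (UKG χ J) (-l) x y) (h2 : IsComponent (UHU χ J) (0, 0) y 0) :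
    cartanCoeff χ J l x = 0 := by
  have hle' : ⨆ a, ⨆ _ : a ≠ -l, UKG χ J a ≤ LinearMap.ker (cartanCoeff χ J l) :=
    iSup_le fun a => iSup_le fun ha => cartanCoeff_UKG l ha
  have e1 := hle' h1.2
  have hle : ⨆ w, ⨆ _ : w ≠ (0, 0), UHU χ J w ≤ LinearMap.ker (cartanCoeff χ J l) :=
    iSup_le fun w => iSup_le fun hw => cartanCoeff_UHU l hw
  have e2 := hle h2.2
  rw [sub_zero] at e2
  rw [← sub_add_cancel x y, map_add, LinearMap.mem_ker.1 e1, LinearMap.mem_ker.1 e2, add_zero]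

end Flip

/-- Evaluation at a family twisted by factors that commute with each other and with the family. -/
theorem PreNicholsIdeal.polyEval_mul_eq_zero {χ : SymmetricBicharacter k n}
    (J : PreNicholsIdeal χ) {A : Type*} [Ring A] [Algebra k A] (g y : Fin n → A)
    (hg : ∀ i j, g i * g j = g j * g i) (hgy : ∀ i j, g i * y j = y j * g i)
    (hy : ∀ p ∈ J.ideal, polyEval y p = 0) (p : Tens k n) (hp : p ∈ J.ideal) :
    polyEval (fun i => g i * y i) p = 0 := by
  have key : ∀ l, word (fun i => g i * y i) l = word g l * word y l := by
    intro l
    have hc : ∀ i l, word g l * y i = y i * word g l := by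
      intro i l
      induction l with
      | nil => simp [word_nil]
      | cons j l ih => rw [word_cons, mul_assoc, ih, ← mul_assoc, hgy, mul_assoc]
    induction l with
    | nil => simp [word_nil]
    | cons i l ih =>
      rw [word_cons, word_cons, word_cons, ih, mul_assoc, mul_assoc, ← mul_assoc (y i), ← hc,
        mul_assoc]
  -- The collected factor depends only on the weight of the word, so for a homogeneous polynomial it
  -- is a common left factor.
  have hperm : ∀ l l' : List (Fin n), l.Perm l' → word g l = word g l' := by
    intro l l' h
    induction h with
    | nil => rfl
    | cons i _ ih => rw [word_cons, word_cons, ih]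
    | swap i j l => simp only [word_cons]; rw [← mul_assoc, hg, mul_assoc]
    | trans _ _ h1 h2 => rw [h1, h2]
  refine J.le_of_homogeneous (LinearMap.ker (polyEval fun i => g i * y i).toLinearMap) ?_ hp
  intro μ p hp hμ
  by_cases hl : ∃ l : List (Fin n), wordWeight l = μ
  · obtain ⟨l₀, hl₀⟩ := hl
    have : weightSpan k (var k) μ ≤ LinearMap.eqLocus (polyEval fun i => g i * y i).toLinearMap
        (LinearMap.mulLeft k (word g l₀) ∘ₗ (polyEval y).toLinearMap) := by
      refine Submodule.span_le.2 ?_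
      rintro _ ⟨l, hl, rfl⟩
      rw [SetLike.mem_coe, LinearMap.mem_eqLocus, AlgHom.toLinearMap_apply, polyEval_word, key,
        LinearMap.comp_apply, AlgHom.toLinearMap_apply, polyEval_word, LinearMap.mulLeft_apply,
        hperm l l₀ (perm_of_wordWeight_eq (hl.trans hl₀.symm))]
    have e : polyEval (fun i => g i * y i) p = word g l₀ * polyEval y p := this hμ
    rw [LinearMap.mem_ker, AlgHom.toLinearMap_apply, e, hy p hp, mul_zero]
  · have : weightSpan k (var k) μ = ⊥ := by
      rw [weightSpan, Submodule.span_eq_bot]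
      rintro _ ⟨l, hl', rfl⟩
      exact absurd ⟨l, hl'⟩ hl
    rw [this, Submodule.mem_bot] at hμ
    simp [hμ]

/-- The involution `τ` is compatible with the bicharacter and with the pre-Nichols ideal. -/
structure Compatible (χ : SymmetricBicharacter k n) (τ : Equiv.Perm (Fin n))
    (J : PreNicholsIdeal χ) : Prop where
  invol : ∀ i, τ (τ i) = i
  bichar : ∀ i j, χ (α (τ i)) (α (τ j)) = χ (α i) (α j)
  map_ideal : J.ideal.map (polyEval fun i => var k (τ i)).toLinearMap = J.ideal

/-! ### The twisted coproduct `C` and the twist product on `H ⋉ U⁻`. -/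

section Twist

variable {χ : SymmetricBicharacter k n} {τ : Equiv.Perm (Fin n)} (c : Fin n → k)
  {J : PreNicholsIdeal χ}

theorem Compatible.swap (h : Compatible χ τ J) (i j : Fin n) :
    χ (α i) (α (τ j)) = χ (α (τ i)) (α j) := by rw [← h.bichar, h.invol]

theorem lder_lgrp (a : Weight n) (j : Fin n) (y : Bos χ (-1) J) :
    lder χ J j (lgrp χ J a y) = (χ a (α j))⁻¹ • lgrp χ J a (lder χ J j y) := by
  rw [lder, lgrp, ← leftAct_mul, ← leftAct_mul, Bos.K_X, leftAct_smul, LinearMap.smul_apply,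
    smul_smul, one_smul, inv_mul_cancel₀ (χ.ne_zero _ _), one_smul]

theorem lgrp_lgrp (a b : Weight n) (y : Bos χ (-1) J) :
    lgrp χ J a (lgrp χ J b y) = lgrp χ J (a + b) y := by
  rw [lgrp, lgrp, lgrp, ← leftAct_mul, Bos.K_add]

theorem rder_lgrp (a : Weight n) (j : Fin n) (y : Bos χ (-1) J) :
    rder χ J j (lgrp χ J a y) = lgrp χ J a (rder χ J j y) := by
  induction y using bos_induction with
  | one => simp
  | X i y h => rw [lgrp_F_mul, rder_F_mul, rder_F_mul, h, map_add, map_smul, map_smul, lgrp_F_mul]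
  | K b y h => rw [lgrp_K_mul, rder_K_mul, map_smul, map_smul, rder_K_mul, h, lgrp_K_mul, smul_comm]
  | add y z hy hz => simp only [map_add, hy, hz]
  | smul r y hy => simp only [map_smul, hy]

/-- The weight `-a - τ(a)`. -/
def thetaDefect (τ : Equiv.Perm (Fin n)) (a : Weight n) : Weight n := fun i => -a i - a (τ i)

theorem thetaDefect_zero : thetaDefect τ 0 = 0 := by ext i; simp [thetaDefect]

theorem thetaDefect_add (a b : Weight n) :
    thetaDefect τ (a + b) = thetaDefect τ a + thetaDefect τ b := by
  ext i; simp [thetaDefect]; ring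

theorem IsTheta.thetaDefect {a : Weight n} (ha : IsTheta τ a) : thetaDefect τ a = 0 := by
  ext i; simp [StarProduct.thetaDefect, ha i]

theorem Compatible.thetaDefect_left (h : Compatible χ τ J) (a : Weight n) (j : Fin n) :
    χ (thetaDefect τ a) (α j) = (χ a (α j))⁻¹ * (χ a (α (τ j)))⁻¹ := by
  rw [← χ.comp_perm τ h.invol h.bichar, ← χ.neg_left, ← χ.neg_left, ← χ.add_left]
  rfl

variable (χ τ J)

/-- The factor `K_i⁻¹ (K_τ(i) ▷ ·) ⊗ c_i q_{i,τ(i)}` of the twisting part. -/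
def twistFactor (i : Fin n) : Module.End k (Bos χ (-1) J ⊗[k] Bos χ 1 J) :=
  TensorProduct.map (LinearMap.mulLeft k (KA χ J (-α i)) ∘ₗ lgrp χ J (α (τ i)))
    ((c i * χ (α i) (α (τ i))) • LinearMap.id)

/-- Left multiplication by `E_τ(i)` in the second tensor factor. -/
def twistMulE (i : Fin n) : Module.End k (Bos χ (-1) J ⊗[k] Bos χ 1 J) :=
  TensorProduct.map LinearMap.id (LinearMap.mulLeft k (Bos.X χ 1 J (τ i)))

variable {χ τ J}

theorem tmap_ext {V W Z : Type*} [AddCommGroup V] [Module k V] [AddCommGroup W] [Module k W]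
    [AddCommGroup Z] [Module k Z] {f g : V ⊗[k] W →ₗ[k] Z} (h : ∀ v w, f (v ⊗ₜ w) = g (v ⊗ₜ w)) :
    f = g := TensorProduct.ext' h

theorem twistFactor_tmul (i : Fin n) (a : Bos χ (-1) J) (e : Bos χ 1 J) :
    twistFactor χ τ c J i (a ⊗ₜ e) =
      (c i * χ (α i) (α (τ i))) • ((KA χ J (-α i) * lgrp χ J (α (τ i)) a) ⊗ₜ e) := by
  simp [twistFactor]

theorem twistMulE_tmul (i : Fin n) (a : Bos χ (-1) J) (e : Bos χ 1 J) :
    twistMulE χ τ J i (a ⊗ₜ e) = a ⊗ₜ (Bos.X χ 1 J (τ i) * e) := by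
  simp [twistMulE]

/-- The image of `F_i` is a sum of two operators that commute up to `q_ij`, so the ideal relations
reduce to those of the summands: the first is left multiplication in `U⁻`, the second is `E_τ(i)`
times factors that commute with everything in sight. The weight `-a - τ(a)` in the second leg of
`K_a` makes both summands scale alike; it is zero on `ℤⁿ_θ`. -/
theorem cleft_isLift (h : Compatible χ τ J) : Bos.IsLift χ (-1) J
    (fun i => TensorProduct.map (LinearMap.mulLeft k (FA χ J i)) LinearMap.id +
      twistFactor χ τ c J i * twistMulE χ τ J i)
    (fun a => TensorProduct.map (LinearMap.mulLeft k (KA χ J a))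
      (LinearMap.mulLeft k (Bos.K χ 1 J (thetaDefect τ a)))) where
  g_zero := by
    refine tmap_ext fun a e => ?_
    simp [KA, Bos.K_zero, thetaDefect_zero]
  g_add a b := by
    refine tmap_ext fun y e => ?_
    simp [KA, Bos.K_add, thetaDefect_add]
  g_x a i := by
    refine tmap_ext fun y e => ?_
    simp only [Module.End.mul_apply, LinearMap.add_apply, LinearMap.smul_apply,
      TensorProduct.map_tmul, LinearMap.mulLeft_apply, LinearMap.id_apply, twistMulE_tmul,
      twistFactor_tmul, map_add, map_smul, smul_add]
    congr 1
    · rw [← mul_assoc, Bos.K_X, smul_mul_assoc, mul_assoc, TensorProduct.smul_tmul']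
    · rw [← mul_assoc (Bos.K χ 1 J _), Bos.K_X, lgrp_K_mul, one_smul, smul_mul_assoc, mul_assoc,
        mul_smul_comm, TensorProduct.tmul_smul, ← TensorProduct.smul_tmul', smul_comm (χ a _),
        ← mul_assoc, KA_comm, mul_assoc, smul_smul (χ a _), h.thetaDefect_left, h.invol,
        neg_one_smul_weight, χ.neg_right, mul_comm (χ a (α (τ i)))⁻¹]
  ideal := by
    refine J.polyEval_add_eq_zero _ _ ?_ ?_ ?_
    · intro i j
      refine tmap_ext fun y e => ?_
      simp only [Module.End.mul_apply, LinearMap.smul_apply,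
        TensorProduct.map_tmul, LinearMap.mulLeft_apply, LinearMap.id_apply, twistMulE_tmul,
        twistFactor_tmul, map_smul]
      rw [lgrp_F_mul, ← mul_assoc, KA_FA, χ.neg_left, inv_inv, smul_mul_assoc, mul_assoc,
        ← TensorProduct.smul_tmul', smul_comm]
    · intro p hp
      have := alghom_polyEval ((Module.endTensorEndAlgHom (R := k) (S := k) (A := k)
        (M := Bos χ (-1) J) (N := Bos χ 1 J)).comp
        (Algebra.TensorProduct.includeLeft.comp (Algebra.lmul k (Bos χ (-1) J)))) (FA χ J) p
      rw [Bos.polyEval_X χ (-1) J p hp, map_zero] at this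
      exact this.symm
    · refine J.polyEval_mul_eq_zero _ _ ?_ ?_ ?_
      · intro i j
        refine tmap_ext fun y e => ?_
        simp only [Module.End.mul_apply, twistFactor_tmul, map_smul, lgrp_K_mul, mul_smul_comm,
          ← TensorProduct.smul_tmul', lgrp_lgrp, smul_smul]
        rw [← mul_assoc (KA χ J (-α i)), ← mul_assoc (KA χ J (-α j)), KA_comm,
          add_comm (α (τ i)), χ.neg_left, χ.neg_left, h.swap j i,
          χ.symm_all (α (τ j))]
        congr 1
        ring
      · intro i j
        refine tmap_ext fun y e => ?_
        simp only [Module.End.mul_apply, twistFactor_tmul, twistMulE_tmul, map_smul]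
      · intro p hp
        -- Stability of the ideal under `τ` makes the `E_τ(i)` satisfy the same relations as the
        -- `E_i`.
        have hp' : polyEval (fun i => var k (τ i)) p ∈ J.ideal := by
          rw [← h.map_ideal]
          exact ⟨p, hp, rfl⟩
        have := alghom_polyEval ((Module.endTensorEndAlgHom (R := k) (S := k) (A := k)
          (M := Bos χ (-1) J) (N := Bos χ 1 J)).comp
          (Algebra.TensorProduct.includeRight.comp (Algebra.lmul k (Bos χ 1 J))))
          (fun i => Bos.X χ 1 J (τ i)) p
        have e : polyEval (fun i => Bos.X χ 1 J (τ i)) p = 0 := by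
          rw [← Bos.polyEval_X χ 1 J _ hp', alghom_polyEval]
          simp only [FreeAlgebra.lift_ι_apply]
        rw [e, map_zero] at this
        exact this.symm

/-- The algebra homomorphism from `H ⋉ U⁻` to the endomorphisms of `(H ⋉ U⁻) ⊗ (U⁺ ⋊ H)` which
describes the left multiplication in the twisted coproduct. -/
def cleft (h : Compatible χ τ J) :
    Bos χ (-1) J →ₐ[k] Module.End k (Bos χ (-1) J ⊗[k] Bos χ 1 J) :=
  Bos.lift (cleft_isLift c h)

/-- The linear map `C : H ⋉ U⁻ → (H ⋉ U⁻) ⊗ (U⁺ ⋊ H)` with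
`∑ σ(F_ρ) ▷ x ⊗ E_ρ` as its image in the maximal quotient. -/
def ccoact (h : Compatible χ τ J) : Bos χ (-1) J →ₗ[k] Bos χ (-1) J ⊗[k] Bos χ 1 J :=
  LinearMap.applyₗ (1 ⊗ₜ[k] 1) ∘ₗ (cleft c h).toLinearMap

theorem ccoact_one (h : Compatible χ τ J) : ccoact c h 1 = 1 ⊗ₜ 1 := by simp [ccoact]

theorem ccoact_F_mul (h : Compatible χ τ J) (i : Fin n) (y : Bos χ (-1) J) :
    ccoact c h (FA χ J i * y) =
      TensorProduct.map (LinearMap.mulLeft k (FA χ J i)) LinearMap.id (ccoact c h y) +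
      twistFactor χ τ c J i (twistMulE χ τ J i (ccoact c h y)) := by
  simp only [ccoact, LinearMap.comp_apply, AlgHom.toLinearMap_apply, map_mul, cleft, Bos.lift_X]
  rfl

theorem ccoact_K_mul (h : Compatible χ τ J) (a : Weight n) (y : Bos χ (-1) J) :
    ccoact c h (KA χ J a * y) = TensorProduct.map (LinearMap.mulLeft k (KA χ J a))
      (LinearMap.mulLeft k (Bos.K χ 1 J (thetaDefect τ a))) (ccoact c h y) := by
  simp only [ccoact, LinearMap.comp_apply, AlgHom.toLinearMap_apply, map_mul, cleft, Bos.lift_K]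
  rfl

theorem ccoact_theta_mul (h : Compatible χ τ J) {a : Weight n} (ha : IsTheta τ a)
    (y : Bos χ (-1) J) : ccoact c h (KA χ J a * y) =
      TensorProduct.map (LinearMap.mulLeft k (KA χ J a)) LinearMap.id (ccoact c h y) := by
  rw [ccoact_K_mul, ha.thetaDefect, Bos.K_zero, LinearMap.mulLeft_one]

/-- `C` is made of left actions on the argument, and these commute with the right action of `E_j`.
-/
theorem ccoact_rder (h : Compatible χ τ J) (j : Fin n) (y : Bos χ (-1) J) :
    ccoact c h (rder χ J j y) =
      TensorProduct.map (rder χ J j) LinearMap.id (ccoact c h y) := by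
  induction y using bos_induction with
  | one => simp [ccoact_one]
  | X i y ih =>
    rw [rder_F_mul, map_add, map_smul, map_smul, ccoact_F_mul, ccoact_F_mul, ih, map_add]
    generalize ccoact c h y = t
    induction t using TensorProduct.induction_on with
    | zero => simp
    | tmul a e =>
      simp only [TensorProduct.map_tmul, LinearMap.mulLeft_apply, LinearMap.id_apply,
        twistMulE_tmul, twistFactor_tmul, map_smul, rder_F_mul, rder_K_mul, rder_lgrp,
        TensorProduct.add_tmul, ← TensorProduct.smul_tmul', χ.neg_left, inv_inv, smul_add]
      rw [smul_comm (χ (α i) (α j)) (_ * _ : k)]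
      abel
    | add s t hs ht =>
      simp only [map_add, smul_add] at hs ht ⊢
      linear_combination (norm := abel) hs + ht
  | K a y ih =>
    rw [rder_K_mul, map_smul, ccoact_K_mul, ccoact_K_mul, ih]
    generalize ccoact c h y = t
    induction t using TensorProduct.induction_on with
    | zero => simp
    | tmul b e =>
      simp only [TensorProduct.map_tmul, LinearMap.mulLeft_apply, LinearMap.id_apply,
        rder_K_mul, ← TensorProduct.smul_tmul']
    | add s t hs ht => simp only [map_add, smul_add, hs, ht]
  | add y z hy hz => simp only [map_add, hy, hz]
  | smul r y hy => simp only [map_smul, hy]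

/-! ### The twisted multiplication operators -/

variable (χ τ J) in
/-- Left multiplication with `F_i` for the twist product, `y ↦ F_i y + c_i q_{i,τ(i)} K_i⁻¹ K_τ(i)
(y ◁ E_τ(i))`. -/
def starF (i : Fin n) : Module.End k (Bos χ (-1) J) :=
  LinearMap.mulLeft k (FA χ J i) + (c i * χ (α i) (α (τ i))) •
    (LinearMap.mulLeft k (KA χ J (-α i)) ∘ₗ kder χ J (τ i))

theorem starF_apply (i : Fin n) (y : Bos χ (-1) J) : starF χ τ c J i y =
    FA χ J i * y + (c i * χ (α i) (α (τ i))) • (KA χ J (-α i) * kder χ J (τ i) y) := rfl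

theorem starF_apply' (i : Fin n) (y : Bos χ (-1) J) : starF χ τ c J i y =
    FA χ J i * y + (c i * χ (α i) (α (τ i))) • (KA χ J (α (τ i) - α i) * rder χ J (τ i) y) := by
  rw [starF_apply, kder_apply, ← mul_assoc, KA, ← Bos.K_add, neg_add_eq_sub]

/-- The span of the words of length `m`. -/
def lenSpan (χ : SymmetricBicharacter k n) (J : PreNicholsIdeal χ) (m : ℕ) :
    Submodule k (Bos χ (-1) J) :=
  Submodule.span k {y | ∃ l : List (Fin n), l.length = m ∧ word (FA χ J) l = y}

theorem word_mem_lenSpan (l : List (Fin n)) : word (FA χ J) l ∈ lenSpan χ J l.length :=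
  Submodule.subset_span ⟨l, rfl, rfl⟩

theorem F_mul_mem_lenSpan (i : Fin n) {m : ℕ} {y : Bos χ (-1) J} (hy : y ∈ lenSpan χ J m) :
    FA χ J i * y ∈ lenSpan χ J (m + 1) := by
  have : lenSpan χ J m ≤ (lenSpan χ J (m + 1)).comap (LinearMap.mulLeft k (FA χ J i)) := by
    refine Submodule.span_le.2 ?_
    rintro _ ⟨l, rfl, rfl⟩
    rw [SetLike.mem_coe, Submodule.mem_comap, LinearMap.mulLeft_apply, ← word_cons]
    exact word_mem_lenSpan (i :: l)
  exact this hy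

theorem rder_word_mem (j : Fin n) (l : List (Fin n)) :
    rder χ J j (word (FA χ J) l) ∈ lenSpan χ J (l.length - 1) := by
  induction l with
  | nil => rw [word_nil, rder_one]; exact zero_mem _
  | cons i l ih =>
    rw [word_cons, rder_F_mul]
    refine add_mem (Submodule.smul_mem _ _ (word_mem_lenSpan l)) (Submodule.smul_mem _ _ ?_)
    cases l with
    | nil => rw [word_nil, rder_one, mul_zero]; exact zero_mem _
    | cons i' l => exact F_mul_mem_lenSpan i ih

/-- Normal ordering: the `K_a` can be moved to the left of all `F_i` at the cost of scalars. -/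
theorem partialBos_eq_span (hτ : ∀ i, τ (τ i) = i) :
    Subalgebra.toSubmodule (PartialBos χ τ J) = Submodule.span k
      {y | ∃ (a : Weight n) (l : List (Fin n)), IsTheta τ a ∧ KA χ J a * word (FA χ J) l = y} := by
  have hF : ∀ i, FA χ J i ∈ PartialBos χ τ J := fun i => Algebra.subset_adjoin (by simp)
  have hK : ∀ a, IsTheta τ a → KA χ J a ∈ PartialBos χ τ J := by
    refine fun a ha => theta_induction (P := fun a => KA χ J a ∈ PartialBos χ τ J) hτ ?_
      (fun i => Algebra.subset_adjoin (by simp)) (fun a b ha hb => ?_) ha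
    · rw [KA, Bos.K_zero]; exact one_mem _
    · rw [KA, Bos.K_add]; exact mul_mem ha hb
  apply le_antisymm
  · set S := Submodule.span k
      {y | ∃ (a : Weight n) (l : List (Fin n)), IsTheta τ a ∧ KA χ J a * word (FA χ J) l = y}
    have h1 : (1 : Bos χ (-1) J) ∈ S :=
      Submodule.subset_span ⟨0, [], isTheta_zero τ, by simp [KA, Bos.K_zero, word_nil]⟩
    have hKS : ∀ a, IsTheta τ a → ∀ y ∈ S, KA χ J a * y ∈ S := by
      intro a ha y hy
      have : S ≤ S.comap (LinearMap.mulLeft k (KA χ J a)) := by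
        refine Submodule.span_le.2 ?_
        rintro _ ⟨b, l, hb, rfl⟩
        exact Submodule.subset_span ⟨a + b, l, ha.add hb, by
          rw [LinearMap.mulLeft_apply, ← mul_assoc, KA, Bos.K_add]⟩
      exact this hy
    have hFS : ∀ i, ∀ y ∈ S, FA χ J i * y ∈ S := by
      intro i y hy
      have : S ≤ S.comap (LinearMap.mulLeft k (FA χ J i)) := by
        refine Submodule.span_le.2 ?_
        rintro _ ⟨b, l, hb, rfl⟩
        rw [SetLike.mem_coe, Submodule.mem_comap, LinearMap.mulLeft_apply, ← mul_assoc, FA_KA,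
          smul_mul_assoc, mul_assoc, ← word_cons]
        exact Submodule.smul_mem _ _ (Submodule.subset_span ⟨b, i :: l, hb, rfl⟩)
      exact this hy
    have key : ∀ x ∈ PartialBos χ τ J, ∀ y ∈ S, x * y ∈ S := by
      intro x hx
      induction hx using Algebra.adjoin_induction with
      | mem x hx =>
        rcases hx with ⟨i, rfl⟩ | ⟨i, rfl⟩
        · exact hKS _ (isTheta_sub τ hτ i)
        · exact hFS i
      | algebraMap r =>
        intro y hy; rw [← Algebra.smul_def]; exact S.smul_mem _ hy
      | add x y _ _ hx hy => intro z hz; rw [add_mul]; exact add_mem (hx z hz) (hy z hz)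
      | mul x y _ _ hx hy => intro z hz; rw [mul_assoc]; exact hx _ (hy z hz)
    intro x hx
    rw [← mul_one x]
    exact key x hx 1 h1
  · refine Submodule.span_le.2 ?_
    rintro _ ⟨a, l, ha, rfl⟩
    refine (PartialBos χ τ J).mul_mem (hK a ha) ?_
    induction l with
    | nil => rw [word_nil]; exact one_mem _
    | cons i l ih => rw [word_cons]; exact mul_mem (hF i) ih

theorem K_mem_partialBos (hτ : ∀ i, τ (τ i) = i) {a : Weight n} (ha : IsTheta τ a) :
    KA χ J a ∈ PartialBos χ τ J := by
  rw [← Subalgebra.mem_toSubmodule, partialBos_eq_span hτ]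
  exact Submodule.subset_span ⟨a, [], ha, by rw [word_nil, mul_one]⟩

theorem F_mem_partialBos (i : Fin n) : FA χ J i ∈ PartialBos χ τ J :=
  Algebra.subset_adjoin (by simp)

theorem word_mem_partialBos (l : List (Fin n)) : word (FA χ J) l ∈ PartialBos χ τ J := by
  induction l with
  | nil => rw [word_nil]; exact one_mem _
  | cons i l ih => rw [word_cons]; exact mul_mem (F_mem_partialBos i) ih

theorem lenSpan_le_partialBos (m : ℕ) :
    lenSpan χ J m ≤ Subalgebra.toSubmodule (PartialBos χ τ J) := by
  refine Submodule.span_le.2 ?_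
  rintro _ ⟨l, rfl, rfl⟩
  exact word_mem_partialBos l

/-- A subspace with `1` that is stable under the twisted left multiplications with the generators
contains the partial bosonization. -/
theorem partialBos_le_of_star (hτ : ∀ i, τ (τ i) = i) (S : Submodule k (Bos χ (-1) J))
    (h1 : 1 ∈ S) (hF : ∀ i, ∀ y ∈ PartialBos χ τ J, y ∈ S → starF χ τ c J i y ∈ S)
    (hK : ∀ a, IsTheta τ a → ∀ y ∈ PartialBos χ τ J, y ∈ S → KA χ J a * y ∈ S) :
    Subalgebra.toSubmodule (PartialBos χ τ J) ≤ S := by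
  have key : ∀ m, lenSpan χ J m ≤ S := by
    intro m
    induction m using Nat.strong_induction_on with
    | _ m ih =>
      refine Submodule.span_le.2 ?_
      rintro _ ⟨l, rfl, rfl⟩
      cases l with
      | nil => exact h1
      | cons i l =>
        have e := starF_apply' (τ := τ) c i (word (FA χ J) l)
        have hθ : IsTheta τ (α (τ i) - α i) := by
          have := isTheta_sub τ hτ (τ i)
          rwa [hτ] at this
        -- Ordinary and twisted multiplication by `F_i` differ by a term with fewer letters, so
        -- strong induction on the length applies to both pieces.
        rw [word_cons, SetLike.mem_coe, ← add_sub_cancel_right (FA χ J i * word (FA χ J) l)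
          ((c i * χ (α i) (α (τ i))) • (KA χ J (α (τ i) - α i) *
            rder χ J (τ i) (word (FA χ J) l))), ← e]
        have hr := rder_word_mem (τ i) l (J := J)
        refine sub_mem (hF i _ (word_mem_partialBos l)
          (ih l.length (by simp) (word_mem_lenSpan l)))
          (Submodule.smul_mem _ _ (hK _ hθ _ (lenSpan_le_partialBos _ hr) (ih _ ?_ hr)))
        simp only [List.length_cons]
        omega
  rw [partialBos_eq_span hτ]
  refine Submodule.span_le.2 ?_
  rintro _ ⟨a, l, ha, rfl⟩
  exact hK a ha _ (word_mem_partialBos l) (key _ (word_mem_lenSpan l))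

theorem rder_mem_partialBos (hτ : ∀ i, τ (τ i) = i) (j : Fin n) {y : Bos χ (-1) J}
    (hy : y ∈ PartialBos χ τ J) : rder χ J j y ∈ PartialBos χ τ J := by
  have : Subalgebra.toSubmodule (PartialBos χ τ J) ≤
      (Subalgebra.toSubmodule (PartialBos χ τ J)).comap (rder χ J j) := by
    conv_lhs => rw [partialBos_eq_span hτ]
    refine Submodule.span_le.2 ?_
    rintro _ ⟨a, l, ha, rfl⟩
    rw [SetLike.mem_coe, Submodule.mem_comap, rder_K_mul]
    exact Submodule.smul_mem _ _ ((PartialBos χ τ J).mul_mem (K_mem_partialBos hτ ha)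
      (lenSpan_le_partialBos _ (rder_word_mem j l)))
  exact this hy

theorem starF_mem_partialBos (hτ : ∀ i, τ (τ i) = i) (i : Fin n) {y : Bos χ (-1) J}
    (hy : y ∈ PartialBos χ τ J) : starF χ τ c J i y ∈ PartialBos χ τ J := by
  have hθ : IsTheta τ (α (τ i) - α i) := by
    have := isTheta_sub τ hτ (τ i)
    rwa [hτ] at this
  rw [starF_apply']
  exact add_mem (mul_mem (F_mem_partialBos i) hy) (Subalgebra.smul_mem _
    (mul_mem (K_mem_partialBos hτ hθ) (rder_mem_partialBos hτ _ hy)) _)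

/-! ### The twist product -/

/-- The twist product on `H ⋉ U⁻`, `x ⋆ y = ∑ a · e(y)` for `C(x) = ∑ a ⊗ e`. -/
def starA (h : Compatible χ τ J) : Bos χ (-1) J →ₗ[k] Module.End k (Bos χ (-1) J) :=
  TensorProduct.lift ((LinearMap.mul k (Module.End k (Bos χ (-1) J))).compl₁₂
    (Algebra.lmul k (Bos χ (-1) J)).toLinearMap
    ((kderHom χ J).comp (Bos.proj χ 1 (le_maxIdeal J))).toLinearMap) ∘ₗ ccoact c h

theorem starA_one (h : Compatible χ τ J) (y : Bos χ (-1) J) : starA c h 1 y = y := by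
  simp [starA, ccoact_one]

/-- Write `a ⊗ e` for a term of `C(x)`. The correction term of `starF` gives `kder` on `a`, and the
second term of `C(F_i x)` gives `kder` on `e(y)` with `a` twisted. By the Leibniz rule their sum is
`kder` of the product. This is associativity for the generators. -/
theorem starA_starF (h : Compatible χ τ J) (i : Fin n) (x y : Bos χ (-1) J) :
    starA c h (starF χ τ c J i x) y = starF χ τ c J i (starA c h x y) := by
  have hθ : IsTheta τ (α (τ i) - α i) := by
    have := isTheta_sub τ h.invol (τ i)
    rwa [h.invol] at this
  rw [starF_apply', starF_apply]
  simp only [starA, LinearMap.comp_apply]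
  rw [map_add, map_smul, ccoact_F_mul, ccoact_theta_mul _ _ hθ, ccoact_rder]
  generalize ccoact c h x = t
  induction t using TensorProduct.induction_on with
  | zero => simp
  | tmul a e =>
    simp only [TensorProduct.map_tmul, LinearMap.mulLeft_apply, LinearMap.id_apply,
      twistMulE_tmul, twistFactor_tmul, map_smul, map_add, TensorProduct.lift.tmul,
      LinearMap.compl₁₂_apply, LinearMap.add_apply, LinearMap.smul_apply, LinearMap.mul_apply',
      Module.End.mul_apply, AlgHom.toLinearMap_apply, AlgHom.comp_apply, map_mul, proj_X, kderHom_X,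
      Algebra.coe_lmul_eq_mul, kder_mul, mul_add, smul_add]
    have e1 : KA χ J (α (τ i) - α i) * (rder χ J (τ i) a * kderHom χ J (Bos.proj χ 1 (le_maxIdeal J) e) y) =
      KA χ J (-α i) * (kder χ J (τ i) a * kderHom χ J (Bos.proj χ 1 (le_maxIdeal J) e) y) := by
      rw [kder_apply, ← mul_assoc, ← mul_assoc, ← mul_assoc, KA, KA, ← Bos.K_add, neg_add_eq_sub]
    rw [e1]
    abel
  | add s t hs ht =>
    simp only [map_add, smul_add, LinearMap.add_apply, mul_add] at hs ht ⊢
    linear_combination (norm := abel) hs + ht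

theorem starA_theta_mul (h : Compatible χ τ J) {a : Weight n} (ha : IsTheta τ a)
    (x y : Bos χ (-1) J) : starA c h (KA χ J a * x) y = KA χ J a * starA c h x y := by
  simp only [starA, LinearMap.comp_apply]
  rw [ccoact_theta_mul _ _ ha]
  generalize ccoact c h x = t
  induction t using TensorProduct.induction_on with
  | zero => simp
  | tmul b e => simp [mul_assoc]
  | add s t hs ht => simp only [map_add, LinearMap.add_apply, hs, ht, mul_add]

end Twist

/-! ### Comparison of `C` with the left action through `σ`. -/

section Slices

variable {χ : SymmetricBicharacter k n} {τ : Equiv.Perm (Fin n)} (c : Fin n → k)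
  {J : PreNicholsIdeal χ}

theorem sigmaBar_var_mul (i : Fin n) (p : Tens k n) : sigmaBar χ τ c (var k i * p) =
    c (τ i) • (Bos.K χ 1 (maxIdeal χ) (α i) * Bos.X χ 1 (maxIdeal χ) (τ i)) *
      sigmaBar χ τ c p := by
  rw [sigmaBar, map_mul, FreeAlgebra.lift_ι_apply]

theorem leftAct_sigmaBar_var_mul (i : Fin n) (p : Tens k n) (y : Bos χ (-1) J) :
    leftAct χ J (sigmaBar χ τ c (var k i * p)) y =
      c (τ i) • lgrp χ J (α i) (lder χ J (τ i) (leftAct χ J (sigmaBar χ τ c p) y)) := by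
  rw [sigmaBar_var_mul, smul_mul_assoc, mul_assoc, leftAct_smul, LinearMap.smul_apply, leftAct_mul,
    leftAct_mul]
  rfl

theorem leftAct_sigmaBar_one (y : Bos χ (-1) J) :
    leftAct χ J (sigmaBar χ τ c 1) y = y := by
  rw [map_one (sigmaBar χ τ c), leftAct_one]

/-- This is the recursion of `C` read through the pairing: multiplication by `E_τ(i)` in the second
leg is transposed to the derivation with index `τ i` on `p`. -/
theorem leftAct_sigmaBar_F_mul (h : Compatible χ τ J) (p : Tens k n) (i : Fin n)
    (y : Bos χ (-1) J) : leftAct χ J (sigmaBar χ τ c p) (FA χ J i * y) =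
      FA χ J i * leftAct χ J (sigmaBar χ τ c p) y + (c i * χ (α i) (α (τ i))) •
        (KA χ J (-α i) * lgrp χ J (α (τ i))
          (leftAct χ J (sigmaBar χ τ c (skewDer χ (τ i) p)) y)) := by
  induction p using tens_induction with
  | hw l =>
    induction l with
    | nil =>
      rw [word_nil, skewDer_one, leftAct_sigmaBar_one, leftAct_sigmaBar_one, map_zero,
        leftAct_zero]
      simp
    | cons l w ih =>
      rw [word_cons]
      simp only [leftAct_sigmaBar_var_mul, ih, skewDer_var_mul, map_add, map_smul, leftAct_add,
        leftAct_smul, LinearMap.add_apply, LinearMap.smul_apply, lder_F_mul, lder_K_mul, lder_lgrp,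
        lgrp_F_mul, lgrp_K_mul, smul_add, mul_add, mul_smul_comm, χ.neg_left, inv_inv, lgrp_lgrp]
      have e1 : (if i = τ l then (1 : k) else 0) = if l = τ i then 1 else 0 := by
        congr 1
        exact propext ⟨fun e => by rw [e, h.invol], fun e => by rw [e, h.invol]⟩
      rw [add_comm (α l), e1]
      have h1 := χ.ne_zero (α (τ i)) (α (τ l))
      -- Symmetry and `τ`-invariance of `χ` identify the scalars that arise from the two orders of
      -- passing `K` and `E`.
      have e2 : χ (α i) (α (τ l)) = χ (α l) (α (τ i)) := by rw [h.swap, χ.symm_all]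
      have e3 : χ (α (τ i)) (α (τ l)) = χ (α i) (α l) := h.bichar i l
      rw [e3] at h1
      by_cases hl : l = τ i
      · subst hl
        rw [h.invol] at e2
        rw [if_pos rfl, h.invol, χ.symm_all (α (τ i)) (α i), e2]
        match_scalars
        · ring
        · ring
        · field_simp
      · rw [if_neg hl, e2, e3]
        simp only [zero_smul, smul_zero]
        match_scalars
        · field_simp
        · field_simp
  | hadd p q hp hq =>
    simp only [map_add, leftAct_add, LinearMap.add_apply, hp, hq, mul_add, smul_add]
    abel
  | hsmul r p hp =>
    simp only [map_smul, leftAct_smul, LinearMap.smul_apply, hp, mul_smul_comm, smul_add]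
    rw [smul_comm r]

theorem leftAct_sigmaBar_K_mul (h : Compatible χ τ J) {μ : Weight n} {p : Tens k n}
    (hp : p ∈ weightSpan k (var k) μ) (a : Weight n) (y : Bos χ (-1) J) :
    leftAct χ J (sigmaBar χ τ c p) (KA χ J a * y) =
      χ μ (thetaDefect τ a) • (KA χ J a * leftAct χ J (sigmaBar χ τ c p) y) := by
  induction hp using Submodule.span_induction with
  | mem p hp =>
    obtain ⟨l, rfl, rfl⟩ := hp
    induction l with
    | nil => rw [word_nil, leftAct_sigmaBar_one, leftAct_sigmaBar_one, wordWeight_nil, χ.zero_left,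
        one_smul]
    | cons i l ih =>
      rw [word_cons, leftAct_sigmaBar_var_mul, leftAct_sigmaBar_var_mul, ih, wordWeight_cons,
        χ.add_left, χ.symm_all (α i), h.thetaDefect_left, map_smul, lder_K_mul, map_smul, map_smul,
        lgrp_K_mul, mul_smul_comm]
      simp only [smul_smul]
      congr 1
      ring
  | zero => simp [leftAct_zero]
  | add p q _ _ hp hq =>
    simp only [map_add, leftAct_add, LinearMap.add_apply, hp, hq, mul_add, smul_add]
  | smul r p _ hp =>
    simp only [map_smul, leftAct_smul, LinearMap.smul_apply, hp, mul_smul_comm]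
    rw [smul_comm]

/-- The functional `⟨p(F_1, …, F_n), ·⟩`. -/
def dualFun (J' : PreNicholsIdeal χ) : Tens k n →ₗ[k] Bos χ 1 J' →ₗ[k] k :=
  (WithConv.linearEquiv k (Bos χ 1 J' →ₗ[k] k)).toLinearMap ∘ₗ (polyEval (xi χ J')).toLinearMap

theorem dualFun_apply (J' : PreNicholsIdeal χ) (p : Tens k n) (e : Bos χ 1 J') :
    dualFun J' p e = polyEval (xi χ J') p e := rfl

theorem dualFun_one_right (J' : PreNicholsIdeal χ) (i : Fin n) (p : Tens k n) :
    dualFun J' (var k i * p) 1 = 0 := by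
  rw [dualFun_apply, map_mul, mul_apply_one, FreeAlgebra.lift_ι_apply, xi_apply, map_one]
  simp

theorem dualFun_one_one (J' : PreNicholsIdeal χ) : dualFun J' 1 1 = 1 := by
  rw [dualFun_apply, map_one (polyEval (xi χ J')), LinearMap.convOne_apply]
  simp

/-- The functional of a polynomial in the `F_i` is computed by the same derivations on any quotient
of the tensor algebra, so it does not depend on the ideal on the `U⁺` side. -/
theorem dualFun_proj (p : Tens k n) (e : Bos χ 1 J) :
    dualFun (maxIdeal χ) p (Bos.proj χ 1 (le_maxIdeal J) e) = dualFun J p e := by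
  induction e using bos_induction generalizing p with
  | one =>
    rw [map_one]
    induction p using tens_induction with
    | hw l =>
      cases l with
      | nil => rw [word_nil, dualFun_one_one, dualFun_one_one]
      | cons i l => rw [word_cons, dualFun_one_right, dualFun_one_right]
    | hadd p q hp hq => simp only [map_add, LinearMap.add_apply, hp, hq]
    | hsmul r p hp => simp only [map_smul, LinearMap.smul_apply, hp]
  | X i e ih =>
    rw [map_mul, proj_X, dualFun_apply, dualFun_apply, polyEval_xi_X_mul, polyEval_xi_X_mul]
    exact ih _
  | K a e ih =>
    induction p using tens_induction with
    | hw l =>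
      rw [map_mul, proj_K, dualFun_apply, dualFun_apply,
        polyEval_xi_K_mul (weightSpan_word_mem _ l), polyEval_xi_K_mul (weightSpan_word_mem _ l)]
      exact congrArg _ (ih _)
    | hadd p q hp hq => simp only [map_add (dualFun _), LinearMap.add_apply, hp, hq]
    | hsmul r p hp => simp only [map_smul (dualFun _), LinearMap.smul_apply, hp]
  | add e e' he he' => simp only [map_add, he, he']
  | smul r e he => simp only [map_smul, he]

/-- Both sides obey the same recursion in `y`. This identifies `C(y)` with `∑ σ(F_ρ) ▷ y ⊗ E_ρ`
without choosing bases. -/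
theorem rid_map_dualFun_ccoact (h : Compatible χ τ J) (p : Tens k n) (y : Bos χ (-1) J) :
    TensorProduct.rid k _ (TensorProduct.map LinearMap.id (dualFun J p) (ccoact c h y)) =
      leftAct χ J (sigmaBar χ τ c p) y := by
  induction y using bos_induction generalizing p with
  | one =>
    rw [ccoact_one, TensorProduct.map_tmul, TensorProduct.rid_tmul, LinearMap.id_apply]
    induction p using tens_induction with
    | hw l =>
      cases l with
      | nil => rw [word_nil, leftAct_sigmaBar_one, dualFun_one_one, one_smul]
      | cons i l =>
        rw [word_cons, dualFun_one_right, zero_smul, leftAct_one_right, sigmaBar_var_mul]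
        simp
    | hadd p q hp hq => simp only [map_add, leftAct_add, LinearMap.add_apply, add_smul, hp, hq]
    | hsmul r p hp =>
      simp only [map_smul, leftAct_smul, LinearMap.smul_apply, ← hp, smul_smul, smul_eq_mul]
  | X i y ih =>
    rw [leftAct_sigmaBar_F_mul c h, ← ih, ← ih, ccoact_F_mul, map_add, map_add]
    congr 1
    · generalize ccoact c h y = t
      induction t using TensorProduct.induction_on with
      | zero => simp
      | tmul a e => simp
      | add s t hs ht => simp only [map_add, mul_add, hs, ht]
    · generalize ccoact c h y = t
      induction t using TensorProduct.induction_on with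
      | zero => simp
      | tmul a e =>
        rw [twistMulE_tmul, twistFactor_tmul, map_smul, map_smul, TensorProduct.map_tmul,
          TensorProduct.map_tmul, TensorProduct.rid_tmul, TensorProduct.rid_tmul, dualFun_apply,
          polyEval_xi_X_mul, map_smul, mul_smul_comm]
        rfl
      | add s t hs ht => simp only [map_add, mul_add, smul_add, hs, ht]
  | K a y ih =>
    induction p using tens_induction with
    | hw l =>
      rw [leftAct_sigmaBar_K_mul c h (weightSpan_word_mem _ l), ← ih, ccoact_K_mul]
      generalize ccoact c h y = t
      induction t using TensorProduct.induction_on with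
      | zero => simp
      | tmul b e =>
        rw [TensorProduct.map_tmul, TensorProduct.map_tmul, TensorProduct.map_tmul,
          TensorProduct.rid_tmul, TensorProduct.rid_tmul, dualFun_apply, LinearMap.mulLeft_apply,
          LinearMap.mulLeft_apply, polyEval_xi_K_mul (weightSpan_word_mem _ l), mul_smul_comm,
          smul_smul]
        rfl
      | add s t hs ht => simp only [map_add, mul_add, smul_add, hs, ht]
    | hadd p q hp hq =>
      simp only [map_add, leftAct_add, LinearMap.add_apply, TensorProduct.map_add_right, ← hp, ← hq]
    | hsmul r p hp =>
      simp only [map_smul, leftAct_smul, LinearMap.smul_apply, TensorProduct.map_smul_right, ← hp]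
  | add y z hy hz => simp only [map_add, hy, hz]
  | smul r y hy => simp only [map_smul, hy]

/-- The right action of `K_b` commutes with the left actions that `C` consists of, as for `rder`. -/
theorem ccoact_rgrp (h : Compatible χ τ J) (b : Weight n) (y : Bos χ (-1) J) :
    ccoact c h (rgrp χ J b y) = TensorProduct.map (rgrp χ J b) LinearMap.id (ccoact c h y) := by
  have hcomm : ∀ (a : Weight n) (y : Bos χ (-1) J),
      rgrp χ J b (lgrp χ J a y) = lgrp χ J a (rgrp χ J b y) := by
    intro a y
    induction y using bos_induction with
    | one => simp
    | X i y h => simp only [lgrp_F_mul, rgrp_F_mul, h, map_smul]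
    | K d y h => simp only [lgrp_K_mul, rgrp_K_mul, h, map_smul, smul_comm (χ d b)⁻¹]
    | add y z hy hz => simp only [map_add, hy, hz]
    | smul r y hy => simp only [map_smul, hy]
  induction y using bos_induction with
  | one => simp [ccoact_one]
  | X i y ih =>
    rw [rgrp_F_mul, map_smul, ccoact_F_mul, ccoact_F_mul, ih, map_add]
    generalize ccoact c h y = t
    induction t using TensorProduct.induction_on with
    | zero => simp
    | tmul a e =>
      simp only [TensorProduct.map_tmul, LinearMap.mulLeft_apply, LinearMap.id_apply,
        twistMulE_tmul, twistFactor_tmul, map_smul, rgrp_F_mul, rgrp_K_mul, hcomm,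
        ← TensorProduct.smul_tmul', χ.neg_left, inv_inv, smul_add]
      rw [smul_comm (χ (α i) b) (_ * _ : k)]
    | add s t hs ht =>
      simp only [map_add, smul_add] at hs ht ⊢
      linear_combination (norm := abel) hs + ht
  | K a y ih =>
    rw [rgrp_K_mul, map_smul, ccoact_K_mul, ccoact_K_mul, ih]
    generalize ccoact c h y = t
    induction t using TensorProduct.induction_on with
    | zero => simp
    | tmul b e =>
      simp only [TensorProduct.map_tmul, LinearMap.mulLeft_apply, LinearMap.id_apply,
        rgrp_K_mul, ← TensorProduct.smul_tmul']
    | add s t hs ht => simp only [map_add, smul_add, hs, ht]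
  | add y z hy hz => simp only [map_add, hy, hz]
  | smul r y hy => simp only [map_smul, hy]

end Slices

/-! ### The twisted coaction on `H ⋉ U⁻` with values in `U(χ)`. -/

section Coaction

variable {χ : SymmetricBicharacter k n} {τ : Equiv.Perm (Fin n)} (c : Fin n → k)
  {J : PreNicholsIdeal χ}

variable (χ J) in
theorem gammaHom_isLift (J' : PreNicholsIdeal χ) : Bos.IsLift χ 1 J'
    (fun i => KA χ J (α i) ⊗ₜ[k] U.E χ J' i)
    (fun a => (1 : Bos χ (-1) J) ⊗ₜ[k] U.K χ J' a) where
  g_zero := by rw [U.K_zero]; rfl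
  g_add a b := by rw [U.K_add, Algebra.TensorProduct.tmul_mul_tmul, one_mul]
  g_x a i := by
    rw [Algebra.TensorProduct.tmul_mul_tmul, Algebra.TensorProduct.tmul_mul_tmul, one_mul, mul_one,
      U.K_E, TensorProduct.tmul_smul, one_smul]
  ideal p hp := by
    have e : (fun i => KA χ J (α i) ⊗ₜ[k] U.E χ J' i) =
        fun i => (KA χ J (α i) ⊗ₜ[k] (1 : U χ J')) * (1 ⊗ₜ[k] U.E χ J' i) := by
      ext i; simp
    rw [e]
    refine J'.polyEval_twist_eq_zero (fun a => KA χ J a ⊗ₜ[k] (1 : U χ J')) ?_ ?_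
      (fun i => 1 ⊗ₜ[k] U.E χ J' i) ?_ ?_ p hp
    · rw [KA, Bos.K_zero]; rfl
    · intro a b; rw [KA, Bos.K_add, Algebra.TensorProduct.tmul_mul_tmul, one_mul]
    · intro a i; simp
    · intro p hp
      have : polyEval (fun i => (1 : Bos χ (-1) J) ⊗ₜ[k] U.E χ J' i) =
          Algebra.TensorProduct.includeRight.comp (polyEval (k := k) (U.E χ J')) := by
        ext i; simp
      rw [this, AlgHom.comp_apply, U.polyEval_E χ J' p hp, map_zero]

variable (χ J) in
/-- The algebra homomorphism `U⁺ ⋊ H → (H ⋉ U⁻) ⊗ U(χ)` with `E_i ↦ K_i ⊗ E_i` and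
`K_a ↦ 1 ⊗ K_a`. -/
def gammaHom (J' : PreNicholsIdeal χ) : Bos χ 1 J' →ₐ[k] Bos χ (-1) J ⊗[k] U χ J' :=
  Bos.lift (gammaHom_isLift χ J J')

@[simp] theorem gammaHom_X (J' : PreNicholsIdeal χ) (i : Fin n) :
    gammaHom χ J J' (Bos.X χ 1 J' i) = KA χ J (α i) ⊗ₜ U.E χ J' i := Bos.lift_X _ i

@[simp] theorem gammaHom_K (J' : PreNicholsIdeal χ) (a : Weight n) :
    gammaHom χ J J' (Bos.K χ 1 J' a) = 1 ⊗ₜ U.K χ J' a := Bos.lift_K _ a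

/-- The first leg of `γ(e)` contains only factors `K_a`, and `kder` commutes with right
multiplication by them. -/
theorem kder_mul_gammaHom (j : Fin n) (e : Bos χ 1 J) (z : Bos χ (-1) J ⊗[k] U χ J) :
    TensorProduct.map (kder χ J j) LinearMap.id (z * gammaHom χ J J e) =
      TensorProduct.map (kder χ J j) LinearMap.id z * gammaHom χ J J e := by
  induction e using bos_induction generalizing z with
  | one => simp
  | X i e h =>
    rw [map_mul (gammaHom χ J J), ← mul_assoc, h, ← mul_assoc, gammaHom_X]
    congr 1
    induction z using TensorProduct.induction_on with
    | zero => simp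
    | tmul a u => simp [kder_mul_K]
    | add s t hs ht => simp only [map_add, add_mul, hs, ht]
  | K a e h =>
    rw [map_mul (gammaHom χ J J), ← mul_assoc, h, ← mul_assoc, gammaHom_K]
    congr 1
    induction z using TensorProduct.induction_on with
    | zero => simp
    | tmul a u => simp
    | add s t hs ht => simp only [map_add, add_mul, hs, ht]
  | add e e' he he' => simp only [map_add, mul_add, he, he']
  | smul r e he => simp only [map_smul, mul_smul_comm, he]

variable (χ J) in
/-- The map `(a ⊗ e, u) ↦ (a ⊗ u) γ(e)`. -/
def gammaMul (J' : PreNicholsIdeal χ) :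
    Bos χ (-1) J ⊗[k] Bos χ 1 J' →ₗ[k] U χ J' →ₗ[k] Bos χ (-1) J ⊗[k] U χ J' :=
  TensorProduct.lift (LinearMap.mk₂ k
    (fun a e => LinearMap.mulRight k (gammaHom χ J J' e) ∘ₗ TensorProduct.mk k _ _ a)
    (fun a a' e => by ext u; simp [add_mul])
    (fun r a e => by ext u; simp)
    (fun a e e' => by ext u; simp [mul_add])
    (fun r a e => by ext u; simp))

theorem gammaMul_tmul (J' : PreNicholsIdeal χ) (a : Bos χ (-1) J) (e : Bos χ 1 J') (u : U χ J') :
    gammaMul χ J J' (a ⊗ₜ e) u = a ⊗ₜ u * gammaHom χ J J' e := rfl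

/-- The map `x ⊗ u ↦ ∑ (a ⊗ u) γ(e)` for `C(x) = ∑ a ⊗ e`. -/
def preCoact (h : Compatible χ τ J) : Bos χ (-1) J ⊗[k] U χ J →ₗ[k] Bos χ (-1) J ⊗[k] U χ J :=
  TensorProduct.lift (gammaMul χ J J ∘ₗ ccoact c h)

theorem preCoact_tmul (h : Compatible χ τ J) (x : Bos χ (-1) J) (u : U χ J) :
    preCoact c h (x ⊗ₜ u) = gammaMul χ J J (ccoact c h x) u := rfl

/-- The twisted coaction on `H ⋉ U⁻` with values in `(H ⋉ U⁻) ⊗ U(χ)`. -/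
def starCoact (h : Compatible χ τ J) : Bos χ (-1) J →ₗ[k] Bos χ (-1) J ⊗[k] U χ J :=
  preCoact c h ∘ₗ TensorProduct.map LinearMap.id (U.ofBos χ J).toLinearMap ∘ₗ copComul χ J

theorem preCoact_theta (h : Compatible χ τ J) {a : Weight n} (ha : IsTheta τ a) :
    preCoact c h ∘ₗ TensorProduct.map (LinearMap.mulLeft k (KA χ J a)) LinearMap.id =
      TensorProduct.map (LinearMap.mulLeft k (KA χ J a)) LinearMap.id ∘ₗ preCoact c h := by
  refine tmap_ext fun x u => ?_
  rw [LinearMap.comp_apply, LinearMap.comp_apply, TensorProduct.map_tmul, preCoact_tmul,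
    preCoact_tmul, LinearMap.mulLeft_apply, ccoact_theta_mul c h ha, LinearMap.id_apply]
  generalize ccoact c h x = t
  induction t using TensorProduct.induction_on with
  | zero => simp
  | tmul b e =>
    rw [TensorProduct.map_tmul, gammaMul_tmul, gammaMul_tmul]
    generalize gammaHom χ J J e = z
    induction z using TensorProduct.induction_on with
    | zero => simp
    | tmul b e => simp [mul_assoc]
    | add s t hs ht => simp only [map_add, mul_add, hs, ht]
  | add s t hs ht => simp only [map_add, LinearMap.add_apply, hs, ht]

theorem preCoact_mulLeft (h : Compatible χ τ J) (v : U χ J) :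
    preCoact c h ∘ₗ TensorProduct.map LinearMap.id (LinearMap.mulLeft k v) =
      TensorProduct.map LinearMap.id (LinearMap.mulLeft k v) ∘ₗ preCoact c h := by
  refine tmap_ext fun x u => ?_
  rw [LinearMap.comp_apply, LinearMap.comp_apply, TensorProduct.map_tmul, preCoact_tmul,
    preCoact_tmul, LinearMap.mulLeft_apply, LinearMap.id_apply]
  generalize ccoact c h x = t
  induction t using TensorProduct.induction_on with
  | zero => simp
  | tmul b e =>
    rw [gammaMul_tmul, gammaMul_tmul]
    generalize gammaHom χ J J e = z
    induction z using TensorProduct.induction_on with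
    | zero => simp
    | tmul b e => simp [mul_assoc]
    | add s t hs ht => simp only [map_add, mul_add, hs, ht]
  | add s t hs ht => simp only [map_add, LinearMap.add_apply, hs, ht]

/-- `C` intertwines `rder` with itself on the first leg, and `γ` does not interfere; the two sides
then differ by the factor `K_j` that turns `rder` into `kder`. -/
theorem preCoact_kder (h : Compatible χ τ J) (j : Fin n) :
    TensorProduct.map (kder χ J j) LinearMap.id ∘ₗ preCoact c h =
      TensorProduct.map (LinearMap.mulLeft k (KA χ J (α j))) LinearMap.id ∘ₗ preCoact c h ∘ₗ
        TensorProduct.map (rder χ J j) LinearMap.id := by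
  refine tmap_ext fun x u => ?_
  rw [LinearMap.comp_apply, LinearMap.comp_apply, LinearMap.comp_apply, TensorProduct.map_tmul,
    preCoact_tmul, preCoact_tmul, ccoact_rder, LinearMap.id_apply]
  generalize ccoact c h x = t
  induction t using TensorProduct.induction_on with
  | zero => simp
  | tmul b e =>
    rw [TensorProduct.map_tmul, gammaMul_tmul, gammaMul_tmul, kder_mul_gammaHom,
      TensorProduct.map_tmul, kder_apply]
    generalize gammaHom χ J J e = z
    induction z using TensorProduct.induction_on with
    | zero => simp
    | tmul b e => simp [mul_assoc]
    | add s t hs ht => simp only [map_add, mul_add, hs, ht]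
  | add s t hs ht => simp only [map_add, LinearMap.add_apply, hs, ht]

/-- The factor `E_τ(i)` that `C` puts into the second leg becomes `K_τ(i) ⊗ E_τ(i)` under `γ`. The
factor `K_τ(i)` is then carried to the left by `K_mul_rgrp`, which turns the left action into the
right one. -/
theorem preCoact_F (h : Compatible χ τ J) (i : Fin n) :
    preCoact c h ∘ₗ TensorProduct.map (LinearMap.mulLeft k (FA χ J i)) LinearMap.id =
      TensorProduct.map (LinearMap.mulLeft k (FA χ J i)) LinearMap.id ∘ₗ preCoact c h +
      (c i * χ (α i) (α (τ i))) •
        (TensorProduct.map (LinearMap.mulLeft k (KA χ J (α (τ i) - α i))) LinearMap.id ∘ₗ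
        preCoact c h ∘ₗ TensorProduct.map (rgrp χ J (α (τ i)))
          (LinearMap.mulRight k (U.E χ J (τ i)))) := by
  refine tmap_ext fun x u => ?_
  simp only [LinearMap.add_apply, LinearMap.smul_apply, LinearMap.comp_apply,
    TensorProduct.map_tmul, preCoact_tmul, LinearMap.id_apply, LinearMap.mulLeft_apply,
    LinearMap.mulRight_apply, ccoact_F_mul, ccoact_rgrp, map_add]
  generalize ccoact c h x = t
  induction t using TensorProduct.induction_on with
  | zero => simp
  | tmul b e =>
    have e1 : KA χ J (-α i) * lgrp χ J (α (τ i)) b * KA χ J (α (τ i)) =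
        KA χ J (α (τ i) - α i) * rgrp χ J (α (τ i)) b := by
      rw [mul_assoc, ← K_mul_rgrp, ← mul_assoc, KA, KA, ← Bos.K_add, neg_add_eq_sub]
    rw [twistMulE_tmul, twistFactor_tmul, map_smul, LinearMap.smul_apply, TensorProduct.map_tmul,
      TensorProduct.map_tmul, gammaMul_tmul, gammaMul_tmul, gammaMul_tmul, gammaMul_tmul, map_mul,
      ← mul_assoc, gammaHom_X, Algebra.TensorProduct.tmul_mul_tmul, e1, LinearMap.id_apply]
    generalize gammaHom χ J J e = z
    induction z using TensorProduct.induction_on with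
    | zero => simp
    | tmul b e => simp [mul_assoc]
    | add s t hs ht =>
      simp only [map_add, mul_add, smul_add] at hs ht ⊢
      linear_combination (norm := abel) hs + ht
  | add s t hs ht =>
    simp only [map_add, LinearMap.add_apply, smul_add] at hs ht ⊢
    linear_combination (norm := abel) hs + ht

theorem copComul_F_mul (i : Fin n) (y : Bos χ (-1) J) : copComul χ J (FA χ J i * y) =
    TensorProduct.map LinearMap.id (LinearMap.mulLeft k (FA χ J i)) (copComul χ J y) +
    TensorProduct.map (LinearMap.mulLeft k (FA χ J i)) (LinearMap.mulLeft k (KA χ J (-α i)))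
      (copComul χ J y) := by
  rw [copComul_mul, copComul_F, add_mul]
  congr 1
  all_goals
    generalize copComul χ J y = z
    induction z using TensorProduct.induction_on with
    | zero => simp
    | tmul b e => simp
    | add s t hs ht => simp only [map_add, mul_add, hs, ht]

theorem copComul_K_mul (a : Weight n) (y : Bos χ (-1) J) : copComul χ J (KA χ J a * y) =
    TensorProduct.map (LinearMap.mulLeft k (KA χ J a)) (LinearMap.mulLeft k (KA χ J a))
      (copComul χ J y) := by
  rw [copComul_mul, copComul_K]
  generalize copComul χ J y = z
  induction z using TensorProduct.induction_on with
  | zero => simp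
  | tmul b e => simp
  | add s t hs ht => simp only [map_add, mul_add, hs, ht]

theorem map_map_apply {V W V' W' V'' W'' : Type*} [AddCommGroup V] [Module k V] [AddCommGroup W]
    [Module k W] [AddCommGroup V'] [Module k V'] [AddCommGroup W'] [Module k W']
    [AddCommGroup V''] [Module k V''] [AddCommGroup W''] [Module k W''] (f : V →ₗ[k] V')
    (g : W →ₗ[k] W') (f' : V' →ₗ[k] V'') (g' : W' →ₗ[k] W'') (t : V ⊗[k] W) :
    TensorProduct.map f' g' (TensorProduct.map f g t) =
      TensorProduct.map (f' ∘ₗ f) (g' ∘ₗ g) t := by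
  rw [TensorProduct.map_comp]; rfl

/-- The right action pairs away the last leg of the iterated coproduct, so it acts on the second
factor. -/
theorem copComul_rder (j : Fin n) (y : Bos χ (-1) J) : copComul χ J (rder χ J j y) =
    TensorProduct.map LinearMap.id (rder χ J j) (copComul χ J y) := by
  induction y using bos_induction with
  | one => simp [copComul_one]
  | X i y h =>
    rw [rder_F_mul, map_add, map_smul, map_smul, copComul_F_mul, copComul_F_mul, h, map_add]
    simp only [map_map_apply]
    generalize copComul χ J y = z
    induction z using TensorProduct.induction_on with
    | zero => simp
    | tmul b e =>
      simp [rder_F_mul, rder_K_mul, TensorProduct.tmul_add, χ.neg_left]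
      split_ifs <;> (try rw [TensorProduct.tmul_zero]) <;> abel
    | add s t hs ht =>
      simp only [map_add, smul_add] at hs ht ⊢
      linear_combination (norm := abel) hs + ht
  | K a y h =>
    rw [rder_K_mul, map_smul, copComul_K_mul, copComul_K_mul, h]
    simp only [map_map_apply]
    generalize copComul χ J y = z
    induction z using TensorProduct.induction_on with
    | zero => simp
    | tmul b e => simp [rder_K_mul]
    | add s t hs ht => simp only [map_add, smul_add, hs, ht]
  | add y z hy hz => simp only [map_add, hy, hz]
  | smul r y hy => simp only [map_smul, hy]

/-- Both sides pair the middle leg of the iterated coproduct with `K_a`. The analogous statement for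
`E_j` is `map_rder_copComul`. -/
theorem map_rgrp_copComul (a : Weight n) (y : Bos χ (-1) J) :
    TensorProduct.map (rgrp χ J a) LinearMap.id (copComul χ J y) =
    TensorProduct.map LinearMap.id (lgrp χ J a) (copComul χ J y) := by
  induction y using bos_induction with
  | one => simp [copComul_one]
  | X i y h =>
    rw [copComul_F_mul, map_add, map_add]
    simp only [map_map_apply]
    have e1 : TensorProduct.map (rgrp χ J a ∘ₗ LinearMap.id)
        (LinearMap.id ∘ₗ LinearMap.mulLeft k (FA χ J i)) (copComul χ J y) =
        TensorProduct.map LinearMap.id (LinearMap.mulLeft k (FA χ J i))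
          (TensorProduct.map (rgrp χ J a) LinearMap.id (copComul χ J y)) := by
      rw [map_map_apply]; rfl
    have e2 : TensorProduct.map (rgrp χ J a ∘ₗ LinearMap.mulLeft k (FA χ J i))
        (LinearMap.id ∘ₗ LinearMap.mulLeft k (KA χ J (-α i))) (copComul χ J y) =
        χ (α i) a • TensorProduct.map (LinearMap.mulLeft k (FA χ J i))
          (LinearMap.mulLeft k (KA χ J (-α i)))
          (TensorProduct.map (rgrp χ J a) LinearMap.id (copComul χ J y)) := by
      rw [map_map_apply, ← LinearMap.smul_apply, ← TensorProduct.map_smul_left]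
      congr 2
      ext y
      simp [rgrp_F_mul]
    rw [e1, e2, h, map_map_apply, map_map_apply]
    congr 1
    · congr 2
      ext y
      simp [lgrp_F_mul]
    · rw [← LinearMap.smul_apply, ← TensorProduct.map_smul_right]
      congr 2
      ext y
      simp [lgrp_K_mul, χ.neg_left]
  | K b y h =>
    rw [copComul_K_mul]
    have e1 : TensorProduct.map (rgrp χ J a) LinearMap.id (TensorProduct.map
        (LinearMap.mulLeft k (KA χ J b)) (LinearMap.mulLeft k (KA χ J b)) (copComul χ J y)) =
        (χ b a)⁻¹ • TensorProduct.map (LinearMap.mulLeft k (KA χ J b))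
          (LinearMap.mulLeft k (KA χ J b))
          (TensorProduct.map (rgrp χ J a) LinearMap.id (copComul χ J y)) := by
      rw [map_map_apply, map_map_apply, ← LinearMap.smul_apply, ← TensorProduct.map_smul_left]
      congr 2
      ext y
      simp [rgrp_K_mul]
    rw [e1, h, map_map_apply, map_map_apply, ← LinearMap.smul_apply,
      ← TensorProduct.map_smul_right]
    congr 2
    ext y
    simp [lgrp_K_mul]
  | add y z hy hz => simp only [map_add, hy, hz]
  | smul r y hy => simp only [map_smul, hy]

theorem map_rder_copComul (j : Fin n) (y : Bos χ (-1) J) :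
    TensorProduct.map (rder χ J j) LinearMap.id (copComul χ J y) =
    TensorProduct.map LinearMap.id (lder χ J j) (copComul χ J y) := by
  induction y using bos_induction with
  | one => simp [copComul_one]
  | X i y h =>
    rw [copComul_F_mul, map_add, map_add]
    have e1 : TensorProduct.map (rder χ J j) LinearMap.id (TensorProduct.map LinearMap.id
        (LinearMap.mulLeft k (FA χ J i)) (copComul χ J y)) =
        TensorProduct.map LinearMap.id (LinearMap.mulLeft k (FA χ J i))
          (TensorProduct.map (rder χ J j) LinearMap.id (copComul χ J y)) := by
      rw [map_map_apply, map_map_apply]; rfl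
    have e2 : TensorProduct.map (rder χ J j) LinearMap.id (TensorProduct.map
        (LinearMap.mulLeft k (FA χ J i)) (LinearMap.mulLeft k (KA χ J (-α i))) (copComul χ J y)) =
        (if i = j then 1 else 0 : k) • TensorProduct.map LinearMap.id
          (LinearMap.mulLeft k (KA χ J (-α i))) (copComul χ J y) +
        χ (α i) (α j) • TensorProduct.map (LinearMap.mulLeft k (FA χ J i))
          (LinearMap.mulLeft k (KA χ J (-α i)))
          (TensorProduct.map (rder χ J j) LinearMap.id (copComul χ J y)) := by
      rw [map_map_apply, map_map_apply, ← LinearMap.smul_apply, ← LinearMap.smul_apply,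
        ← TensorProduct.map_smul_left, ← TensorProduct.map_smul_left, ← LinearMap.add_apply]
      have := TensorProduct.map_add_left ((if i = j then 1 else 0 : k) • LinearMap.id)
        (χ (α i) (α j) • (LinearMap.mulLeft k (FA χ J i) ∘ₗ rder χ J j))
        (LinearMap.mulLeft k (KA χ J (-α i)))
      rw [LinearMap.comp_id, ← this, LinearMap.id_comp]
      congr 2
      ext y
      split_ifs <;> simp [rder_F_mul, *]
    rw [e1, e2, h]
    simp only [map_map_apply]
    generalize copComul χ J y = z
    induction z using TensorProduct.induction_on with
    | zero => simp
    | tmul b e =>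
      simp [lder_F_mul, lder_K_mul, TensorProduct.tmul_add, χ.neg_left]
      split_ifs <;> (try rw [TensorProduct.tmul_zero]) <;> abel
    | add s t hs ht =>
      simp only [map_add, smul_add] at hs ht ⊢
      linear_combination (norm := abel) hs + ht
  | K b y h =>
    rw [copComul_K_mul]
    have e1 : TensorProduct.map (rder χ J j) LinearMap.id (TensorProduct.map
        (LinearMap.mulLeft k (KA χ J b)) (LinearMap.mulLeft k (KA χ J b)) (copComul χ J y)) =
        (χ b (α j))⁻¹ • TensorProduct.map (LinearMap.mulLeft k (KA χ J b))
          (LinearMap.mulLeft k (KA χ J b))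
          (TensorProduct.map (rder χ J j) LinearMap.id (copComul χ J y)) := by
      rw [map_map_apply, map_map_apply, ← LinearMap.smul_apply, ← TensorProduct.map_smul_left]
      congr 2
      ext y
      simp [rder_K_mul]
    rw [e1, h, map_map_apply, map_map_apply, ← LinearMap.smul_apply,
      ← TensorProduct.map_smul_right]
    congr 2
    ext y
    simp [lder_K_mul]
  | add y z hy hz => simp only [map_add, hy, hz]
  | smul r y hy => simp only [map_smul, hy]

theorem starCoact_one (h : Compatible χ τ J) : starCoact c h 1 = 1 ⊗ₜ 1 := by
  simp [starCoact, copComul_one, preCoact_tmul, ccoact_one, gammaMul_tmul]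

theorem starCoact_theta_mul (h : Compatible χ τ J) {a : Weight n} (ha : IsTheta τ a)
    (y : Bos χ (-1) J) : starCoact c h (KA χ J a * y) =
      TensorProduct.map (LinearMap.mulLeft k (KA χ J a)) (LinearMap.mulLeft k (U.K χ J a))
        (starCoact c h y) := by
  have e : TensorProduct.map LinearMap.id (U.ofBos χ J).toLinearMap (copComul χ J (KA χ J a * y)) =
      TensorProduct.map (LinearMap.mulLeft k (KA χ J a)) LinearMap.id
      (TensorProduct.map LinearMap.id (LinearMap.mulLeft k (U.K χ J a))
        (TensorProduct.map LinearMap.id (U.ofBos χ J).toLinearMap (copComul χ J y))) := by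
    rw [copComul_K_mul]
    simp only [map_map_apply]
    congr 2
    ext z
    simp
  have e2 := LinearMap.congr_fun (preCoact_theta c h ha)
  have e3 := LinearMap.congr_fun (preCoact_mulLeft c h (U.K χ J a))
  simp only [LinearMap.comp_apply] at e2 e3
  simp only [starCoact, LinearMap.comp_apply]
  rw [e, e2, e3, map_map_apply]
  rfl

/-- The three summands are those of the coproduct of `B_i`, with `B_i` replaced by `starF`. The only
obstruction is that `E_τ(i)` has to pass the second leg of the coproduct of `y`; the terms of that
commutator are matched by the derivation in `starF`. -/
theorem starCoact_starF (h : Compatible χ τ J) (i : Fin n) (y : Bos χ (-1) J) :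
    starCoact c h (starF χ τ c J i y) =
      TensorProduct.map LinearMap.id (LinearMap.mulLeft k (U.F χ J i)) (starCoact c h y) +
      TensorProduct.map (starF χ τ c J i) (LinearMap.mulLeft k (U.K χ J (-α i)))
        (starCoact c h y) +
      (c i * χ (α i) (α (τ i))) • TensorProduct.map
        (LinearMap.mulLeft k (KA χ J (α (τ i) - α i)))
        (LinearMap.mulLeft k (U.K χ J (-α i) * U.E χ J (τ i))) (starCoact c h y) := by
  set j := τ i with hj
  set q := c i * χ (α i) (α j) with hq
  have hθ : IsTheta τ (α j - α i) := by
    have := isTheta_sub τ h.invol (τ i)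
    rwa [h.invol] at this
  set w := TensorProduct.map LinearMap.id (U.ofBos χ J).toLinearMap (copComul χ J y) with hw
  -- This is `E_mul_ofBos` in the second leg, after the operators `rgrp` and `rder` on the first leg
  -- have been traded for `lgrp` and `lder` on the second.
  have hmain : TensorProduct.map (rgrp χ J (α j)) (LinearMap.mulRight k (U.E χ J j))
        (TensorProduct.map LinearMap.id (LinearMap.mulLeft k (U.K χ J (-α i))) w) +
      TensorProduct.map LinearMap.id (LinearMap.mulLeft k (U.K χ J (α j - α i)))
        (TensorProduct.map LinearMap.id (U.ofBos χ J).toLinearMap (copComul χ J (rder χ J j y))) =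
      TensorProduct.map (rder χ J j) LinearMap.id
        (TensorProduct.map LinearMap.id (LinearMap.mulLeft k (U.K χ J (-α i))) w) +
      TensorProduct.map LinearMap.id (LinearMap.mulLeft k (U.K χ J (-α i) * U.E χ J j)) w := by
    have e1 : TensorProduct.map (rgrp χ J (α j)) (LinearMap.mulRight k (U.E χ J j))
        (TensorProduct.map LinearMap.id (LinearMap.mulLeft k (U.K χ J (-α i))) w) =
        TensorProduct.map LinearMap.id (LinearMap.mulRight k (U.E χ J j) ∘ₗ
          LinearMap.mulLeft k (U.K χ J (-α i)) ∘ₗ (U.ofBos χ J).toLinearMap)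
          (TensorProduct.map (rgrp χ J (α j)) LinearMap.id (copComul χ J y)) := by
      rw [hw, map_map_apply, map_map_apply, map_map_apply]; rfl
    have e2 : TensorProduct.map (rder χ J j) LinearMap.id
        (TensorProduct.map LinearMap.id (LinearMap.mulLeft k (U.K χ J (-α i))) w) =
        TensorProduct.map LinearMap.id
          (LinearMap.mulLeft k (U.K χ J (-α i)) ∘ₗ (U.ofBos χ J).toLinearMap)
          (TensorProduct.map (rder χ J j) LinearMap.id (copComul χ J y)) := by
      rw [hw, map_map_apply, map_map_apply, map_map_apply]; rfl
    rw [e1, e2, map_rgrp_copComul, map_rder_copComul, copComul_rder, hw]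
    simp only [map_map_apply, LinearMap.id_comp]
    generalize copComul χ J y = z
    induction z using TensorProduct.induction_on with
    | zero => simp
    | tmul a b =>
      simp only [TensorProduct.map_tmul, ← TensorProduct.tmul_add, LinearMap.comp_apply,
        LinearMap.mulLeft_apply, LinearMap.mulRight_apply, AlgHom.toLinearMap_apply]
      congr 1
      rw [mul_assoc _ (U.E χ J j), E_mul_ofBos, sub_eq_add_neg (α j), add_comm (α j), U.K_add]
      simp only [mul_add, mul_sub, mul_assoc]
      abel
    | add s t hs ht =>
      simp only [map_add] at hs ht ⊢
      linear_combination (norm := abel) hs + ht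
  have e2 := LinearMap.congr_fun (preCoact_theta c h hθ)
  have e3 := fun v => LinearMap.congr_fun (preCoact_mulLeft c h v)
  have e4 := LinearMap.congr_fun (preCoact_F c h i)
  have e5 := LinearMap.congr_fun (preCoact_kder c h j)
  simp only [LinearMap.comp_apply, LinearMap.add_apply, LinearMap.smul_apply, ← hj, ← hq]
    at e2 e3 e4 e5
  have eA : TensorProduct.map LinearMap.id (U.ofBos χ J).toLinearMap (copComul χ J (FA χ J i * y)) =
      TensorProduct.map LinearMap.id (LinearMap.mulLeft k (U.F χ J i)) w +
      TensorProduct.map (LinearMap.mulLeft k (FA χ J i)) LinearMap.id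
        (TensorProduct.map LinearMap.id (LinearMap.mulLeft k (U.K χ J (-α i))) w) := by
    rw [copComul_F_mul, hw, map_add]
    simp only [map_map_apply]
    congr 2 <;> congr 1 <;> ext z <;> simp
  have eB : TensorProduct.map LinearMap.id (U.ofBos χ J).toLinearMap
        (copComul χ J (KA χ J (α j - α i) * rder χ J j y)) =
      TensorProduct.map (LinearMap.mulLeft k (KA χ J (α j - α i))) LinearMap.id
        (TensorProduct.map LinearMap.id (LinearMap.mulLeft k (U.K χ J (α j - α i)))
        (TensorProduct.map LinearMap.id (U.ofBos χ J).toLinearMap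
          (copComul χ J (rder χ J j y)))) := by
    rw [copComul_K_mul]
    simp only [map_map_apply]
    congr 2
    ext z
    simp
  have eC : ∀ z : Bos χ (-1) J ⊗[k] U χ J,
      TensorProduct.map (starF χ τ c J i) (LinearMap.mulLeft k (U.K χ J (-α i))) z =
      TensorProduct.map (LinearMap.mulLeft k (FA χ J i)) LinearMap.id
        (TensorProduct.map LinearMap.id (LinearMap.mulLeft k (U.K χ J (-α i))) z) +
      q • TensorProduct.map (LinearMap.mulLeft k (KA χ J (-α i))) LinearMap.id
        (TensorProduct.map (kder χ J j) LinearMap.id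
        (TensorProduct.map LinearMap.id (LinearMap.mulLeft k (U.K χ J (-α i))) z)) := by
    intro z
    induction z using TensorProduct.induction_on with
    | zero => simp
    | tmul a b =>
      simp only [TensorProduct.map_tmul, starF_apply, TensorProduct.add_tmul,
        ← TensorProduct.smul_tmul', LinearMap.mulLeft_apply, LinearMap.id_apply, ← hj, ← hq]
    | add s t hs ht =>
      simp only [map_add, smul_add] at hs ht ⊢
      linear_combination (norm := abel) hs + ht
  have eD : ∀ z : Bos χ (-1) J ⊗[k] U χ J,
      TensorProduct.map (LinearMap.mulLeft k (KA χ J (-α i))) LinearMap.id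
        (TensorProduct.map (LinearMap.mulLeft k (KA χ J (α j))) LinearMap.id z) =
      TensorProduct.map (LinearMap.mulLeft k (KA χ J (α j - α i))) LinearMap.id z := by
    intro z
    rw [map_map_apply, LinearMap.id_comp]
    congr 2
    ext a
    simp only [LinearMap.comp_apply, LinearMap.mulLeft_apply, ← mul_assoc, KA, ← Bos.K_add,
      neg_add_eq_sub]
  have eE : ∀ z : Bos χ (-1) J ⊗[k] U χ J,
      TensorProduct.map (LinearMap.mulLeft k (KA χ J (α j - α i)))
        (LinearMap.mulLeft k (U.K χ J (-α i) * U.E χ J j)) z =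
      TensorProduct.map (LinearMap.mulLeft k (KA χ J (α j - α i))) LinearMap.id
        (TensorProduct.map LinearMap.id
          (LinearMap.mulLeft k (U.K χ J (-α i) * U.E χ J j)) z) := by
    intro z
    rw [map_map_apply]; rfl
  have hw' : starCoact c h y = preCoact c h w := rfl
  rw [starF_apply', map_add, map_smul]
  change preCoact c h (TensorProduct.map LinearMap.id (U.ofBos χ J).toLinearMap
    (copComul χ J (FA χ J i * y))) + q • preCoact c h (TensorProduct.map LinearMap.id
      (U.ofBos χ J).toLinearMap (copComul χ J (KA χ J (α j - α i) * rder χ J j y))) = _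
  rw [eA, eB, map_add, e2, e4, eC, hw', ← e3, ← e3 (U.K χ J (-α i)), e5, eD, eE,
    ← e3 (U.K χ J (-α i) * U.E χ J j)]
  -- After the intertwining rules the two sides differ precisely by the image of `hmain` under
  -- `preCoact`, followed by `K_τ(i) K_i⁻¹` on the first leg.
  have h2 := congrArg (fun z => q • TensorProduct.map
    (LinearMap.mulLeft k (KA χ J (α j - α i))) LinearMap.id (preCoact c h z)) hmain
  simp only [map_add, smul_add] at h2 ⊢
  linear_combination (norm := abel) h2

end Coaction

theorem U.counit_E (χ : SymmetricBicharacter k n) (J : PreNicholsIdeal χ) (i : Fin n) :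
    Coalgebra.counit (R := k) (U.E χ J i) = 0 := U.counitHom_E χ J i

theorem U.counit_F (χ : SymmetricBicharacter k n) (J : PreNicholsIdeal χ) (i : Fin n) :
    Coalgebra.counit (R := k) (U.F χ J i) = 0 := U.counitHom_F χ J i

theorem U.counit_K (χ : SymmetricBicharacter k n) (J : PreNicholsIdeal χ) (a : Weight n) :
    Coalgebra.counit (R := k) (U.K χ J a) = 1 := U.counitHom_K χ J a

/-! ### Comodule algebras determined by operators of left multiplication. -/

section TwistedComodule

variable (χ : SymmetricBicharacter k n) (τ : Equiv.Perm (Fin n)) (c : Fin n → k)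
  (J : PreNicholsIdeal χ)

/-- The operator on `A ⊗ U` that is given by the coproduct of `B_i`, for the operators `f` and `g`
on `A` that describe the multiplications with `B_i` and `K_i⁻¹ K_τ(i)`. -/
def coactOp {A : Type*} [AddCommGroup A] [Module k A] (i : Fin n)
    (f g : Module.End k A) : Module.End k (A ⊗[k] U χ J) :=
  TensorProduct.map LinearMap.id (LinearMap.mulLeft k (U.F χ J i)) +
    TensorProduct.map f (LinearMap.mulLeft k (U.K χ J (-α i))) +
    (c i * χ (α i) (α (τ i))) • TensorProduct.map g
      (LinearMap.mulLeft k (U.K χ J (-α i) * U.E χ J (τ i)))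

/-- The iterated form of `coactOp`. -/
def coactOpTwo {A : Type*} [AddCommGroup A] [Module k A] (i : Fin n)
    (f g : Module.End k A) : Module.End k (A ⊗[k] (U χ J ⊗[k] U χ J)) :=
  TensorProduct.map LinearMap.id
      (LinearMap.mulLeft k (1 ⊗ₜ U.F χ J i + U.F χ J i ⊗ₜ U.K χ J (-α i))) +
    TensorProduct.map f (LinearMap.mulLeft k (U.K χ J (-α i) ⊗ₜ U.K χ J (-α i))) +
    (c i * χ (α i) (α (τ i))) • TensorProduct.map g
      (LinearMap.mulLeft k ((U.K χ J (-α i) ⊗ₜ U.K χ J (-α i)) *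
        (U.E χ J (τ i) ⊗ₜ 1 + U.K χ J (α (τ i)) ⊗ₜ U.E χ J (τ i))))

variable {χ τ c J} {A : Type*} [AddCommGroup A] [Module k A]

theorem coactOp_tmul (i : Fin n)
    (f g : Module.End k A) (a : A) (u : U χ J) : coactOp χ τ c J i f g (a ⊗ₜ u) =
      a ⊗ₜ (U.F χ J i * u) + f a ⊗ₜ (U.K χ J (-α i) * u) +
      (c i * χ (α i) (α (τ i))) • g a ⊗ₜ (U.K χ J (-α i) * U.E χ J (τ i) * u) := by
  simp [coactOp, mul_assoc]

theorem coactOpTwo_tmul (i : Fin n) (f g : Module.End k A) (a : A) (u v : U χ J) :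
    coactOpTwo χ τ c J i f g (a ⊗ₜ (u ⊗ₜ v)) =
      a ⊗ₜ (u ⊗ₜ (U.F χ J i * v)) + a ⊗ₜ ((U.F χ J i * u) ⊗ₜ (U.K χ J (-α i) * v)) +
      f a ⊗ₜ ((U.K χ J (-α i) * u) ⊗ₜ (U.K χ J (-α i) * v)) +
      (c i * χ (α i) (α (τ i))) • (g a ⊗ₜ ((U.K χ J (-α i) * U.E χ J (τ i) * u) ⊗ₜ
        (U.K χ J (-α i) * v)) + g a ⊗ₜ ((U.K χ J (α (τ i) - α i) * u) ⊗ₜ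
        (U.K χ J (-α i) * U.E χ J (τ i) * v))) := by
  rw [sub_eq_neg_add, U.K_add]
  simp [coactOpTwo, add_mul, mul_add, TensorProduct.tmul_add, mul_assoc]

theorem coactOp_comul (i : Fin n) (f g : Module.End k A) (t : A ⊗[k] U χ J) :
    TensorProduct.map LinearMap.id (Coalgebra.comul (R := k) (A := U χ J))
      (coactOp χ τ c J i f g t) = coactOpTwo χ τ c J i f g
      (TensorProduct.map LinearMap.id (Coalgebra.comul (R := k) (A := U χ J)) t) := by
  induction t using TensorProduct.induction_on with
  | zero => simp
  | tmul a u => simp [coactOp_tmul, coactOpTwo, Bialgebra.comul_mul, mul_assoc]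
  | add s t hs ht => simp only [map_add, hs, ht]

variable (J) in
/-- The map `a ⊗ u ↦ ρ(a) ⊗ u` after reassociating. -/
def coactLeft (ρ : A →ₗ[k] A ⊗[k] U χ J) : A ⊗[k] U χ J →ₗ[k] A ⊗[k] (U χ J ⊗[k] U χ J) :=
  (TensorProduct.assoc k A (U χ J) (U χ J)).toLinearMap ∘ₗ TensorProduct.map ρ LinearMap.id

theorem coactLeft_tmul (ρ : A →ₗ[k] A ⊗[k] U χ J) (a : A) (u : U χ J) :
    coactLeft J ρ (a ⊗ₜ u) =
      TensorProduct.map LinearMap.id ((TensorProduct.mk k (U χ J) (U χ J)).flip u) (ρ a) := by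
  rw [coactLeft, LinearMap.comp_apply, TensorProduct.map_tmul, LinearMap.id_apply]
  generalize ρ a = s
  induction s using TensorProduct.induction_on with
  | zero => rw [TensorProduct.zero_tmul, map_zero, map_zero]
  | tmul b v => rfl
  | add s t hs ht => rw [TensorProduct.add_tmul, map_add, map_add, hs, ht]

/-- Coassociativity for one generator follows formally from the rules `hf` and `hg`, as `coactOpTwo`
is what the coproduct of `U(χ)` makes of `coactOp`. -/
theorem coactLeft_coactOp (i : Fin n) (ρ : A →ₗ[k] A ⊗[k] U χ J) (f g : Module.End k A)
    (hf : ∀ a, ρ (f a) = coactOp χ τ c J i f g (ρ a))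
    (hg : ∀ a, ρ (g a) = TensorProduct.map g (LinearMap.mulLeft k (U.K χ J (α (τ i) - α i))) (ρ a))
    (t : A ⊗[k] U χ J) : coactLeft J ρ (coactOp χ τ c J i f g t) =
      coactOpTwo χ τ c J i f g (coactLeft J ρ t) := by
  induction t using TensorProduct.induction_on with
  | zero => simp only [map_zero]
  | tmul a u =>
    rw [coactOp_tmul, map_add, map_add, map_smul]
    simp only [coactLeft_tmul, hf, hg]
    generalize ρ a = s
    induction s using TensorProduct.induction_on with
    | zero => simp only [map_zero, smul_zero, add_zero]
    | tmul b v =>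
      rw [coactOp_tmul]
      simp only [map_add, map_smul, TensorProduct.map_tmul, LinearMap.id_apply,
        LinearMap.flip_apply, TensorProduct.mk_apply, LinearMap.mulLeft_apply, coactOpTwo_tmul,
        smul_add]
      abel
    | add s t hs ht =>
      simp only [map_add, smul_add] at hs ht ⊢
      linear_combination (norm := abel) hs + ht
  | add s t hs ht => simp only [map_add, hs, ht]

theorem coactLeft_map (ρ : A →ₗ[k] A ⊗[k] U χ J) (g : Module.End k A) (a : Weight n)
    (hg : ∀ x, ρ (g x) = TensorProduct.map g (LinearMap.mulLeft k (U.K χ J a)) (ρ x))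
    (t : A ⊗[k] U χ J) :
    coactLeft J ρ (TensorProduct.map g (LinearMap.mulLeft k (U.K χ J a)) t) =
      TensorProduct.map g (LinearMap.mulLeft k (U.K χ J a ⊗ₜ U.K χ J a)) (coactLeft J ρ t) := by
  induction t using TensorProduct.induction_on with
  | zero => simp only [map_zero]
  | tmul x u =>
    rw [TensorProduct.map_tmul, coactLeft_tmul, coactLeft_tmul, hg]
    generalize ρ x = s
    induction s using TensorProduct.induction_on with
    | zero => simp only [map_zero]
    | tmul b v => simp
    | add s t hs ht => simp only [map_add, hs, ht]
  | add s t hs ht => simp only [map_add, hs, ht]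

theorem map_comul_map (g : Module.End k A) (a : Weight n) (t : A ⊗[k] U χ J) :
    TensorProduct.map LinearMap.id (Coalgebra.comul (R := k) (A := U χ J))
      (TensorProduct.map g (LinearMap.mulLeft k (U.K χ J a)) t) =
    TensorProduct.map g (LinearMap.mulLeft k (U.K χ J a ⊗ₜ U.K χ J a))
      (TensorProduct.map LinearMap.id (Coalgebra.comul (R := k) (A := U χ J)) t) := by
  induction t using TensorProduct.induction_on with
  | zero => simp only [map_zero]
  | tmul b u => simp [Bialgebra.comul_mul]
  | add s t hs ht => simp only [map_add, hs, ht]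

variable (χ τ c J) in
/-- A multiplication and a coaction that are determined by the operators `f i` and `g a` of left
multiplication with generators which behave like `B_i` and `K_a`. -/
structure IsTwistedComodule (m : A →ₗ[k] A →ₗ[k] A) (one : A) (ρ : A →ₗ[k] A ⊗[k] U χ J)
    (f : Fin n → Module.End k A) (g : ∀ a, IsTheta τ a → Module.End k A) : Prop where
  isTheta : ∀ i, IsTheta τ (α (τ i) - α i)
  ind : ∀ S : Submodule k A, one ∈ S → (∀ i, ∀ x ∈ S, f i x ∈ S) →
    (∀ a ha, ∀ x ∈ S, g a ha x ∈ S) → S = ⊤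
  mul_one_left : ∀ y, m one y = y
  mul_f : ∀ i x y, m (f i x) y = f i (m x y)
  mul_g : ∀ a ha x y, m (g a ha x) y = g a ha (m x y)
  coact_one : ρ one = one ⊗ₜ 1
  coact_f : ∀ i x, ρ (f i x) = coactOp χ τ c J i (f i) (g _ (isTheta i)) (ρ x)
  coact_g : ∀ a ha x, ρ (g a ha x) =
    TensorProduct.map (g a ha) (LinearMap.mulLeft k (U.K χ J a)) (ρ x)

namespace IsTwistedComodule

variable {m : A →ₗ[k] A →ₗ[k] A} {one : A} {ρ : A →ₗ[k] A ⊗[k] U χ J}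
    {f : Fin n → Module.End k A} {g : ∀ a, IsTheta τ a → Module.End k A}

theorem ext (H : IsTwistedComodule χ τ c J m one ρ f g) {V : Type*} [AddCommGroup V] [Module k V]
    {φ φ' : A →ₗ[k] V} (h1 : φ one = φ' one) (hf : ∀ i x, φ x = φ' x → φ (f i x) = φ' (f i x))
    (hg : ∀ a ha x, φ x = φ' x → φ (g a ha x) = φ' (g a ha x)) (x : A) : φ x = φ' x := by
  have := H.ind (LinearMap.eqLocus φ φ') h1 hf hg
  have hx : x ∈ LinearMap.eqLocus φ φ' := by rw [this]; trivial
  exact hx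

/-- Each axiom is an equality of linear maps in the first argument. It holds at `one`, and the rules
for `f` and `g` propagate it; no axiom for a general product has to be checked directly. -/
theorem isComoduleAlgebra (H : IsTwistedComodule χ τ c J m one ρ f g) :
    IsComoduleAlgebra m one ρ where
  mul_assoc a b d := by
    refine H.ext (φ := m.flip d ∘ₗ m.flip b) (φ' := m.flip (m b d)) ?_ ?_ ?_ a
    · simp [H.mul_one_left]
    · intro i x hx
      simp only [LinearMap.comp_apply, LinearMap.flip_apply, H.mul_f] at hx ⊢
      rw [hx]
    · intro a ha x hx
      simp only [LinearMap.comp_apply, LinearMap.flip_apply, H.mul_g] at hx ⊢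
      rw [hx]
  one_mul := H.mul_one_left
  mul_one a := by
    refine H.ext (φ := m.flip one) (φ' := LinearMap.id) ?_ ?_ ?_ a
    · simp [H.mul_one_left]
    · intro i x hx
      simp only [LinearMap.flip_apply, H.mul_f, LinearMap.id_apply] at hx ⊢
      rw [hx]
    · intro a ha x hx
      simp only [LinearMap.flip_apply, H.mul_g, LinearMap.id_apply] at hx ⊢
      rw [hx]
  coassoc a := by
    refine H.ext (φ := coactLeft J ρ ∘ₗ ρ) (φ' := TensorProduct.map LinearMap.id
      (Coalgebra.comul (R := k) (A := U χ J)) ∘ₗ ρ) ?_ ?_ ?_ a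
    · rw [LinearMap.comp_apply, LinearMap.comp_apply, H.coact_one, coactLeft_tmul, H.coact_one]
      simp [Algebra.TensorProduct.one_def]
    · intro i x hx
      rw [LinearMap.comp_apply, LinearMap.comp_apply] at hx ⊢
      rw [H.coact_f, coactOp_comul, ← hx, coactLeft_coactOp i ρ _ _ (H.coact_f i) (H.coact_g _ _)]
    · intro a ha x hx
      rw [LinearMap.comp_apply, LinearMap.comp_apply] at hx ⊢
      rw [H.coact_g, map_comul_map, ← hx, coactLeft_map ρ _ a (H.coact_g _ _)]
  counit a := by
    refine H.ext (φ := (TensorProduct.rid k A).toLinearMap ∘ₗ TensorProduct.map LinearMap.id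
      (Coalgebra.counit (R := k) (A := U χ J)) ∘ₗ ρ) (φ' := LinearMap.id) ?_ ?_ ?_ a
    · simp [H.coact_one]
    · intro i x hx
      conv_rhs => rw [LinearMap.id_apply, ← LinearMap.id_apply (R := k) x, ← hx]
      simp only [LinearMap.comp_apply, H.coact_f]
      generalize ρ x = t
      induction t using TensorProduct.induction_on with
      | zero => simp only [map_zero]
      | tmul a u =>
        rw [coactOp_tmul]
        simp [Bialgebra.counit_mul, U.counit_E, U.counit_F, U.counit_K]
      | add s t hs ht => simp only [map_add, hs, ht]
    · intro a ha x hx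
      conv_rhs => rw [LinearMap.id_apply, ← LinearMap.id_apply (R := k) x, ← hx]
      simp only [LinearMap.comp_apply, H.coact_g]
      generalize ρ x = t
      induction t using TensorProduct.induction_on with
      | zero => simp only [map_zero]
      | tmul a u => simp [Bialgebra.counit_mul, U.counit_K]
      | add s t hs ht => simp only [map_add, hs, ht]
  map_mul a b := by
    refine H.ext (φ := ρ ∘ₗ m.flip b) (φ' := (TensorProduct.map₂ m
      (LinearMap.mul k (U χ J))).flip (ρ b) ∘ₗ ρ) ?_ ?_ ?_ a
    · simp only [LinearMap.comp_apply, LinearMap.flip_apply, H.mul_one_left, H.coact_one]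
      generalize ρ b = t
      induction t using TensorProduct.induction_on with
      | zero => simp only [map_zero]
      | tmul a u => simp [H.mul_one_left]
      | add s t hs ht => rw [map_add, ← hs, ← ht]
    · intro i x hx
      simp only [LinearMap.comp_apply, LinearMap.flip_apply, H.mul_f, H.coact_f] at hx ⊢
      rw [hx]
      generalize ρ x = s
      generalize ρ b = t
      induction s using TensorProduct.induction_on with
      | zero => simp only [map_zero, LinearMap.zero_apply]
      | tmul a u =>
        induction t using TensorProduct.induction_on with
        | zero => simp only [map_zero]
        | tmul a' u' =>
          rw [coactOp_tmul, TensorProduct.map₂_apply_tmul, TensorProduct.map_tmul, coactOp_tmul]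
          simp [H.mul_f, H.mul_g, mul_assoc]
        | add s t hs ht => simp only [map_add, hs, ht]
      | add s t hs ht => simp only [map_add, LinearMap.add_apply, hs, ht]
    · intro a ha x hx
      simp only [LinearMap.comp_apply, LinearMap.flip_apply, H.mul_g, H.coact_g] at hx ⊢
      rw [hx]
      generalize ρ x = s
      generalize ρ b = t
      induction s using TensorProduct.induction_on with
      | zero => simp only [map_zero, LinearMap.zero_apply]
      | tmul a u =>
        induction t using TensorProduct.induction_on with
        | zero => simp only [map_zero]
        | tmul a' u' => simp [H.mul_g, mul_assoc]
        | add s t hs ht => simp only [map_add, hs, ht]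
      | add s t hs ht => simp only [map_add, LinearMap.add_apply, hs, ht]
  map_one := H.coact_one

variable {A' : Type*} [AddCommGroup A'] [Module k A'] {m' : A' →ₗ[k] A' →ₗ[k] A'} {one' : A'}
    {ρ' : A' →ₗ[k] A' ⊗[k] U χ J} {f' : Fin n → Module.End k A'}
    {g' : ∀ a, IsTheta τ a → Module.End k A'}

/-- The same principle: a linear bijection that matches the units and the generating operators
automatically respects products and coactions. -/
theorem isComoduleAlgebraIso (H : IsTwistedComodule χ τ c J m one ρ f g)
    (H' : IsTwistedComodule χ τ c J m' one' ρ' f' g') (φ : A →ₗ[k] A')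
    (hφ : Function.Bijective φ) (h1 : φ one = one') (hf : ∀ i x, φ (f i x) = f' i (φ x))
    (hg : ∀ a ha x, φ (g a ha x) = g' a ha (φ x)) :
    IsComoduleAlgebraIso m one ρ m' one' ρ' φ where
  bijective := hφ
  map_one := h1
  map_mul a b := by
    refine H.ext (φ := φ ∘ₗ m.flip b) (φ' := m'.flip (φ b) ∘ₗ φ) ?_ ?_ ?_ a
    · simp only [LinearMap.comp_apply, LinearMap.flip_apply, H.mul_one_left, h1, H'.mul_one_left]
    · intro i x hx
      simp only [LinearMap.comp_apply, LinearMap.flip_apply, H.mul_f, hf, H'.mul_f] at hx ⊢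
      rw [hx]
    · intro a ha x hx
      simp only [LinearMap.comp_apply, LinearMap.flip_apply, H.mul_g, hg, H'.mul_g] at hx ⊢
      rw [hx]
  map_coact a := by
    refine H.ext (φ := ρ' ∘ₗ φ) (φ' := TensorProduct.map φ LinearMap.id ∘ₗ ρ) ?_ ?_ ?_ a
    · simp [h1, H.coact_one, H'.coact_one]
    · intro i x hx
      simp only [LinearMap.comp_apply, hf, H.coact_f, H'.coact_f] at hx ⊢
      rw [hx]
      generalize ρ x = t
      induction t using TensorProduct.induction_on with
      | zero => simp only [map_zero]
      | tmul a u =>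
        rw [coactOp_tmul, TensorProduct.map_tmul, coactOp_tmul]
        simp [hf, hg]
      | add s t hs ht => simp only [map_add, hs, ht]
    · intro a ha x hx
      simp only [LinearMap.comp_apply, hg, H.coact_g, H'.coact_g] at hx ⊢
      rw [hx]
      generalize ρ x = t
      induction t using TensorProduct.induction_on with
      | zero => simp only [map_zero]
      | tmul a u => simp [hg]
      | add s t hs ht => simp only [map_add, hs, ht]

end IsTwistedComodule

end TwistedComodule

/-! ### Restriction to `H_θ ⋉ U⁻`. -/

section PartialBosonization

variable {χ : SymmetricBicharacter k n} {τ : Equiv.Perm (Fin n)} (c : Fin n → k)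
  {J : PreNicholsIdeal χ}

theorem isTheta_swap_sub (hτ : ∀ i, τ (τ i) = i) (i : Fin n) : IsTheta τ (α (τ i) - α i) := by
  have := isTheta_sub τ hτ (τ i)
  rwa [hτ] at this

theorem Compatible.isTheta (h : Compatible χ τ J) (i : Fin n) : IsTheta τ (α (τ i) - α i) :=
  isTheta_swap_sub h.invol i

/-- The operator `starF` on the partial bosonization. -/
def starFM (h : Compatible χ τ J) (i : Fin n) : Module.End k (PartialBos χ τ J) :=
  (starF χ τ c J i).restrict (p := Subalgebra.toSubmodule (PartialBos χ τ J))
    (q := Subalgebra.toSubmodule (PartialBos χ τ J))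
    fun _ hy => starF_mem_partialBos c h.invol i hy

theorem starFM_coe (h : Compatible χ τ J) (i : Fin n) (y : PartialBos χ τ J) :
    (starFM c h i y : Bos χ (-1) J) = starF χ τ c J i y := rfl

/-- The group-like elements of the partial bosonization. -/
def KM (h : Compatible χ τ J) {a : Weight n} (ha : IsTheta τ a) : PartialBos χ τ J :=
  ⟨KA χ J a, K_mem_partialBos h.invol ha⟩

/-- Elements are reached from `1` by the twisted operators instead of ordinary multiplication, since
`⋆` and the coaction have simple rules only for the former. -/
theorem partialBos_induction (h : Compatible χ τ J) {P : PartialBos χ τ J → Prop} (h1 : P 1)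
    (hadd : ∀ x y, P x → P y → P (x + y)) (hsmul : ∀ (r : k) x, P x → P (r • x))
    (hF : ∀ i x, P x → P (starFM c h i x))
    (hK : ∀ a (ha : IsTheta τ a) x, P x → P (KM h ha * x)) (x : PartialBos χ τ J) : P x := by
  let S : Submodule k (PartialBos χ τ J) :=
    { carrier := {x | P x}
      zero_mem' := by simpa using hsmul 0 1 h1
      add_mem' := fun hx hy => hadd _ _ hx hy
      smul_mem' := fun r x hx => hsmul r x hx }
  have key := partialBos_le_of_star c h.invol (S.map (PartialBos χ τ J).val.toLinearMap)
    ⟨1, h1, rfl⟩ ?_ ?_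
  · obtain ⟨y, hy, e⟩ := key x.2
    rwa [← Subtype.ext e]
  · rintro i _ _ ⟨y, hy, rfl⟩
    exact ⟨starFM c h i y, hF i y hy, rfl⟩
  · rintro a ha _ _ ⟨y, hy, rfl⟩
    exact ⟨KM h ha * y, hK a ha y hy, rfl⟩

theorem starA_mem (h : Compatible χ τ J) (x y : PartialBos χ τ J) :
    starA c h x y ∈ PartialBos χ τ J := by
  induction x using partialBos_induction c h with
  | h1 => simp [starA_one]
  | hadd x x' hx hx' => simpa using add_mem hx hx'
  | hsmul r x hx => simpa using Subalgebra.smul_mem _ hx r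
  | hF i x hx => rw [starFM_coe, starA_starF]; exact starF_mem_partialBos c h.invol i hx
  | hK a ha x hx =>
    have : ((KM h ha * x : PartialBos χ τ J) : Bos χ (-1) J) = KA χ J a * x := rfl
    rw [this, starA_theta_mul c h ha]
    exact mul_mem (K_mem_partialBos h.invol ha) hx

/-- The twist product on the partial bosonization. -/
def starM (h : Compatible χ τ J) :
    PartialBos χ τ J →ₗ[k] PartialBos χ τ J →ₗ[k] PartialBos χ τ J :=
  LinearMap.mk₂ k (fun x y => ⟨starA c h x y, starA_mem c h x y⟩)
    (fun x x' y => Subtype.ext (by simp)) (fun r x y => Subtype.ext (by simp))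
    (fun x y y' => Subtype.ext (by simp)) (fun r x y => Subtype.ext (by simp))

theorem starM_coe (h : Compatible χ τ J) (x y : PartialBos χ τ J) :
    (starM c h x y : Bos χ (-1) J) = starA c h x y := rfl

theorem starM_one (h : Compatible χ τ J) (y : PartialBos χ τ J) : starM c h 1 y = y :=
  Subtype.ext (by rw [starM_coe]; exact starA_one c h y)

theorem starM_starFM (h : Compatible χ τ J) (i : Fin n) (x y : PartialBos χ τ J) :
    starM c h (starFM c h i x) y = starFM c h i (starM c h x y) :=
  Subtype.ext (starA_starF c h i x y)

theorem starM_KM (h : Compatible χ τ J) {a : Weight n} (ha : IsTheta τ a)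
    (x y : PartialBos χ τ J) : starM c h (KM h ha * x) y = KM h ha * starM c h x y :=
  Subtype.ext (starA_theta_mul c h ha x y)

/-- The inclusion of `(H_θ ⋉ U⁻) ⊗ U(χ)_max` in `(H ⋉ U⁻) ⊗ U(χ)_max`. -/
def inclM (χ : SymmetricBicharacter k n) (τ : Equiv.Perm (Fin n)) (J : PreNicholsIdeal χ) :
    PartialBos χ τ J ⊗[k] U χ (maxIdeal χ) →ₗ[k] Bos χ (-1) J ⊗[k] U χ (maxIdeal χ) :=
  TensorProduct.map (PartialBos χ τ J).val.toLinearMap LinearMap.id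

theorem inclM_injective : Function.Injective (inclM χ τ J) :=
  Module.Flat.rTensor_preserves_injective_linearMap (M := U χ (maxIdeal χ))
    (PartialBos χ τ J).val.toLinearMap Subtype.val_injective

/-- The twisted coaction on `H ⋉ U⁻` with values in `(H ⋉ U⁻) ⊗ U(χ)_max`. -/
def starCoactMax (h : Compatible χ τ J) :
    Bos χ (-1) J →ₗ[k] Bos χ (-1) J ⊗[k] U χ (maxIdeal χ) :=
  TensorProduct.map LinearMap.id (U.proj χ (le_maxIdeal J)).toLinearMap ∘ₗ starCoact c h

@[simp] theorem U.proj_E {J' : PreNicholsIdeal χ} (h : J.ideal ≤ J'.ideal) (i : Fin n) :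
    U.proj χ h (U.E χ J i) = U.E χ J' i := U.lift_E _ i

@[simp] theorem U.proj_F {J' : PreNicholsIdeal χ} (h : J.ideal ≤ J'.ideal) (i : Fin n) :
    U.proj χ h (U.F χ J i) = U.F χ J' i := U.lift_F _ i

@[simp] theorem U.proj_K {J' : PreNicholsIdeal χ} (h : J.ideal ≤ J'.ideal) (a : Weight n) :
    U.proj χ h (U.K χ J a) = U.K χ J' a := U.lift_K _ a

theorem starCoactMax_one (h : Compatible χ τ J) : starCoactMax c h 1 = 1 ⊗ₜ 1 := by
  simp [starCoactMax, starCoact_one]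

theorem starCoactMax_starF (h : Compatible χ τ J) (i : Fin n) (y : Bos χ (-1) J) :
    starCoactMax c h (starF χ τ c J i y) = coactOp χ τ c (maxIdeal χ) i (starF χ τ c J i)
      (LinearMap.mulLeft k (KA χ J (α (τ i) - α i))) (starCoactMax c h y) := by
  rw [starCoactMax, LinearMap.comp_apply, LinearMap.comp_apply, starCoact_starF]
  generalize starCoact c h y = z
  induction z using TensorProduct.induction_on with
  | zero => simp
  | tmul a b => simp [coactOp_tmul, mul_assoc]
  | add s t hs ht =>
    simp only [map_add, smul_add] at hs ht ⊢
    linear_combination (norm := abel) hs + ht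

theorem starCoactMax_theta_mul (h : Compatible χ τ J) {a : Weight n} (ha : IsTheta τ a)
    (y : Bos χ (-1) J) : starCoactMax c h (KA χ J a * y) =
      TensorProduct.map (LinearMap.mulLeft k (KA χ J a))
        (LinearMap.mulLeft k (U.K χ (maxIdeal χ) a)) (starCoactMax c h y) := by
  rw [starCoactMax, LinearMap.comp_apply, LinearMap.comp_apply, starCoact_theta_mul c h ha,
    map_map_apply, map_map_apply]
  congr 2
  ext z
  simp

theorem inclM_coactOp (h : Compatible χ τ J) (i : Fin n)
    (z : PartialBos χ τ J ⊗[k] U χ (maxIdeal χ)) :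
    inclM χ τ J (coactOp χ τ c (maxIdeal χ) i (starFM c h i)
      (LinearMap.mulLeft k (KM h (h.isTheta i))) z) =
    coactOp χ τ c (maxIdeal χ) i (starF χ τ c J i)
      (LinearMap.mulLeft k (KA χ J (α (τ i) - α i))) (inclM χ τ J z) := by
  induction z using TensorProduct.induction_on with
  | zero => simp
  | tmul a b =>
    rw [coactOp_tmul, map_add, map_add, map_smul]
    simp only [inclM, TensorProduct.map_tmul, coactOp_tmul]
    rfl
  | add s t hs ht => simp only [map_add, hs, ht]

theorem inclM_theta (h : Compatible χ τ J) {a : Weight n} (ha : IsTheta τ a)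
    (z : PartialBos χ τ J ⊗[k] U χ (maxIdeal χ)) :
    inclM χ τ J (TensorProduct.map (LinearMap.mulLeft k (KM h ha))
        (LinearMap.mulLeft k (U.K χ (maxIdeal χ) a)) z) =
    TensorProduct.map (LinearMap.mulLeft k (KA χ J a))
        (LinearMap.mulLeft k (U.K χ (maxIdeal χ) a)) (inclM χ τ J z) := by
  rw [inclM, map_map_apply, map_map_apply]
  rfl

theorem starCoactMax_mem (h : Compatible χ τ J) (x : PartialBos χ τ J) :
    starCoactMax c h x ∈ LinearMap.range (inclM χ τ J) := by
  induction x using partialBos_induction c h with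
  | h1 => exact ⟨1 ⊗ₜ 1, by simp [inclM, starCoactMax_one]⟩
  | hadd x x' hx hx' => simpa using add_mem hx hx'
  | hsmul r x hx => simpa using Submodule.smul_mem _ r hx
  | hF i x hx =>
    obtain ⟨z, hz⟩ := hx
    exact ⟨_, by rw [starFM_coe, starCoactMax_starF, ← hz, inclM_coactOp c h]⟩
  | hK a ha x hx =>
    obtain ⟨z, hz⟩ := hx
    refine ⟨_, (inclM_theta h ha z).trans ?_⟩
    rw [hz, ← starCoactMax_theta_mul c h ha]
    rfl

/-- The twisted coaction on the partial bosonization. -/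
def coactM (h : Compatible χ τ J) :
    PartialBos χ τ J →ₗ[k] PartialBos χ τ J ⊗[k] U χ (maxIdeal χ) :=
  (LinearEquiv.ofInjective (inclM χ τ J) inclM_injective).symm.toLinearMap ∘ₗ
    (starCoactMax c h ∘ₗ (PartialBos χ τ J).val.toLinearMap).codRestrict _
      (starCoactMax_mem c h)

theorem inclM_coactM (h : Compatible χ τ J) (x : PartialBos χ τ J) :
    inclM χ τ J (coactM c h x) = starCoactMax c h x :=
  congrArg Subtype.val ((LinearEquiv.ofInjective (inclM χ τ J) inclM_injective).apply_symm_apply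
    ⟨starCoactMax c h x, starCoactMax_mem c h x⟩)

theorem coactM_one (h : Compatible χ τ J) : coactM c h 1 = 1 ⊗ₜ 1 :=
  inclM_injective (by rw [inclM_coactM]; simp [inclM, starCoactMax_one])

theorem coactM_starFM (h : Compatible χ τ J) (i : Fin n) (x : PartialBos χ τ J) :
    coactM c h (starFM c h i x) = coactOp χ τ c (maxIdeal χ) i (starFM c h i)
      (LinearMap.mulLeft k (KM h (h.isTheta i))) (coactM c h x) :=
  inclM_injective (by
    rw [inclM_coactM, inclM_coactOp, inclM_coactM, starFM_coe, starCoactMax_starF])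

theorem coactM_KM_mul (h : Compatible χ τ J) {a : Weight n} (ha : IsTheta τ a)
    (x : PartialBos χ τ J) : coactM c h (KM h ha * x) =
      TensorProduct.map (LinearMap.mulLeft k (KM h ha))
        (LinearMap.mulLeft k (U.K χ (maxIdeal χ) a)) (coactM c h x) :=
  inclM_injective (by
    rw [inclM_coactM, inclM_theta, inclM_coactM, ← starCoactMax_theta_mul c h ha]; rfl)

/-- The first half of part 1, with `starF` in the role of `B_i`. -/
theorem starM_isTwisted (h : Compatible χ τ J) : IsTwistedComodule χ τ c (maxIdeal χ) (starM c h) 1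
    (coactM c h) (starFM c h) (fun _ ha => LinearMap.mulLeft k (KM h ha)) where
  isTheta := h.isTheta
  ind S h1 hF hK := eq_top_iff.2 fun x _ => by
    induction x using partialBos_induction c h with
    | h1 => exact h1
    | hadd x y hx hy => exact add_mem (hx trivial) (hy trivial)
    | hsmul r x hx => exact S.smul_mem r (hx trivial)
    | hF i x hx => exact hF i x (hx trivial)
    | hK a ha x hx => exact hK a ha x (hx trivial)
  mul_one_left := starM_one c h
  mul_f := starM_starFM c h
  mul_g _ ha := starM_KM c h ha
  coact_one := coactM_one c h
  coact_f := coactM_starFM c h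
  coact_g _ ha := coactM_KM_mul c h ha

end PartialBosonization

/-! ### The coideal subalgebra `B_c`. -/

section CoidealSubalgebra

variable {χ : SymmetricBicharacter k n} {τ : Equiv.Perm (Fin n)} (c : Fin n → k)
  {J : PreNicholsIdeal χ} (hτ : ∀ i, τ (τ i) = i)

theorem inclB_coactB (x : Bc χ τ c J) : inclB χ τ c J (coactB χ τ c J hτ x) = coactU χ J x :=
  congrArg Subtype.val ((AlgEquiv.ofInjective (inclB χ τ c J)
    (inclB_injective χ τ c J)).apply_symm_apply ⟨coactU χ J x, coactU_mem χ τ c J hτ x⟩)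

theorem K_mem_Bc (hτ : ∀ i, τ (τ i) = i) {a : Weight n} (ha : IsTheta τ a) : U.K χ J a ∈ Bc χ τ c J := by
  refine theta_induction (P := fun a => U.K χ J a ∈ Bc χ τ c J) hτ ?_
    (fun i => Algebra.subset_adjoin (by simp)) (fun a b ha hb => ?_) ha
  · rw [U.K_zero]; exact one_mem _
  · rw [U.K_add]; exact mul_mem ha hb

theorem genB_mem_Bc (i : Fin n) : genB χ τ c J i ∈ Bc χ τ c J := Algebra.subset_adjoin (by simp)

/-- The generators `B_i` of `B_c`. -/
def BB (i : Fin n) : Bc χ τ c J := ⟨genB χ τ c J i, genB_mem_Bc c i⟩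

/-- The group-like elements of `B_c`. -/
def KB {a : Weight n} (ha : IsTheta τ a) : Bc χ τ c J := ⟨U.K χ J a, K_mem_Bc c hτ ha⟩

/-- The scalar `χ (α i) (α (τ i))` arises from writing `E_τ(i) K_i⁻¹` with the group-like factor on
the left; this is the same scalar as in `starF`. -/
theorem coactU_genB (i : Fin n) : coactU χ J (genB χ τ c J i) =
    1 ⊗ₜ U.F χ (maxIdeal χ) i + genB χ τ c J i ⊗ₜ U.K χ (maxIdeal χ) (-α i) +
      (c i * χ (α i) (α (τ i))) • U.K χ J (α (τ i) - α i) ⊗ₜ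
        (U.K χ (maxIdeal χ) (-α i) * U.E χ (maxIdeal χ) (τ i)) := by
  have e : U.K χ (maxIdeal χ) (-α i) * U.E χ (maxIdeal χ) (τ i) = (χ (α i) (α (τ i)))⁻¹ •
      (U.E χ (maxIdeal χ) (τ i) * U.K χ (maxIdeal χ) (-α i)) := by rw [U.K_E, χ.neg_left]
  rw [e, TensorProduct.tmul_smul, smul_smul, mul_assoc, mul_inv_cancel₀ (χ.ne_zero _ _), mul_one]
  simp [coactU, genB, U.proj, add_mul, TensorProduct.add_tmul, sub_eq_add_neg, U.K_add,
    TensorProduct.smul_tmul']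
  abel

theorem coactB_BB_mul (i : Fin n) (x : Bc χ τ c J) : coactB χ τ c J hτ (BB c i * x) =
    coactOp χ τ c (maxIdeal χ) i (LinearMap.mulLeft k (BB c i))
      (LinearMap.mulLeft k (KB c hτ (isTheta_swap_sub hτ i))) (coactB χ τ c J hτ x) := by
  refine inclB_injective χ τ c J ?_
  rw [inclB_coactB]
  have e : ((BB c i * x : Bc χ τ c J) : U χ J) = genB χ τ c J i * x := rfl
  rw [e, map_mul, coactU_genB, ← inclB_coactB c hτ]
  generalize coactB χ τ c J hτ x = t
  induction t using TensorProduct.induction_on with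
  | zero => simp
  | tmul a u =>
    rw [coactOp_tmul, map_add, map_add, map_smul]
    simp [inclB, BB, KB, add_mul]
  | add s t hs ht => simp only [map_add, mul_add, hs, ht]

theorem coactB_KB_mul {a : Weight n} (ha : IsTheta τ a) (x : Bc χ τ c J) :
    coactB χ τ c J hτ (KB c hτ ha * x) =
      TensorProduct.map (LinearMap.mulLeft k (KB c hτ ha))
        (LinearMap.mulLeft k (U.K χ (maxIdeal χ) a)) (coactB χ τ c J hτ x) := by
  refine inclB_injective χ τ c J ?_
  rw [inclB_coactB]
  have e : ((KB c hτ ha * x : Bc χ τ c J) : U χ J) = U.K χ J a * x := rfl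
  have e2 : coactU χ J (U.K χ J a) = U.K χ J a ⊗ₜ U.K χ (maxIdeal χ) a := by simp [coactU]
  rw [e, map_mul, e2, ← inclB_coactB c hτ]
  generalize coactB χ τ c J hτ x = t
  induction t using TensorProduct.induction_on with
  | zero => simp
  | tmul a u => simp [inclB, KB]
  | add s t hs ht => simp only [map_add, mul_add, hs, ht]

/-- A subspace with `1` that is stable under left multiplication with the generators is `B_c`. -/
theorem Bc_eq_top (S : Submodule k (Bc χ τ c J)) (h1 : 1 ∈ S) (hB : ∀ i, ∀ x ∈ S, BB c i * x ∈ S)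
    (hK : ∀ a (ha : IsTheta τ a), ∀ x ∈ S, KB c hτ ha * x ∈ S) : S = ⊤ := by
  have key : ∀ (x : U χ J) (hx : x ∈ Bc χ τ c J), ∀ y ∈ S, (⟨x, hx⟩ : Bc χ τ c J) * y ∈ S := by
    intro x hx
    induction hx using Algebra.adjoin_induction with
    | mem x hx =>
      rcases hx with ⟨i, rfl⟩ | ⟨i, rfl⟩
      · exact hK _ (isTheta_sub τ hτ i)
      · exact hB i
    | algebraMap r =>
      intro y hy
      have : (⟨algebraMap k (U χ J) r, Subalgebra.algebraMap_mem _ r⟩ : Bc χ τ c J) * y = r • y := by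
        rw [Algebra.smul_def]; rfl
      rw [this]
      exact S.smul_mem r hy
    | add x y hx' hy' hx hy =>
      intro z hz
      have := add_mem (hx z hz) (hy z hz)
      rw [← add_mul] at this
      exact this
    | mul x y hx' hy' hx hy =>
      intro z hz
      have := hx _ (hy z hz)
      rw [← mul_assoc] at this
      exact this
  refine eq_top_iff.2 fun x _ => ?_
  rw [← mul_one x]
  exact key x.1 x.2 1 h1

/-- Here the operators are ordinary left multiplications, so only the coproducts of the generators
enter. The rules are literally those of `starM_isTwisted`, which is what makes the two algebras
comparable. -/
theorem coactB_isTwisted : IsTwistedComodule χ τ c (maxIdeal χ) (LinearMap.mul k (Bc χ τ c J)) 1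
    (coactB χ τ c J hτ).toLinearMap (fun i => LinearMap.mulLeft k (BB c i))
    (fun _ ha => LinearMap.mulLeft k (KB c hτ ha)) where
  isTheta := isTheta_swap_sub hτ
  ind := Bc_eq_top c hτ
  mul_one_left y := one_mul y
  mul_f _ _ _ := mul_assoc _ _ _
  mul_g _ _ _ _ := mul_assoc _ _ _
  coact_one := map_one (coactB χ τ c J hτ)
  coact_f := coactB_BB_mul c hτ
  coact_g _ ha := coactB_KB_mul c hτ ha

end CoidealSubalgebra

theorem alghom_word {A B : Type*} [Ring A] [Algebra k A] [Ring B] [Algebra k B] (f : A →ₐ[k] B)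
    (x : Fin n → A) (l : List (Fin n)) : f (word x l) = word (fun i => f (x i)) l := by
  induction l with
  | nil => rw [word_nil, word_nil, map_one]
  | cons i l ih => rw [word_cons, word_cons, map_mul, ih]

/-! ### Finite sums over dual bases -/

/-- The family `F` has finite support and the sum `v`. -/
def HasFinsum {ι V : Type*} [AddCommMonoid V] (F : ι → V) (v : V) : Prop :=
  (Function.support F).Finite ∧ ∑ᶠ i, F i = v

namespace HasFinsum

variable {ι V W : Type*} [AddCommGroup V] [Module k V] [AddCommGroup W] [Module k W]

theorem zero : HasFinsum (fun _ : ι => (0 : V)) 0 :=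
  ⟨by simp [Function.support_fun_zero], finsum_zero⟩

theorem add {F G : ι → V} {v w : V} (hF : HasFinsum F v) (hG : HasFinsum G w) :
    HasFinsum (fun i => F i + G i) (v + w) :=
  ⟨(hF.1.union hG.1).subset (Function.support_add F G), by
    rw [finsum_add_distrib hF.1 hG.1, hF.2, hG.2]⟩

theorem map {F : ι → V} {v : V} (hF : HasFinsum F v) (g : V →ₗ[k] W) :
    HasFinsum (fun i => g (F i)) (g v) :=
  ⟨hF.1.subset fun i hi h => hi (by simp [h]), by
    rw [← hF.2]; exact ((g : V →+ W).map_finsum hF.1).symm⟩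

theorem single {F : ι → V} (i : ι) (h : ∀ j, j ≠ i → F j = 0) : HasFinsum F (F i) :=
  ⟨(Set.finite_singleton i).subset fun j hj => by
    by_contra hne; exact hj (h j hne), finsum_eq_single F i h⟩

theorem congr {F G : ι → V} {v w : V} (hF : HasFinsum F v) (h : ∀ i, G i = F i) (e : w = v) :
    HasFinsum G w := by
  rw [e, funext h]; exact hF

/-- A family of linear maps has finite sums on a span if it does on the generators. -/
theorem of_mem_span {F : ι → V →ₗ[k] W} {g : V →ₗ[k] W} {S : Set V}
    (h : ∀ x ∈ S, HasFinsum (fun i => F i x) (g x)) {x : V} (hx : x ∈ Submodule.span k S) :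
    HasFinsum (fun i => F i x) (g x) := by
  induction hx using Submodule.span_induction with
  | mem x hx => exact h x hx
  | zero => exact zero.congr (fun i => map_zero _) (map_zero _)
  | add x y _ _ hx hy => exact (hx.add hy).congr (fun i => map_add _ _ _) (map_add _ _ _)
  | smul r x _ hx =>
    exact (hx.map (r • (LinearMap.id : W →ₗ[k] W))).congr
      (fun i => map_smul (F i) r x) (map_smul g r x)

end HasFinsum

namespace DualBases

variable {χ : SymmetricBicharacter k n} (D : DualBases χ)

theorem dualFun_dual (μ : Fin n → ℕ) (i j : Fin (D.dim μ)) :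
    dualFun (maxIdeal χ) (D.f μ i) (polyEval (Bos.X χ 1 (maxIdeal χ)) (D.e μ j)) =
      if i = j then 1 else 0 := by
  rw [dualFun_apply, ← pairing_polyEval (maxIdeal χ), D.dual]

theorem expand_E {μ : Fin n → ℕ} {x : Bos χ 1 (maxIdeal χ)}
    (hx : x ∈ weightSpan k (Bos.X χ 1 (maxIdeal χ)) (natWeight μ)) :
    ∑ j, dualFun (maxIdeal χ) (D.f μ j) x • polyEval (Bos.X χ 1 (maxIdeal χ)) (D.e μ j) = x := by
  rw [← D.e_span, Submodule.mem_span_range_iff_exists_fun] at hx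
  obtain ⟨r, rfl⟩ := hx
  refine Finset.sum_congr rfl fun j _ => ?_
  congr 1
  rw [map_sum, Finset.sum_eq_single j]
  · rw [map_smul, dualFun_dual, if_pos rfl, smul_eq_mul, mul_one]
  · intro b _ hb
    rw [map_smul, dualFun_dual, if_neg hb.symm, smul_zero]
  · simp

theorem expand_F {μ : Fin n → ℕ} {x : Bos χ (-1) (maxIdeal χ)}
    (hx : x ∈ weightSpan k (Bos.X χ (-1) (maxIdeal χ)) (natWeight μ)) :
    ∑ j, pairing χ (maxIdeal χ) (maxIdeal χ) x (polyEval (Bos.X χ 1 (maxIdeal χ)) (D.e μ j)) •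
      polyEval (Bos.X χ (-1) (maxIdeal χ)) (D.f μ j) = x := by
  rw [← D.f_span, Submodule.mem_span_range_iff_exists_fun] at hx
  obtain ⟨r, rfl⟩ := hx
  refine Finset.sum_congr rfl fun j _ => ?_
  congr 1
  rw [map_sum, LinearMap.sum_apply, Finset.sum_eq_single j]
  · rw [map_smul, LinearMap.smul_apply, D.dual, if_pos rfl, smul_eq_mul, mul_one]
  · intro b _ hb
    rw [map_smul, LinearMap.smul_apply, D.dual, if_neg hb, smul_zero]
  · simp

theorem dualFun_word_of_ne {μ : Fin n → ℕ} (j : Fin (D.dim μ)) (l : List (Fin n))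
    (hl : wordWeight l ≠ natWeight μ) :
    dualFun (maxIdeal χ) (D.f μ j) (word (Bos.X χ 1 (maxIdeal χ)) l) = 0 :=
  evalXi_word_of_ne (D.f_mem μ j) l hl

/-- By `mul_kappa_word`, so the group-like factor in the second leg of a coproduct does not disturb
contractions. -/
theorem pairing_word_mul_K (l : List (Fin n)) (a : Weight n) (p : Tens k n) :
    pairing χ (maxIdeal χ) (maxIdeal χ)
      (word (Bos.X χ (-1) (maxIdeal χ)) l * Bos.K χ (-1) (maxIdeal χ) a)
      (polyEval (Bos.X χ 1 (maxIdeal χ)) p) = pairing χ (maxIdeal χ) (maxIdeal χ)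
      (word (Bos.X χ (-1) (maxIdeal χ)) l) (polyEval (Bos.X χ 1 (maxIdeal χ)) p) := by
  induction p using tens_induction with
  | hw w =>
    rw [polyEval_word]
    change hom χ _ _ (_ * _) _ = hom χ _ _ _ _
    rw [map_mul, hom_K, mul_kappa_word]
  | hadd p q hp hq => simp only [map_add, hp, hq]
  | hsmul r p hp => simp only [map_smul, hp]

theorem pairing_word_of_ne {μ : Fin n → ℕ} (j : Fin (D.dim μ)) (l : List (Fin n))
    (hl : wordWeight l ≠ natWeight μ) :
    pairing χ (maxIdeal χ) (maxIdeal χ) (word (Bos.X χ (-1) (maxIdeal χ)) l)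
      (polyEval (Bos.X χ 1 (maxIdeal χ)) (D.e μ j)) = 0 := by
  have : weightSpan k (var k) (natWeight μ) ≤ LinearMap.ker
      (pairing χ (maxIdeal χ) (maxIdeal χ) (word (Bos.X χ (-1) (maxIdeal χ)) l) ∘ₗ
        (polyEval (Bos.X χ 1 (maxIdeal χ))).toLinearMap) := by
    refine Submodule.span_le.2 ?_
    rintro _ ⟨w, hw, rfl⟩
    rw [SetLike.mem_coe, LinearMap.mem_ker, LinearMap.comp_apply, AlgHom.toLinearMap_apply,
      polyEval_word, ← polyEval_word (k := k) (Bos.X χ (-1) (maxIdeal χ)), pairing_polyEval]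
    exact evalXi_word_of_ne (weightSpan_word_mem _ l) w (by rw [hw]; exact hl.symm)
  exact this (D.e_mem μ j)

/-- The contraction with an element of the dual basis in the second tensor factor. -/
def contractE {A : Type*} [AddCommGroup A] [Module k A] (p : Tens k n) :
    A ⊗[k] Bos χ 1 (maxIdeal χ) →ₗ[k] A :=
  (TensorProduct.rid k A).toLinearMap ∘ₗ
    TensorProduct.map LinearMap.id (dualFun (maxIdeal χ) p)

/-- The contraction with `E` in the second tensor factor. -/
def contractF {A : Type*} [AddCommGroup A] [Module k A] (e : Bos χ 1 (maxIdeal χ)) :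
    A ⊗[k] Bos χ (-1) (maxIdeal χ) →ₗ[k] A :=
  (TensorProduct.rid k A).toLinearMap ∘ₗ
    TensorProduct.map LinearMap.id ((pairing χ (maxIdeal χ) (maxIdeal χ)).flip e)

variable {A : Type*} [AddCommGroup A] [Module k A]

theorem contractE_tmul (p : Tens k n) (a : A) (e : Bos χ 1 (maxIdeal χ)) :
    contractE p (a ⊗ₜ e) = dualFun (maxIdeal χ) p e • a := by
  simp [contractE]

theorem contractF_tmul (e : Bos χ 1 (maxIdeal χ)) (a : A) (y : Bos χ (-1) (maxIdeal χ)) :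
    contractF e (a ⊗ₜ y) = pairing χ (maxIdeal χ) (maxIdeal χ) y e • a := by
  simp [contractF]

variable {V : Type*} [AddCommGroup V] [Module k V]

/-- A tensor in `A ⊗ U⁺` is the sum of its contractions with the dual bases. -/
theorem hasFinsum_contractE (G : A ⊗[k] Bos χ 1 (maxIdeal χ) →ₗ[k] V)
    {t : A ⊗[k] Bos χ 1 (maxIdeal χ)}
    (ht : t ∈ Submodule.span k {x | ∃ (a : A) (l : List (Fin n)),
      a ⊗ₜ word (Bos.X χ 1 (maxIdeal χ)) l = x}) :
    HasFinsum (fun ρ : Fin n → ℕ => ∑ j, G (contractE (D.f ρ j) t ⊗ₜ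
      polyEval (Bos.X χ 1 (maxIdeal χ)) (D.e ρ j))) (G t) := by
  let F : (Fin n → ℕ) → A ⊗[k] Bos χ 1 (maxIdeal χ) →ₗ[k] V := fun ρ => ∑ j,
    G ∘ₗ ((TensorProduct.mk k A _).flip (polyEval (Bos.X χ 1 (maxIdeal χ)) (D.e ρ j))) ∘ₗ
      contractE (D.f ρ j)
  refine (HasFinsum.of_mem_span (F := F) ?_ ht).congr (fun ρ => ?_) rfl
  · rintro _ ⟨a, l, rfl⟩
    have e : ∀ ρ, F ρ (a ⊗ₜ word (Bos.X χ 1 (maxIdeal χ)) l) = ∑ j,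
        G (a ⊗ₜ (dualFun (maxIdeal χ) (D.f ρ j) (word (Bos.X χ 1 (maxIdeal χ)) l) •
          polyEval (Bos.X χ 1 (maxIdeal χ)) (D.e ρ j))) := by
      intro ρ
      rw [LinearMap.sum_apply]
      refine Finset.sum_congr rfl fun j _ => ?_
      rw [LinearMap.comp_apply, LinearMap.comp_apply, contractE_tmul, LinearMap.flip_apply,
        TensorProduct.mk_apply, TensorProduct.tmul_smul, TensorProduct.smul_tmul']
    -- A word is seen only by the dual bases of its own weight, and these reproduce it. So on a
    -- spanning vector exactly one summand can be nonzero.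
    refine (HasFinsum.single (F := fun ρ => F ρ _) (fun i => l.count i) ?_).congr
      (fun _ => rfl) ?_
    · intro ρ hρ
      rw [e]
      refine Finset.sum_eq_zero fun j _ => ?_
      rw [D.dualFun_word_of_ne j l, zero_smul, TensorProduct.tmul_zero, map_zero]
      rw [wordWeight_eq_natWeight]
      exact fun h => hρ (natWeight_injective h).symm
    · rw [e, ← map_sum, ← TensorProduct.tmul_sum, D.expand_E]
      rw [← wordWeight_eq_natWeight]
      exact weightSpan_word_mem _ l
  · rw [LinearMap.sum_apply]; rfl

/-- A tensor in `(A ⊗ U⁺) ⊗ U⁻` is the sum of its contractions with the dual bases. -/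
theorem hasFinsum_contract (a : Weight n)
    (G : (A ⊗[k] Bos χ 1 (maxIdeal χ)) ⊗[k] Bos χ (-1) (maxIdeal χ) →ₗ[k] V)
    {t : (A ⊗[k] Bos χ 1 (maxIdeal χ)) ⊗[k] Bos χ (-1) (maxIdeal χ)}
    (ht : t ∈ Submodule.span k {x | ∃ (b : A) (l l' : List (Fin n)),
      (b ⊗ₜ word (Bos.X χ 1 (maxIdeal χ)) l) ⊗ₜ (word (Bos.X χ (-1) (maxIdeal χ)) l' *
        Bos.K χ (-1) (maxIdeal χ) (wordWeight l' - a)) = x}) :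
    HasFinsum (fun w : (Fin n → ℕ) × (Fin n → ℕ) => ∑ i, ∑ j,
      G ((contractE (D.f w.1 i) (contractF (polyEval (Bos.X χ 1 (maxIdeal χ)) (D.e w.2 j)) t) ⊗ₜ
        polyEval (Bos.X χ 1 (maxIdeal χ)) (D.e w.1 i)) ⊗ₜ
        (polyEval (Bos.X χ (-1) (maxIdeal χ)) (D.f w.2 j) *
          Bos.K χ (-1) (maxIdeal χ) (natWeight w.2 - a)))) (G t) := by
  let F : (Fin n → ℕ) × (Fin n → ℕ) →
      (A ⊗[k] Bos χ 1 (maxIdeal χ)) ⊗[k] Bos χ (-1) (maxIdeal χ) →ₗ[k] V := fun w => ∑ i, ∑ j,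
    G ∘ₗ ((TensorProduct.mk k (A ⊗[k] Bos χ 1 (maxIdeal χ)) _).flip
      (polyEval (Bos.X χ (-1) (maxIdeal χ)) (D.f w.2 j) *
          Bos.K χ (-1) (maxIdeal χ) (natWeight w.2 - a))) ∘ₗ
      ((TensorProduct.mk k A _).flip (polyEval (Bos.X χ 1 (maxIdeal χ)) (D.e w.1 i))) ∘ₗ
      contractE (D.f w.1 i) ∘ₗ contractF (polyEval (Bos.X χ 1 (maxIdeal χ)) (D.e w.2 j))
  refine (HasFinsum.of_mem_span (F := F) ?_ ht).congr (fun w => ?_) rfl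
  · rintro _ ⟨b, l, l', rfl⟩
    have e : ∀ w, F w ((b ⊗ₜ word (Bos.X χ 1 (maxIdeal χ)) l) ⊗ₜ
        (word (Bos.X χ (-1) (maxIdeal χ)) l' * Bos.K χ (-1) (maxIdeal χ) (wordWeight l' - a))) =
        ∑ i, ∑ j,
        G ((b ⊗ₜ (dualFun (maxIdeal χ) (D.f w.1 i) (word (Bos.X χ 1 (maxIdeal χ)) l) •
          polyEval (Bos.X χ 1 (maxIdeal χ)) (D.e w.1 i))) ⊗ₜ
          ((pairing χ (maxIdeal χ) (maxIdeal χ) (word (Bos.X χ (-1) (maxIdeal χ)) l')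
            (polyEval (Bos.X χ 1 (maxIdeal χ)) (D.e w.2 j)) •
            polyEval (Bos.X χ (-1) (maxIdeal χ)) (D.f w.2 j)) *
          Bos.K χ (-1) (maxIdeal χ) (natWeight w.2 - a))) := by
      intro w
      rw [LinearMap.sum_apply]
      refine Finset.sum_congr rfl fun i _ => ?_
      rw [LinearMap.sum_apply]
      refine Finset.sum_congr rfl fun j _ => ?_
      rw [LinearMap.comp_apply, LinearMap.comp_apply, LinearMap.comp_apply, LinearMap.comp_apply,
        contractF_tmul, pairing_word_mul_K, map_smul, contractE_tmul, LinearMap.flip_apply,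
        LinearMap.flip_apply, TensorProduct.mk_apply, TensorProduct.mk_apply,
        TensorProduct.tmul_smul, smul_mul_assoc, TensorProduct.tmul_smul, TensorProduct.smul_tmul',
        TensorProduct.smul_tmul', TensorProduct.smul_tmul']
    -- Likewise only the pair of weights of the two words contributes.
    refine (HasFinsum.single (F := fun w => F w _)
      (fun i => l.count i, fun i => l'.count i) ?_).congr (fun _ => rfl) ?_
    · rintro ⟨ρ, μ⟩ hw
      rw [e]
      refine Finset.sum_eq_zero fun i _ => Finset.sum_eq_zero fun j _ => ?_
      by_cases h1 : ρ = fun i => l.count i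
      · have h2 : wordWeight l' ≠ natWeight μ := by
          rw [wordWeight_eq_natWeight]
          exact fun h => hw (Prod.ext h1 (natWeight_injective h).symm)
        rw [D.pairing_word_of_ne j l' h2, zero_smul, zero_mul, TensorProduct.tmul_zero, map_zero]
      · have h2 : wordWeight l ≠ natWeight ρ := by
          rw [wordWeight_eq_natWeight]
          exact fun h => h1 (natWeight_injective h).symm
        rw [D.dualFun_word_of_ne i l h2, zero_smul, TensorProduct.tmul_zero,
          TensorProduct.zero_tmul, map_zero]
    · rw [e]
      simp only [← map_sum, ← TensorProduct.tmul_sum, ← TensorProduct.sum_tmul, ← Finset.sum_mul]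
      rw [D.expand_E, D.expand_F, ← wordWeight_eq_natWeight]
      · rw [← wordWeight_eq_natWeight]
        exact weightSpan_word_mem _ l'
      · rw [← wordWeight_eq_natWeight]
        exact weightSpan_word_mem _ l
  · rw [LinearMap.sum_apply]
    refine Finset.sum_congr rfl fun i _ => ?_
    rw [LinearMap.sum_apply]; rfl

end DualBases

/-! ### The formula for the twist product in terms of dual bases. -/

section TwistFormula

variable {χ : SymmetricBicharacter k n} {τ : Equiv.Perm (Fin n)} (c : Fin n → k)
  {J : PreNicholsIdeal χ}

theorem rder_rgrp (a : Weight n) (j : Fin n) (y : Bos χ (-1) J) :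
    rder χ J j (rgrp χ J a y) = χ a (α j) • rgrp χ J a (rder χ J j y) := by
  rw [rder, rgrp, ← rightAct_mul, ← rightAct_mul, Bos.K_X, rightAct_smul, LinearMap.smul_apply,
    one_smul]

theorem antipodeInv_var_mul (i : Fin n) (p : Tens k n) : antipodeInv χ (var k i * p) =
    antipodeInv χ p * -(Bos.X χ 1 (maxIdeal χ) i * Bos.K χ 1 (maxIdeal χ) (-α i)) := by
  rw [antipodeInv, map_mul, MulOpposite.unop_mul, FreeAlgebra.lift_ι_apply]
  rfl

theorem antipodeInv_add (p q : Tens k n) :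
    antipodeInv χ (p + q) = antipodeInv χ p + antipodeInv χ q := by
  rw [antipodeInv, map_add, MulOpposite.unop_add]; rfl

theorem antipodeInv_smul (r : k) (p : Tens k n) :
    antipodeInv χ (r • p) = r • antipodeInv χ p := by
  rw [antipodeInv, map_smul, MulOpposite.unop_smul]; rfl

/-- Each letter contributes a sign and a factor `K_i⁻¹` from `S⁻¹(E_i) = -E_i K_i⁻¹`; collecting all
group-like factors on the left gives `K_ρ`. This turns the second half of a summand of `⋆` into an
algebra homomorphism. -/
theorem kderHom_word (l : List (Fin n)) (y : Bos χ (-1) J) :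
    kderHom χ J (word (Bos.X χ 1 (maxIdeal χ)) l) y = (-1 : k) ^ l.length •
      (KA χ J (wordWeight l) * rightAct χ J (antipodeInv χ (word (var k) l) *
        Bos.K χ 1 (maxIdeal χ) (wordWeight l)) y) := by
  induction l with
  | nil => simp [word_nil, wordWeight_nil, KA, Bos.K_zero, antipodeInv, rightAct_one]
  | cons i l ih =>
    have e1 : ∀ (a : Weight n) (z : Bos χ (-1) J),
        rightAct χ J (Bos.K χ 1 (maxIdeal χ) a) z = rgrp χ J a z := fun _ _ => rfl
    have e2 : ∀ (z : Bos χ (-1) J),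
        rightAct χ J (Bos.X χ 1 (maxIdeal χ) i) z = rder χ J i z := fun _ => rfl
    have e3 : ∀ (a b : Weight n) (z : Bos χ (-1) J),
        rgrp χ J a (rgrp χ J b z) = rgrp χ J (a + b) z := by
      intro a b z
      rw [rgrp, rgrp, rgrp, ← rightAct_mul, ← Bos.K_add, add_comm]
    rw [word_cons, word_cons, map_mul, Module.End.mul_apply, ih, kderHom_X, map_smul, kder_K_mul,
      antipodeInv_var_mul, rightAct_mul, rightAct_mul, rightAct_mul,
      ← neg_one_smul k (Bos.X χ 1 (maxIdeal χ) i * _), rightAct_smul, LinearMap.smul_apply, rightAct_mul]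
    simp only [e1, e2]
    rw [kder_apply, rder_rgrp, map_smul, e3, wordWeight_cons, List.length_cons, pow_succ,
      mul_smul_comm, mul_smul_comm, mul_smul_comm, smul_smul (χ _ _)⁻¹, smul_smul, smul_smul,
      inv_mul_cancel₀ (χ.ne_zero _ _), ← mul_assoc, KA, KA, ← Bos.K_add, add_comm (wordWeight l)]
    congr 1
    · ring
    · rw [show α i + wordWeight l + -α i = wordWeight l by abel]

theorem kderHom_polyEval {ρ : Fin n → ℕ} {p : Tens k n}
    (hp : p ∈ weightSpan k (var k) (natWeight ρ)) (y : Bos χ (-1) J) :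
    kderHom χ J (polyEval (Bos.X χ 1 (maxIdeal χ)) p) y = (-1 : k) ^ (∑ i, ρ i) •
      (KA χ J (natWeight ρ) * rightAct χ J (antipodeInv χ p *
        Bos.K χ 1 (maxIdeal χ) (natWeight ρ)) y) := by
  induction hp using Submodule.span_induction with
  | mem p hp =>
    obtain ⟨l, hl, rfl⟩ := hp
    have : l.length = ∑ i, ρ i := by
      have := congrArg height hl
      rw [height_wordWeight, height_natWeight] at this
      exact_mod_cast this
    rw [polyEval_word, kderHom_word, hl, this]
  | zero =>
    have : antipodeInv χ 0 = 0 := by rw [← zero_smul k 0, antipodeInv_smul, zero_smul]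
    simp [this, rightAct_zero]
  | add p q _ _ hp hq =>
    rw [map_add, map_add, LinearMap.add_apply, hp, hq, antipodeInv_add, add_mul, rightAct_add,
      LinearMap.add_apply, mul_add, smul_add]
  | smul r p _ hp =>
    rw [map_smul, map_smul, LinearMap.smul_apply, hp, antipodeInv_smul, smul_mul_assoc,
      rightAct_smul, LinearMap.smul_apply, mul_smul_comm, smul_comm]

theorem twistTerm_eq (D : DualBases χ) (x y : Bos χ (-1) J) (ρ : Fin n → ℕ) :
    twistTerm χ τ c J D x y ρ = ∑ j, leftAct χ J (sigmaBar χ τ c (D.f ρ j)) x *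
      kderHom χ J (polyEval (Bos.X χ 1 (maxIdeal χ)) (D.e ρ j)) y := by
  refine Finset.sum_congr rfl fun j _ => ?_
  rw [kderHom_polyEval (D.e_mem ρ j), mul_smul_comm, mul_assoc]

/-- On words, without factors `K_a`, the second leg of `C` stays inside `U⁺`. This is required since
the dual bases expand only elements of `U⁺`. -/
theorem ccoact_word_mem (h : Compatible χ τ J) (l : List (Fin n)) :
    TensorProduct.map LinearMap.id (Bos.proj χ 1 (le_maxIdeal J)).toLinearMap
      (ccoact c h (word (FA χ J) l)) ∈ Submodule.span k
      {x | ∃ (a : Bos χ (-1) J) (l : List (Fin n)),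
        a ⊗ₜ word (Bos.X χ 1 (maxIdeal χ)) l = x} := by
  set S := Submodule.span k {x | ∃ (a : Bos χ (-1) J) (l : List (Fin n)),
        a ⊗ₜ[k] word (Bos.X χ 1 (maxIdeal χ)) l = x}
  set S' := Submodule.span k {x | ∃ (a : Bos χ (-1) J) (l : List (Fin n)),
        a ⊗ₜ[k] word (Bos.X χ 1 J) l = x} with hS'
  have hS : ∀ {x}, x ∈ S' → TensorProduct.map LinearMap.id
      (Bos.proj χ 1 (le_maxIdeal J)).toLinearMap x ∈ S := by
    intro x hx
    have : S' ≤ S.comap (TensorProduct.map LinearMap.id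
        (Bos.proj χ 1 (le_maxIdeal J)).toLinearMap) := by
      refine Submodule.span_le.2 ?_
      rintro _ ⟨a, l, rfl⟩
      refine Submodule.subset_span ⟨a, l, ?_⟩
      rw [TensorProduct.map_tmul, LinearMap.id_apply, AlgHom.toLinearMap_apply,
        alghom_word]
      simp only [proj_X]
    exact this hx
  refine hS ?_
  induction l with
  | nil => exact Submodule.subset_span ⟨1, [], by rw [word_nil, word_nil, ccoact_one]⟩
  | cons i l ih =>
    rw [word_cons, ccoact_F_mul]
    have key : S' ≤ S'.comap (TensorProduct.map (LinearMap.mulLeft k (FA χ J i)) LinearMap.id +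
        twistFactor χ τ c J i ∘ₗ twistMulE χ τ J i) := by
      refine Submodule.span_le.2 ?_
      rintro _ ⟨a, l, rfl⟩
      rw [SetLike.mem_coe, Submodule.mem_comap, LinearMap.add_apply, LinearMap.comp_apply,
        twistMulE_tmul, twistFactor_tmul, ← word_cons]
      exact add_mem (Submodule.subset_span ⟨_, l, rfl⟩)
        (Submodule.smul_mem _ _ (Submodule.subset_span ⟨_, _, rfl⟩))
    exact key ih

theorem contractE_ccoact (h : Compatible χ τ J) (p : Tens k n) (y : Bos χ (-1) J) :
    DualBases.contractE p (TensorProduct.map LinearMap.id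
      (Bos.proj χ 1 (le_maxIdeal J)).toLinearMap (ccoact c h y)) =
      leftAct χ J (sigmaBar χ τ c p) y := by
  rw [← rid_map_dualFun_ccoact c h, DualBases.contractE, LinearMap.comp_apply, map_map_apply,
    show dualFun (maxIdeal χ) p ∘ₗ (Bos.proj χ 1 (le_maxIdeal J)).toLinearMap = dualFun J p from
      LinearMap.ext fun e => dualFun_proj p e]
  rfl

/-- Expanding the second leg of `C(x)` in dual bases gives coefficients `σ(F_ρ) ▷ x`, and applying
`kderHom` to `E_ρ` gives the remaining factor. -/
theorem starA_hasFinsum (h : Compatible χ τ J) (D : DualBases χ) {a : Weight n}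
    {x : Bos χ (-1) J} (hx : x ∈ weightSpan k (FA χ J) a) (y : Bos χ (-1) J) :
    HasFinsum (twistTerm χ τ c J D x y) (starA c h x y) := by
  let G : Bos χ (-1) J ⊗[k] Bos χ 1 (maxIdeal χ) →ₗ[k] Bos χ (-1) J :=
    TensorProduct.lift ((LinearMap.mul k (Bos χ (-1) J)).compl₂
      ((kderHom χ J).toLinearMap.flip y))
  have hmem : TensorProduct.map LinearMap.id (Bos.proj χ 1 (le_maxIdeal J)).toLinearMap
      (ccoact c h x) ∈ Submodule.span k {x | ∃ (a : Bos χ (-1) J) (l : List (Fin n)),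
        a ⊗ₜ word (Bos.X χ 1 (maxIdeal χ)) l = x} := by
    induction hx using Submodule.span_induction with
    | mem x hx => obtain ⟨l, -, rfl⟩ := hx; exact ccoact_word_mem c h l
    | zero => simp
    | add x y _ _ hx hy => rw [map_add, map_add]; exact add_mem hx hy
    | smul r x _ hx => rw [map_smul, map_smul]; exact Submodule.smul_mem _ r hx
  refine (D.hasFinsum_contractE G hmem).congr (fun ρ => ?_) ?_
  · rw [twistTerm_eq]
    refine Finset.sum_congr rfl fun j _ => ?_
    rw [contractE_ccoact]
    rfl
  · rw [starA, LinearMap.comp_apply]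
    generalize ccoact c h x = t
    induction t using TensorProduct.induction_on with
    | zero => simp
    | tmul a e => rfl
    | add s t hs ht => simp only [map_add, LinearMap.add_apply, hs, ht]

/-- The operators `kder` commute with right multiplication by group-like elements, so for these the
twist is invisible. -/
theorem starM_K (h : Compatible χ τ J) {a : Weight n} (ha : IsTheta τ a)
    (x : PartialBos χ τ J) : starM c h x (KM h ha) = x * KM h ha := by
  induction x using partialBos_induction c h with
  | h1 => rw [starM_one, one_mul]
  | hadd x y hx hy => rw [map_add, LinearMap.add_apply, hx, hy, add_mul]
  | hsmul r x hx => rw [map_smul, LinearMap.smul_apply, hx, smul_mul_assoc]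
  | hF i x hx =>
    rw [starM_starFM, hx]
    refine Subtype.ext ?_
    have e : ((x * KM h ha : PartialBos χ τ J) : Bos χ (-1) J) = x * KA χ J a := rfl
    have e' : ((starFM c h i x * KM h ha : PartialBos χ τ J) : Bos χ (-1) J) =
      starF χ τ c J i x * KA χ J a := rfl
    rw [starFM_coe, e, e', starF_apply, starF_apply, kder_mul_K, add_mul, smul_mul_assoc,
      mul_assoc, mul_assoc]
  | hK b hb x hx => rw [starM_KM, hx, mul_assoc]

theorem weightSpan_mul_KA {a : Weight n} {x : Bos χ (-1) J} (hx : x ∈ weightSpan k (FA χ J) a)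
    (b : Weight n) : x * KA χ J b = χ a b • (KA χ J b * x) := by
  induction hx using Submodule.span_induction with
  | mem x hx =>
    obtain ⟨l, rfl, rfl⟩ := hx
    induction l with
    | nil => rw [word_nil, wordWeight_nil, χ.zero_left, one_smul, one_mul, mul_one]
    | cons i l ih =>
      rw [word_cons, mul_assoc, ih, mul_smul_comm, ← mul_assoc, FA_KA, smul_mul_assoc, smul_smul,
        wordWeight_cons, χ.add_left, mul_comm (χ _ _), χ.symm_all b, mul_assoc]
  | zero => simp
  | add x y _ _ hx hy => rw [add_mul, hx, hy, mul_add, smul_add]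
  | smul r x _ hx => rw [smul_mul_assoc, hx, mul_smul_comm, smul_comm]

theorem weightSpan_le_partialBos (a : Weight n) :
    weightSpan k (FA χ J) a ≤ Subalgebra.toSubmodule (PartialBos χ τ J) := by
  refine Submodule.span_le.2 ?_
  rintro _ ⟨l, -, rfl⟩
  exact word_mem_partialBos l

theorem adjoin_F_le_partialBos :
    Algebra.adjoin k (Set.range (FA χ J)) ≤ PartialBos χ τ J :=
  Algebra.adjoin_mono Set.subset_union_right

theorem starM_isTwistProduct (h : Compatible χ τ J) : IsTwistProduct χ τ c J (starM c h) := by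
  intro D l m hl hm a f hf g hg x y hx hy
  have hsum := starA_hasFinsum c h D hf g
  refine ⟨hsum.1, ?_⟩
  rw [hsum.2]
  let f' : PartialBos χ τ J := ⟨f, weightSpan_le_partialBos _ hf⟩
  let g' : PartialBos χ τ J := ⟨g, adjoin_F_le_partialBos hg⟩
  have ex : x = KM h hl * f' := Subtype.ext hx
  have ey : y = KM h hm * g' := Subtype.ext hy
  have e1 : KM h hm * g' = starM c h (KM h hm) g' := by
    conv_rhs => rw [← mul_one (KM h hm), starM_KM, starM_one]
  have e2 : f' * KM h hm = χ (natWeight a) m • (KM h hm * f') :=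
    Subtype.ext (weightSpan_mul_KA hf m)
  -- Associativity moves `K_m` to the first argument; commuting it past `f` there produces the
  -- scalar `χ(a, m)`.
  rw [ex, ey, starM_KM, e1, ← (starM_isTwisted c h).isComoduleAlgebra.mul_assoc, starM_K, e2,
    map_smul, LinearMap.smul_apply, starM_KM, mul_smul_comm]
  change χ (natWeight a) m • (KA χ J l * (KA χ J m * starA c h f g)) = _
  rw [← mul_assoc, KA, KA, ← Bos.K_add]

theorem partialBos_ext (hτ : ∀ i, τ (τ i) = i) {V : Type*} [AddCommGroup V] [Module k V]
    {φ φ' : PartialBos χ τ J →ₗ[k] V} (H : ∀ (a : Weight n) (l : List (Fin n))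
      (x : PartialBos χ τ J), IsTheta τ a →
      (x : Bos χ (-1) J) = KA χ J a * word (FA χ J) l → φ x = φ' x) : φ = φ' := by
  have : Subalgebra.toSubmodule (PartialBos χ τ J) ≤
      (LinearMap.eqLocus φ φ').map (PartialBos χ τ J).val.toLinearMap := by
    conv_lhs => rw [partialBos_eq_span hτ]
    refine Submodule.span_le.2 ?_
    rintro _ ⟨a, l, ha, rfl⟩
    exact ⟨⟨_, (PartialBos χ τ J).mul_mem (K_mem_partialBos hτ ha) (word_mem_partialBos l)⟩,
      H a l _ ha rfl, rfl⟩
  ext x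
  obtain ⟨y, hy, e⟩ := this x.2
  rwa [← Subtype.ext e]

theorem word_mem_natWeightSpan (l : List (Fin n)) :
    word (FA χ J) l ∈ weightSpan k (FA χ J) (natWeight fun i => l.count i) := by
  rw [← wordWeight_eq_natWeight]; exact weightSpan_word_mem _ l

/-- The formula fixes the product on the spanning elements `K_a F_{l_1} ⋯ F_{l_r}`. It is quantified
over dual bases, so their existence is needed to make it a constraint. -/
theorem isTwistProduct_unique (hτ : ∀ i, τ (τ i) = i)
    {star star' : PartialBos χ τ J →ₗ[k] PartialBos χ τ J →ₗ[k] PartialBos χ τ J}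
    (H : IsTwistProduct χ τ c J star) (H' : IsTwistProduct χ τ c J star') : star = star' := by
  obtain ⟨D⟩ := nonempty_dualBases χ
  refine partialBos_ext hτ fun a l x ha hx => partialBos_ext hτ fun b l' y hb hy =>
    Subtype.ext ?_
  have hg : word (FA χ J) l' ∈ Algebra.adjoin k (Set.range (FA χ J)) := by
    induction l' generalizing y with
    | nil => rw [word_nil]; exact one_mem _
    | cons i l' ih =>
      rw [word_cons]
      refine mul_mem (Algebra.subset_adjoin ⟨i, rfl⟩) (ih ⟨_, (PartialBos χ τ J).mul_mem
        (K_mem_partialBos hτ hb) (word_mem_partialBos l')⟩ rfl)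
  rw [(H D a b ha hb _ _ (word_mem_natWeightSpan l) _ hg x y hx hy).2,
    (H' D a b ha hb _ _ (word_mem_natWeightSpan l) _ hg x y hx hy).2]

end TwistFormula

/-! ### The formula for the twisted coaction in terms of dual bases. -/

section CoactionFormula

variable {χ : SymmetricBicharacter k n} {τ : Equiv.Perm (Fin n)} (c : Fin n → k)
  {J : PreNicholsIdeal χ}

theorem map_proj_gammaHom (e : Bos χ 1 J) :
    TensorProduct.map LinearMap.id (U.proj χ (le_maxIdeal J)).toLinearMap (gammaHom χ J J e) =
      gammaHom χ J (maxIdeal χ) (Bos.proj χ 1 (le_maxIdeal J) e) := by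
  have : (Algebra.TensorProduct.map (AlgHom.id k (Bos χ (-1) J))
      (U.proj χ (le_maxIdeal J))).comp (gammaHom χ J J) =
      (gammaHom χ J (maxIdeal χ)).comp (Bos.proj χ 1 (le_maxIdeal J)) := by
    refine Bos.hom_ext (fun i => ?_) fun a => ?_
    · simp
    · simp
  exact DFunLike.congr_fun this e

theorem gammaHom_polyEval {μ : Weight n} {p : Tens k n} (hp : p ∈ weightSpan k (var k) μ) :
    gammaHom χ J (maxIdeal χ) (polyEval (Bos.X χ 1 (maxIdeal χ)) p) =
      KA χ J μ ⊗ₜ polyEval (U.E χ (maxIdeal χ)) p := by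
  have h1 : polyEval (fun i => (1 : Bos χ (-1) J) ⊗ₜ[k] U.E χ (maxIdeal χ) i) =
      Algebra.TensorProduct.includeRight.comp (polyEval (k := k) (U.E χ (maxIdeal χ))) := by
    ext i; simp
  have h2 : (fun i => gammaHom χ J (maxIdeal χ) (Bos.X χ 1 (maxIdeal χ) i)) =
      fun i => (KA χ J (α i) ⊗ₜ[k] (1 : U χ (maxIdeal χ))) * (1 ⊗ₜ[k] U.E χ (maxIdeal χ) i) := by
    ext i; simp
  rw [alghom_polyEval, h2, polyEval_twist (fun a => KA χ J a ⊗ₜ[k] (1 : U χ (maxIdeal χ))) _ _ _ _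
    hp, h1]
  · simp
  · rw [KA, Bos.K_zero]; rfl
  · intro a b; rw [KA, Bos.K_add, Algebra.TensorProduct.tmul_mul_tmul, one_mul]
  · intro a i; simp

/-- The coproduct distributes the letters over the two legs, and each letter in the first leg leaves
its `K_i⁻¹` in the second. So the group-like factor has minus the weight of the first leg, which
accounts for `K_{μ-a}` in the formula. -/
theorem copComul_word_mem (l : List (Fin n)) : copComul χ J (word (FA χ J) l) ∈
    Submodule.span k {x | ∃ l₁ l₂ : List (Fin n),
      word (FA χ J) l₁ ⊗ₜ (word (FA χ J) l₂ * KA χ J (wordWeight l₂ - wordWeight l)) = x} := by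
  induction l with
  | nil =>
    refine Submodule.subset_span ⟨[], [], ?_⟩
    rw [word_nil, copComul_one, sub_self, KA, Bos.K_zero, mul_one]
  | cons i l ih =>
    rw [word_cons, copComul_F_mul]
    have key : Submodule.span k {x | ∃ l₁ l₂ : List (Fin n),
        word (FA χ J) l₁ ⊗ₜ[k] (word (FA χ J) l₂ * KA χ J (wordWeight l₂ - wordWeight l)) = x} ≤
        (Submodule.span k {x | ∃ l₁ l₂ : List (Fin n), word (FA χ J) l₁ ⊗ₜ[k]
          (word (FA χ J) l₂ * KA χ J (wordWeight l₂ - wordWeight (i :: l))) = x}).comap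
        (TensorProduct.map LinearMap.id (LinearMap.mulLeft k (FA χ J i)) +
          TensorProduct.map (LinearMap.mulLeft k (FA χ J i))
            (LinearMap.mulLeft k (KA χ J (-α i)))) := by
      refine Submodule.span_le.2 ?_
      rintro _ ⟨l₁, l₂, rfl⟩
      rw [SetLike.mem_coe, Submodule.mem_comap, LinearMap.add_apply, TensorProduct.map_tmul,
        TensorProduct.map_tmul]
      refine add_mem (Submodule.subset_span ⟨l₁, i :: l₂, ?_⟩) ?_
      · rw [LinearMap.mulLeft_apply, LinearMap.id_apply, word_cons, wordWeight_cons,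
          wordWeight_cons, add_sub_add_left_eq_sub, mul_assoc]
      · have e := weightSpan_mul_KA (weightSpan_word_mem (k := k) (FA χ J) l₂) (-α i)
        have e' : KA χ J (-α i) * word (FA χ J) l₂ =
            (χ (wordWeight l₂) (-α i))⁻¹ • (word (FA χ J) l₂ * KA χ J (-α i)) := by
          rw [e, smul_smul, inv_mul_cancel₀ (χ.ne_zero _ _), one_smul]
        rw [LinearMap.mulLeft_apply, LinearMap.mulLeft_apply, ← word_cons, ← mul_assoc, e',
          smul_mul_assoc, mul_assoc, KA, KA, ← Bos.K_add, TensorProduct.tmul_smul]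
        refine Submodule.smul_mem _ _ (Submodule.subset_span ⟨i :: l₁, l₂, ?_⟩)
        rw [wordWeight_cons, show wordWeight l₂ - (α i + wordWeight l) =
          -α i + (wordWeight l₂ - wordWeight l) by abel]
    exact key ih

/-- The twice iterated coproduct with a twisted coproduct in the first tensor factor. -/
def tripleCoact (h : Compatible χ τ J) : Bos χ (-1) J →ₗ[k]
    (Bos χ (-1) J ⊗[k] Bos χ 1 (maxIdeal χ)) ⊗[k] Bos χ (-1) (maxIdeal χ) :=
  TensorProduct.map
    (TensorProduct.map LinearMap.id (Bos.proj χ 1 (le_maxIdeal J)).toLinearMap ∘ₗ ccoact c h)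
    (Bos.proj χ (-1) (le_maxIdeal J)).toLinearMap ∘ₗ copComul χ J

theorem tripleCoact_mem (h : Compatible χ τ J) {a : Weight n} {y : Bos χ (-1) J}
    (hy : y ∈ weightSpan k (FA χ J) a) :
    tripleCoact c h y ∈ Submodule.span k {x | ∃ (b : Bos χ (-1) J) (l l' : List (Fin n)),
      (b ⊗ₜ word (Bos.X χ 1 (maxIdeal χ)) l) ⊗ₜ (word (Bos.X χ (-1) (maxIdeal χ)) l' *
        Bos.K χ (-1) (maxIdeal χ) (wordWeight l' - a)) = x} := by
  set S := Submodule.span k {x | ∃ (b : Bos χ (-1) J) (l l' : List (Fin n)),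
      (b ⊗ₜ[k] word (Bos.X χ 1 (maxIdeal χ)) l) ⊗ₜ[k] (word (Bos.X χ (-1) (maxIdeal χ)) l' *
        Bos.K χ (-1) (maxIdeal χ) (wordWeight l' - a)) = x} with hS
  induction hy using Submodule.span_induction with
  | mem y hy =>
    obtain ⟨l, hl, rfl⟩ := hy
    have key : Submodule.span k {x | ∃ l₁ l₂ : List (Fin n),
        word (FA χ J) l₁ ⊗ₜ[k] (word (FA χ J) l₂ * KA χ J (wordWeight l₂ - wordWeight l)) = x} ≤
        S.comap (TensorProduct.map (TensorProduct.map LinearMap.id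
          (Bos.proj χ 1 (le_maxIdeal J)).toLinearMap ∘ₗ ccoact c h)
          (Bos.proj χ (-1) (le_maxIdeal J)).toLinearMap) := by
      refine Submodule.span_le.2 ?_
      rintro _ ⟨l₁, l₂, rfl⟩
      rw [SetLike.mem_coe, Submodule.mem_comap, TensorProduct.map_tmul, LinearMap.comp_apply,
        AlgHom.toLinearMap_apply, map_mul, alghom_word, proj_K, hl]
      simp only [proj_X]
      have hle : Submodule.span k {x | ∃ (a : Bos χ (-1) J) (l : List (Fin n)),
          a ⊗ₜ[k] word (Bos.X χ 1 (maxIdeal χ)) l = x} ≤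
          S.comap ((TensorProduct.mk k (Bos χ (-1) J ⊗[k] Bos χ 1 (maxIdeal χ)) _).flip
            (word (Bos.X χ (-1) (maxIdeal χ)) l₂ *
              Bos.K χ (-1) (maxIdeal χ) (wordWeight l₂ - a))) := by
        refine Submodule.span_le.2 ?_
        rintro _ ⟨b, l', rfl⟩
        exact Submodule.subset_span ⟨b, l', l₂, rfl⟩
      exact hle (ccoact_word_mem c h l₁)
    exact key (copComul_word_mem l)
  | zero => rw [map_zero]; exact zero_mem _
  | add x y _ _ hx hy => rw [map_add]; exact add_mem hx hy
  | smul r x _ hx => rw [map_smul]; exact Submodule.smul_mem _ r hx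

/-- Contraction of the last leg is the right action of `e`, and contraction of the `U⁺` leg is the
left action through `σ`. -/
theorem contract_tripleCoact (h : Compatible χ τ J) (p : Tens k n) (e : Bos χ 1 (maxIdeal χ))
    (y : Bos χ (-1) J) :
    DualBases.contractE p (DualBases.contractF e (tripleCoact c h y)) =
      leftAct χ J (sigmaBar χ τ c p) (rightAct χ J e y) := by
  rw [← contractE_ccoact c h, rightAct, LinearMap.comp_apply, LinearMap.comp_apply, tripleCoact,
    LinearMap.comp_apply]
  generalize copComul χ J y = t
  congr 1
  induction t using TensorProduct.induction_on with
  | zero => simp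
  | tmul a b =>
    rw [TensorProduct.map_tmul, DualBases.contractF_tmul, TensorProduct.map_tmul]
    simp only [LinearEquiv.coe_coe, TensorProduct.rid_tmul, map_smul]
    rfl
  | add s t hs ht => simp only [map_add, hs, ht]

variable (χ J) in
/-- The map `(a ⊗ e) ⊗ y ↦ (a ⊗ y) γ(e)`. -/
def gammaContract :
    (Bos χ (-1) J ⊗[k] Bos χ 1 (maxIdeal χ)) ⊗[k] Bos χ (-1) (maxIdeal χ) →ₗ[k]
      Bos χ (-1) J ⊗[k] U χ (maxIdeal χ) :=
  TensorProduct.lift ((gammaMul χ J (maxIdeal χ)).compl₂ (U.ofBos χ (maxIdeal χ)).toLinearMap)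

theorem gammaContract_tripleCoact (h : Compatible χ τ J) (y : Bos χ (-1) J) :
    gammaContract χ J (tripleCoact c h y) = starCoactMax c h y := by
  rw [tripleCoact, starCoactMax, starCoact, LinearMap.comp_apply, LinearMap.comp_apply,
    LinearMap.comp_apply, LinearMap.comp_apply]
  generalize copComul χ J y = t
  induction t using TensorProduct.induction_on with
  | zero => simp
  | tmul b z =>
    rw [TensorProduct.map_tmul, TensorProduct.map_tmul, preCoact_tmul, LinearMap.comp_apply,
      gammaContract, TensorProduct.lift.tmul, LinearMap.compl₂_apply]
    generalize ccoact c h b = s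
    have e1 : U.ofBos χ (maxIdeal χ) (Bos.proj χ (-1) (le_maxIdeal J) z) =
        U.proj χ (le_maxIdeal J) (U.ofBos χ J z) := by
      have : (U.ofBos χ (maxIdeal χ)).comp (Bos.proj χ (-1) (le_maxIdeal J)) =
          (U.proj χ (le_maxIdeal J)).comp (U.ofBos χ J) := by
        refine Bos.hom_ext (fun i => ?_) fun a => ?_ <;> simp
      exact DFunLike.congr_fun this z
    simp only [AlgHom.toLinearMap_apply, e1]
    induction s using TensorProduct.induction_on with
    | zero => simp
    | tmul a e =>
      rw [TensorProduct.map_tmul, gammaMul_tmul, gammaMul_tmul, AlgHom.toLinearMap_apply,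
        ← map_proj_gammaHom]
      exact (map_mul (Algebra.TensorProduct.map (AlgHom.id k (Bos χ (-1) J))
        (U.proj χ (le_maxIdeal J))) (a ⊗ₜ U.ofBos χ J z) (gammaHom χ J J e)).symm
    | add s t hs ht => simp only [map_add, LinearMap.add_apply, hs, ht]
  | add s t hs ht => simp only [map_add, hs, ht]

theorem gammaContract_tmul (b : Bos χ (-1) J) {μ : Weight n} {p : Tens k n}
    (hp : p ∈ weightSpan k (var k) μ) (q : Tens k n) (a : Weight n) :
    gammaContract χ J ((b ⊗ₜ polyEval (Bos.X χ 1 (maxIdeal χ)) p) ⊗ₜ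
      (polyEval (Bos.X χ (-1) (maxIdeal χ)) q * Bos.K χ (-1) (maxIdeal χ) a)) =
    (b * KA χ J μ) ⊗ₜ (polyEval (U.F χ (maxIdeal χ)) q * U.K χ (maxIdeal χ) a *
      polyEval (U.E χ (maxIdeal χ)) p) := by
  rw [gammaContract, TensorProduct.lift.tmul, LinearMap.compl₂_apply, gammaMul_tmul,
    gammaHom_polyEval hp, AlgHom.toLinearMap_apply, map_mul, alghom_polyEval, U.ofBos_K,
    Algebra.TensorProduct.tmul_mul_tmul]
  simp only [U.ofBos_X]

/-- The triple tensor is expanded in dual bases in its two outer legs. Under `gammaContract` the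
factor `E_λ` becomes `K_λ ⊗ E_λ`, which explains the `K_λ` in the first leg of the formula. -/
theorem starCoactMax_hasFinsum (h : Compatible χ τ J) (D : DualBases χ) {v : Weight n}
    (hv : IsTheta τ v) {a : Fin n → ℕ} {y : Bos χ (-1) J}
    (hy : y ∈ weightSpan k (FA χ J) (natWeight a)) :
    HasFinsum (coactTerm χ τ c J D v a y) (starCoactMax c h (KA χ J v * y)) := by
  refine ((D.hasFinsum_contract (natWeight a) (gammaContract χ J) (tripleCoact_mem c h hy)).map
    (TensorProduct.map (LinearMap.mulLeft k (KA χ J v))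
      (LinearMap.mulLeft k (U.K χ (maxIdeal χ) v)))).congr (fun w => ?_) ?_
  · rw [map_sum]
    refine Finset.sum_congr rfl fun i _ => ?_
    rw [map_sum]
    refine Finset.sum_congr rfl fun j _ => ?_
    rw [contract_tripleCoact, gammaContract_tmul _ (D.e_mem w.1 i), TensorProduct.map_tmul,
      LinearMap.mulLeft_apply, LinearMap.mulLeft_apply]
    simp only [mul_assoc]
  · rw [gammaContract_tripleCoact, starCoactMax_theta_mul c h hv]

theorem coactM_isTwistedCoaction (h : Compatible χ τ J) :
    IsTwistedCoaction χ τ c J (coactM c h) := by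
  intro D v hv a f hf x hx
  have := starCoactMax_hasFinsum c h D hv hf
  refine ⟨this.1, ?_⟩
  rw [this.2, ← hx]
  exact inclM_coactM c h x

theorem isTwistedCoaction_unique (hτ : ∀ i, τ (τ i) = i)
    {Δ Δ' : PartialBos χ τ J →ₗ[k] PartialBos χ τ J ⊗[k] U χ (maxIdeal χ)}
    (H : IsTwistedCoaction χ τ c J Δ) (H' : IsTwistedCoaction χ τ c J Δ') : Δ = Δ' := by
  obtain ⟨D⟩ := nonempty_dualBases χ
  refine partialBos_ext hτ fun a l x ha hx => inclM_injective ?_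
  exact (H D a ha _ _ (word_mem_natWeightSpan l) x hx).2.trans
    (H' D a ha _ _ (word_mem_natWeightSpan l) x hx).2.symm

end CoactionFormula

/-! ### The projection `ψ` as the part of height zero of `x · 1`. -/

section Psi

variable {χ : SymmetricBicharacter k n} {τ : Equiv.Perm (Fin n)} (c : Fin n → k)
  {J : PreNicholsIdeal χ}

variable (χ J) in
/-- The elements of `H ⋉ U⁻` all of whose components have a factor `K_a` with `|a| ≤ r`. -/
def heightLE (r : ℤ) : Submodule k (Bos χ (-1) J) where
  carrier := {y | ∀ d, r < d → gradComp χ J 0 height d y = 0}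
  zero_mem' d _ := map_zero _
  add_mem' hx hy d hd := by rw [map_add, hx d hd, hy d hd, add_zero]
  smul_mem' s y hy d hd := by rw [map_smul, hy d hd, smul_zero]

theorem one_mem_heightLE : (1 : Bos χ (-1) J) ∈ heightLE χ J 0 := by
  intro d hd
  rw [gradComp_one, if_neg hd.ne']

theorem K_mul_mem_heightLE (a : Weight n) {r : ℤ} {y : Bos χ (-1) J} (hy : y ∈ heightLE χ J r) :
    KA χ J a * y ∈ heightLE χ J (r + height a) := by
  intro d hd
  rw [gradComp_K_mul, hy _ (by linarith), mul_zero]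

theorem height_neg_α (i : Fin n) : height (-α i) = -1 := by rw [map_neg, height_α]

/-- The part `kder` returns the factor `K_i` removed by `K_i⁻¹`, so it preserves the height of the
factors `K`; the part `lder` lowers it by two. -/
theorem uAct_EK_grad (i : Fin n) (d : ℤ) (y : Bos χ (-1) J) :
    gradComp χ J 0 height d (uAct χ J (U.E χ J i * U.K χ J (-α i)) y) =
      kder χ J i (KA χ J (-α i) * gradComp χ J 0 height d y) -
      lder χ J i (KA χ J (-α i) * gradComp χ J 0 height (d + 2) y) := by
  rw [uAct_mul, uAct_K, uAct_E, map_sub, gradComp_kder, gradComp_lder, gradComp_K_mul,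
    gradComp_K_mul, height_neg_α, height_α, AddMonoidHom.zero_apply]
  congr 4
  · ring_nf
  · ring_nf

/-- No generator of `U(χ)^poly` raises the height of the factors `K`. This would fail for `K_i`
itself and is why `ψ` is defined only on `U(χ)^poly`. -/
theorem uAct_mem_heightLE {x : U χ J} (hx : x ∈ Upoly χ τ J) {r : ℤ}
    {y : Bos χ (-1) J} (hy : y ∈ heightLE χ J r) : uAct χ J x y ∈ heightLE χ J r := by
  induction hx using Algebra.adjoin_induction generalizing y with
  | mem x hx =>
    rcases hx with ((⟨i, rfl⟩ | ⟨i, rfl⟩) | ⟨i, rfl⟩) | ⟨i, rfl⟩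
    · intro d hd
      rw [uAct_F, gradComp_F_mul, AddMonoidHom.zero_apply, sub_zero, hy d hd, mul_zero]
    · intro d hd
      rw [uAct_EK_grad, hy d hd, hy _ (by linarith)]
      simp
    · intro d hd
      rw [uAct_K]
      exact K_mul_mem_heightLE _ hy d (by rw [height_neg_α]; linarith)
    · intro d hd
      rw [uAct_K]
      exact K_mul_mem_heightLE _ hy d (by rw [map_sub, height_α, height_α]; linarith)
  | algebraMap s =>
    rw [AlgHom.commutes, Module.algebraMap_end_apply]
    exact Submodule.smul_mem _ s hy
  | add x x' _ _ hx hx' => rw [map_add, LinearMap.add_apply]; exact add_mem (hx hy) (hx' hy)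
  | mul x x' _ _ hx hx' => rw [uAct_mul]; exact hx (hx' hy)

variable (χ J) in
/-- The component of `x · 1` of degree `0` with respect to the grading by the factors `K_a`. -/
def psiU : U χ J →ₗ[k] Bos χ (-1) J :=
  gradComp χ J 0 height 0 ∘ₗ LinearMap.applyₗ (1 : Bos χ (-1) J) ∘ₗ (uAct χ J).toLinearMap

theorem psiU_apply (x : U χ J) : psiU χ J x = gradComp χ J 0 height 0 (uAct χ J x 1) := rfl

theorem gradComp_partialBos (hτ : ∀ i, τ (τ i) = i) {y : Bos χ (-1) J}
    (hy : y ∈ PartialBos χ τ J) : gradComp χ J 0 height 0 y = y := by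
  have : Subalgebra.toSubmodule (PartialBos χ τ J) ≤
      LinearMap.eqLocus (gradComp χ J 0 height 0) LinearMap.id := by
    rw [partialBos_eq_span hτ]
    refine Submodule.span_le.2 ?_
    rintro _ ⟨a, l, ha, rfl⟩
    rw [SetLike.mem_coe, LinearMap.mem_eqLocus, LinearMap.id_apply, gradComp_K_mul, ha.height,
      sub_zero]
    congr 1
    induction l with
    | nil => rw [word_nil, gradComp_one, if_pos rfl]
    | cons i l ih => rw [word_cons, gradComp_F_mul, AddMonoidHom.zero_apply, sub_zero, ih]
  exact this hy

theorem psiU_ofBos (hτ : ∀ i, τ (τ i) = i) {y : Bos χ (-1) J} (hy : y ∈ PartialBos χ τ J) :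
    psiU χ J (U.ofBos χ J y) = y := by
  rw [psiU_apply, uAct_ofBos, mul_one, gradComp_partialBos hτ hy]

theorem psiU_one : psiU χ J 1 = 1 := by
  rw [psiU_apply, map_one (uAct χ J), Module.End.one_apply, gradComp_one, if_pos rfl]

theorem psiU_mul_EK (x : U χ J) (i : Fin n) : psiU χ J (x * (U.E χ J i * U.K χ J (-α i))) = 0 := by
  have e : uAct χ J (U.E χ J i * U.K χ J (-α i)) 1 = 0 := by
    rw [uAct_mul, uAct_K, uAct_E, kder_K_mul, lder_K_mul]
    simp
  rw [psiU_apply, uAct_mul, e, map_zero, map_zero]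

/-- `K_i⁻¹` moves `1` to height `-1`, from where `U(χ)^poly` cannot return to height `0`. -/
theorem psiU_mul_K {x : U χ J} (hx : x ∈ Upoly χ τ J) (i : Fin n) :
    psiU χ J (x * U.K χ J (-α i)) = 0 := by
  have h1 : uAct χ J (U.K χ J (-α i)) 1 ∈ heightLE χ J (-1) := by
    rw [uAct_K]
    have := K_mul_mem_heightLE (-α i) (one_mem_heightLE (χ := χ) (J := J))
    rwa [height_neg_α, zero_add] at this
  rw [psiU_apply, uAct_mul]
  exact uAct_mem_heightLE hx h1 0 (by norm_num)

/-- In height `0` only the part `kder` of `E_τ(i)` survives, since `lder` would need a component of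
height `2`. What is left is the formula of `starF`. -/
theorem psiU_genB_mul {x : U χ J} (hx : x ∈ Upoly χ τ J) (i : Fin n) :
    psiU χ J (genB χ τ c J i * x) = starF χ τ c J i (psiU χ J x) := by
  have e : U.E χ J (τ i) * U.K χ J (-α i) =
      (U.E χ J (τ i) * U.K χ J (-α (τ i))) * U.K χ J (α (τ i) - α i) := by
    rw [mul_assoc, ← U.K_add, neg_add_eq_sub, sub_sub_cancel_left]
  have h2 : uAct χ J x 1 ∈ heightLE χ J 0 := uAct_mem_heightLE hx one_mem_heightLE
  have h0 : height (α (τ i) - α i) = 0 := by rw [map_sub, height_α, height_α, sub_self]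
  rw [psiU_apply, genB, uAct_mul, map_add, map_smul, LinearMap.add_apply, LinearMap.smul_apply,
    uAct_F, map_add, gradComp_F_mul, AddMonoidHom.zero_apply, sub_zero, map_smul, e, uAct_mul,
    uAct_EK_grad, uAct_K, gradComp_K_mul, gradComp_K_mul, h0, h2 (0 + 2 - 0) (by norm_num),
    mul_zero, mul_zero, map_zero, sub_zero, sub_zero, starF_apply, ← psiU_apply, ← mul_assoc, KA,
    KA, ← Bos.K_add, neg_add_eq_sub, sub_sub_cancel_left, ← KA, kder_K_mul, χ.neg_left, inv_inv,
    smul_smul]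

theorem psiU_K_mul {a : Weight n} (ha : IsTheta τ a) (x : U χ J) :
    psiU χ J (U.K χ J a * x) = KA χ J a * psiU χ J x := by
  rw [psiU_apply, uAct_mul, uAct_K, gradComp_K_mul, ha.height, sub_zero, psiU_apply]

theorem K_mul_partialBos (hτ : ∀ i, τ (τ i) = i) (b : Weight n) {x : Bos χ (-1) J}
    (hx : x ∈ PartialBos χ τ J) : ∃ y ∈ PartialBos χ τ J, KA χ J b * x = y * KA χ J b := by
  have : Subalgebra.toSubmodule (PartialBos χ τ J) ≤
      ((Subalgebra.toSubmodule (PartialBos χ τ J)).map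
        (LinearMap.mulRight k (KA χ J b))).comap (LinearMap.mulLeft k (KA χ J b)) := by
    conv_lhs => rw [partialBos_eq_span hτ]
    refine Submodule.span_le.2 ?_
    rintro _ ⟨a, l, ha, rfl⟩
    refine ⟨(χ (wordWeight l) b)⁻¹ • (KA χ J a * word (FA χ J) l), Submodule.smul_mem _ _
      ((PartialBos χ τ J).mul_mem (K_mem_partialBos hτ ha) (word_mem_partialBos l)), ?_⟩
    rw [LinearMap.mulRight_apply, LinearMap.mulLeft_apply, smul_mul_assoc, mul_assoc,
      weightSpan_mul_KA (weightSpan_word_mem (k := k) (FA χ J) l), mul_smul_comm, smul_smul,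
      inv_mul_cancel₀ (χ.ne_zero _ _), one_smul, ← mul_assoc, KA_comm, mul_assoc]
  obtain ⟨y, hy, e⟩ := this hx
  exact ⟨y, hy, e.symm⟩

theorem lgrp_mem_partialBos (hτ : ∀ i, τ (τ i) = i) (b : Weight n) {x : Bos χ (-1) J}
    (hx : x ∈ PartialBos χ τ J) : lgrp χ J b x ∈ PartialBos χ τ J := by
  have : Subalgebra.toSubmodule (PartialBos χ τ J) ≤
      (Subalgebra.toSubmodule (PartialBos χ τ J)).comap (lgrp χ J b) := by
    conv_lhs => rw [partialBos_eq_span hτ]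
    refine Submodule.span_le.2 ?_
    rintro _ ⟨a, l, ha, rfl⟩
    rw [SetLike.mem_coe, Submodule.mem_comap, lgrp_K_mul]
    refine Submodule.smul_mem _ _ ((PartialBos χ τ J).mul_mem (K_mem_partialBos hτ ha) ?_)
    induction l with
    | nil => rw [word_nil, lgrp_one]; exact one_mem _
    | cons i l ih => rw [word_cons, lgrp_F_mul]; exact mul_mem (F_mem_partialBos i) ih
  exact this hx

/-- Each term of `lder` carries a factor `K_j⁻¹`, which can be moved to the right end. -/
theorem lder_partialBos (hτ : ∀ i, τ (τ i) = i) (j : Fin n) {x : Bos χ (-1) J}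
    (hx : x ∈ PartialBos χ τ J) :
    ∃ y ∈ PartialBos χ τ J, lder χ J j x = y * KA χ J (-α j) := by
  have : Subalgebra.toSubmodule (PartialBos χ τ J) ≤
      ((Subalgebra.toSubmodule (PartialBos χ τ J)).map
        (LinearMap.mulRight k (KA χ J (-α j)))).comap (lder χ J j) := by
    conv_lhs => rw [partialBos_eq_span hτ]
    refine Submodule.span_le.2 ?_
    rintro _ ⟨a, l, ha, rfl⟩
    have key : ∃ y ∈ PartialBos χ τ J, lder χ J j (word (FA χ J) l) = y * KA χ J (-α j) := by
      induction l with
      | nil => exact ⟨0, zero_mem _, by rw [word_nil, lder_one, zero_mul]⟩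
      | cons i l ih =>
        obtain ⟨y, hy, e⟩ := ih
        obtain ⟨z, hz, e'⟩ := K_mul_partialBos hτ (-α i) (word_mem_partialBos (τ := τ) (J := J) l)
        refine ⟨(if i = j then 1 else 0 : k) • z + FA χ J i * y,
          add_mem (Subalgebra.smul_mem _ hz _) (mul_mem (F_mem_partialBos i) hy), ?_⟩
        rw [word_cons, lder_F_mul, e, e', add_mul, smul_mul_assoc, mul_assoc]
        split_ifs with hij
        · rw [hij]
        · rw [zero_smul, zero_smul]
    obtain ⟨y, hy, e⟩ := key
    refine ⟨(χ a (α j))⁻¹ • (KA χ J a * y), Submodule.smul_mem _ _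
      ((PartialBos χ τ J).mul_mem (K_mem_partialBos hτ ha) hy), ?_⟩
    rw [LinearMap.mulRight_apply, lder_K_mul, e, smul_mul_assoc, mul_assoc]
  obtain ⟨y, hy, e⟩ := this hx
  exact ⟨y, hy, e.symm⟩

variable (χ τ J) in
/-- The left ideal of `U(χ)^poly` generated by `E_i K_i⁻¹` and `K_i⁻¹`. -/
def psiKer : Submodule k (U χ J) :=
  Submodule.span k ({x | ∃ y ∈ Upoly χ τ J, ∃ i, x = y * (U.E χ J i * U.K χ J (-α i))} ∪
    {x | ∃ y ∈ Upoly χ τ J, ∃ i, x = y * U.K χ J (-α i)})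

theorem F_mem_Upoly (i : Fin n) : U.F χ J i ∈ Upoly χ τ J := Algebra.subset_adjoin (by simp)

theorem EK_mem_Upoly (i : Fin n) : U.E χ J i * U.K χ J (-α i) ∈ Upoly χ τ J :=
  Algebra.subset_adjoin (by simp)

theorem K_neg_mem_Upoly (i : Fin n) : U.K χ J (-α i) ∈ Upoly χ τ J :=
  Algebra.subset_adjoin (by simp)

theorem ofBos_mem_Upoly {y : Bos χ (-1) J} (hy : y ∈ PartialBos χ τ J) :
    U.ofBos χ J y ∈ Upoly χ τ J := by
  have : PartialBos χ τ J ≤ (Upoly χ τ J).comap (U.ofBos χ J) := by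
    refine Algebra.adjoin_le ?_
    rintro _ (⟨i, rfl⟩ | ⟨i, rfl⟩)
    · rw [SetLike.mem_coe, Subalgebra.mem_comap, U.ofBos_K]
      exact Algebra.subset_adjoin (by simp)
    · rw [SetLike.mem_coe, Subalgebra.mem_comap, U.ofBos_X]
      exact F_mem_Upoly i
  exact this hy

theorem mul_EK_mem_psiKer {y : U χ J} (hy : y ∈ Upoly χ τ J) (i : Fin n) :
    y * (U.E χ J i * U.K χ J (-α i)) ∈ psiKer χ τ J :=
  Submodule.subset_span (Or.inl ⟨y, hy, i, rfl⟩)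

theorem mul_K_mem_psiKer {y : U χ J} (hy : y ∈ Upoly χ τ J) (i : Fin n) :
    y * U.K χ J (-α i) ∈ psiKer χ τ J :=
  Submodule.subset_span (Or.inr ⟨y, hy, i, rfl⟩)

theorem mul_mem_psiKer {x y : U χ J} (hx : x ∈ Upoly χ τ J) (hy : y ∈ psiKer χ τ J) :
    x * y ∈ psiKer χ τ J := by
  have : psiKer χ τ J ≤ (psiKer χ τ J).comap (LinearMap.mulLeft k x) := by
    conv_lhs => rw [psiKer]
    refine Submodule.span_le.2 ?_
    rintro _ (⟨y, hy, i, rfl⟩ | ⟨y, hy, i, rfl⟩)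
    · rw [SetLike.mem_coe, Submodule.mem_comap, LinearMap.mulLeft_apply, ← mul_assoc]
      exact mul_EK_mem_psiKer (mul_mem hx hy) i
    · rw [SetLike.mem_coe, Submodule.mem_comap, LinearMap.mulLeft_apply, ← mul_assoc]
      exact mul_K_mem_psiKer (mul_mem hx hy) i
  exact this hy

/-- Commuting `E_i K_i⁻¹` to the right yields a term ending in `E_i K_i⁻¹`, a term in `H_θ ⋉ U⁻` in
which the factors `K_i` and `K_i⁻¹` cancel, and a term ending in `K_i⁻¹`. -/
theorem EK_mul_ofBos_mem (hτ : ∀ i, τ (τ i) = i) (i : Fin n) {m : Bos χ (-1) J}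
    (hm : m ∈ PartialBos χ τ J) : U.E χ J i * U.K χ J (-α i) * U.ofBos χ J m ∈
      (Subalgebra.toSubmodule (PartialBos χ τ J)).map (U.ofBos χ J).toLinearMap ⊔
        psiKer χ τ J := by
  obtain ⟨m', hm', e1⟩ := K_mul_partialBos hτ (-α i) hm
  obtain ⟨x, hx, e2⟩ := K_mul_partialBos hτ (α i) (rder_mem_partialBos hτ i hm')
  obtain ⟨y, hy, e3⟩ := lder_partialBos hτ i hm'
  have e4 : lgrp χ J (α i) (m' * KA χ J (-α i)) =
      (χ (-α i) (α i))⁻¹ • (lgrp χ J (α i) m' * KA χ J (-α i)) := by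
    rw [lgrp_mul, ← mul_one (KA χ J (-α i)), lgrp_K_mul, lgrp_one, mul_one, mul_smul_comm]
  have e5 : U.K χ J (-α i) * U.E χ J i = χ (-α i) (α i) • (U.E χ J i * U.K χ J (-α i)) :=
    U.K_E χ J _ _
  have e6 : U.E χ J i * U.K χ J (-α i) * U.ofBos χ J m =
      U.ofBos χ J (lgrp χ J (α i) m') * (U.E χ J i * U.K χ J (-α i)) +
      U.ofBos χ J x - U.ofBos χ J y * U.K χ J (-α i) * U.K χ J (-α i) := by
    rw [mul_assoc, ← U.ofBos_K, ← map_mul (U.ofBos χ J), ← KA, e1, E_mul_ofBos, rder_mul_K,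
      lder_mul_K, e3, e4, ← U.ofBos_K, ← map_mul (U.ofBos χ J), ← KA, ← mul_assoc, e2]
    simp only [map_mul, map_smul, U.ofBos_K, KA]
    rw [smul_mul_assoc, mul_assoc (U.ofBos χ J (lgrp χ J (α i) m')), e5, mul_smul_comm, smul_smul,
      inv_mul_cancel₀ (χ.ne_zero _ _), one_smul, mul_assoc (U.ofBos χ J x), ← U.K_add,
      add_neg_cancel, U.K_zero, mul_one]
  rw [e6]
  refine sub_mem (add_mem (Submodule.mem_sup_right (mul_EK_mem_psiKer
    (ofBos_mem_Upoly (lgrp_mem_partialBos hτ _ hm')) i))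
    (Submodule.mem_sup_left ⟨x, hx, rfl⟩)) (Submodule.mem_sup_right ?_)
  exact mul_K_mem_psiKer (mul_mem (ofBos_mem_Upoly hy) (K_neg_mem_Upoly i)) i

/-- The sum contains `1` and is stable under left multiplication by the generators. Directness
follows from `psiU`, which is the identity on the first summand and zero on the second. -/
theorem Upoly_le (hτ : ∀ i, τ (τ i) = i) : Subalgebra.toSubmodule (Upoly χ τ J) ≤
    (Subalgebra.toSubmodule (PartialBos χ τ J)).map (U.ofBos χ J).toLinearMap ⊔
      psiKer χ τ J := by
  set S := (Subalgebra.toSubmodule (PartialBos χ τ J)).map (U.ofBos χ J).toLinearMap ⊔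
    psiKer χ τ J with hS
  have h1 : (1 : U χ J) ∈ S := Submodule.mem_sup_left ⟨1, one_mem (PartialBos χ τ J), map_one (U.ofBos χ J)⟩
  have step : ∀ x ∈ Upoly χ τ J, (∀ m ∈ PartialBos χ τ J, x * U.ofBos χ J m ∈ S) →
      ∀ y ∈ S, x * y ∈ S := by
    intro x hx hm y hy
    obtain ⟨_, ⟨m, hm', rfl⟩, z, hz, rfl⟩ := Submodule.mem_sup.1 hy
    rw [mul_add]
    exact add_mem (hm m hm') (Submodule.mem_sup_right (mul_mem_psiKer hx hz))
  have key : ∀ x ∈ Upoly χ τ J, ∀ y ∈ S, x * y ∈ S := by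
    intro x hx
    induction hx using Algebra.adjoin_induction with
    | mem x hx =>
      have hx' : x ∈ Upoly χ τ J := Algebra.subset_adjoin hx
      refine step x hx' fun m hm => ?_
      rcases hx with ((⟨i, rfl⟩ | ⟨i, rfl⟩) | ⟨i, rfl⟩) | ⟨i, rfl⟩
      · refine Submodule.mem_sup_left ⟨FA χ J i * m, (PartialBos χ τ J).mul_mem (F_mem_partialBos i) hm, ?_⟩
        rw [AlgHom.toLinearMap_apply, map_mul, U.ofBos_X]
      · exact EK_mul_ofBos_mem hτ i hm
      · obtain ⟨m', hm', e⟩ := K_mul_partialBos hτ (-α i) hm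
        refine Submodule.mem_sup_right ?_
        have := mul_K_mem_psiKer (ofBos_mem_Upoly hm') i
        rwa [← U.ofBos_K, ← map_mul, ← KA, ← e, map_mul, U.ofBos_K] at this
      · refine Submodule.mem_sup_left ⟨KA χ J (α i - α (τ i)) * m,
          (PartialBos χ τ J).mul_mem (K_mem_partialBos hτ (isTheta_sub τ hτ i)) hm, ?_⟩
        rw [AlgHom.toLinearMap_apply, map_mul, U.ofBos_K]
    | algebraMap r => intro y hy; rw [← Algebra.smul_def]; exact S.smul_mem r hy
    | add x y _ _ hx hy => intro z hz; rw [add_mul]; exact add_mem (hx z hz) (hy z hz)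
    | mul x y _ _ hx hy => intro z hz; rw [mul_assoc]; exact hx _ (hy z hz)
  intro x hx
  rw [← mul_one x]
  exact key x hx 1 h1

theorem psiU_psiKer {x : U χ J} (hx : x ∈ psiKer χ τ J) : psiU χ J x = 0 := by
  have : psiKer χ τ J ≤ LinearMap.ker (psiU χ J) := by
    refine Submodule.span_le.2 ?_
    rintro _ (⟨y, hy, i, rfl⟩ | ⟨y, hy, i, rfl⟩)
    · exact psiU_mul_EK y i
    · exact psiU_mul_K hy i
  exact this hx

theorem psiU_mem (hτ : ∀ i, τ (τ i) = i) (x : Upoly χ τ J) :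
    (psiU χ J ∘ₗ (Upoly χ τ J).val.toLinearMap) x ∈
      Subalgebra.toSubmodule (PartialBos χ τ J) := by
  obtain ⟨_, ⟨m, hm, rfl⟩, z, hz, e⟩ := Submodule.mem_sup.1 (Upoly_le hτ x.2)
  rw [LinearMap.comp_apply, AlgHom.toLinearMap_apply, Subalgebra.coe_val, ← e, map_add,
    psiU_psiKer hz, add_zero, AlgHom.toLinearMap_apply, psiU_ofBos hτ hm]
  exact hm

/-- The projection `ψ : U(χ)^poly → H_θ ⋉ U⁻`. -/
def psi (hτ : ∀ i, τ (τ i) = i) : Upoly χ τ J →ₗ[k] PartialBos χ τ J :=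
  (psiU χ J ∘ₗ (Upoly χ τ J).val.toLinearMap).codRestrict
    (Subalgebra.toSubmodule (PartialBos χ τ J)) (psiU_mem hτ)

theorem psi_coe (hτ : ∀ i, τ (τ i) = i) (x : Upoly χ τ J) :
    (psi hτ x : Bos χ (-1) J) = psiU χ J x := rfl

theorem psi_isPsi (hτ : ∀ i, τ (τ i) = i) : IsPsi χ τ J (psi hτ) := by
  refine ⟨fun x a hx => Subtype.ext ?_, fun x y i hx => Subtype.ext ?_,
    fun x y i hx => Subtype.ext ?_⟩
  · rw [psi_coe, hx, psiU_ofBos hτ a.2]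
  · rw [psi_coe, hx, psiU_mul_EK]; rfl
  · rw [psi_coe, hx, psiU_mul_K y.2]; rfl

/-- The three conditions prescribe the map on both summands, and these span `U(χ)^poly`. -/
theorem isPsi_unique (hτ : ∀ i, τ (τ i) = i) {ψ ψ' : Upoly χ τ J →ₗ[k] PartialBos χ τ J}
    (H : IsPsi χ τ J ψ) (H' : IsPsi χ τ J ψ') : ψ = ψ' := by
  have hle : psiKer χ τ J ≤ (LinearMap.eqLocus ψ ψ').map (Upoly χ τ J).val.toLinearMap := by
    refine Submodule.span_le.2 ?_
    rintro _ (⟨y, hy, i, rfl⟩ | ⟨y, hy, i, rfl⟩)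
    · refine ⟨⟨y, hy⟩ * ⟨_, EK_mem_Upoly i⟩, ?_, rfl⟩
      exact (H.2.1 _ ⟨y, hy⟩ i rfl).trans (H'.2.1 _ ⟨y, hy⟩ i rfl).symm
    · refine ⟨⟨y, hy⟩ * ⟨_, K_neg_mem_Upoly i⟩, ?_, rfl⟩
      exact (H.2.2 _ ⟨y, hy⟩ i rfl).trans (H'.2.2 _ ⟨y, hy⟩ i rfl).symm
  have hle' : (Subalgebra.toSubmodule (PartialBos χ τ J)).map (U.ofBos χ J).toLinearMap ≤
      (LinearMap.eqLocus ψ ψ').map (Upoly χ τ J).val.toLinearMap := by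
    rintro _ ⟨m, hm, rfl⟩
    exact ⟨⟨_, ofBos_mem_Upoly hm⟩, (H.1 _ ⟨m, hm⟩ rfl).trans (H'.1 _ ⟨m, hm⟩ rfl).symm, rfl⟩
  ext x
  obtain ⟨y, hy, e⟩ := (Upoly_le hτ).trans (sup_le hle' hle) x.2
  have : y = x := Subtype.ext e
  rw [← this, show ψ y = ψ' y from hy]

end Psi

/-! ### The filtrations by number of factors and the leading terms of `ψ`. -/

section Filtration

variable {χ : SymmetricBicharacter k n} {τ : Equiv.Perm (Fin n)} (c : Fin n → k)
  {J : PreNicholsIdeal χ}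

variable (χ τ J) in
/-- The part of `B_c` spanned by the products `K_a B_{l_1} ⋯ B_{l_r}` with `r < m`. -/
def filtB (m : ℕ) : Submodule k (U χ J) :=
  Submodule.span k {x | ∃ (a : Weight n) (l : List (Fin n)), IsTheta τ a ∧ l.length < m ∧
    U.K χ J a * word (genB χ τ c J) l = x}

variable (χ τ J) in
/-- The part of `H_θ ⋉ U⁻` spanned by the products `K_a F_{l_1} ⋯ F_{l_r}` with `r < m`. -/
def filtA (m : ℕ) : Submodule k (Bos χ (-1) J) :=
  Submodule.span k {x | ∃ (a : Weight n) (l : List (Fin n)), IsTheta τ a ∧ l.length < m ∧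
    KA χ J a * word (FA χ J) l = x}

theorem K_word_mem_filtB {a : Weight n} (ha : IsTheta τ a) {l : List (Fin n)} {m : ℕ}
    (hl : l.length < m) : U.K χ J a * word (genB χ τ c J) l ∈ filtB χ τ c J m :=
  Submodule.subset_span ⟨a, l, ha, hl, rfl⟩

theorem word_mem_filtB {l : List (Fin n)} {m : ℕ} (hl : l.length < m) :
    word (genB χ τ c J) l ∈ filtB χ τ c J m := by
  have := K_word_mem_filtB c (χ := χ) (J := J) (isTheta_zero τ) hl
  rwa [U.K_zero, one_mul] at this

theorem K_word_mem_filtA {a : Weight n} (ha : IsTheta τ a) {l : List (Fin n)} {m : ℕ}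
    (hl : l.length < m) : KA χ J a * word (FA χ J) l ∈ filtA χ τ J m :=
  Submodule.subset_span ⟨a, l, ha, hl, rfl⟩

theorem filtB_mono {m m' : ℕ} (h : m ≤ m') : filtB χ τ c J m ≤ filtB χ τ c J m' :=
  Submodule.span_mono fun _ ⟨a, l, ha, hl, e⟩ => ⟨a, l, ha, hl.trans_le h, e⟩

theorem filtA_mono {m m' : ℕ} (h : m ≤ m') : filtA χ τ J m ≤ filtA χ τ J m' :=
  Submodule.span_mono fun _ ⟨a, l, ha, hl, e⟩ => ⟨a, l, ha, hl.trans_le h, e⟩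

theorem K_mul_mem_filtB {a : Weight n} (ha : IsTheta τ a) {m : ℕ} {x : U χ J}
    (hx : x ∈ filtB χ τ c J m) : U.K χ J a * x ∈ filtB χ τ c J m := by
  have : filtB χ τ c J m ≤ (filtB χ τ c J m).comap (LinearMap.mulLeft k (U.K χ J a)) := by
    refine Submodule.span_le.2 ?_
    rintro _ ⟨b, l, hb, hl, rfl⟩
    rw [SetLike.mem_coe, Submodule.mem_comap, LinearMap.mulLeft_apply, ← mul_assoc, ← U.K_add]
    exact K_word_mem_filtB c (ha.add hb) hl
  exact this hx

theorem K_mul_mem_filtA {a : Weight n} (ha : IsTheta τ a) {m : ℕ} {x : Bos χ (-1) J}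
    (hx : x ∈ filtA χ τ J m) : KA χ J a * x ∈ filtA χ τ J m := by
  have : filtA χ τ J m ≤ (filtA χ τ J m).comap (LinearMap.mulLeft k (KA χ J a)) := by
    refine Submodule.span_le.2 ?_
    rintro _ ⟨b, l, hb, hl, rfl⟩
    rw [SetLike.mem_coe, Submodule.mem_comap, LinearMap.mulLeft_apply, ← mul_assoc, KA, KA,
      ← Bos.K_add]
    exact K_word_mem_filtA (ha.add hb) hl
  exact this hx

/-- Both summands of `B_i` have the same commutation factor, because `χ(a, α_τ(i))` is inverse to
`χ(a, α_i)` on `ℤⁿ_θ`. -/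
theorem genB_mul_K (h : Compatible χ τ J) {a : Weight n} (ha : IsTheta τ a) (i : Fin n) :
    genB χ τ c J i * U.K χ J a = χ a (α i) • (U.K χ J a * genB χ τ c J i) := by
  have e := χ.theta_perm τ h.invol h.bichar ha i
  rw [genB, add_mul, mul_add, U.K_F, mul_smul_comm, ← mul_assoc (U.K χ J a), U.K_E, e, smul_add,
    smul_smul, mul_inv_cancel₀ (χ.ne_zero _ _), one_smul, smul_mul_assoc, smul_mul_assoc,
    mul_assoc, mul_assoc, ← U.K_add, ← U.K_add, add_comm a, smul_smul, smul_smul,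
    mul_comm (χ a (α i)) (c i), mul_inv_cancel_right₀ (χ.ne_zero _ _)]

theorem genB_mul_mem_filtB (h : Compatible χ τ J) (i : Fin n) {m : ℕ} {x : U χ J}
    (hx : x ∈ filtB χ τ c J m) : genB χ τ c J i * x ∈ filtB χ τ c J (m + 1) := by
  have : filtB χ τ c J m ≤
      (filtB χ τ c J (m + 1)).comap (LinearMap.mulLeft k (genB χ τ c J i)) := by
    refine Submodule.span_le.2 ?_
    rintro _ ⟨b, l, hb, hl, rfl⟩
    rw [SetLike.mem_coe, Submodule.mem_comap, LinearMap.mulLeft_apply, ← mul_assoc,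
      genB_mul_K c h hb, smul_mul_assoc, mul_assoc, ← word_cons]
    exact Submodule.smul_mem _ _ (K_word_mem_filtB c hb (by simpa using hl))
  exact this hx

theorem word_mul_mem_filtB (h : Compatible χ τ J) (u : List (Fin n)) {m : ℕ} {x : U χ J}
    (hx : x ∈ filtB χ τ c J m) : word (genB χ τ c J) u * x ∈ filtB χ τ c J (u.length + m) := by
  induction u with
  | nil => rwa [word_nil, one_mul, List.length_nil, zero_add]
  | cons i u ih =>
    rw [word_cons, mul_assoc, List.length_cons, add_right_comm]
    exact genB_mul_mem_filtB c h i ih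

theorem mul_word_mem_filtB (u : List (Fin n)) {m : ℕ} {x : U χ J}
    (hx : x ∈ filtB χ τ c J m) : x * word (genB χ τ c J) u ∈ filtB χ τ c J (m + u.length) := by
  have : filtB χ τ c J m ≤
      (filtB χ τ c J (m + u.length)).comap (LinearMap.mulRight k (word (genB χ τ c J) u)) := by
    refine Submodule.span_le.2 ?_
    rintro _ ⟨b, l, hb, hl, rfl⟩
    rw [SetLike.mem_coe, Submodule.mem_comap, LinearMap.mulRight_apply, mul_assoc, ← word_append]
    exact K_word_mem_filtB c hb (by simpa using hl)
  exact this hx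

theorem word_mem_Bc (l : List (Fin n)) : word (genB χ τ c J) l ∈ Bc χ τ c J := by
  induction l with
  | nil => rw [word_nil]; exact one_mem _
  | cons i l ih => rw [word_cons]; exact mul_mem (genB_mem_Bc c i) ih

theorem filtB_le_Bc (hτ : ∀ i, τ (τ i) = i) (m : ℕ) :
    filtB χ τ c J m ≤ Subalgebra.toSubmodule (Bc χ τ c J) := by
  refine Submodule.span_le.2 ?_
  rintro _ ⟨a, l, ha, hl, rfl⟩
  exact (Bc χ τ c J).mul_mem (K_mem_Bc c hτ ha) (word_mem_Bc c l)

theorem exists_mem_filtB (h : Compatible χ τ J) (x : Bc χ τ c J) :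
    ∃ m, (x : U χ J) ∈ filtB χ τ c J m := by
  let S : Submodule k (Bc χ τ c J) :=
    { carrier := {x | ∃ m, (x : U χ J) ∈ filtB χ τ c J m}
      zero_mem' := ⟨0, zero_mem _⟩
      add_mem' := by
        rintro x y ⟨m, hm⟩ ⟨m', hm'⟩
        exact ⟨max m m', add_mem (filtB_mono c (le_max_left _ _) hm)
          (filtB_mono c (le_max_right _ _) hm')⟩
      smul_mem' := fun r x ⟨m, hm⟩ => ⟨m, Submodule.smul_mem _ r hm⟩ }
  have : S = ⊤ := Bc_eq_top c h.invol S ⟨1, word_mem_filtB c (l := []) Nat.one_pos⟩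
    (fun i x ⟨m, hm⟩ => ⟨m + 1, genB_mul_mem_filtB c h i hm⟩)
    (fun a ha x ⟨m, hm⟩ => ⟨m, K_mul_mem_filtB c ha hm⟩)
  exact (this ▸ Submodule.mem_top : x ∈ S)

theorem lenSpan_le_filtA {r m : ℕ} (h : r < m) : lenSpan χ J r ≤ filtA χ τ J m := by
  refine Submodule.span_le.2 ?_
  rintro _ ⟨l, rfl, rfl⟩
  have := K_word_mem_filtA (χ := χ) (J := J) (isTheta_zero τ) h
  rwa [KA, Bos.K_zero, one_mul] at this

theorem starF_word_sub_mem (hτ : ∀ i, τ (τ i) = i) (i : Fin n) (l : List (Fin n)) :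
    starF χ τ c J i (word (FA χ J) l) - word (FA χ J) (i :: l) ∈ filtA χ τ J (l.length + 1) := by
  rw [starF_apply', word_cons, add_sub_cancel_left]
  exact Submodule.smul_mem _ _ (K_mul_mem_filtA (isTheta_swap_sub hτ i)
    (lenSpan_le_filtA (by omega) (rder_word_mem (τ i) l)))

theorem starF_mem_filtA (hτ : ∀ i, τ (τ i) = i) (i : Fin n) {m : ℕ} {y : Bos χ (-1) J}
    (hy : y ∈ filtA χ τ J m) : starF χ τ c J i y ∈ filtA χ τ J (m + 1) := by
  have : filtA χ τ J m ≤ (filtA χ τ J (m + 1)).comap (starF χ τ c J i) := by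
    refine Submodule.span_le.2 ?_
    rintro _ ⟨b, l, hb, hl, rfl⟩
    rw [SetLike.mem_coe, Submodule.mem_comap, starF_apply', ← mul_assoc, FA_KA, smul_mul_assoc,
      mul_assoc, ← word_cons, rder_K_mul]
    refine add_mem (Submodule.smul_mem _ _ (K_word_mem_filtA hb (by simpa using hl)))
      (Submodule.smul_mem _ _ (K_mul_mem_filtA (isTheta_swap_sub hτ i) ?_))
    refine Submodule.smul_mem _ _ (K_mul_mem_filtA hb
      (lenSpan_le_filtA (by omega) (rder_word_mem (τ i) l)))
  exact this hy

theorem mem_Upoly_of_mem_Bc (hτ : ∀ i, τ (τ i) = i) {x : U χ J} (hx : x ∈ Bc χ τ c J) :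
    x ∈ Upoly χ τ J := Bc_le_Upoly χ τ c J hτ hx

/-- `ψ` carries multiplication by `B_i` to `starF`, whose correction term has fewer letters. So `ψ`
is the identity on leading terms. -/
theorem psiU_word_sub_mem (hτ : ∀ i, τ (τ i) = i) (l : List (Fin n)) :
    psiU χ J (word (genB χ τ c J) l) - word (FA χ J) l ∈ filtA χ τ J l.length := by
  induction l with
  | nil => rw [word_nil, word_nil, psiU_one, sub_self]; exact zero_mem _
  | cons i l ih =>
    rw [word_cons, psiU_genB_mul c (mem_Upoly_of_mem_Bc c hτ (word_mem_Bc c l))]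
    have := add_mem (starF_mem_filtA c hτ i ih) (starF_word_sub_mem c (J := J) hτ i l)
    rwa [map_sub, sub_add_sub_cancel] at this

/-- A leading term lifts to the corresponding product of the `B_i`, and the error is lifted by
induction. -/
theorem filtA_le_map (hτ : ∀ i, τ (τ i) = i) (m : ℕ) :
    filtA χ τ J m ≤ (filtB χ τ c J m).map (psiU χ J) := by
  induction m with
  | zero =>
    refine Submodule.span_le.2 ?_
    rintro _ ⟨a, l, ha, hl, rfl⟩
    exact absurd hl (Nat.not_lt_zero _)
  | succ m ih =>
    refine Submodule.span_le.2 ?_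
    rintro _ ⟨a, l, ha, hl, rfl⟩
    obtain ⟨b, hb, e⟩ := ih (filtA_mono (Nat.lt_succ_iff.1 hl)
      (K_mul_mem_filtA ha (psiU_word_sub_mem c (J := J) hτ l)))
    refine ⟨U.K χ J a * word (genB χ τ c J) l - b, sub_mem (K_word_mem_filtB c ha hl)
      (filtB_mono c m.le_succ hb), ?_⟩
    rw [map_sub, e, psiU_K_mul ha, mul_sub, sub_sub_cancel]

/-! ### The coproduct on the filtration -/

theorem comul_genB (i : Fin n) : Bialgebra.comulAlgHom k (U χ J) (genB χ τ c J i) =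
    1 ⊗ₜ U.F χ J i + genB χ τ c J i ⊗ₜ U.K χ J (-α i) +
      (c i * χ (α i) (α (τ i))) • U.K χ J (α (τ i) - α i) ⊗ₜ
        (U.K χ J (-α i) * U.E χ J (τ i)) := by
  have e : U.K χ J (-α i) * U.E χ J (τ i) = (χ (α i) (α (τ i)))⁻¹ •
      (U.E χ J (τ i) * U.K χ J (-α i)) := by rw [U.K_E, χ.neg_left]
  rw [e, TensorProduct.tmul_smul, smul_smul, mul_assoc, mul_inv_cancel₀ (χ.ne_zero _ _), mul_one]
  simp [genB, add_mul, TensorProduct.add_tmul, sub_eq_add_neg, U.K_add, TensorProduct.smul_tmul']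
  abel

/-- The subspace `V ⊗ U(χ)` of `U(χ) ⊗ U(χ)`. -/
def leftTensor (V : Submodule k (U χ J)) : Submodule k (U χ J ⊗[k] U χ J) :=
  LinearMap.range (TensorProduct.map V.subtype (LinearMap.id (R := k) (M := U χ J)))

theorem tmul_mem_leftTensor {V : Submodule k (U χ J)} {x : U χ J} (hx : x ∈ V) (y : U χ J) :
    x ⊗ₜ[k] y ∈ leftTensor V := ⟨⟨x, hx⟩ ⊗ₜ y, by simp⟩

theorem leftTensor_le {V : Submodule k (U χ J)} {W : Submodule k (U χ J ⊗[k] U χ J)}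
    (h : ∀ x ∈ V, ∀ y, x ⊗ₜ[k] y ∈ W) : leftTensor V ≤ W := by
  rintro _ ⟨t, rfl⟩
  induction t using TensorProduct.induction_on with
  | zero => rw [map_zero]; exact zero_mem _
  | tmul x y => exact h x x.2 y
  | add s t hs ht => rw [map_add]; exact add_mem hs ht

theorem leftTensor_mono {V V' : Submodule k (U χ J)} (h : V ≤ V') : leftTensor V ≤ leftTensor V' :=
  leftTensor_le fun _ hx y => tmul_mem_leftTensor (h hx) y

theorem comul_genB_mul_mem (h : Compatible χ τ J) (i : Fin n) {m : ℕ} {t : U χ J ⊗[k] U χ J}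
    (ht : t ∈ leftTensor (filtB χ τ c J m)) :
    Bialgebra.comulAlgHom k (U χ J) (genB χ τ c J i) * t ∈
      leftTensor (filtB χ τ c J (m + 1)) := by
  have : leftTensor (filtB χ τ c J m) ≤ (leftTensor (filtB χ τ c J (m + 1))).comap
      (LinearMap.mulLeft k (Bialgebra.comulAlgHom k (U χ J) (genB χ τ c J i))) := by
    refine leftTensor_le fun x hx y => ?_
    rw [Submodule.mem_comap, LinearMap.mulLeft_apply, comul_genB, add_mul, add_mul, smul_mul_assoc,
      Algebra.TensorProduct.tmul_mul_tmul, Algebra.TensorProduct.tmul_mul_tmul,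
      Algebra.TensorProduct.tmul_mul_tmul, one_mul]
    exact add_mem (add_mem (tmul_mem_leftTensor (filtB_mono c m.le_succ hx) _)
      (tmul_mem_leftTensor (genB_mul_mem_filtB c h i hx) _))
      (Submodule.smul_mem _ _ (tmul_mem_leftTensor (filtB_mono c m.le_succ
        (K_mul_mem_filtB c (isTheta_swap_sub h.invol i) hx)) _))
  exact this ht

/-- Of the three summands in the coproduct of `B_i`, only `B_i ⊗ K_i⁻¹` keeps the number of factors
in the first leg. -/
theorem comul_word_sub_mem (h : Compatible χ τ J) (l : List (Fin n)) :
    Bialgebra.comulAlgHom k (U χ J) (word (genB χ τ c J) l) -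
      word (genB χ τ c J) l ⊗ₜ U.K χ J (-wordWeight l) ∈
      leftTensor (filtB χ τ c J l.length) := by
  induction l with
  | nil =>
    rw [word_nil, map_one, wordWeight_nil, neg_zero, U.K_zero, ← Algebra.TensorProduct.one_def,
      sub_self]
    exact zero_mem _
  | cons i l ih =>
    have e : Bialgebra.comulAlgHom k (U χ J) (word (genB χ τ c J) (i :: l)) -
        word (genB χ τ c J) (i :: l) ⊗ₜ U.K χ J (-wordWeight (i :: l)) =
        Bialgebra.comulAlgHom k (U χ J) (genB χ τ c J i) *
          (Bialgebra.comulAlgHom k (U χ J) (word (genB χ τ c J) l) -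
            word (genB χ τ c J) l ⊗ₜ U.K χ J (-wordWeight l)) +
        (word (genB χ τ c J) l ⊗ₜ (U.F χ J i * U.K χ J (-wordWeight l)) +
        (c i * χ (α i) (α (τ i))) • (U.K χ J (α (τ i) - α i) * word (genB χ τ c J) l) ⊗ₜ
          (U.K χ J (-α i) * U.E χ J (τ i) * U.K χ J (-wordWeight l))) := by
      rw [word_cons, wordWeight_cons, neg_add, U.K_add, map_mul (Bialgebra.comulAlgHom k (U χ J)),
        mul_sub]
      nth_rewrite 3 [comul_genB]
      rw [add_mul, add_mul, smul_mul_assoc,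
        Algebra.TensorProduct.tmul_mul_tmul, Algebra.TensorProduct.tmul_mul_tmul,
        Algebra.TensorProduct.tmul_mul_tmul, one_mul]
      abel
    rw [e]
    have hl : word (genB χ τ c J) l ∈ filtB χ τ c J (l.length + 1) :=
      word_mem_filtB c l.length.lt_succ_self
    exact add_mem (comul_genB_mul_mem c h i ih) (add_mem (tmul_mem_leftTensor hl _)
      (Submodule.smul_mem _ _ (tmul_mem_leftTensor
        (K_mul_mem_filtB c (isTheta_swap_sub h.invol i) hl) _)))

theorem comul_mem_leftTensor (h : Compatible χ τ J) {m : ℕ} {x : U χ J}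
    (hx : x ∈ filtB χ τ c J m) :
    Bialgebra.comulAlgHom k (U χ J) x ∈ leftTensor (filtB χ τ c J m) := by
  have : filtB χ τ c J m ≤ (leftTensor (filtB χ τ c J m)).comap
      (Bialgebra.comulAlgHom k (U χ J)).toLinearMap := by
    refine Submodule.span_le.2 ?_
    rintro _ ⟨a, l, ha, hl, rfl⟩
    rw [SetLike.mem_coe, Submodule.mem_comap, AlgHom.toLinearMap_apply,
      map_mul (Bialgebra.comulAlgHom k (U χ J)), Bialgebra.comulAlgHom_apply, U.comul_K]
    have h1 : Bialgebra.comulAlgHom k (U χ J) (word (genB χ τ c J) l) ∈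
        leftTensor (filtB χ τ c J m) := by
      have := add_mem (leftTensor_mono (filtB_mono c hl.le) (comul_word_sub_mem c h l))
        (tmul_mem_leftTensor (word_mem_filtB c (χ := χ) (τ := τ) (J := J) hl)
          (U.K χ J (-wordWeight l)))
      rwa [sub_add_cancel] at this
    have h2 : leftTensor (filtB χ τ c J m) ≤ (leftTensor (filtB χ τ c J m)).comap
        (LinearMap.mulLeft k (U.K χ J a ⊗ₜ[k] U.K χ J a)) := by
      refine leftTensor_le fun x hx y => ?_
      rw [Submodule.mem_comap, LinearMap.mulLeft_apply, Algebra.TensorProduct.tmul_mul_tmul]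
      exact tmul_mem_leftTensor (K_mul_mem_filtB c ha hx) _
    exact h2 h1
  exact this hx

/-- `starCoact_starF` mirrors the coproduct of `B_i`, so `ψ` is compatible with coactions. This is
stated before projecting to the maximal quotient because the injectivity argument needs the full
coproduct of `U(χ)`. -/
theorem starCoact_psiU (h : Compatible χ τ J) {m : ℕ} {x : U χ J} (hx : x ∈ filtB χ τ c J m) :
    starCoact c h (psiU χ J x) = TensorProduct.map (psiU χ J) LinearMap.id
      (Bialgebra.comulAlgHom k (U χ J) x) := by
  have key : ∀ l, starCoact c h (psiU χ J (word (genB χ τ c J) l)) =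
      TensorProduct.map (psiU χ J) LinearMap.id
        (Bialgebra.comulAlgHom k (U χ J) (word (genB χ τ c J) l)) := by
    intro l
    induction l with
    | nil =>
      rw [word_nil, psiU_one, starCoact_one, map_one (Bialgebra.comulAlgHom k (U χ J)),
        Algebra.TensorProduct.one_def, TensorProduct.map_tmul, psiU_one, LinearMap.id_apply]
    | cons i l ih =>
      have hw := comul_mem_leftTensor c h (word_mem_filtB c (χ := χ) (τ := τ) (J := J)
        l.length.lt_succ_self)
      rw [word_cons, psiU_genB_mul c (mem_Upoly_of_mem_Bc c h.invol (word_mem_Bc c l)),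
        starCoact_starF, ih, map_mul (Bialgebra.comulAlgHom k (U χ J))]
      obtain ⟨t, ht⟩ := hw
      rw [← ht]
      clear ih ht
      induction t using TensorProduct.induction_on with
      | zero => simp
      | tmul b y =>
        have hb := mem_Upoly_of_mem_Bc c h.invol (filtB_le_Bc c h.invol _ b.2)
        rw [comul_genB, TensorProduct.map_tmul, add_mul, add_mul, smul_mul_assoc,
          Algebra.TensorProduct.tmul_mul_tmul, Algebra.TensorProduct.tmul_mul_tmul,
          Algebra.TensorProduct.tmul_mul_tmul, one_mul]
        simp only [TensorProduct.map_tmul, map_add, map_smul, LinearMap.id_apply,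
          Submodule.subtype_apply, LinearMap.mulLeft_apply]
        rw [psiU_genB_mul c hb, psiU_K_mul (isTheta_swap_sub h.invol i)]
      | add s t hs ht =>
        simp only [map_add, mul_add, smul_add] at hs ht ⊢
        linear_combination (norm := abel) hs + ht
  have : filtB χ τ c J m ≤ LinearMap.eqLocus (starCoact c h ∘ₗ psiU χ J)
      (TensorProduct.map (psiU χ J) LinearMap.id ∘ₗ
        (Bialgebra.comulAlgHom k (U χ J)).toLinearMap) := by
    refine Submodule.span_le.2 ?_
    rintro _ ⟨a, l, ha, hl, rfl⟩
    rw [SetLike.mem_coe, LinearMap.mem_eqLocus, LinearMap.comp_apply, LinearMap.comp_apply,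
      psiU_K_mul ha, starCoact_theta_mul c h ha, key, AlgHom.toLinearMap_apply,
      map_mul (Bialgebra.comulAlgHom k (U χ J)), Bialgebra.comulAlgHom_apply k (U χ J) (U.K χ J a),
      U.comul_K]
    generalize Bialgebra.comulAlgHom k (U χ J) (word (genB χ τ c J) l) = t
    induction t using TensorProduct.induction_on with
    | zero => simp
    | tmul b y =>
      rw [Algebra.TensorProduct.tmul_mul_tmul]
      simp only [TensorProduct.map_tmul, LinearMap.id_apply, LinearMap.mulLeft_apply]
      rw [psiU_K_mul ha]
    | add s t hs ht => simp only [map_add, mul_add, hs, ht]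
  exact this hx

end Filtration

/-! ### Homogeneous components of the tensor algebra by length. -/

section LengthComponent

/-- The projection of the tensor algebra onto its component of degree `m`. -/
def tensComp (k : Type*) [Field k] (n m : ℕ) : Tens k n →ₗ[k] Tens k n :=
  (Polynomial.lcoeff (Tens k n) m).restrictScalars k ∘ₗ
    (polyEval fun i => Polynomial.C (var k (n := n) i) * Polynomial.X).toLinearMap

theorem tensComp_word (m : ℕ) (l : List (Fin n)) :
    tensComp k n m (word (var k) l) = if l.length = m then word (var k) l else 0 := by
  have : word (fun i => Polynomial.C (var k (n := n) i) * Polynomial.X) l =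
      Polynomial.monomial l.length (word (var k) l) := by
    induction l with
    | nil => rw [word_nil, word_nil]; rfl
    | cons i l ih =>
      rw [word_cons, word_cons, ih, Polynomial.C_mul_X_eq_monomial, Polynomial.monomial_mul_monomial,
        List.length_cons, add_comm]
  change (polyEval (fun i => Polynomial.C (var k (n := n) i) * Polynomial.X)
    (word (var k) l)).coeff m = _
  rw [polyEval_word, this, Polynomial.coeff_monomial]

variable (k) in
/-- The homogeneous polynomials of degree `m`. -/
def tensLen (n m : ℕ) : Submodule k (Tens k n) :=
  Submodule.span k {p | ∃ l : List (Fin n), l.length = m ∧ word (var k) l = p}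

theorem tensComp_of_mem {m : ℕ} {p : Tens k n} (hp : p ∈ tensLen k n m) (m' : ℕ) :
    tensComp k n m' p = if m = m' then p else 0 := by
  have : tensLen k n m ≤ LinearMap.eqLocus (tensComp k n m')
      (if m = m' then LinearMap.id else 0) := by
    refine Submodule.span_le.2 ?_
    rintro _ ⟨l, rfl, rfl⟩
    rw [SetLike.mem_coe, LinearMap.mem_eqLocus, tensComp_word]
    split_ifs <;> rfl
  rw [show tensComp k n m' p = _ from this hp]
  split_ifs <;> rfl

theorem mem_tensLen_of_mem_weightSpan {μ : Fin n → ℕ} {p : Tens k n}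
    (hp : p ∈ weightSpan k (var k) (natWeight μ)) : p ∈ tensLen k n (∑ i, μ i) := by
  refine Submodule.span_mono ?_ hp
  rintro _ ⟨l, hl, rfl⟩
  refine ⟨l, ?_, rfl⟩
  have := height_wordWeight l
  rw [hl, height_natWeight] at this
  exact_mod_cast this.symm

theorem mul_mem_tensLen {m m' : ℕ} {p q : Tens k n} (hp : p ∈ tensLen k n m)
    (hq : q ∈ tensLen k n m') : p * q ∈ tensLen k n (m + m') := by
  have := Submodule.mul_mem_mul hp hq
  rw [tensLen, tensLen, Submodule.span_mul_span] at this
  refine Submodule.span_mono ?_ this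
  rintro _ ⟨_, ⟨l, rfl, rfl⟩, _, ⟨l', rfl, rfl⟩, rfl⟩
  exact ⟨l ++ l', by simp, word_append _ _ _⟩

theorem word_mem_tensLen (l : List (Fin n)) : word (var k) l ∈ tensLen k n l.length :=
  Submodule.subset_span ⟨l, rfl, rfl⟩

end LengthComponent

/-! ### Injectivity of `ψ` under condition (c). -/

section Injectivity

variable {χ : SymmetricBicharacter k n} {τ : Equiv.Perm (Fin n)} (c : Fin n → k)
  {J : PreNicholsIdeal χ}

theorem psiU_polyEval_sub_mem (hτ : ∀ i, τ (τ i) = i) {m : ℕ} {p : Tens k n}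
    (hp : p ∈ tensLen k n m) :
    psiU χ J (polyEval (genB χ τ c J) p) - polyEval (FA χ J) p ∈ filtA χ τ J m := by
  have : tensLen k n m ≤ (filtA χ τ J m).comap (psiU χ J ∘ₗ (polyEval (genB χ τ c J)).toLinearMap -
      (polyEval (FA χ J)).toLinearMap) := by
    refine Submodule.span_le.2 ?_
    rintro _ ⟨l, rfl, rfl⟩
    rw [SetLike.mem_coe, Submodule.mem_comap, LinearMap.sub_apply, LinearMap.comp_apply,
      AlgHom.toLinearMap_apply, AlgHom.toLinearMap_apply, polyEval_word, polyEval_word]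
    exact psiU_word_sub_mem c hτ l
  exact this hp

theorem comul_polyEval_sub_mem (h : Compatible χ τ J) {μ : Fin n → ℕ} {p : Tens k n}
    (hp : p ∈ weightSpan k (var k) (natWeight μ)) :
    Bialgebra.comulAlgHom k (U χ J) (polyEval (genB χ τ c J) p) -
      polyEval (genB χ τ c J) p ⊗ₜ U.K χ J (-natWeight μ) ∈
      leftTensor (filtB χ τ c J (∑ i, μ i)) := by
  have : weightSpan k (var k) (natWeight μ) ≤ (leftTensor (filtB χ τ c J (∑ i, μ i))).comap
      ((Bialgebra.comulAlgHom k (U χ J)).toLinearMap ∘ₗ (polyEval (genB χ τ c J)).toLinearMap -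
      (TensorProduct.mk k _ _).flip (U.K χ J (-natWeight μ)) ∘ₗ
        (polyEval (genB χ τ c J)).toLinearMap) := by
    refine Submodule.span_le.2 ?_
    rintro _ ⟨l, hl, rfl⟩
    have e := height_wordWeight l
    rw [hl, height_natWeight] at e
    have e' : ∑ i, μ i = l.length := by exact_mod_cast e
    rw [SetLike.mem_coe, Submodule.mem_comap, LinearMap.sub_apply, LinearMap.comp_apply,
      LinearMap.comp_apply, AlgHom.toLinearMap_apply, AlgHom.toLinearMap_apply, polyEval_word,
      LinearMap.flip_apply, TensorProduct.mk_apply, ← hl, e']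
    exact comul_word_sub_mem c h l
  exact this hp

variable (χ J) in
/-- The elements of `H ⋉ U⁻` all of whose components have a factor `K_a` with `|a| < r`. -/
def weightLT (r : ℤ) : Submodule k (Bos χ (-1) J) where
  carrier := {y | ∀ d, r ≤ height d → gradComp χ J 0 (AddMonoidHom.id _) d y = 0}
  zero_mem' d _ := map_zero _
  add_mem' hx hy d hd := by rw [map_add, hx d hd, hy d hd, add_zero]
  smul_mem' s y hy d hd := by rw [map_smul, hy d hd, smul_zero]

theorem K_mul_mem_weightLT (a : Weight n) {r : ℤ} {y : Bos χ (-1) J} (hy : y ∈ weightLT χ J r) :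
    KA χ J a * y ∈ weightLT χ J (r + height a) := by
  intro d hd
  rw [gradComp_K_mul, AddMonoidHom.id_apply, hy _ (by rw [map_sub]; linarith), mul_zero]

/-- In the flipped module each of the two summands of `B_i` creates at most one factor `K_i`. -/
theorem flipAct_genB_mem (i : Fin n) {r : ℤ} {y : Bos χ (-1) J} (hy : y ∈ weightLT χ J r) :
    flipAct χ J (genB χ τ c J i) y ∈ weightLT χ J (r + 1) := by
  rw [genB, map_add, LinearMap.add_apply, map_smul, LinearMap.smul_apply, flipAct_mul, flipAct_F,
    flipAct_E, flipAct_K, neg_neg]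
  refine add_mem (sub_mem ?_ ?_) (Submodule.smul_mem _ _ ?_)
  · intro d hd
    rw [gradComp_kder, hy, map_zero]
    rw [AddMonoidHom.zero_apply, AddMonoidHom.id_apply, map_sub, map_add, map_zero, height_α]
    linarith
  · intro d hd
    rw [gradComp_lder, hy, map_zero]
    rw [AddMonoidHom.zero_apply, AddMonoidHom.id_apply, map_add, map_add, map_zero, height_α]
    linarith
  · intro d hd
    rw [gradComp_F_mul, AddMonoidHom.zero_apply, sub_zero, K_mul_mem_weightLT (α i) hy d,
      mul_zero]
    rwa [height_α]

/-- Fewer than `m` factors `B_i` cannot produce a group-like factor of height `m`, and elements of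
`H_θ` do not change the height. -/
theorem cartanCoeff_filtB {m : ℕ} {x : U χ J} (hx : x ∈ filtB χ τ c J m) {l : Weight n}
    (hl : height l = m) : cartanCoeff χ J l x = 0 := by
  have : filtB χ τ c J m ≤ LinearMap.ker (cartanCoeff χ J l) := by
    refine Submodule.span_le.2 ?_
    rintro _ ⟨a, w, ha, hw, rfl⟩
    have key : flipAct χ J (word (genB χ τ c J) w) 1 ∈ weightLT χ J (w.length + 1) := by
      clear hw
      induction w with
      | nil =>
        rw [word_nil, map_one (flipAct χ J), Module.End.one_apply]
        intro d hd
        classical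
        rw [gradComp_one, if_neg]
        rintro rfl
        rw [map_zero] at hd
        simp at hd
      | cons i w ih =>
        rw [word_cons, flipAct_mul, List.length_cons]
        push_cast
        exact flipAct_genB_mem c i ih
    rw [SetLike.mem_coe, LinearMap.mem_ker, cartanCoeff_apply, flipAct_mul, flipAct_K,
      K_mul_mem_weightLT (-a) key, map_zero]
    rw [map_neg, ha.height, hl]
    omega
  exact this hx

/-- The core of part 2. The leading term of `ψ(p(B))` is `p(F) = 0`, so a shorter `b` has the same
image. The difference `Z` is then shown to be a multiple of `K_{-μ}`, and the vanishing of the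
coefficient of `K_{-μ}` forces `p(B) = b`. -/
theorem polyEval_mem_filtB_of_condition (h : Compatible χ τ J) {μ : Fin n → ℕ} {p : Tens k n}
    (hp : p ∈ weightSpan k (var k) (natWeight μ)) (hpJ : p ∈ J.ideal)
    (hc : cartanCoeff χ J (natWeight μ) (polyEval (genB χ τ c J) p) = 0)
    (hinj : ∀ x ∈ filtB χ τ c J (∑ i, μ i), psiU χ J x = 0 → x = 0) :
    polyEval (genB χ τ c J) p ∈ filtB χ τ c J (∑ i, μ i) := by
  set m := ∑ i, μ i with hm
  have hF : polyEval (FA χ J) p = 0 := Bos.polyEval_X χ (-1) J p hpJ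
  have h1 := psiU_polyEval_sub_mem c (J := J) h.invol (mem_tensLen_of_mem_weightSpan hp)
  rw [hF, sub_zero] at h1
  obtain ⟨b, hb, e⟩ := filtA_le_map c h.invol _ h1
  set Z := polyEval (genB χ τ c J) p - b with hZ
  have hZ0 : psiU χ J Z = 0 := by rw [hZ, map_sub, e, sub_self]
  have hZm : Z ∈ filtB χ τ c J (m + 1) := by
    refine sub_mem ?_ (filtB_mono c m.le_succ hb)
    have : tensLen k n m ≤ (filtB χ τ c J (m + 1)).comap
        (polyEval (genB χ τ c J)).toLinearMap := by
      refine Submodule.span_le.2 ?_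
      rintro _ ⟨l, hl, rfl⟩
      rw [SetLike.mem_coe, Submodule.mem_comap, AlgHom.toLinearMap_apply, polyEval_word]
      exact word_mem_filtB c (by omega)
    exact this (mem_tensLen_of_mem_weightSpan hp)
  have hcom : Bialgebra.comulAlgHom k (U χ J) Z - Z ⊗ₜ U.K χ J (-natWeight μ) ∈
      leftTensor (filtB χ τ c J m) := by
    have := sub_mem (comul_polyEval_sub_mem c h hp)
      (sub_mem (comul_mem_leftTensor c h hb) (tmul_mem_leftTensor hb (U.K χ J (-natWeight μ))))
    rwa [sub_sub_sub_comm, ← map_sub, ← TensorProduct.sub_tmul] at this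
  obtain ⟨t, ht⟩ := hcom
  -- Applying `ψ` to the first leg gives the coaction of `ψ(Z) = 0`. Since `ψ` is injective in lower
  -- filtration degree, and stays so after tensoring over a field, the lower part of the coproduct
  -- vanishes.
  have ht0 : t = 0 := by
    have hi : Function.Injective (psiU χ J ∘ₗ (filtB χ τ c J m).subtype) := by
      rw [← LinearMap.ker_eq_bot, LinearMap.ker_eq_bot']
      exact fun x hx => Subtype.ext (hinj x x.2 hx)
    refine Module.Flat.rTensor_preserves_injective_linearMap (M := U χ J) _ hi ?_
    rw [map_zero]
    have := congrArg (TensorProduct.map (psiU χ J) LinearMap.id) ht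
    rw [map_map_apply, map_sub, ← starCoact_psiU c h hZm, hZ0, map_zero, TensorProduct.map_tmul,
      hZ0, TensorProduct.zero_tmul, sub_zero] at this
    exact this
  rw [ht0, map_zero] at ht
  have hgrp : Coalgebra.comul (R := k) Z = Z ⊗ₜ U.K χ J (-natWeight μ) := sub_eq_zero.1 ht.symm
  -- Applying the counit to the first leg of `Δ(Z) = Z ⊗ K_{-μ}`.
  have hZK : Z = Coalgebra.counit (R := k) Z • U.K χ J (-natWeight μ) := by
    have := Coalgebra.rTensor_counit_comul (R := k) Z
    rw [hgrp, LinearMap.rTensor_tmul] at this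
    have := congrArg (TensorProduct.lid k _) this
    simpa using this.symm
  -- The coefficient of `K_{-μ}` is zero for `p(B)` by hypothesis and for `b` because `b` has too
  -- few factors.
  have hε : Coalgebra.counit (R := k) Z = 0 := by
    have h2 := congrArg (cartanCoeff χ J (natWeight μ)) hZK
    rw [map_smul, cartanCoeff_K, hZ, map_sub, hc, cartanCoeff_filtB c hb (height_natWeight μ),
      ← hZ, sub_zero, smul_eq_mul, mul_one] at h2
    exact h2.symm
  rw [hε, zero_smul, hZ, sub_eq_zero] at hZK
  rwa [hZK]

/-- A relation of degree `m` is a sum of terms `u p v` with words `u`, `v` and a generator `p`;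
projecting to length `m` discards the terms of other degrees. The words restore the filtration
degree that `p` falls short of. -/
theorem polyEval_mem_filtB_of_mem_ideal (h : Compatible χ τ J) (hC : ConditionC χ τ c J) {m : ℕ}
    (hinj : ∀ x ∈ filtB χ τ c J m, psiU χ J x = 0 → x = 0) {q : Tens k n} (hq : q ∈ J.ideal)
    (hqm : q ∈ tensLen k n m) : polyEval (genB χ τ c J) q ∈ filtB χ τ c J m := by
  obtain ⟨S, hS, hSC⟩ := hC
  have key : J.ideal ≤ (filtB χ τ c J m).comap
      ((polyEval (genB χ τ c J)).toLinearMap ∘ₗ tensComp k n m) := by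
    rw [hS]
    refine Submodule.span_le.2 ?_
    rintro _ ⟨p, hp, a, b, rfl⟩
    obtain ⟨μ, hμ, y, hy, hy0⟩ := hSC p hp
    have hpJ : p ∈ J.ideal := by
      rw [hS]; exact Submodule.subset_span ⟨p, hp, 1, 1, by rw [one_mul, mul_one]⟩
    rw [SetLike.mem_coe]
    induction a using tens_induction with
    | hadd a a' ha ha' => rw [add_mul, add_mul]; exact add_mem ha ha'
    | hsmul r a ha => rw [smul_mul_assoc, smul_mul_assoc]; exact Submodule.smul_mem _ _ ha
    | hw u =>
    induction b using tens_induction with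
    | hadd a a' ha ha' => rw [mul_add]; exact add_mem ha ha'
    | hsmul r a ha => rw [mul_smul_comm]; exact Submodule.smul_mem _ _ ha
    | hw v =>
    rw [Submodule.mem_comap, LinearMap.comp_apply, tensComp_of_mem (mul_mem_tensLen
      (mul_mem_tensLen (word_mem_tensLen u) (mem_tensLen_of_mem_weightSpan hμ))
      (word_mem_tensLen v))]
    split_ifs with hm
    · rw [AlgHom.toLinearMap_apply, map_mul, map_mul, polyEval_word, polyEval_word, ← hm]
      refine mul_word_mem_filtB c v (word_mul_mem_filtB c h u ?_)
      exact polyEval_mem_filtB_of_condition c h hμ hpJ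
        (cartanCoeff_eq_zero_of_isComponent hy hy0)
        fun x hx => hinj x (filtB_mono c (by omega) hx)
    · rw [map_zero]; exact zero_mem _
  have := key hq
  rwa [Submodule.mem_comap, LinearMap.comp_apply, tensComp_of_mem hqm, if_pos rfl] at this

/-- The bigrading of `H ⋉ U⁻` by the length in the generators `F_i` and the factor `K_a`. -/
def lenGrad (χ : SymmetricBicharacter k n) (J : PreNicholsIdeal χ) (m : ℕ) (a : Weight n) :
    Module.End k (Bos χ (-1) J) :=
  gradComp χ J ((AddMonoidHom.inl ℤ (Weight n)).comp height) (AddMonoidHom.inr ℤ (Weight n)) (m, a)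

theorem lenGrad_K_word (m : ℕ) (a b : Weight n) (l : List (Fin n)) :
    lenGrad χ J m a (KA χ J b * word (FA χ J) l) =
      if l.length = m ∧ b = a then KA χ J b * word (FA χ J) l else 0 := by
  classical
  have key : ∀ d, gradComp χ J ((AddMonoidHom.inl ℤ (Weight n)).comp height)
      (AddMonoidHom.inr ℤ (Weight n)) d (word (FA χ J) l) =
      if d = ((l.length : ℤ), 0) then word (FA χ J) l else 0 := by
    induction l with
    | nil => intro d; rw [word_nil, gradComp_one]; rfl
    | cons i l ih =>
      intro d
      rw [word_cons, gradComp_F_mul, ih, mul_ite, mul_zero]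
      refine if_congr ?_ rfl rfl
      rw [sub_eq_iff_eq_add]
      simp [height_α]
  rw [lenGrad, gradComp_K_mul, key, mul_ite, mul_zero]
  refine if_congr ?_ rfl rfl
  rw [sub_eq_iff_eq_add]
  simp [eq_comm]

theorem lenGrad_filtA (m : ℕ) (a : Weight n) {y : Bos χ (-1) J} (hy : y ∈ filtA χ τ J m) :
    lenGrad χ J m a y = 0 := by
  have : filtA χ τ J m ≤ LinearMap.ker (lenGrad χ J m a) := by
    refine Submodule.span_le.2 ?_
    rintro _ ⟨b, l, hb, hl, rfl⟩
    rw [SetLike.mem_coe, LinearMap.mem_ker, lenGrad_K_word, if_neg fun e => hl.ne e.1]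
  exact this hy

theorem lenGrad_K_polyEval {m : ℕ} (a b : Weight n) {q : Tens k n} (hq : q ∈ tensLen k n m)
    [Decidable (b = a)] : lenGrad χ J m a (KA χ J b * polyEval (FA χ J) q) =
      if b = a then KA χ J b * polyEval (FA χ J) q else 0 := by
  have : tensLen k n m ≤ LinearMap.eqLocus
      (lenGrad χ J m a ∘ₗ LinearMap.mulLeft k (KA χ J b) ∘ₗ (polyEval (FA χ J)).toLinearMap)
      (if b = a then LinearMap.mulLeft k (KA χ J b) ∘ₗ (polyEval (FA χ J)).toLinearMap
        else 0) := by
    refine Submodule.span_le.2 ?_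
    rintro _ ⟨l, rfl, rfl⟩
    rw [SetLike.mem_coe, LinearMap.mem_eqLocus, LinearMap.comp_apply, LinearMap.comp_apply,
      AlgHom.toLinearMap_apply, polyEval_word, LinearMap.mulLeft_apply, lenGrad_K_word]
    by_cases hb : b = a
    · simp [hb, polyEval_word]
    · simp [hb]
  have e := this hq
  rw [LinearMap.mem_eqLocus] at e
  split_ifs at e ⊢ <;> exact e

theorem filtB_succ_le (m : ℕ) : filtB χ τ c J (m + 1) ≤ filtB χ τ c J m ⊔
    ⨆ a : {a : Weight n // IsTheta τ a}, (tensLen k n m).map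
      (LinearMap.mulLeft k (U.K χ J a) ∘ₗ (polyEval (genB χ τ c J)).toLinearMap) := by
  refine Submodule.span_le.2 ?_
  rintro _ ⟨a, l, ha, hl, rfl⟩
  rcases Nat.lt_succ_iff_lt_or_eq.1 hl with hl | hl
  · exact Submodule.mem_sup_left (K_word_mem_filtB c ha hl)
  · refine Submodule.mem_sup_right (Submodule.mem_iSup_of_mem ⟨a, ha⟩ ?_)
    exact ⟨word (var k) l, Submodule.subset_span ⟨l, hl, rfl⟩, by
      rw [LinearMap.comp_apply, AlgHom.toLinearMap_apply, polyEval_word, LinearMap.mulLeft_apply]⟩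

/-- Write the top part of `x` as a sum of `K_a q_a(B)` with `q_a` of degree `m`. If `ψ(x) = 0`, then
comparing leading terms gives `q_a(F) = 0` for every `a`, so `q_a` is in the ideal and `q_a(B)`
drops in the filtration. Hence `x` lies one step lower, and induction applies. -/
theorem psiU_injOn_filtB (h : Compatible χ τ J) (hC : ConditionC χ τ c J) (m : ℕ) :
    ∀ x ∈ filtB χ τ c J m, psiU χ J x = 0 → x = 0 := by
  classical
  induction m with
  | zero =>
    intro x hx _
    have : filtB χ τ c J 0 ≤ ⊥ := by
      refine Submodule.span_le.2 ?_
      rintro _ ⟨a, l, ha, hl, rfl⟩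
      exact absurd hl (Nat.not_lt_zero _)
    exact (Submodule.mem_bot k).1 (this hx)
  | succ m ih =>
    intro x hx hx0
    refine ih x ?_ hx0
    obtain ⟨b, hb, y, hy, rfl⟩ := Submodule.mem_sup.1 (filtB_succ_le c m hx)
    obtain ⟨f, hf, rfl⟩ := (Submodule.mem_iSup_iff_exists_finsupp _ _).1 hy
    choose q hq hqf using hf
    refine add_mem hb (Submodule.sum_mem _ fun a ha => ?_)
    -- The bigrading by length and by the factor `K_a` isolates the leading term of a single
    -- summand; everything shorter is invisible to it.
    have hlen : ∀ a a', lenGrad χ J m a (psiU χ J (f a')) =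
        if (a' : Weight n) = a then KA χ J a' * polyEval (FA χ J) (q a') else 0 := by
      intro a a'
      rw [← hqf a', LinearMap.comp_apply, LinearMap.mulLeft_apply, AlgHom.toLinearMap_apply,
        psiU_K_mul a'.2, ← lenGrad_K_polyEval _ _ (hq a'), ← sub_eq_zero, ← map_sub, ← mul_sub]
      exact lenGrad_filtA m a (K_mul_mem_filtA a'.2 (psiU_polyEval_sub_mem c h.invol (hq a')))
    have hbA : psiU χ J b ∈ filtA χ τ J m := by
      have : filtB χ τ c J m ≤ (filtA χ τ J m).comap (psiU χ J) := by
        refine Submodule.span_le.2 ?_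
        rintro _ ⟨a, l, ha, hl, rfl⟩
        rw [SetLike.mem_coe, Submodule.mem_comap, psiU_K_mul ha]
        refine K_mul_mem_filtA ha ?_
        have := add_mem (filtA_mono hl.le (psiU_word_sub_mem c (J := J) h.invol l))
          (lenSpan_le_filtA (τ := τ) hl (word_mem_lenSpan l))
        rwa [sub_add_cancel] at this
      exact this hb
    have e := congrArg (lenGrad χ J m a) hx0
    rw [map_add, map_add, lenGrad_filtA m _ hbA, zero_add, Finsupp.sum, map_sum, map_sum,
      map_zero] at e
    simp only [hlen] at e
    rw [Finset.sum_eq_single a (fun a' _ hne => if_neg fun e => hne (Subtype.ext e))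
      (fun hn => absurd ha hn), if_pos rfl] at e
    -- The factor `K_a` is invertible.
    have hq0 : polyEval (FA χ J) (q a) = 0 := by
      have := congrArg (fun z => KA χ J (-a) * z) e
      simp only [mul_zero, ← mul_assoc, KA, ← Bos.K_add, neg_add_cancel, Bos.K_zero,
        one_mul] at this
      exact this
    rw [← hqf a, LinearMap.comp_apply, LinearMap.mulLeft_apply, AlgHom.toLinearMap_apply]
    exact K_mul_mem_filtB c a.2
      (polyEval_mem_filtB_of_mem_ideal c h hC ih (mem_of_polyEval_F_eq_zero hq0) (hq a))

end Injectivity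

/-! ### The restriction of `ψ` to `B_c` and the conclusion. -/

section RestrictedProjection

variable {χ : SymmetricBicharacter k n} {τ : Equiv.Perm (Fin n)} (c : Fin n → k)
  {J : PreNicholsIdeal χ} {φ : Bc χ τ c J →ₗ[k] PartialBos χ τ J}

theorem restrict_one (hφ : ∀ x, (φ x : Bos χ (-1) J) = psiU χ J x) : φ 1 = 1 :=
  Subtype.ext ((hφ 1).trans psiU_one)

theorem restrict_BB_mul (hφ : ∀ x, (φ x : Bos χ (-1) J) = psiU χ J x) (h : Compatible χ τ J)
    (i : Fin n) (x : Bc χ τ c J) : φ (BB c i * x) = starFM c h i (φ x) :=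
  Subtype.ext <| by
    rw [hφ, starFM_coe, hφ]
    exact psiU_genB_mul c (mem_Upoly_of_mem_Bc c h.invol x.2) i

theorem restrict_KB_mul (hφ : ∀ x, (φ x : Bos χ (-1) J) = psiU χ J x) (h : Compatible χ τ J)
    {a : Weight n} (ha : IsTheta τ a) (x : Bc χ τ c J) :
    φ (KB c h.invol ha * x) = KM h ha * φ x :=
  Subtype.ext <| by
    have e : ((KM h ha * φ x : PartialBos χ τ J) : Bos χ (-1) J) =
      KA χ J a * (φ x : Bos χ (-1) J) := rfl
    rw [hφ, e, hφ]
    exact psiU_K_mul ha (x : U χ J)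

/-- Injectivity is checked in each filtration degree. For surjectivity, the image contains `1` and
is stable under the operators that generate `H_θ ⋉ U⁻`. -/
theorem restrict_bijective (hφ : ∀ x, (φ x : Bos χ (-1) J) = psiU χ J x) (h : Compatible χ τ J)
    (hC : ConditionC χ τ c J) : Function.Bijective φ := by
  constructor
  · refine (injective_iff_map_eq_zero φ).2 fun x hx => ?_
    obtain ⟨m, hm⟩ := exists_mem_filtB c h x
    refine Subtype.ext (psiU_injOn_filtB c h hC m x hm ?_)
    rw [← hφ, hx]
    rfl
  · intro y
    induction y using partialBos_induction c h with
    | h1 => exact ⟨1, restrict_one c hφ⟩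
    | hadd x y hx hy =>
      obtain ⟨a, rfl⟩ := hx
      obtain ⟨b, rfl⟩ := hy
      exact ⟨a + b, map_add φ a b⟩
    | hsmul r x hx =>
      obtain ⟨a, rfl⟩ := hx
      exact ⟨r • a, map_smul φ r a⟩
    | hF i x hx =>
      obtain ⟨a, rfl⟩ := hx
      exact ⟨BB c i * a, restrict_BB_mul c hφ h i a⟩
    | hK a ha x hx =>
      obtain ⟨b, rfl⟩ := hx
      exact ⟨KB c h.invol ha * b, restrict_KB_mul c hφ h ha b⟩

theorem isPsi_restrict_coe (hτ : ∀ i, τ (τ i) = i) {ψ : Upoly χ τ J →ₗ[k] PartialBos χ τ J}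
    (hψ : IsPsi χ τ J ψ) (x : Bc χ τ c J) :
    ((ψ ∘ₗ (Subalgebra.inclusion (Bc_le_Upoly χ τ c J hτ)).toLinearMap) x : Bos χ (-1) J) =
      psiU χ J x := by
  rw [LinearMap.comp_apply, isPsi_unique hτ hψ (psi_isPsi hτ), psi_coe, AlgHom.toLinearMap_apply,
    Subalgebra.coe_inclusion]

end RestrictedProjection

end

end StarProduct

theorem proposition3p7 {k : Type*} [Field k] {n : ℕ} (χ : SymmetricBicharacter k n)
    (τ : Equiv.Perm (Fin n)) (hτ : ∀ i, τ (τ i) = i)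
    (hχτ : ∀ i j, χ (α (τ i)) (α (τ j)) = χ (α i) (α j))
    (J : PreNicholsIdeal χ)
    (hJτ : J.ideal.map (polyEval fun i => var k (τ i)).toLinearMap = J.ideal)
    (c : Fin n → k) :
    -- the objects that enter the statement exist and are unique
    Nonempty (DualBases χ) ∧
    (∃! star, IsTwistProduct χ τ c J star) ∧
    (∃! Δ, IsTwistedCoaction χ τ c J Δ) ∧
    (∃! ψ, IsPsi χ τ J ψ) ∧
    ∀ star, IsTwistProduct χ τ c J star → ∀ Δ, IsTwistedCoaction χ τ c J Δ →
      -- the twist product and the twisted coaction form a comodule algebra, for every `c`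
      IsComoduleAlgebra star 1 Δ ∧
      IsComoduleAlgebra (LinearMap.mul k (Bc χ τ c J)) 1 (coactB χ τ c J hτ).toLinearMap ∧
      (ConditionC χ τ c J → ∀ ψ, IsPsi χ τ J ψ →
        IsComoduleAlgebraIso (LinearMap.mul k (Bc χ τ c J)) 1 (coactB χ τ c J hτ).toLinearMap
          star 1 Δ
          (ψ ∘ₗ (Subalgebra.inclusion (Bc_le_Upoly χ τ c J hτ)).toLinearMap)) := by
  have h : Compatible χ τ J := ⟨hτ, hχτ, hJτ⟩
  refine ⟨nonempty_dualBases χ,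
    ⟨starM c h, starM_isTwistProduct c h, fun _ H =>
      isTwistProduct_unique c hτ H (starM_isTwistProduct c h)⟩,
    ⟨coactM c h, coactM_isTwistedCoaction c h, fun _ H =>
      isTwistedCoaction_unique c hτ H (coactM_isTwistedCoaction c h)⟩,
    ⟨psi hτ, psi_isPsi hτ, fun _ H => isPsi_unique hτ H (psi_isPsi hτ)⟩,
    fun star hstar Δ hΔ => ?_⟩
  -- By uniqueness the given product and coaction are the constructed ones.
  obtain rfl := isTwistProduct_unique c hτ hstar (starM_isTwistProduct c h)
  obtain rfl := isTwistedCoaction_unique c hτ hΔ (coactM_isTwistedCoaction c h)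
  refine ⟨(starM_isTwisted c h).isComoduleAlgebra, (coactB_isTwisted c hτ).isComoduleAlgebra,
    fun hC ψ hψ => ?_⟩
  have hφ := isPsi_restrict_coe c hτ hψ
  exact (coactB_isTwisted c hτ).isComoduleAlgebraIso (starM_isTwisted c h) _
    (restrict_bijective c hφ h hC) (restrict_one c hφ) (restrict_BB_mul c hφ h)
    fun _ ha => restrict_KB_mul c hφ h ha
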